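/- **Conventions.** A *pointed graph* $\Gamma$ is a finite directed multigraph (loops and multiple edges allowed, not necessarily connected) with a distinguished vertex $\bullet$; the other vertices are called ordinary. $V(\Gamma)$ denotes the set of all vertices including $\bullet$, the weight is $w(\Gamma)=|E(\Gamma)|-|V(\Gamma)\setminus\{\bullet\}|$, and $\mathrm{Aut}(\Gamma)$ is the group of automorphisms (pairs of compatible bijections of vertices and edges) fixing $\bullet$. $\Gamma$ is *semistable* if every ordinary vertex $v$ satisfies $\deg^-(v)\ge1$, $\deg^+(v)\ge1$, $\deg^-(v)+\deg^+(v)\ge3$, and *stable* if every ordinary vertex satisfies $\deg^-(v)\ge2$, $\deg^+(v)\ge2$. $\mathcal G_1(k)$ is the (finite) set of isomorphism classes of stable pointed graphs of weight $k$, and $\mathcal G_1=\bigcup_{k\ge0}\mathcal G_1(k)$. An edge $uv$ is *contractible* if $u\ne v$ and either $u$ is ordinary with $\deg^+(u)=1$ or $v$ is ordinary with $\deg^-(v)=1$. A pointed graph $\Gamma$ is *generalized stabilizable* (GS) if it arises by inserting finitely many vertices into edges of a semistable pointed graph $\Gamma^{ss}$ which becomes stable after finitely many contractions of contractible edges; the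 resulting stable graph, which is unique up to isomorphism, is the *stabilization graph* $\Gamma^s$. A pointed subgraph of $Z$ is a subgraph containing $\bullet$; $Z/\Gamma$ is obtained from $Z$ by contracting the pointed subgraph $\Gamma$ to one point, the new distinguished vertex (edges of $Z$ between vertices of $\Gamma$ that are not in $\Gamma$ become loops). Let $g=(g_{i\bar j})$ be a Kähler metric on an open set $U\subset\mathbb C^n$. In given holomorphic coordinates, a semistable pointed graph $\Gamma$ and a smooth function $f$ define the following polynomial in the derivatives of $f$, the derivatives of $g_{i\bar j}$ and $g^{i\bar j}$: each ordinary vertex is a derivative $g_{i\bar j\,\alpha}$ of the metric and $\bullet$ is a derivative of $f$, outward half-edges being holomorphic (unbarred) and inward half-edges antiholomorphic (barred) indices, and each edge contracts the index at its tail with the one at its head by $g^{i\bar j}$. For $\Gamma$ stable, the covariant differential operator $\Gamma$ sends $f$ to the function $\Gamma(f)$ whose value at each $x\in U$ is the value of this polynomial at the centre $x$ of holomorphic coordinates that are normal at $x$ to sufficiently high order $N$ (i.e. at the centre $g_{i\bar j}=\delta_{ij}$, and all purely holomorphic and all purely antiholomorphic derivatives of $g_{i\bar j}$ of orders $1,\dots,N$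 vanish). **Theorem 4.10.** For every stable pointed graph $\Gamma$, $\Gamma(f)$ is well defined and smooth on $U$ for every smooth $f$ on $U$. For any functions $c_1,c_2:\mathcal G_1\to\mathbb C$ we have $$\left(\sum_{Z_1\in \mathcal G_1}c_1(Z_1)\frac{(-1)^{|V(Z_1)|}}{|\mathrm{Aut}(Z_1)|}Z_1\right) \circ \left(\sum_{Z_2\in \mathcal G_1}c_2(Z_2)\frac{(-1)^{|V(Z_2)|}}{|\mathrm{Aut}(Z_2)|}Z_2\right) =\sum_{Z\in \mathcal G_1}\left(\sum_{\Gamma\subset Z}^{\mathrm{GS}}(-1)^{|V(Z/\Gamma)|+|V(\Gamma)|} c_1((Z/\Gamma)^s)\,c_2(\Gamma^s)\right)\frac{1}{|\mathrm{Aut}(Z)|}Z,$$ where $\Gamma$ runs over all GS pointed subgraphs of $Z$. The sums are formal sums graded by weight: for every $k\ge0$, the sum over $k_1+k_2=k$ of the composites of the weight $k_1$ part of the first factor with the weight $k_2$ part of the second is equal, as an operator on $C^\infty(U)$, to the weight $k$ part of the right-hand side, for every $n$, $U$ and $g$. -/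

import Mathlib

open scoped ContDiff BigOperators ComplexOrder

noncomputable section

/-! ### Pointed graphs -/

/-- A pointed graph: a finite directed multigraph (multiple edges and loops are allowed, it need
not be connected) with a distinguished vertex `base`. The vertices different from `base` are the
ordinary ones. An edge `e` goes from its tail `src e` to its head `tgt e`. -/
structure PointedGraph : Type 1 where
  V : Type
  E : Type
  [fintypeV : Fintype V]
  [fintypeE : Fintype E]
  src : E → V
  tgt : E → V
  base : V

namespace PointedGraph

attribute [instance] PointedGraph.fintypeV PointedGraph.fintypeE

/-- Isomorphisms of pointed graphs: compatible bijections on vertices and on edges that preserve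
the distinguished vertex. -/
structure Iso (G H : PointedGraph) where
  onV : G.V ≃ H.V
  onE : G.E ≃ H.E
  src_eq : ∀ e, H.src (onE e) = onV (G.src e)
  tgt_eq : ∀ e, H.tgt (onE e) = onV (G.tgt e)
  base_eq : onV G.base = H.base

def Iso.refl (G : PointedGraph) : Iso G G :=
  ⟨Equiv.refl _, Equiv.refl _, fun _ => rfl, fun _ => rfl, rfl⟩

def Iso.symm {G H : PointedGraph} (φ : Iso G H) : Iso H G where
  onV := φ.onV.symm
  onE := φ.onE.symm
  src_eq e := by
    apply φ.onV.injective
    rw [← φ.src_eq]; simp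
  tgt_eq e := by
    apply φ.onV.injective
    rw [← φ.tgt_eq]; simp
  base_eq := by rw [← φ.base_eq]; simp

def Iso.trans {G H K : PointedGraph} (φ : Iso G H) (χ : Iso H K) : Iso G K where
  onV := φ.onV.trans χ.onV
  onE := φ.onE.trans χ.onE
  src_eq e := by simp [χ.src_eq, φ.src_eq]
  tgt_eq e := by simp [χ.tgt_eq, φ.tgt_eq]
  base_eq := by simp [φ.base_eq, χ.base_eq]

instance isoSetoid : Setoid PointedGraph where
  r G H := Nonempty (Iso G H)
  iseqv := ⟨fun G => ⟨Iso.refl G⟩, fun ⟨φ⟩ => ⟨φ.symm⟩, fun ⟨φ⟩ ⟨χ⟩ => ⟨φ.trans χ⟩⟩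

/-- Isomorphism classes of pointed graphs. -/
abbrev IsoClass : Type 1 := Quotient isoSetoid

/-- The order of the automorphism group. -/
def autCard (G : PointedGraph) : ℕ := Nat.card (Iso G G)

/-- The number of all vertices, the distinguished one included. -/
def numV (G : PointedGraph) : ℕ := Fintype.card G.V

/-- The weight: the number of edges minus the number of ordinary vertices. -/
def weight (G : PointedGraph) : ℤ := (Fintype.card G.E : ℤ) - ((Fintype.card G.V : ℤ) - 1)

open Classical in
/-- The edges that leave `v`. -/
def outEdges (G : PointedGraph) (v : G.V) : Finset G.E := Finset.univ.filter fun e => G.src e = v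

open Classical in
/-- The edges that enter `v`. -/
def inEdges (G : PointedGraph) (v : G.V) : Finset G.E := Finset.univ.filter fun e => G.tgt e = v

def outDeg (G : PointedGraph) (v : G.V) : ℕ := (G.outEdges v).card

def inDeg (G : PointedGraph) (v : G.V) : ℕ := (G.inEdges v).card

/-- Semistable: every ordinary vertex has in- and out-degree at least one and total degree at
least three. -/
def IsSemistable (G : PointedGraph) : Prop :=
  ∀ v, v ≠ G.base → 1 ≤ G.inDeg v ∧ 1 ≤ G.outDeg v ∧ 3 ≤ G.inDeg v + G.outDeg v

/-- Stable: every ordinary vertex has in- and out-degree at least two. -/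
def IsStable (G : PointedGraph) : Prop :=
  ∀ v, v ≠ G.base → 2 ≤ G.inDeg v ∧ 2 ≤ G.outDeg v

/-! ### Stabilization -/

/-- An edge `uv` is contractible if `u ≠ v` and either `u` is ordinary of out-degree one or `v` is
ordinary of in-degree one. -/
def IsContractible (G : PointedGraph) (e : G.E) : Prop :=
  G.src e ≠ G.tgt e ∧
    ((G.src e ≠ G.base ∧ G.outDeg (G.src e) = 1) ∨ (G.tgt e ≠ G.base ∧ G.inDeg (G.tgt e) = 1))

open Classical in
/-- Contraction of an edge: its end points are identified and the edge is removed. -/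
def contractEdge (G : PointedGraph) (e : G.E) : PointedGraph where
  V := Quot fun a b : G.V => a = G.src e ∧ b = G.tgt e
  E := {e' : G.E // e' ≠ e}
  fintypeV := Fintype.ofFinite _
  fintypeE := Fintype.ofFinite _
  src e' := Quot.mk _ (G.src e')
  tgt e' := Quot.mk _ (G.tgt e')
  base := Quot.mk _ G.base

/-- `ContractsTo G H`: up to isomorphism, `H` arises from `G` by finitely many successive
contractions of contractible edges. -/
inductive ContractsTo (G : PointedGraph) : PointedGraph → Prop
  | refl : ContractsTo G G
  | iso {A B : PointedGraph} : ContractsTo G A → Nonempty (Iso A B) → ContractsTo G B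
  | contract {A : PointedGraph} : ContractsTo G A → (e : A.E) → A.IsContractible e →
      ContractsTo G (A.contractEdge e)

open Classical in
/-- Insertion of a new vertex `none` in the middle of the edge `e`: the first half of `e` keeps the
name `e` and ends at the new vertex, the second half is the new edge `none`. -/
def insertVertex (G : PointedGraph) (e : G.E) : PointedGraph where
  V := Option G.V
  E := Option G.E
  src
    | some e' => some (G.src e')
    | none => none
  tgt
    | some e' => if e' = e then none else some (G.tgt e')
    | none => some (G.tgt e)
  base := some G.base

/-- `Subdivides G H`: up to isomorphism, `H` arises from `G` by inserting a finite number of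
vertices to edges. -/
inductive Subdivides (G : PointedGraph) : PointedGraph → Prop
  | refl : Subdivides G G
  | iso {A B : PointedGraph} : Subdivides G A → Nonempty (Iso A B) → Subdivides G B
  | insert {A : PointedGraph} : Subdivides G A → (e : A.E) → Subdivides G (A.insertVertex e)

/-- `S` is a stabilization graph of `Γ`: `Γ` is obtained by inserting vertices to edges of a
semistable pointed graph `H`, and contracting contractible edges of `H` leads to the stable pointed
graph `S`. -/
def IsStabilization (Γ S : PointedGraph) : Prop :=
  ∃ H : PointedGraph, H.IsSemistable ∧ H.Subdivides Γ ∧ H.ContractsTo S ∧ S.IsStable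

/-- Generalized stabilizable (GS) pointed graphs. -/
def IsGS (Γ : PointedGraph) : Prop := ∃ S, Γ.IsStabilization S

open Classical in
/-- The isomorphism class of the stabilization graph of a GS pointed graph (which is unique up to
isomorphism). The value at graphs that are not GS is irrelevant. -/
def stabClass (Γ : PointedGraph) : IsoClass :=
  if h : Γ.IsGS then Quotient.mk _ h.choose else Quotient.mk _ Γ

/-! ### Pointed subgraphs -/

/-- A pointed subgraph: a set of vertices that contains the distinguished one, and a set of edges
whose end points lie in the set of vertices. -/
@[ext]
structure Subgraph (Z : PointedGraph) where
  verts : Finset Z.V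
  edges : Finset Z.E
  base_mem : Z.base ∈ verts
  src_mem : ∀ e ∈ edges, Z.src e ∈ verts
  tgt_mem : ∀ e ∈ edges, Z.tgt e ∈ verts

/-- A pointed subgraph as a pointed graph of its own. -/
def Subgraph.toGraph {Z : PointedGraph} (Γ : Z.Subgraph) : PointedGraph where
  V := {v // v ∈ Γ.verts}
  E := {e // e ∈ Γ.edges}
  src e := ⟨Z.src e, Γ.src_mem e e.2⟩
  tgt e := ⟨Z.tgt e, Γ.tgt_mem e e.2⟩
  base := ⟨Z.base, Γ.base_mem⟩

open Classical in
/-- The quotient `Z/Γ`: all vertices of `Γ` are identified to one point, the distinguished vertex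
of the quotient, and the edges of `Γ` are removed. -/
def Subgraph.quotient {Z : PointedGraph} (Γ : Z.Subgraph) : PointedGraph where
  V := Quot fun a b : Z.V => a ∈ Γ.verts ∧ b ∈ Γ.verts
  E := {e : Z.E // e ∉ Γ.edges}
  fintypeV := Fintype.ofFinite _
  fintypeE := Fintype.ofFinite _
  src e := Quot.mk _ (Z.src e)
  tgt e := Quot.mk _ (Z.tgt e)
  base := Quot.mk _ Z.base

instance (Z : PointedGraph) : Fintype Z.Subgraph := by
  classical
  exact Fintype.ofInjective (fun Γ : Z.Subgraph => (Γ.verts, Γ.edges)) fun a b h => by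
    simp only [Prod.mk.injEq] at h
    exact Subgraph.ext h.1 h.2

open Classical in
/-- The GS pointed subgraphs of `Z`. -/
def gsSubgraphs (Z : PointedGraph) : Finset Z.Subgraph :=
  Finset.univ.filter fun Γ => Γ.toGraph.IsGS

/-! ### The isomorphism classes of stable pointed graphs of a given weight -/

theorem sum_outDeg (G : PointedGraph) : ∑ v, G.outDeg v = Fintype.card G.E := by
  classical
  rw [← Finset.card_univ]
  unfold outDeg outEdges
  rw [Finset.card_eq_sum_card_fiberwise (f := G.src) (t := Finset.univ) (by simp)]

theorem IsStable.two_mul_le {G : PointedGraph} (h : G.IsStable) :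
    2 * (Fintype.card G.V - 1) ≤ Fintype.card G.E := by
  classical
  rw [← G.sum_outDeg, ← Finset.card_univ, ← Finset.card_erase_of_mem (Finset.mem_univ G.base),
    mul_comm, ← smul_eq_mul]
  calc _ ≤ ∑ v ∈ Finset.univ.erase G.base, G.outDeg v :=
        Finset.card_nsmul_le_sum _ _ _ fun v hv => (h v (Finset.ne_of_mem_erase hv)).2
    _ ≤ _ := Finset.sum_le_sum_of_subset (Finset.subset_univ _)

theorem finite_stable (k : ℕ) :
    {q : IsoClass | q.out.IsStable ∧ q.out.weight = k}.Finite := by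
  let T := Σ a : Fin (k + 2), Σ b : Fin (2 * k + 1),
    (Fin b → Fin a) × (Fin b → Fin a) × Fin a
  let F : T → IsoClass := fun t =>
    Quotient.mk _ { V := Fin t.1, E := Fin t.2.1, src := t.2.2.1, tgt := t.2.2.2.1,
                    base := t.2.2.2.2 }
  refine (Set.finite_range F).subset ?_
  rintro q ⟨hs, hw⟩
  have h2 := hs.two_mul_le
  have h1 : 0 < Fintype.card q.out.V := Fintype.card_pos_iff.2 ⟨q.out.base⟩
  unfold weight at hw
  have hV : Fintype.card q.out.V < k + 2 := by omega
  have hE : Fintype.card q.out.E < 2 * k + 1 := by omega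
  let eV := Fintype.equivFin q.out.V
  let eE := Fintype.equivFin q.out.E
  refine ⟨⟨⟨_, hV⟩, ⟨_, hE⟩, fun e => eV (q.out.src (eE.symm e)),
    fun e => eV (q.out.tgt (eE.symm e)), eV q.out.base⟩, ?_⟩
  refine Eq.trans ?_ (Quotient.out_eq q)
  refine Quotient.sound ⟨Iso.symm ⟨eV, eE, fun e => ?_, fun e => ?_, ?_⟩⟩ <;> simp

/-- The finite set of isomorphism classes of stable pointed graphs of weight `k`. -/
def stableClasses (k : ℕ) : Finset IsoClass := (finite_stable k).toFinset

end PointedGraph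

/-! ### Kähler metrics on open subsets of `ℂⁿ` -/

/-- The derivative `∂/∂zᵢ` of a function of `n` complex variables. -/
def wirtinger {n : ℕ} (i : Fin n) (h : (Fin n → ℂ) → ℂ) (x : Fin n → ℂ) : ℂ :=
  (fderiv ℝ h x (Pi.single i 1) - Complex.I * fderiv ℝ h x (Pi.single i Complex.I)) / 2

/-- The derivative `∂/∂z̄ᵢ` of a function of `n` complex variables. -/
def wirtingerBar {n : ℕ} (i : Fin n) (h : (Fin n → ℂ) → ℂ) (x : Fin n → ℂ) : ℂ :=
  (fderiv ℝ h x (Pi.single i 1) + Complex.I * fderiv ℝ h x (Pi.single i Complex.I)) / 2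

/-- The iterated derivative of `h` along the holomorphic directions in the list `a` and the
antiholomorphic directions in the list `b`. -/
def iterWirtinger {n : ℕ} (a b : List (Fin n)) (h : (Fin n → ℂ) → ℂ) : (Fin n → ℂ) → ℂ :=
  a.foldr wirtinger (b.foldr wirtingerBar h)

/-- `g x i j` is the coefficient `g_{i j̄}(x)`. The last condition says that the associated
`(1,1)`-form is closed on `U`; its complex conjugate holds because `g` is Hermitian. -/
structure IsKahlerMetricOn {n : ℕ} (g : (Fin n → ℂ) → Matrix (Fin n) (Fin n) ℂ)
    (U : Set (Fin n → ℂ)) : Prop where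
  contDiffOn : ∀ i j, ContDiffOn ℝ ∞ (fun x => g x i j) U
  posDef : ∀ x ∈ U, (g x).PosDef
  closed : ∀ x ∈ U, ∀ i j k,
    wirtinger k (fun y => g y i j) x = wirtinger i (fun y => g y k j) x

/-- The expression of the metric `g` in the coordinates given by the parametrization `ψ`. -/
def pullbackMetric {n : ℕ} (g : (Fin n → ℂ) → Matrix (Fin n) (Fin n) ℂ)
    (ψ : (Fin n → ℂ) → (Fin n → ℂ)) (w : Fin n → ℂ) : Matrix (Fin n) (Fin n) ℂ :=
  fun i j => ∑ k, ∑ l, fderiv ℂ ψ w (Pi.single i 1) k *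
    starRingEnd ℂ (fderiv ℂ ψ w (Pi.single j 1) l) * g (ψ w) k l

/-- `ψ` is (the germ at `0` of the parametrization of) a holomorphic coordinate system centred at
`x` that is normal to order `N`: at the centre, the metric is the identity, and all its purely
holomorphic and purely antiholomorphic derivatives of orders `1, …, N` vanish. (The first condition
makes the derivative of `ψ` at `0` invertible, so that `ψ` is biholomorphic near `0`.) -/
structure IsNormalChart {n : ℕ} (N : ℕ) (g : (Fin n → ℂ) → Matrix (Fin n) (Fin n) ℂ)
    (x : Fin n → ℂ) (ψ : (Fin n → ℂ) → (Fin n → ℂ)) : Prop where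
  analytic : AnalyticAt ℂ ψ 0
  center : ψ 0 = x
  metric_center : pullbackMetric g ψ 0 = 1
  pure : ∀ a : List (Fin n), a ≠ [] → a.length ≤ N → ∀ i j,
    iterWirtinger a [] (fun w => pullbackMetric g ψ w i j) 0 = 0
  pure_bar : ∀ a : List (Fin n), a ≠ [] → a.length ≤ N → ∀ i j,
    iterWirtinger [] a (fun w => pullbackMetric g ψ w i j) 0 = 0

/-! ### The differential operators attached to pointed graphs -/

/-- The factor of the distinguished vertex: the derivative of `f` along the holomorphic indices `a`
and the antiholomorphic indices `b` (sorted, as the order of differentiation does not matter). -/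
def functionJet {n : ℕ} (f : (Fin n → ℂ) → ℂ) (a b : Multiset (Fin n)) (x : Fin n → ℂ) : ℂ :=
  iterWirtinger (a.sort (· ≤ ·)) (b.sort (· ≤ ·)) f x

/-- The factor `g_{i j̄ α}` of an ordinary vertex: one holomorphic index and one antiholomorphic
index belong to the metric coefficient, the others are derivatives of it. By the Kähler condition
it does not matter which of them are chosen; here the smallest ones are. The value for empty `a` or
`b` is irrelevant, since it does not occur for semistable graphs. -/
def metricJet {n : ℕ} (g : (Fin n → ℂ) → Matrix (Fin n) (Fin n) ℂ) (a b : Multiset (Fin n))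
    (x : Fin n → ℂ) : ℂ :=
  match a.sort (· ≤ ·), b.sort (· ≤ ·) with
  | i :: a', j :: b' => iterWirtinger a' b' (fun y => g y i j) x
  | _, _ => 0

namespace PointedGraph

open Classical in
/-- The polynomial in the derivatives of `g_{i j̄}` and `f` associated to a pointed graph, in the
given coordinates: every ordinary vertex is a derivative of the metric, the distinguished vertex is
a derivative of `f`, and every edge `e` contracts a holomorphic index `ι e` at its tail with an
antiholomorphic index `κ e` at its head by means of `g^{i j̄}`, where
`∑ⱼ g^{i j̄} g_{k j̄} = δ_{ik}`. -/
def eval {n : ℕ} (Γ : PointedGraph) (g : (Fin n → ℂ) → Matrix (Fin n) (Fin n) ℂ)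
    (f : (Fin n → ℂ) → ℂ) (x : Fin n → ℂ) : ℂ :=
  ∑ ι : Γ.E → Fin n, ∑ κ : Γ.E → Fin n,
    (∏ e, (g x)⁻¹ (κ e) (ι e)) *
    (∏ v ∈ Finset.univ.erase Γ.base,
      metricJet g ((Γ.outEdges v).val.map ι) ((Γ.inEdges v).val.map κ) x) *
    functionJet f ((Γ.outEdges Γ.base).val.map ι) ((Γ.inEdges Γ.base).val.map κ) x

/-- `c` is the value of the polynomial associated to `Γ` at the centre of every coordinate system
around `x` that is normal to a sufficiently high order. -/
def IsNormalValue {n : ℕ} (Γ : PointedGraph) (g : (Fin n → ℂ) → Matrix (Fin n) (Fin n) ℂ)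
    (f : (Fin n → ℂ) → ℂ) (x : Fin n → ℂ) (c : ℂ) : Prop :=
  ∃ N : ℕ, ∀ ψ, IsNormalChart N g x ψ → Γ.eval (pullbackMetric g ψ) (f ∘ ψ) 0 = c

/-- The covariant differential operator with graph `Γ`, applied to `f`: at every point, it equals
the polynomial associated to `Γ` at the centre of normal coordinates around that point. (Coordinates
that are normal to any given finite order exist, so there is at most one such value.) -/
def covOp {n : ℕ} (Γ : PointedGraph) (g : (Fin n → ℂ) → Matrix (Fin n) (Fin n) ℂ)
    (f : (Fin n → ℂ) → ℂ) (x : Fin n → ℂ) : ℂ :=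
  Classical.epsilon fun c => Γ.IsNormalValue g f x c

/-- The part of weight `k` of the formal sum `∑_Z c(Z) (-1)^{|V(Z)|} / |Aut Z| · Z` over the stable
pointed graphs, as a differential operator. -/
def graphSum {n : ℕ} (c : IsoClass → ℂ) (k : ℕ)
    (g : (Fin n → ℂ) → Matrix (Fin n) (Fin n) ℂ) (f : (Fin n → ℂ) → ℂ) (x : Fin n → ℂ) : ℂ :=
  ∑ Z ∈ stableClasses k, c Z * (-1) ^ Z.out.numV / Z.out.autCard * Z.out.covOp g f x

end PointedGraph

end

open scoped ContDiff BigOperators ComplexOrder Topology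
open scoped Classical

noncomputable section

/-! The value of a composite at `x` involves derivatives of the inner operator, but coordinates that
are normal at `x` are not normal at nearby points. The sum over stable graphs in normal coordinates
is therefore replaced by an expression valid in all coordinates: the sum `semiSum` over all
semistable graphs `G`, with the coefficient of the stabilization of `G`, the sign given by the
number of ordinary vertices, and the inverse metric on the edges. The two sums agree at the centre
of a normal chart (`semiSum_eq_stableSum`). Applied to the indicator of one isomorphism class, this
also shows that the operator of a stable graph is well defined and smooth.

Everything rests on one elimination principle, `sum_tot_elim`. Suppose that the arrays at the
vertices are related to new arrays by a chain rule whose coefficients are themselves the values of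
the old array at certain vertices of in-degree one. Expanding the product over the vertices then
hangs new vertices of in-degree one on the graph (`ev_expand`). The expanded graph contracts back to
the original one, so a coefficient that depends on the stabilization only is unchanged. A given
expanded graph arises once for every subset of its set `elimE` of eliminable edges, with alternating
signs, and these contributions cancel unless `elimE` is empty. If `elimE` is empty although
eliminable vertices remain, these form a set that no edge enters from outside, which prevents the
graph from contracting to a stable one, so its coefficient is zero. Thus all vertices of the type in
question disappear.

The principle is used three times. In coordinates that are orthonormal at the centre, the purely
holomorphic derivatives of the metric are the Taylor coefficients of the change to normal
coordinates; hence the vertices of in-degree one are eliminated by the holomorphic chain rule, and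
those of out-degree one by its conjugate on the reversed graph (`NormalChange.sum_semistable`). The
third time, the coefficient of the chain rule is the metric minus the identity, over the algebra of
smooth functions. This is the geometric series of the inverse metric: `jet_semiSum` replaces the
inverse metric on the edges by a constant contraction, at the cost of admitting vertices of in- and
out-degree one.

With a constant contraction, the derivatives at the distinguished vertex of an outer graph `A` are
distributed by the Leibniz rule over the vertices of an inner graph `B` (`jetAt_ev`). This produces
exactly the graphs `Z` that contain `B` with quotient `A` (`eval_semiSum`). At the centre of normal
coordinates only stable `Z` survive, and the quotient of a stable graph is stable. Counting labelled
graphs with a marked subgraph turns the product of the two normalizations into `1 / |Aut Z|`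
(`tot_sum_subgraph`).

All sums are finite because a graph of fixed weight with positive degrees and many vertices has many
vertices of in- and out-degree one, and those carry factors that vanish at the centre. The
stabilization graph is unique because contractions are confluent (`ContractsTo.unique`). -/

/-- `Fintype.sum_equiv`, for arbitrary instances. -/
theorem sum_equiv_inst {α β M : Type*} [AddCommMonoid M] {_ : Fintype α} {_ : Fintype β}
    (e : α ≃ β) (f : α → M) (g : β → M) (h : ∀ x, f x = g (e x)) : ∑ x, f x = ∑ x, g x :=
  Fintype.sum_equiv e f g h

/-- `Fintype.prod_equiv`, for arbitrary instances. -/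
theorem prod_equiv_inst {α β M : Type*} [CommMonoid M] {_ : Fintype α} {_ : Fintype β}
    (e : α ≃ β) (f : α → M) (g : β → M) (h : ∀ x, f x = g (e x)) : ∏ x, f x = ∏ x, g x :=
  Fintype.prod_equiv e f g h

/-! ### Labels in the fibres of a map -/

/-- The function on `Option I` with the value `x` at `none` and the values of `f` elsewhere. -/
def optFun {I X : Type} (x : X) (f : I → X) (o : Option I) : X := o.elim x f

theorem sum_pi_option {I X M : Type} [Fintype I] [Fintype X] [AddCommMonoid M]
    {_ : Fintype (Option I → X)} (G : (Option I → X) → M) :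
    ∑ f, G f = ∑ x, ∑ f : I → X, G (optFun x f) := by
  rw [← Fintype.sum_prod_type']
  exact sum_equiv_inst (Equiv.piOptionEquivProd (β := fun _ => X)) _ _ fun f => by
    congr 1; ext o; cases o <;> rfl

/-- The multiset of the labels `ι p` of the elements `p` of the fibre of `s` over `v`. -/
def Mo {P V I : Type} [Fintype P] (s : P → V) (ι : P → I) (v : V) : Multiset I :=
  ∑ p, if s p = v then {ι p} else 0

section Mo
variable {P Q V W I : Type} [Fintype P] [Fintype Q]

theorem Mo_equiv (e : P ≃ Q) (s : Q → V) (ι : Q → I) (v : V) :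
    Mo (s ∘ e) (ι ∘ e) v = Mo s ι v :=
  Fintype.sum_equiv e _ _ fun _ => rfl

theorem Mo_option (s : Option P → V) (ι : Option P → I) (v : V) :
    Mo s ι v = (if s none = v then {ι none} else 0) + Mo (s ∘ some) (ι ∘ some) v :=
  Fintype.sum_option _

theorem Mo_sum (s : P ⊕ Q → V) (ι : P ⊕ Q → I) (v : V) :
    Mo s ι v = Mo (s ∘ Sum.inl) (ι ∘ Sum.inl) v + Mo (s ∘ Sum.inr) (ι ∘ Sum.inr) v :=
  Fintype.sum_sum_type _

theorem Mo_empty [IsEmpty P] (s : P → V) (ι : P → I) (v : V) : Mo s ι v = 0 := by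
  simp [Mo]

theorem Mo_injective {f : V → W} (hf : Function.Injective f) (s : P → V) (ι : P → I) (v : V) :
    Mo (f ∘ s) ι (f v) = Mo s ι v := by
  simp [Mo, hf.eq_iff]

theorem Mo_of_forall_ne {s : P → V} {v : V} (h : ∀ p, s p ≠ v) (ι : P → I) : Mo s ι v = 0 := by
  simp [Mo, h]

omit [Fintype P] in
theorem sum_singleton_eq_map (S : Finset P) (ι : P → I) : ∑ p ∈ S, ({ι p} : Multiset I) = S.val.map ι := by
  induction S using Finset.induction_on with
  | empty => simp
  | insert a t ha ih => rw [Finset.sum_insert ha, ih, Finset.insert_val_of_notMem ha]; simp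

theorem Mo_eq_map (s : P → V) (ι : P → I) (v : V) :
    Mo s ι v = (Finset.univ.filter fun p => s p = v).val.map ι := by
  rw [Mo, ← Finset.sum_filter, sum_singleton_eq_map]

theorem card_Mo (s : P → V) (ι : P → I) (v : V) :
    Multiset.card (Mo s ι v) = (Finset.univ.filter fun p => s p = v).card := by
  rw [Mo_eq_map, Multiset.card_map, Finset.card_val]

theorem Mo_map {J : Type} (s : P → V) (ι : P → I) (f : I → J) (v : V) :
    (Mo s ι v).map f = Mo s (f ∘ ι) v := by
  simp [Mo_eq_map]

/-- Splitting of a fibre into the part in `B` and the rest. -/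
theorem Mo_split (B : Finset P) (s : P → V) (ι : P → I) (v : V) :
    Mo s ι v = Mo (fun p : {p // p ∈ B} => s p) (fun p => ι p) v +
      Mo (fun p : {p // p ∉ B} => s p) (fun p => ι p) v := by
  unfold Mo
  refine (Fintype.sum_subtype_add_sum_subtype (fun p => p ∈ B)
    (fun p => if s p = v then ({ι p} : Multiset I) else 0)).symm.trans ?_
  congr 1
  exact sum_equiv_inst (Equiv.refl _) _ _ fun _ => rfl

end Mo

/-! ### The chain rule for products of symmetric arrays -/

/-- A system of pairs of symmetric arrays that are related by the chain rule for a change of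
coordinates tangent to the identity with higher derivatives `θ`. -/
structure ChainSys {n : ℕ} {R : Type} [CommRing R] (θ : Multiset (Fin n) → Fin n → R)
    (𝒞 : Set ((Multiset (Fin n) → R) × (Multiset (Fin n) → R))) : Prop where
  zero : ∀ Ψ ∈ 𝒞, Ψ.1 0 = Ψ.2 0
  -- One index `p` is converted into the sum over `j` of new indices with coefficient `δ + θ`. In `Φ
  -- j` that index is already converted and the others are not. By the Leibniz rule each of the
  -- others either hits the coefficient (those in `B`) or stays with `Φ j`; as `Φ j` belongs to the
  -- system again, the conversion can be iterated.
  cons : ∀ Ψ ∈ 𝒞, ∃ Φ : Fin n → Multiset (Fin n) → R,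
    (∀ j, (Φ j, fun J => Ψ.2 (j ::ₘ J)) ∈ 𝒞) ∧
    ∀ (p : Fin n) (Q : Type) [Fintype Q] (κ : Q → Fin n),
      Ψ.1 (p ::ₘ ∑ q, {κ q}) = Φ p (∑ q, {κ q}) +
        ∑ j, ∑ B : Finset Q, Φ j (∑ q : {q // q ∉ B}, {κ q}) * θ (p ::ₘ ∑ q : {q // q ∈ B}, {κ q}) j

section Expand
variable {n : ℕ} {R : Type} [CommRing R] {V : Type} [Fintype V]

/-- The terms of the chain rule with new vertices `I`. -/
def chainTerm (θ : V → Multiset (Fin n) → Fin n → R) (Ψ : V → Multiset (Fin n) → R) {P : Type}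
    [Fintype P] (s : P → V) (ι : P → Fin n) (I : Type) [Fintype I] : R :=
  ∑ r : I → V, ∑ j : I → Fin n, ∑ S : P → V ⊕ I,
    if ∀ p, Sum.elim id r (S p) = s p then
      (∏ v, Ψ v (Mo S ι (Sum.inl v) + Mo r j v)) * ∏ i, θ (r i) (Mo S ι (Sum.inr i)) (j i)
    else 0

theorem chainTerm_congr_left (θ : V → Multiset (Fin n) → Fin n → R)
    (Ψ : V → Multiset (Fin n) → R) {P Q : Type} [Fintype P] [Fintype Q] (e : Q ≃ P) (s : P → V)
    (ι : P → Fin n) (I : Type) [Fintype I] :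
    chainTerm θ Ψ (s ∘ e) (ι ∘ e) I = chainTerm θ Ψ s ι I := by
  unfold chainTerm
  refine Finset.sum_congr rfl fun r _ => Finset.sum_congr rfl fun j _ => ?_
  refine Fintype.sum_equiv (Equiv.arrowCongr e (Equiv.refl _)) _ _ fun S => ?_
  have hS : S = (Equiv.arrowCongr e (Equiv.refl (V ⊕ I)) S) ∘ e := by ext; simp
  generalize Equiv.arrowCongr e (Equiv.refl (V ⊕ I)) S = S' at hS
  subst hS
  simp only [Mo_equiv]
  refine if_congr ?_ rfl rfl
  exact e.forall_congr_left.trans (by simp)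

/-- A map to `Option X` amounts to the set `B` where its value is `none` and a map to `X` on the
complement. In the application `B` is the set of labels carried by one distinguished new vertex. -/
theorem sum_option_fun {Q X M : Type} [Fintype Q] [Fintype X] [AddCommMonoid M]
    (G : (Q → Option X) → M) :
    ∑ f, G f = ∑ B : Finset Q, ∑ f : {q // q ∉ B} → X,
      G fun q => if h : q ∈ B then none else some (f ⟨q, h⟩) := by
  rw [← Fintype.sum_sigma' (fun (B : Finset Q) (f : {q // q ∉ B} → X) =>
      G fun q => if h : q ∈ B then none else some (f ⟨q, h⟩))]
  symm
  refine Fintype.sum_bijective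
    (fun x : (Σ B : Finset Q, ({q // q ∉ B} → X)) =>
      fun q => if h : q ∈ x.1 then none else some (x.2 ⟨q, h⟩)) ⟨?_, ?_⟩ _ _ fun _ => rfl
  · rintro ⟨B, f⟩ ⟨B', f'⟩ h
    have hB : B = B' := by
      ext q
      have := congrFun h q
      by_cases h1 : q ∈ B <;> by_cases h2 : q ∈ B' <;> simp_all
    subst hB
    congr
    ext ⟨q, hq⟩
    have := congrFun h q
    simpa [hq] using this
  · intro g
    refine ⟨⟨Finset.univ.filter fun q => g q = none, fun q => (g q).get (by
      have := q.2; simpa [Option.isSome_iff_ne_none] using this)⟩, ?_⟩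
    ext q : 1
    by_cases h : g q = none <;> simp [h]

/-- Subsets of the fibre over `w` are rewritten as subsets `B` of all of `Q` that lie over `w`, so
that the complement of `B` can serve as the label set for the whole product in `ChainSys.prod_eq`.
-/
theorem ChainSys.cons_fiber {θ : Multiset (Fin n) → Fin n → R}
    {𝒞 : Set ((Multiset (Fin n) → R) × (Multiset (Fin n) → R))} (h : ChainSys θ 𝒞)
    {Ψ : (Multiset (Fin n) → R) × (Multiset (Fin n) → R)} (hΨ : Ψ ∈ 𝒞) :
    ∃ Φ : Fin n → Multiset (Fin n) → R, (∀ j, (Φ j, fun J => Ψ.2 (j ::ₘ J)) ∈ 𝒞) ∧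
    ∀ (p : Fin n) (Q W : Type) [Fintype Q] (s : Q → W) (κ : Q → Fin n) (w : W),
      Ψ.1 (p ::ₘ Mo s κ w) = Φ p (Mo s κ w) + ∑ j, ∑ B : Finset Q,
        if ∀ q ∈ B, s q = w then
          Φ j (Mo (fun q : {q // q ∉ B} => s q) (fun q => κ q) w) *
            θ (p ::ₘ ∑ q : {q // q ∈ B}, {κ q}) j else 0 := by
  obtain ⟨Φ, h1, h2⟩ := h.cons Ψ hΨ
  refine ⟨Φ, h1, fun p Q W _ s κ w => ?_⟩
  have key : ∀ (Q' : Type) [Fintype Q'] (s' : Q' → W) (κ' : Q' → Fin n),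
      Mo s' κ' w = ∑ q : {q // s' q = w}, {κ' q} := by
    intro Q' _ s' κ'
    unfold Mo
    rw [← Finset.sum_filter]
    exact (Finset.sum_subtype _ (by simp) _)
  rw [key Q, h2 p {q // s q = w} fun q => κ q]
  congr 1
  refine Finset.sum_congr rfl fun j _ => ?_
  rw [← Finset.sum_filter]
  refine Finset.sum_bij' (fun B _ => B.map (Function.Embedding.subtype _))
    (fun B _ => B.subtype _) ?_ ?_ ?_ ?_ ?_
  · intro B _
    simp only [Finset.mem_filter, Finset.mem_univ, true_and, Finset.mem_map]
    rintro q ⟨a, _, rfl⟩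
    exact a.2
  · simp
  · intro B _; ext q; simpa using fun _ => q.2
  · intro B hB
    ext q
    simp only [Finset.mem_filter, Finset.mem_univ, true_and] at hB
    simpa using hB q
  · intro B _
    have hm : ∀ q (h : s q = w), q ∈ B.map (Function.Embedding.subtype _) ↔ ⟨q, h⟩ ∈ B := by
      intro q h; simp [h]
    congr 2
    · rw [key]
      let e : {q : {q // s q = w} // q ∉ B} ≃
          {q : {q // q ∉ B.map (Function.Embedding.subtype fun q => s q = w)} // s q.1 = w} :=
        { toFun := fun q => ⟨⟨q.1.1, fun h => q.2 ((hm _ q.1.2).1 h)⟩, q.1.2⟩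
          invFun := fun q => ⟨⟨q.1.1, q.2⟩, fun h => q.1.2 ((hm _ q.2).2 h)⟩
          left_inv := fun _ => rfl
          right_inv := fun _ => rfl }
      exact sum_equiv_inst e _ _ fun _ => rfl
    · congr 1
      have hs : ∀ q ∈ B.map (Function.Embedding.subtype fun q => s q = w), s q = w := by
        intro q hq
        obtain ⟨a, _, rfl⟩ := Finset.mem_map.1 hq
        exact a.2
      let e : {q : {q // s q = w} // q ∈ B} ≃
          {q // q ∈ B.map (Function.Embedding.subtype fun q => s q = w)} :=
        { toFun := fun q => ⟨q.1.1, (hm _ q.1.2).2 q.2⟩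
          invFun := fun q => ⟨⟨q.1, hs _ q.2⟩, (hm _ (hs _ q.2)).1 q.2⟩
          left_inv := fun _ => rfl
          right_inv := fun _ => rfl }
      exact sum_equiv_inst e _ _ fun _ => rfl

/-- The terms of the chain rule in which the label `p` belongs to the new vertex `i`. -/
def chainTermAt (θ : V → Multiset (Fin n) → Fin n → R) (Ψ : V → Multiset (Fin n) → R) {P : Type}
    [Fintype P] (s : P → V) (ι : P → Fin n) (w : V) (p : Fin n) (I : Type) [Fintype I] (i : I) : R :=
  ∑ r : I → V, ∑ j : I → Fin n, ∑ S : P → V ⊕ I,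
    if r i = w ∧ ∀ p, Sum.elim id r (S p) = s p then
      (∏ v, Ψ v (Mo S ι (Sum.inl v) + Mo r j v)) *
        ∏ i', θ (r i') ((if i = i' then {p} else 0) + Mo S ι (Sum.inr i')) (j i')
    else 0

theorem chainTermAt_congr (θ : V → Multiset (Fin n) → Fin n → R)
    (Ψ : V → Multiset (Fin n) → R) {P : Type} [Fintype P] (s : P → V)
    (ι : P → Fin n) (w : V) (p : Fin n) {I J : Type} [Fintype I] [Fintype J] (e : I ≃ J) (i : I) :
    chainTermAt θ Ψ s ι w p I i = chainTermAt θ Ψ s ι w p J (e i) := by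
  unfold chainTermAt
  refine Fintype.sum_equiv (Equiv.arrowCongr e (Equiv.refl _)) _ _ fun r => ?_
  refine Fintype.sum_equiv (Equiv.arrowCongr e (Equiv.refl _)) _ _ fun j => ?_
  refine Fintype.sum_equiv (Equiv.arrowCongr (Equiv.refl _)
    (Equiv.sumCongr (Equiv.refl _) e)) _ _ fun S => ?_
  have hr : r = (Equiv.arrowCongr e (Equiv.refl V) r) ∘ e := by ext; simp
  have hj : j = (Equiv.arrowCongr e (Equiv.refl (Fin n)) j) ∘ e := by ext; simp
  have hS : Equiv.arrowCongr (Equiv.refl P) (Equiv.sumCongr (Equiv.refl V) e) S =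
    Equiv.sumCongr (Equiv.refl V) e ∘ S := by ext; simp
  rw [hS]
  generalize Equiv.arrowCongr e (Equiv.refl V) r = r' at hr
  generalize Equiv.arrowCongr e (Equiv.refl (Fin n)) j = j' at hj
  subst hr hj
  have h1 : ∀ v, Mo (Equiv.sumCongr (Equiv.refl V) e ∘ S) ι (Sum.inl v) = Mo S ι (Sum.inl v) :=
    fun v => Mo_injective (Equiv.sumCongr (Equiv.refl V) e).injective S ι (Sum.inl v)
  have h2 : ∀ i, Mo (Equiv.sumCongr (Equiv.refl V) e ∘ S) ι (Sum.inr (e i)) = Mo S ι (Sum.inr i) :=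
    fun v => Mo_injective (Equiv.sumCongr (Equiv.refl V) e).injective S ι (Sum.inr v)
  simp only [h1, Mo_equiv]
  refine if_congr ?_ ?_ rfl
  · refine and_congr Iff.rfl <| forall_congr' fun p => ?_
    simp only [Function.comp]
    cases S p <;> simp
  · congr 1
    exact Fintype.prod_equiv e _ _ fun i => by simp [h2]

theorem Mo_update_prod (Ψ : V → Multiset (Fin n) → R) (w : V) (p : Fin n) (f : V → Multiset (Fin n)) :
    ∏ v, Function.update Ψ w (fun J => Ψ w (p ::ₘ J)) v (f v) =
      ∏ v, Ψ v ((if w = v then {p} else 0) + f v) := by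
  refine Finset.prod_congr rfl fun v _ => ?_
  by_cases h : w = v
  · subst h; simp
  · simp [Function.update_of_ne (Ne.symm h), h]

/-- The label `none` either remains at its vertex, which adds an index to the array there, or is
carried by one of the new vertices, which must then hang on `s none`. -/
theorem chainTerm_option (θ : V → Multiset (Fin n) → Fin n → R)
    (Ψ : V → Multiset (Fin n) → R) {Q : Type} [Fintype Q] (s : Option Q → V)
    (ι : Option Q → Fin n) (I : Type) [Fintype I] :
    chainTerm θ Ψ s ι I =
      chainTerm θ (Function.update Ψ (s none) fun J => Ψ (s none) (ι none ::ₘ J))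
        (s ∘ some) (ι ∘ some) I +
      ∑ i, chainTermAt θ Ψ (s ∘ some) (ι ∘ some) (s none) (ι none) I i := by
  unfold chainTerm chainTermAt
  rw [Finset.sum_comm (s := (Finset.univ : Finset I)), ← Finset.sum_add_distrib]
  refine Finset.sum_congr rfl fun r _ => ?_
  rw [Finset.sum_comm (s := (Finset.univ : Finset I)), ← Finset.sum_add_distrib]
  refine Finset.sum_congr rfl fun j _ => ?_
  rw [Finset.sum_comm (s := (Finset.univ : Finset I)), ← Finset.sum_add_distrib]
  rw [sum_pi_option, Finset.sum_comm]
  refine Finset.sum_congr rfl fun S _ => ?_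
  rw [Fintype.sum_sum_type]
  have e1 : ∀ (x : V ⊕ I), optFun x S none = x := fun _ => rfl
  have e2 : ∀ (x : V ⊕ I), optFun x S ∘ some = S := fun _ => rfl
  have e3 : ∀ (x : V ⊕ I) q, optFun x S (some q) = S q := fun _ _ => rfl
  congr 1
  · rw [Finset.sum_eq_single (s none)]
    · simp only [Mo_option, e1, e2, Option.forall, e3, Mo_update_prod]
      simp [add_assoc]
    · intro v _ hv
      rw [if_neg]
      intro h
      exact hv (by simpa [e1] using h none)
    · simp
  · refine Finset.sum_congr rfl fun i _ => ?_
    simp only [Mo_option, e1, e2, Option.forall, e3]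
    simp

/-- The new vertex with the distinguished label can be split off: it is determined by the index `j`
on the edge that joins it to `w` and by the set `B` of further labels that it carries. What remains
is an ordinary term with the extra index `j` at `w`. -/
theorem chainTermAt_option (θ : V → Multiset (Fin n) → Fin n → R)
    (Ψ : V → Multiset (Fin n) → R) {Q : Type} [Fintype Q] (s : Q → V)
    (ι : Q → Fin n) (w : V) (p : Fin n) (I : Type) [Fintype I] :
    chainTermAt θ Ψ s ι w p (Option I) none = ∑ j, ∑ B : Finset Q,
      if ∀ q ∈ B, s q = w then θ w (p ::ₘ ∑ q : {q // q ∈ B}, {ι q}) j *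
        chainTerm θ (Function.update Ψ w fun J => Ψ w (j ::ₘ J))
          (fun q : {q // q ∉ B} => s q) (fun q => ι q) I else 0 := by
  unfold chainTermAt
  let e : Option (V ⊕ I) ≃ V ⊕ Option I :=
    { toFun := fun x => x.elim (Sum.inr none) (Sum.elim Sum.inl (fun i => Sum.inr (some i)))
      invFun := Sum.elim (fun v => some (Sum.inl v)) (fun i => i.map Sum.inr)
      left_inv := by rintro (_ | _ | _) <;> rfl
      right_inv := by rintro (_ | _ | _) <;> rfl }
  have hS : ∀ G : (Q → V ⊕ Option I) → R, ∑ S, G S = ∑ S : Q → Option (V ⊕ I), G (fun q => e (S q)) :=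
    fun G => (sum_equiv_inst (Equiv.arrowCongr (Equiv.refl Q) e) _ _ fun _ => rfl).symm
  rw [sum_pi_option, Finset.sum_eq_single w]
  rotate_left
  · intro w' _ hw'
    refine Finset.sum_eq_zero fun _ _ => Finset.sum_eq_zero fun _ _ =>
      Finset.sum_eq_zero fun _ _ => if_neg fun h => hw' h.1
  · simp
  simp only [sum_pi_option (X := Fin n)]
  rw [Finset.sum_comm]
  refine Finset.sum_congr rfl fun j' _ => ?_
  simp only [hS, sum_option_fun (X := V ⊕ I)]
  have hd : ∀ B : Finset Q, (if ∀ q ∈ B, s q = w then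
        θ w (p ::ₘ ∑ q : {q // q ∈ B}, {ι q}) j' *
        chainTerm θ (Function.update Ψ w fun J => Ψ w (j' ::ₘ J))
          (fun q : {q // q ∉ B} => s q) (fun q => ι q) I else 0) =
      ∑ r : I → V, ∑ j : I → Fin n, ∑ S : {q // q ∉ B} → V ⊕ I,
        if (∀ q ∈ B, s q = w) ∧ ∀ q, Sum.elim id r (S q) = s q then
        θ w (p ::ₘ ∑ q : {q // q ∈ B}, {ι q}) j' *
            ((∏ v, Function.update Ψ w (fun J => Ψ w (j' ::ₘ J)) v
              (Mo S (fun q => ι q) (Sum.inl v) + Mo r j v)) *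
            ∏ i, θ (r i) (Mo S (fun q => ι q) (Sum.inr i)) (j i)) else 0 := by
    intro B
    unfold chainTerm
    simp only [Finset.mul_sum]
    split_ifs with hB
    · refine Finset.sum_congr rfl fun r _ => Finset.sum_congr rfl fun j _ =>
        sum_equiv_inst (Equiv.refl _) _ _ fun S => ?_
      rw [mul_ite, mul_zero]
      exact if_congr ⟨fun h => ⟨hB, h⟩, And.right⟩ rfl rfl
    · simp [hB]
  simp only [hd]
  rw [Finset.sum_comm' (t' := (Finset.univ : Finset (I → V)))
    (s' := fun _ => (Finset.univ : Finset (Finset Q))) (by simp)]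
  refine Finset.sum_congr rfl fun r _ => ?_
  rw [Finset.sum_comm' (t' := (Finset.univ : Finset (I → Fin n)))
    (s' := fun _ => (Finset.univ : Finset (Finset Q))) (by simp)]
  refine Finset.sum_congr rfl fun j _ => Finset.sum_congr rfl fun B _ =>
    Finset.sum_congr rfl fun S _ => ?_
  set S' : Q → V ⊕ Option I := fun q =>
    e (if h : q ∈ B then none else some (S ⟨q, h⟩)) with hS'
  have hB : ∀ q ∈ B, S' q = Sum.inr none := fun q hq => by simp [hS', hq, e]
  have hBc : ∀ q : {q // q ∉ B}, S' q = Sum.elim Sum.inl (fun i => Sum.inr (some i)) (S q) :=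
    fun q => by simp [hS', q.2, e]
  have m1 : ∀ v, Mo S' ι (Sum.inl v) = Mo S (fun q => ι q) (Sum.inl v) := by
    intro v
    rw [Mo_split B, Mo_of_forall_ne (fun q => by rw [hB q q.2]; simp), zero_add]
    simp only [hBc]
    refine Finset.sum_congr rfl fun q _ => ?_
    rcases hq : S q <;> simp [hq]
  have m2 : ∀ i, Mo S' ι (Sum.inr (some i)) = Mo S (fun q => ι q) (Sum.inr i) := by
    intro v
    rw [Mo_split B, Mo_of_forall_ne (fun q => by rw [hB q q.2]; simp), zero_add]
    simp only [hBc]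
    refine Finset.sum_congr rfl fun q _ => ?_
    rcases hq : S q <;> simp [hq]
  have m3 : Mo S' ι (Sum.inr none) = ∑ q : {q // q ∈ B}, {ι q} := by
    rw [Mo_split B, Mo_of_forall_ne (s := fun q : {q // q ∉ B} => S' q)
      (fun q => by rw [hBc]; rcases hq : S q <;> simp), add_zero]
    exact Finset.sum_congr rfl fun q _ => by simp [hB q q.2]
  have r0 : optFun w r none = w := rfl
  have r1 : ∀ i, optFun w r (some i) = r i :=
    fun _ => rfl
  have r2 : optFun w r ∘ some = r := rfl
  have j0 : optFun j' j none = j' := rfl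
  have j1 : ∀ i, optFun j' j (some i) = j i :=
    fun _ => rfl
  have j2 : optFun j' j ∘ some = j := rfl
  refine if_congr ?_ ?_ rfl
  · rw [r0]
    simp only [true_and]
    constructor
    · intro h
      refine ⟨fun q hq => ?_, fun q => ?_⟩
      · have := h q
        change Sum.elim id (optFun w r) (S' q) = s q at this
        rw [hB q hq] at this; exact this.symm
      · have := h q
        change Sum.elim id (optFun w r) (S' q) = s q at this
        rw [hBc q] at this
        rw [← this]; rcases S q <;> rfl
    · rintro ⟨h1, h2⟩ q
      change Sum.elim id (optFun w r) (S' q) = s q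
      by_cases hq : q ∈ B
      · rw [hB q hq, h1 q hq]; rfl
      · rw [hBc ⟨q, hq⟩, ← h2 ⟨q, hq⟩]; rcases S ⟨q, hq⟩ <;> rfl
  · rw [Fintype.prod_option]
    simp only [m1, m2, m3, r0, r1, j0, j1, Mo_option, r2, j2, Mo_update_prod]
    simp only [if_true, reduceCtorEq, if_false, zero_add, Multiset.singleton_add]
    simp only [add_left_comm]
    ring

variable [Algebra ℂ R]

/-- The chain rule for a product of arrays, in the form with labelled new vertices. -/
theorem ChainSys.prod_eq {θ : V → Multiset (Fin n) → Fin n → R}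
    {𝒞 : V → Set ((Multiset (Fin n) → R) × (Multiset (Fin n) → R))}
    (h : ∀ v, ChainSys (θ v) (𝒞 v)) (h0 : ∀ v j, θ v 0 j = 0) (N : ℕ) :
    ∀ (P : Type) [Fintype P], Fintype.card P = N → ∀ (s : P → V) (ι : P → Fin n)
      (Ψ : V → (Multiset (Fin n) → R) × (Multiset (Fin n) → R)), (∀ v, Ψ v ∈ 𝒞 v) → ∀ L, N < L →
      ∏ v, (Ψ v).1 (Mo s ι v) = ∑ m ∈ Finset.range L,
        ((m.factorial : ℂ)⁻¹) • chainTerm θ (fun v => (Ψ v).2) s ι (Fin m) := by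
  -- The bound `L` is free, since terms with more new vertices than labels vanish by `h0`; the two
  -- recursive calls use different bounds.
  induction N using Nat.strong_induction_on with
  | _ N ih =>
  intro P _ hP s ι Ψ hΨ L hL
  obtain ⟨L, rfl⟩ : ∃ L', L = L' + 1 := ⟨L - 1, by omega⟩
  rcases N with _ | k
  · have : IsEmpty P := Fintype.card_eq_zero_iff.1 hP
    rw [Finset.sum_eq_single 0]
    · simp [chainTerm, Mo_empty, fun v => (h v).zero _ (hΨ v)]
    · intro m _ hm
      obtain ⟨m, rfl⟩ := Nat.exists_eq_succ_of_ne_zero hm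
      simp [chainTerm, Mo_empty, h0]
    · simp
  · obtain ⟨Q, _, hQ, ⟨e⟩⟩ : ∃ (Q : Type) (_ : Fintype Q),
        Fintype.card Q = k ∧ Nonempty (Option Q ≃ P) :=
      ⟨Fin k, inferInstance, by simp, ⟨Fintype.equivOfCardEq (by simp [hP])⟩⟩
    have hr : ∀ m, chainTerm θ (fun v => (Ψ v).2) s ι (Fin m) =
        chainTerm θ (fun v => (Ψ v).2) (s ∘ e) (ι ∘ e) (Fin m) := fun m =>
      (chainTerm_congr_left θ (fun v => (Ψ v).2) e s ι (Fin m)).symm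
    have hl : ∀ v, Mo s ι v = Mo (s ∘ e) (ι ∘ e) v := fun v => (Mo_equiv e s ι v).symm
    simp only [hr, hl]
    clear hr hl
    generalize s ∘ e = s
    generalize ι ∘ e = ι
    set w := s none with hw
    obtain ⟨Φ, hΦ, hc⟩ := (h w).cons_fiber (hΨ w)
    have hlow : ∀ (B : Finset Q), Fintype.card {q // q ∉ B} ≤ k := fun B =>
      (Fintype.card_subtype_le _).trans hQ.le
    have hupd : ∀ j v, Function.update Ψ w (Φ j, fun J => (Ψ w).2 (j ::ₘ J)) v ∈ 𝒞 v := by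
      intro j v
      by_cases hv : v = w
      · subst hv; simpa using hΦ j
      · simpa [Function.update_of_ne hv] using hΨ v
    have hsnd : ∀ j, (fun v => (Function.update Ψ w (Φ j, fun J => (Ψ w).2 (j ::ₘ J)) v).2) =
        Function.update (fun v => (Ψ v).2) w fun J => (Ψ w).2 (j ::ₘ J) := by
      intro j; ext v
      by_cases hv : v = w
      · subst hv; simp
      · simp [Function.update_of_ne hv]
    have hprod : ∀ j (f : V → Multiset (Fin n)),
        ∏ v, (Function.update Ψ w (Φ j, fun J => (Ψ w).2 (j ::ₘ J)) v).1 (f v) =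
          Φ j (f w) * ∏ v ∈ Finset.univ.erase w, (Ψ v).1 (f v) := by
      intro j f
      rw [← Finset.mul_prod_erase _ _ (Finset.mem_univ w)]
      congr 1
      · simp
      · exact Finset.prod_congr rfl fun v hv => by
          rw [Function.update_of_ne (Finset.ne_of_mem_erase hv)]
    rw [← Finset.mul_prod_erase _ _ (Finset.mem_univ w)]
    have hMw : Mo s ι w = ι none ::ₘ Mo (s ∘ some) (ι ∘ some) w := by
      rw [Mo_option, if_pos hw.symm, Multiset.singleton_add]
    have hMv : ∀ v ∈ Finset.univ.erase w, Mo s ι v = Mo (s ∘ some) (ι ∘ some) v := fun v hv => by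
      rw [Mo_option, if_neg (Finset.ne_of_mem_erase hv).symm, zero_add]
    rw [hMw, hc, Finset.prod_congr rfl fun v hv => by rw [hMv v hv], add_mul, ← hprod,
      ih k (by omega) Q hQ _ _ _ (hupd _) (L + 1) (by omega), hsnd]
    simp only [chainTerm_option, smul_add, Finset.sum_add_distrib]
    congr 1
    -- In these terms some new vertex carries the label `none`, so `m = 0` contributes nothing and
    -- the index shifts by one.
    rw [Finset.sum_range_succ']
    simp only [Finset.univ_eq_empty, Finset.sum_empty, smul_zero, add_zero]
    -- Each of the `m + 1` new vertices may be the one with the distinguished label, and `(m + 1) /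
    -- (m + 1)! = 1 / m!`.
    have hT : ∀ m : ℕ, (((m + 1).factorial : ℂ)⁻¹) • ∑ i : Fin (m + 1),
        chainTermAt θ (fun v => (Ψ v).2) (s ∘ some) (ι ∘ some) (s none) (ι none) (Fin (m + 1)) i =
        ((m.factorial : ℂ)⁻¹) • chainTermAt θ (fun v => (Ψ v).2) (s ∘ some) (ι ∘ some) (s none) (ι none)
          (Option (Fin m)) none := by
      intro m
      rw [Finset.sum_congr rfl fun i _ => by
        rw [chainTermAt_congr _ _ _ _ _ _ (finSuccEquiv' i) i, finSuccEquiv'_at]]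
      rw [Finset.sum_const, Finset.card_univ, Fintype.card_fin, ← Nat.cast_smul_eq_nsmul ℂ, smul_smul]
      congr 1
      have : ((m + 1 : ℕ) : ℂ) ≠ 0 := by exact_mod_cast Nat.succ_ne_zero m
      have h2 : (m.factorial : ℂ) ≠ 0 := by exact_mod_cast Nat.factorial_ne_zero m
      rw [Nat.factorial_succ]
      push_cast at this ⊢
      field_simp
    rw [Finset.sum_congr rfl fun m _ => hT m]
    simp only [chainTermAt_option, Finset.smul_sum, Finset.sum_mul]
    symm
    rw [Finset.sum_comm]
    refine Finset.sum_congr rfl fun j _ => ?_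
    rw [Finset.sum_comm]
    refine Finset.sum_congr rfl fun B _ => ?_
    symm
    by_cases hB : ∀ q ∈ B, (s ∘ some) q = w
    · rw [if_pos hB]
      have hMB : ∀ v ∈ Finset.univ.erase w, Mo (s ∘ some) (ι ∘ some) v =
          Mo (fun q : {q // q ∉ B} => (s ∘ some) q) (fun q => (ι ∘ some) q) v := by
        intro v hv
        rw [Mo_split B, Mo_of_forall_ne (fun q => by
          simpa using fun h => (Finset.ne_of_mem_erase hv) (h.symm.trans (hB q q.2))), zero_add]
      rw [Finset.prod_congr rfl fun v hv => by rw [hMB v hv], mul_right_comm, ← hprod,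
        ih _ (Nat.lt_succ_of_le (hlow B)) _ rfl _ _ _ (hupd j) L (by have := hlow B; omega),
        hsnd, Finset.sum_mul]
      refine Finset.sum_congr rfl fun m _ => ?_
      rw [if_pos hB, smul_mul_assoc, mul_comm]
    · rw [if_neg hB, zero_mul]
      refine (Finset.sum_eq_zero fun m _ => ?_).symm
      rw [if_neg hB, smul_zero]

end Expand

/-! ### Graph polynomials and the vertices to be eliminated -/

namespace PointedGraph

/-- The pointed graph with given vertices and edges. -/
@[reducible] def gr {V E : Type} [Fintype V] [Fintype E] (b : V) (s t : E → V) : PointedGraph where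
  V := V
  E := E
  src := s
  tgt := t
  base := b

/-- Every ordinary vertex has in- and out-degree at least one. -/
def PosDeg (G : PointedGraph) : Prop := ∀ v, v ≠ G.base → 1 ≤ G.inDeg v ∧ 1 ≤ G.outDeg v

theorem outDeg_eq_card {I : Type} (G : PointedGraph) (ι : G.E → I) (v : G.V) :
    G.outDeg v = Multiset.card (Mo G.src ι v) := by
  rw [card_Mo]; rfl

theorem inDeg_eq_card {I : Type} (G : PointedGraph) (ι : G.E → I) (v : G.V) :
    G.inDeg v = Multiset.card (Mo G.tgt ι v) := by
  rw [card_Mo]; rfl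

theorem one_le_outDeg {G : PointedGraph} {v : G.V} : 1 ≤ G.outDeg v ↔ ∃ e, G.src e = v := by
  unfold outDeg outEdges
  rw [Nat.one_le_iff_ne_zero, Finset.card_ne_zero]
  simp [Finset.Nonempty]

theorem one_le_inDeg {G : PointedGraph} {v : G.V} : 1 ≤ G.inDeg v ↔ ∃ e, G.tgt e = v := by
  unfold inDeg inEdges
  rw [Nat.one_le_iff_ne_zero, Finset.card_ne_zero]
  simp [Finset.Nonempty]

theorem eq_of_inDeg_eq_one {G : PointedGraph} {v : G.V} (h : G.inDeg v = 1) {e e' : G.E}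
    (he : G.tgt e = v) (he' : G.tgt e' = v) : e = e' := by
  have := Finset.card_le_one.1 h.le e (by simp [inEdges, he]) e' (by simp [inEdges, he'])
  exact this

theorem Iso.outDeg_eq {G H : PointedGraph} (φ : Iso G H) (v : G.V) :
    H.outDeg (φ.onV v) = G.outDeg v := by
  unfold outDeg outEdges
  refine (Finset.card_equiv φ.onE fun e => ?_).symm
  simp [φ.src_eq]

theorem Iso.inDeg_eq {G H : PointedGraph} (φ : Iso G H) (v : G.V) :
    H.inDeg (φ.onV v) = G.inDeg v := by
  unfold inDeg inEdges
  refine (Finset.card_equiv φ.onE fun e => ?_).symm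
  simp [φ.tgt_eq]

theorem Iso.eq_base_iff {G H : PointedGraph} (φ : Iso G H) (v : G.V) :
    φ.onV v = H.base ↔ v = G.base := by
  rw [← φ.base_eq, φ.onV.injective.eq_iff]

theorem Iso.posDeg {G H : PointedGraph} (φ : Iso G H) (h : G.PosDeg) : H.PosDeg := by
  intro v hv
  obtain ⟨v, rfl⟩ := φ.onV.surjective v
  rw [φ.outDeg_eq, φ.inDeg_eq]
  exact h v fun h0 => hv ((φ.eq_base_iff v).2 h0)

theorem Iso.isStable {G H : PointedGraph} (φ : Iso G H) (h : G.IsStable) : H.IsStable := by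
  intro v hv
  obtain ⟨v, rfl⟩ := φ.onV.surjective v
  rw [φ.outDeg_eq, φ.inDeg_eq]
  exact h v fun h0 => hv ((φ.eq_base_iff v).2 h0)

theorem IsStable.posDeg {G : PointedGraph} (h : G.IsStable) : G.PosDeg := fun v hv => by
  have := h v hv; omega

/-- Relabelling of the vertices and edges. -/
def grIso {V E V' E' : Type} [Fintype V] [Fintype E] [Fintype V'] [Fintype E'] (eV : V ≃ V')
    (eE : E ≃ E') {b : V} {b' : V'} (hb : eV b = b') (s t : E → V) :
    Iso (gr b s t) (gr b' (Equiv.arrowCongr eE eV s) (Equiv.arrowCongr eE eV t)) where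
  onV := eV
  onE := eE
  src_eq e := by simp
  tgt_eq e := by simp
  base_eq := hb

theorem sum_gr_relabel {V E V' E' M : Type}
    [AddCommMonoid M] {_ : Fintype (E → V)} {_ : Fintype (E' → V')} (eV : V ≃ V') (eE : E ≃ E')
    (f : (E → V) → (E → V) → M) (g : (E' → V') → (E' → V') → M)
    (h : ∀ s t, f s t = g (Equiv.arrowCongr eE eV s) (Equiv.arrowCongr eE eV t)) :
    ∑ s, ∑ t, f s t = ∑ s, ∑ t, g s t :=
  sum_equiv_inst (Equiv.arrowCongr eE eV) _ _ fun s =>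
    sum_equiv_inst (Equiv.arrowCongr eE eV) _ _ fun t => h s t

section ev
variable {n : ℕ} {R : Type} [CommRing R]

/-- The polynomial associated to a graph, for given arrays at the ordinary vertices and at the
distinguished vertex; the indices at the ends of an edge are equal. -/
def ev (G : PointedGraph) (lam F : Multiset (Fin n) → Multiset (Fin n) → R) : R :=
  ∑ ι : G.E → Fin n, ∏ v, (if v = G.base then F else lam) (Mo G.src ι v) (Mo G.tgt ι v)

theorem Iso.ev_eq {G H : PointedGraph} (φ : Iso G H)
    (lam F : Multiset (Fin n) → Multiset (Fin n) → R) : G.ev lam F = H.ev lam F := by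
  unfold ev
  refine sum_equiv_inst (Equiv.arrowCongr φ.onE (Equiv.refl _)) _ _ fun ι => ?_
  refine prod_equiv_inst φ.onV _ _ fun v => ?_
  obtain ⟨ι, rfl⟩ : ∃ ι', ι = ι' ∘ φ.onE := ⟨ι ∘ φ.onE.symm, by ext; simp⟩
  have h1 : Equiv.arrowCongr φ.onE (Equiv.refl (Fin n)) (ι ∘ φ.onE) = ι := by ext; simp
  rw [h1]
  have h2 : Mo G.src (ι ∘ φ.onE) v = Mo H.src ι (φ.onV v) := by
    rw [← Mo_equiv φ.onE H.src ι, ← Mo_injective φ.onV.injective]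
    congr 1; ext e; exact (φ.src_eq e).symm
  have h3 : Mo G.tgt (ι ∘ φ.onE) v = Mo H.tgt ι (φ.onV v) := by
    rw [← Mo_equiv φ.onE H.tgt ι, ← Mo_injective φ.onV.injective]
    congr 1; ext e; exact (φ.tgt_eq e).symm
  rw [h2, h3]
  simp only [φ.eq_base_iff]

end ev

/-- The vertices to be eliminated: the ordinary ones of in-degree one (and, if `D` holds, of
out-degree one). -/
def elimV (D : Prop) (G : PointedGraph) (v : G.V) : Prop :=
  v ≠ G.base ∧ G.inDeg v = 1 ∧ (D → G.outDeg v = 1)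

/-- The edges from vertices that are not to be eliminated to vertices that are. -/
def elimE (D : Prop) (G : PointedGraph) : Finset G.E :=
  Finset.univ.filter fun e => elimV D G (G.tgt e) ∧ ¬ elimV D G (G.src e)

theorem mem_elimE {D : Prop} {G : PointedGraph} {e : G.E} :
    e ∈ elimE D G ↔ elimV D G (G.tgt e) ∧ ¬ elimV D G (G.src e) := by
  simp [elimE]

theorem Iso.elimV_iff {D : Prop} {G H : PointedGraph} (φ : Iso G H) (v : G.V) :
    elimV D H (φ.onV v) ↔ elimV D G v := by
  simp [elimV, φ.outDeg_eq, φ.inDeg_eq, φ.eq_base_iff]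

theorem Iso.mem_elimE_iff {D : Prop} {G H : PointedGraph} (φ : Iso G H) (e : G.E) :
    φ.onE e ∈ elimE D H ↔ e ∈ elimE D G := by
  simp [PointedGraph.mem_elimE, φ.src_eq, φ.tgt_eq, φ.elimV_iff]

theorem Iso.card_elimE {D : Prop} {G H : PointedGraph} (φ : Iso G H) :
    (elimE D G).card = (elimE D H).card :=
  Finset.card_equiv φ.onE fun e => (φ.mem_elimE_iff e).symm

/-- The heads of these edges are ordinary, and distinct because each has in-degree one. -/
theorem card_elimE_le (D : Prop) (G : PointedGraph) :
    (elimE D G).card ≤ Fintype.card G.V - 1 := by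
  rw [← Finset.card_univ, ← Finset.card_erase_of_mem (Finset.mem_univ G.base)]
  refine Finset.card_le_card_of_injOn G.tgt (fun e he => ?_) fun e he e' he' h => ?_
  · simpa using (mem_elimE.1 he).1.1
  · exact eq_of_inDeg_eq_one (mem_elimE.1 he).1.2.1 rfl h.symm

/-- The coefficient functions that are compatible with the contraction of the edges that enter
ordinary vertices of in-degree one. -/
structure IsStabCoeff (C : PointedGraph → ℂ) : Prop where
  iso : ∀ {G H : PointedGraph}, Iso G H → C G = C H
  posDeg : ∀ {G : PointedGraph}, C G ≠ 0 → G.PosDeg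
  contract : ∀ (G : PointedGraph) (e : G.E), G.PosDeg → G.src e ≠ G.tgt e → G.tgt e ≠ G.base →
    G.inDeg (G.tgt e) = 1 → C (G.contractEdge e) = C G
  obstruct : ∀ (G : PointedGraph) (W : Set G.V), W.Nonempty → G.base ∉ W →
    (∀ v ∈ W, G.inDeg v = 1) → (∀ e, G.tgt e ∈ W → G.src e ∈ W) → C G = 0

/-- The eliminable vertices then form a set that no edge enters from outside. Going back along the
unique incoming edges leads to a directed cycle, which contractions can shrink but never remove. -/
theorem IsStabCoeff.eq_zero {C : PointedGraph → ℂ} (hC : IsStabCoeff C) {D : Prop}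
    {G : PointedGraph} (h : elimE D G = ∅) {v : G.V} (hv : elimV D G v) : C G = 0 := by
  refine hC.obstruct G {v | elimV D G v} ⟨v, hv⟩ (fun h => h.1 rfl) (fun v hv => hv.2.1)
    fun e he => ?_
  by_contra h'
  have : e ∈ elimE D G := mem_elimE.2 ⟨he, h'⟩
  simp [h] at this

/-! ### Expansion of a graph by new vertices of in-degree one -/

section ext
variable {V E I : Type} [Fintype V] [Fintype E] [Fintype I]

/-- The graph with new vertices `I`; the vertex `i` is entered by a new edge from `r i`. -/
@[reducible] def ext (b : V) (r : I → V) (S : E → V ⊕ I) (t : E → V) : PointedGraph :=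
  gr (V := V ⊕ I) (E := E ⊕ I) (Sum.inl b) (Sum.elim S (Sum.inl ∘ r)) (Sum.elim (Sum.inl ∘ t) Sum.inr)

variable {b : V} {r : I → V} {S : E → V ⊕ I} {t : E → V} {X : Type}

theorem Mo_ext_src_inl (ι : E ⊕ I → X) (v : V) :
    Mo (ext b r S t).src ι (Sum.inl v : V ⊕ I) =
      Mo S (ι ∘ Sum.inl) (Sum.inl v) + Mo r (ι ∘ Sum.inr) v := by
  refine (Mo_sum _ _ _).trans ?_
  congr 1
  exact Mo_injective Sum.inl_injective r _ v

theorem Mo_ext_src_inr (ι : E ⊕ I → X) (i : I) :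
    Mo (ext b r S t).src ι (Sum.inr i : V ⊕ I) = Mo S (ι ∘ Sum.inl) (Sum.inr i) := by
  refine (Mo_sum _ _ _).trans ?_
  have : Mo ((ext b r S t).src ∘ Sum.inr) (ι ∘ Sum.inr) (Sum.inr i : V ⊕ I) = 0 :=
    Mo_of_forall_ne (fun p => by simp [ext, gr]) _
  exact (congrArg _ this).trans (add_zero _)

theorem Mo_ext_tgt_inl (ι : E ⊕ I → X) (v : V) :
    Mo (ext b r S t).tgt ι (Sum.inl v : V ⊕ I) = Mo t (ι ∘ Sum.inl) v := by
  refine (Mo_sum _ _ _).trans ?_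
  have : Mo ((ext b r S t).tgt ∘ Sum.inr) (ι ∘ Sum.inr) (Sum.inl v : V ⊕ I) = 0 :=
    Mo_of_forall_ne (fun p => by simp [ext, gr]) _
  refine (congrArg _ this).trans ((add_zero _).trans ?_)
  exact Mo_injective Sum.inl_injective t _ v

theorem Mo_ext_tgt_inr (ι : E ⊕ I → X) (i : I) :
    Mo (ext b r S t).tgt ι (Sum.inr i : V ⊕ I) = {ι (Sum.inr i)} := by
  refine (Mo_sum _ _ _).trans ?_
  have : Mo ((ext b r S t).tgt ∘ Sum.inl) (ι ∘ Sum.inl) (Sum.inr i : V ⊕ I) = 0 :=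
    Mo_of_forall_ne (fun p => by simp [ext, gr]) _
  refine (congrArg (· + _) this).trans ((zero_add _).trans ?_)
  refine (Mo_injective (f := (Sum.inr : I → V ⊕ I)) Sum.inr_injective id _ i).trans ?_
  simp [Mo]

theorem Mo_collapse (ι : E → X) (v : V) :
    Mo (fun e => Sum.elim id r (S e)) ι v =
      Mo S ι (Sum.inl v) + ∑ i, if r i = v then Mo S ι (Sum.inr i) else 0 := by
  unfold Mo
  simp only [← Finset.sum_filter (fun i => r i = v)]
  rw [Finset.sum_comm, ← Finset.sum_add_distrib]
  refine Finset.sum_congr rfl fun e _ => ?_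
  obtain ⟨w, hS⟩ | ⟨i, hS⟩ : (∃ w, S e = Sum.inl w) ∨ ∃ i, S e = Sum.inr i := by
    cases S e <;> simp
  · simp [hS]
  · by_cases h : r i = v <;> simp [hS, h, Finset.sum_ite_eq]

theorem outDeg_ext_inl (v : V) : (ext b r S t).outDeg (Sum.inl v : V ⊕ I) =
    Multiset.card (Mo S id (Sum.inl v)) + Multiset.card (Mo r id v) := by
  rw [outDeg_eq_card _ id, Mo_ext_src_inl, Multiset.card_add]
  simp [card_Mo]

theorem outDeg_ext_inr (i : I) : (ext b r S t).outDeg (Sum.inr i : V ⊕ I) =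
    Multiset.card (Mo S id (Sum.inr i)) := by
  rw [outDeg_eq_card _ id, Mo_ext_src_inr]
  simp [card_Mo]

theorem inDeg_ext_inl (v : V) : (ext b r S t).inDeg (Sum.inl v : V ⊕ I) =
    Multiset.card (Mo t id v) := by
  rw [inDeg_eq_card _ id, Mo_ext_tgt_inl]
  simp [card_Mo]

theorem inDeg_ext_inr (i : I) : (ext b r S t).inDeg (Sum.inr i : V ⊕ I) = 1 := by
  rw [inDeg_eq_card _ id, Mo_ext_tgt_inr]
  simp

/-- The admissible expansions. -/
def Adm (D : Prop) (b : V) (r : I → V) (S : E → V ⊕ I) (t : E → V) : Prop :=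
  ∀ i, ¬ elimV D (gr b (fun e => Sum.elim id r (S e)) t) (r i) ∧
    (D → Multiset.card (Mo S id (Sum.inr i)) = 1)

/-- A new vertex with exactly one outgoing label takes one label away from `r i` and gives back one
edge, so the out-degrees of the old vertices do not change. -/
theorem card_collapse (h : ∀ i, Multiset.card (Mo S id (Sum.inr i)) = 1) (ι : E → X) (j : I → X) (v : V) :
    Multiset.card (Mo (fun e => Sum.elim id r (S e)) ι v) =
      Multiset.card (Mo S ι (Sum.inl v) + Mo r j v) := by
  rw [Mo_collapse, Multiset.card_add, Multiset.card_add]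
  congr 1
  rw [card_Mo r, Finset.card_filter, ← Finset.sum_filter, ← Finset.sum_filter, Multiset.card_sum]
  refine Finset.sum_congr rfl fun i _ => ?_
  rw [card_Mo, ← card_Mo S id, h]

end ext
end PointedGraph

namespace PointedGraph

section ext
variable {V E I : Type} [Fintype V] [Fintype E] [Fintype I]
variable {b : V} {r : I → V} {S : E → V ⊕ I} {t : E → V} {X : Type}

theorem elimV_ext_inl {D : Prop} (h : D → ∀ i, Multiset.card (Mo S id (Sum.inr i)) = 1) (v : V) :
    elimV D (ext b r S t) (Sum.inl v : V ⊕ I) ↔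
      elimV D (gr b (fun e => Sum.elim id r (S e)) t) v := by
  unfold elimV
  rw [inDeg_ext_inl, inDeg_eq_card _ id]
  refine and_congr (by simp) (and_congr Iff.rfl (imp_congr_right fun hD => ?_))
  rw [outDeg_ext_inl, outDeg_eq_card _ (fun _ => ()), card_collapse (h hD) _ (fun _ => ()),
    Multiset.card_add]
  simp only [card_Mo]

/-- `Adm` refers to the collapsed graph. This is its intrinsic form in the expanded graph, which
lets expansions be counted as graphs with marked edges of `elimE`. -/
theorem adm_iff {D : Prop} : Adm D b r S t ↔ ∀ i, (Sum.inr i : E ⊕ I) ∈ elimE D (ext b r S t) := by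
  constructor
  · intro h i
    refine mem_elimE.2 ⟨⟨by simp, inDeg_ext_inr i, fun hD => ?_⟩, fun h' => ?_⟩
    · exact (outDeg_ext_inr i).trans ((h i).2 hD)
    · exact (h i).1 ((elimV_ext_inl (fun hD i => (h i).2 hD) _).1 h')
  · intro h
    replace h := fun i => mem_elimE.1 (h i)
    have hD : D → ∀ i, Multiset.card (Mo S id (Sum.inr i)) = 1 := fun hD i =>
      (outDeg_ext_inr i).symm.trans ((h i).1.2.2 hD)
    exact fun i => ⟨fun h' => (h i).2 ((elimV_ext_inl hD _).2 h'), fun hd => hD hd i⟩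

theorem ev_ext {n : ℕ} {R : Type} [CommRing R] (lam F : Multiset (Fin n) → Multiset (Fin n) → R) :
    (ext b r S t).ev lam F = ∑ ι : E → Fin n, ∑ j : I → Fin n,
      (∏ v, (if v = b then F else lam) (Mo S ι (Sum.inl v) + Mo r j v) (Mo t ι v)) *
        ∏ i, lam (Mo S ι (Sum.inr i)) {j i} := by
  unfold ev
  rw [sum_equiv_inst (Equiv.sumArrowEquivProdArrow E I (Fin n)) _ (fun x =>
      (∏ v, (if v = b then F else lam) (Mo S x.1 (Sum.inl v) + Mo r x.2 v) (Mo t x.1 v)) *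
        ∏ i, lam (Mo S x.1 (Sum.inr i)) {x.2 i}) fun ι => ?_, Fintype.sum_prod_type]
  rw [Fintype.prod_sum_type]
  congr 1
  · refine Finset.prod_congr rfl fun v _ => ?_
    rw [Mo_ext_src_inl, Mo_ext_tgt_inl]
    simp only [Sum.inl.injEq]
    rfl
  · refine Finset.prod_congr rfl fun v _ => ?_
    rw [Mo_ext_src_inr, Mo_ext_tgt_inr, if_neg (by simp)]
    rfl

/-- Relabelling of the new vertices. -/
def extCongr {J : Type} [Fintype J] (e : I ≃ J) :
    Iso (ext b r S t) (ext b (r ∘ e.symm) (fun x => Sum.map id e (S x)) t) where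
  onV := Equiv.sumCongr (Equiv.refl V) e
  onE := Equiv.sumCongr (Equiv.refl E) e
  src_eq x := by
    rcases x with x | x
    · rfl
    · simp
  tgt_eq x := by rcases x with x | x <;> simp
  base_eq := rfl

/-- The contraction of the edge that enters the new vertex `none`. -/
def contractExt {r : Option I → V} {S : E → V ⊕ Option I} :
    Iso ((ext b r S t).contractEdge (Sum.inr none : E ⊕ Option I))
      (ext b (r ∘ some) (fun x => Sum.elim Sum.inl (fun o => o.elim (Sum.inl (r none)) Sum.inr) (S x)) t) where
  onV :=
    { toFun := Quot.lift (fun x : V ⊕ Option I =>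
          (Sum.elim Sum.inl (fun o => o.elim (Sum.inl (r none)) Sum.inr) x : V ⊕ I)) (by
          rintro a b ⟨rfl, rfl⟩; rfl)
      invFun := fun x => Quot.mk _ (Sum.map id some x)
      left_inv := by
        rintro ⟨v | _ | i⟩
        · rfl
        · exact Quot.sound ⟨rfl, rfl⟩
        · rfl
      right_inv := by rintro (v | i) <;> rfl }
  onE :=
    { toFun := fun x => match x with
        | ⟨Sum.inl e, _⟩ => (Sum.inl e : E ⊕ I)
        | ⟨Sum.inr (some i), _⟩ => Sum.inr i
        | ⟨Sum.inr none, h⟩ => absurd rfl h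
      invFun := fun x => ⟨Sum.map id some x, by rcases x with x | x <;> simp⟩
      left_inv := by
        rintro ⟨e | _ | i, h⟩
        · rfl
        · exact absurd rfl h
        · rfl
      right_inv := by rintro (v | i) <;> rfl }
  src_eq := by
    rintro ⟨e | _ | i, h⟩
    · rfl
    · exact absurd rfl h
    · rfl
  tgt_eq := by
    rintro ⟨e | _ | i, h⟩
    · rfl
    · exact absurd rfl h
    · rfl
  base_eq := rfl

theorem posDeg_ext_iff : (ext b r S t).PosDeg ↔
    (∀ v, v ≠ b → (∃ e, t e = v) ∧ ((∃ e, S e = Sum.inl v) ∨ ∃ i, r i = v)) ∧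
      ∀ i, ∃ e, S e = Sum.inr i := by
  simp only [PosDeg, one_le_inDeg, one_le_outDeg, Sum.forall, Sum.exists]
  simp

theorem posDeg_gr_iff {s t : E → V} : (gr b s t).PosDeg ↔
    ∀ v, v ≠ b → (∃ e, t e = v) ∧ ∃ e, s e = v := by
  simp only [PosDeg, one_le_inDeg, one_le_outDeg]

-- The new edges are contracted one at a time. Each enters a vertex of in-degree one, so `contract`
-- applies, and the contracted graph inherits positive degrees.
omit [Fintype I] in
theorem IsStabCoeff.ext_of_posDeg {C : PointedGraph → ℂ} (hC : IsStabCoeff C) (N : ℕ) :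
    ∀ (I : Type) [Fintype I], Fintype.card I = N → ∀ (r : I → V) (S : E → V ⊕ I),
      (ext b r S t).PosDeg → C (ext b r S t) = C (gr b (fun e => Sum.elim id r (S e)) t) := by
  induction N with
  | zero =>
    intro I _ hI r S _
    have : IsEmpty I := Fintype.card_eq_zero_iff.1 hI
    refine hC.iso ⟨Equiv.sumEmpty V I, Equiv.sumEmpty E I, ?_, ?_, rfl⟩
    · rintro (e | i)
      · simp only [Equiv.sumEmpty_apply_inl]
        change _ = Equiv.sumEmpty V I (S e)
        rcases S e with v | i
        · rfl
        · exact isEmptyElim i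
      · exact isEmptyElim i
    · rintro (e | i)
      · rfl
      · exact isEmptyElim i
  | succ N ih =>
    intro I _ hI r S hpos
    obtain ⟨J, _, hJ, ⟨e⟩⟩ : ∃ (J : Type) (_ : Fintype J),
        Fintype.card J = N ∧ Nonempty (I ≃ Option J) :=
      ⟨Fin N, inferInstance, by simp, ⟨Fintype.equivOfCardEq (by simp [hI])⟩⟩
    have hpos' := (extCongr (b := b) (r := r) (S := S) (t := t) e).posDeg hpos
    rw [hC.iso (extCongr e)]
    have hcol : (fun x => Sum.elim id r (S x)) =
        fun x => Sum.elim id (r ∘ e.symm) (Sum.map id e (S x)) := by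
      ext x; rcases S x with _ | _ <;> simp
    rw [hcol]
    clear hcol
    revert hpos'
    change (ext b (r ∘ e.symm) (fun x => Sum.map id e (S x)) t).PosDeg →
      C (ext b (r ∘ e.symm) (fun x => Sum.map id e (S x)) t) =
      C (gr b (fun x => Sum.elim id (r ∘ e.symm) ((fun x => Sum.map id e (S x)) x)) t)
    generalize r ∘ e.symm = r
    generalize (fun x => Sum.map id e (S x)) = S
    intro hpos'
    rw [← hC.contract _ (Sum.inr none : E ⊕ Option J) hpos' (by simp) (by simp) (inDeg_ext_inr none),
      hC.iso contractExt, ih J hJ]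
    · congr 2
      ext x
      rcases S x with _ | _ | _ <;> rfl
    · rw [posDeg_ext_iff] at hpos' ⊢
      refine ⟨fun v hv => ⟨(hpos'.1 v hv).1, ?_⟩, fun i => ?_⟩
      · rcases (hpos'.1 v hv).2 with ⟨e, he⟩ | ⟨_ | i, hi⟩
        · exact Or.inl ⟨e, by simp [he]⟩
        · obtain ⟨e, he⟩ := hpos'.2 none
          exact Or.inl ⟨e, by simp [he, hi]⟩
        · exact Or.inr ⟨i, hi⟩
      · obtain ⟨e, he⟩ := hpos'.2 (some i)
        exact ⟨e, by simp [he]⟩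

/-- If the expanded graph lacks positive degrees, so does the collapsed one, and both coefficients
vanish. This uses `hS`: a new vertex without outgoing edge would spoil the expanded graph only. -/
theorem IsStabCoeff.ext_eq {C : PointedGraph → ℂ} (hC : IsStabCoeff C)
    (hS : ∀ i, ∃ e, S e = Sum.inr i) :
    C (ext b r S t) = C (gr b (fun e => Sum.elim id r (S e)) t) := by
  by_cases h : (ext b r S t).PosDeg
  · exact hC.ext_of_posDeg _ I rfl r S h
  · rw [not_imp_comm.1 hC.posDeg h, not_imp_comm.1 hC.posDeg]
    refine fun h' => h ?_
    rw [posDeg_ext_iff]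
    rw [posDeg_gr_iff] at h'
    refine ⟨fun v hv => ⟨(h' v hv).1, ?_⟩, hS⟩
    obtain ⟨e, he⟩ := (h' v hv).2
    rcases hSe : S e with w | i
    · simp only [hSe] at he
      exact Or.inl ⟨e, by rw [hSe]; exact congrArg _ he⟩
    · simp only [hSe] at he
      exact Or.inr ⟨i, he⟩

end ext

/-- The relations between the arrays before and after the elimination of vertices. -/
structure ElimData (D : Prop) {n : ℕ} {R : Type} [CommRing R]
    (lam F lam' F' : Multiset (Fin n) → Multiset (Fin n) → R) where
  𝒞 : Set ((Multiset (Fin n) → R) × (Multiset (Fin n) → R))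
  -- The coefficients of the chain rule are values of `lam` at vertices to be eliminated; this is
  -- why the new vertices of an expansion are again vertices of a graph. In `core`, the index
  -- patterns of eliminated vertices are exempt.
  chain : ChainSys (fun B j => if D → Multiset.card B = 1 then lam B {j} else 0) 𝒞
  zero : ∀ q, lam 0 q = 0
  elim : ∀ P q, Multiset.card q = 1 → (D → Multiset.card P = 1) → lam' P q = lam P q
  base : ∀ q, (fun P => F P q, fun P => F' P q) ∈ 𝒞
  core : ∀ q, (Multiset.card q = 1 → D) → ∃ Ψ ∈ 𝒞, ∀ P,
    ¬ (Multiset.card q = 1 ∧ (D → Multiset.card P = 1)) → Ψ.1 P = lam P q ∧ Ψ.2 P = lam' P q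

/-- The trivial system is used at the vertices that are to be eliminated: nothing is hung on them.
-/
theorem chainSys_diag {n : ℕ} {R : Type} [CommRing R] :
    ChainSys (0 : Multiset (Fin n) → Fin n → R) {p | p.1 = p.2} where
  zero := fun Ψ h => congrFun h 0
  cons := fun Ψ h => ⟨fun j J => Ψ.2 (j ::ₘ J), fun j => rfl, fun p Q _ κ => by
    have h' : Ψ.1 = Ψ.2 := h
    simp [h']⟩

section expand
variable {n : ℕ} {R : Type} [CommRing R] [Algebra ℂ R] {V E : Type} [Fintype V] [Fintype E]

/-- For each labelling of the edges this is `ChainSys.prod_eq`, with the trivial system at the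
vertices to be eliminated and the system of `h` elsewhere. By `elim`, the coefficient at a new
vertex is the value of `lam'` there, so each term is again a graph polynomial. -/
theorem ev_expand {D : Prop} {lam F lam' F' : Multiset (Fin n) → Multiset (Fin n) → R}
    (h : ElimData D lam F lam' F') (b : V) (s t : E → V) {L : ℕ} (hL : Fintype.card E < L) :
    (gr b s t).ev lam F = ∑ m ∈ Finset.range L, ((m.factorial : ℂ)⁻¹) •
      ∑ r : Fin m → V, ∑ S : E → V ⊕ Fin m,
        if (∀ e, Sum.elim id r (S e) = s e) ∧ Adm D b r S t then (ext b r S t).ev lam' F' else 0 := by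
  let θ : Multiset (Fin n) → Fin n → R := fun B j => if D → Multiset.card B = 1 then lam B {j} else 0
  have hθ0 : ∀ j, θ 0 j = 0 := fun j => by simp [θ, h.zero]
  have key : ∀ ι : E → Fin n, ∏ v, (if v = b then F else lam) (Mo s ι v) (Mo t ι v) =
      ∑ m ∈ Finset.range L, ((m.factorial : ℂ)⁻¹) • ∑ r : Fin m → V, ∑ j : Fin m → Fin n,
        ∑ S : E → V ⊕ Fin m, if (∀ e, Sum.elim id r (S e) = s e) ∧ Adm D b r S t then
          (∏ v, (if v = b then F' else lam') (Mo S ι (Sum.inl v) + Mo r j v) (Mo t ι v)) *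
            ∏ i, lam' (Mo S ι (Sum.inr i)) {j i} else 0 := by
    intro ι
    let X : V → Prop := fun v => elimV D (gr b s t) v
    have hX : ∀ v, X v ↔ v ≠ b ∧ Multiset.card (Mo t ι v) = 1 ∧
        (D → Multiset.card (Mo s ι v) = 1) := by
      intro v
      rw [← outDeg_eq_card (gr b s t) ι, ← inDeg_eq_card (gr b s t) ι]
      rfl
    -- The condition on `P` in the last clause is available because, if `D` holds, admissible
    -- expansions preserve out-degrees and hence the type of a vertex.
    have hΨ : ∀ v, ∃ Ψ : (Multiset (Fin n) → R) × (Multiset (Fin n) → R),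
        Ψ ∈ (if X v then {p | p.1 = p.2} else h.𝒞) ∧
        Ψ.1 (Mo s ι v) = (if v = b then F else lam) (Mo s ι v) (Mo t ι v) ∧
        (X v → Ψ.2 (Mo s ι v) = (if v = b then F' else lam') (Mo s ι v) (Mo t ι v)) ∧
        (¬ X v → ∀ P, (D → Multiset.card P = Multiset.card (Mo s ι v)) →
          Ψ.2 P = (if v = b then F' else lam') P (Mo t ι v)) := by
      intro v
      by_cases hv : X v
      · have hv' := (hX v).1 hv
        refine ⟨(fun P => lam P (Mo t ι v), fun P => lam P (Mo t ι v)), by simp [hv], ?_, ?_, ?_⟩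
        · simp [hv'.1]
        · intro _
          simp only [if_neg hv'.1]
          exact (h.elim _ _ hv'.2.1 hv'.2.2).symm
        · exact fun h' => absurd hv h'
      · by_cases hb : v = b
        · refine ⟨_, by simpa [hv] using h.base (Mo t ι v), by simp [hb], fun h' => absurd h' hv,
            fun _ P _ => by simp [hb]⟩
        · have hv' := (not_congr (hX v)).1 hv
          simp only [hb, ne_eq, not_false_eq_true, true_and] at hv'
          obtain ⟨Ψ, h1, h2⟩ := h.core (Mo t ι v) (fun hq => by
            by_contra hD
            exact hv' ⟨hq, fun hd => absurd hd hD⟩)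
          refine ⟨Ψ, by simpa [hv] using h1, ?_, fun h' => absurd h' hv, fun _ P hP => ?_⟩
          · simp only [if_neg hb]
            exact (h2 _ hv').1
          · simp only [if_neg hb]
            exact (h2 P fun hc => hv' ⟨hc.1, fun hD => (hP hD).symm.trans (hc.2 hD)⟩).2
    choose Ψ h1 h2 h3 h4 using hΨ
    rw [← Finset.prod_congr rfl fun v _ => h2 v]
    have hchain : ∀ v, ChainSys (if X v then 0 else θ)
        (if X v then {p : (Multiset (Fin n) → R) × (Multiset (Fin n) → R) | p.1 = p.2}
          else h.𝒞) := fun v => by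
      by_cases hv : X v
      · simpa only [if_pos hv] using chainSys_diag
      · simpa only [if_neg hv] using h.chain
    have hzero : ∀ v j, (if X v then 0 else θ) 0 j = 0 := fun v j => by
      by_cases hv : X v
      · simp [if_pos hv]
      · simp only [if_neg hv]; exact hθ0 j
    refine (ChainSys.prod_eq hchain hzero (Fintype.card E) E rfl s ι Ψ h1 L hL).trans ?_
    refine Finset.sum_congr rfl fun m _ => congrArg _ ?_
    unfold chainTerm
    refine sum_equiv_inst (Equiv.refl _) _ _ fun r => sum_equiv_inst (Equiv.refl _) _ _ fun j =>
      sum_equiv_inst (Equiv.refl _) _ _ fun S => ?_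
    by_cases hcol : ∀ e, Sum.elim id r (S e) = s e
    swap
    · rw [if_neg hcol, if_neg (fun h => hcol h.1)]
    have hs : s = fun e => Sum.elim id r (S e) := by ext e; exact (hcol e).symm
    have hcard : ∀ i, Multiset.card (Mo S id (Sum.inr i)) = Multiset.card (Mo S ι (Sum.inr i)) := by
      intro i; simp only [card_Mo]
    rw [if_pos hcol]
    by_cases hA : Adm D b r S t
    · rw [if_pos ⟨hcol, hA⟩]
      have hXr : ∀ i, ¬ X (r i) := fun i hi => (hA i).1 (by subst hs; exact hi)
      congr 1
      · refine Finset.prod_congr rfl fun v _ => ?_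
        by_cases hv : X v
        · have hr : ∀ i, r i ≠ v := fun i hi => hXr i (hi ▸ hv)
          have : Mo S ι (Sum.inl v) + Mo r j v = Mo s ι v := by
            rw [Mo_of_forall_ne hr, hs, Mo_collapse]
            simp [hr]
          change (Ψ v).2 _ = (if v = b then F' else lam') (Mo S ι (Sum.inl v) + Mo r j v) _
          rw [this, h3 v hv]
        · refine h4 v hv _ fun hD => ?_
          rw [hs]
          exact (card_collapse (fun i => (hA i).2 hD) ι j v).symm
      · refine Finset.prod_congr rfl fun i _ => ?_
        change (if X (r i) then 0 else θ) _ _ = lam' (Mo S ι (Sum.inr i)) {j i}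
        rw [if_neg (hXr i)]
        have : D → Multiset.card (Mo S ι (Sum.inr i)) = 1 := fun hD => by
          rw [← hcard, (hA i).2 hD]
        simp only [θ, if_pos this]
        exact (h.elim _ _ (by simp) this).symm
    -- The chain rule also yields inadmissible terms, but one of their factors vanishes: some new
    -- vertex hangs on an eliminated one, where the system is trivial, or has the wrong out-degree,
    -- where the coefficient is zero.
    · rw [if_neg (fun h => hA h.2)]
      unfold Adm at hA
      rw [← hs] at hA
      push Not at hA
      obtain ⟨i, hi⟩ := hA
      rw [Finset.prod_eq_zero (Finset.mem_univ i), mul_zero]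
      change (if X (r i) then 0 else θ) (Mo S ι (Sum.inr i)) (j i) = 0
      by_cases hX' : X (r i)
      · simp [hX']
      · have := hi hX'
        rw [if_neg hX']
        simp only [θ]
        rw [if_neg]
        intro h'
        rw [hcard] at this
        exact this.2 (h' this.1)
  have hsw : ∀ m, ∑ r : Fin m → V, ∑ S : E → V ⊕ Fin m,
      (if (∀ e, Sum.elim id r (S e) = s e) ∧ Adm D b r S t then (ext b r S t).ev lam' F' else 0) =
      ∑ ι : E → Fin n, ∑ r : Fin m → V, ∑ j : Fin m → Fin n,
        ∑ S : E → V ⊕ Fin m, if (∀ e, Sum.elim id r (S e) = s e) ∧ Adm D b r S t then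
          (∏ v, (if v = b then F' else lam') (Mo S ι (Sum.inl v) + Mo r j v) (Mo t ι v)) *
            ∏ i, lam' (Mo S ι (Sum.inr i)) {j i} else 0 := by
    intro m
    rw [Finset.sum_comm (s := (Finset.univ : Finset (E → Fin n)))]
    refine Finset.sum_congr rfl fun r _ => ?_
    have : ∀ S : E → V ⊕ Fin m, (if (∀ e, Sum.elim id r (S e) = s e) ∧ Adm D b r S t then
        (ext b r S t).ev lam' F' else 0) = ∑ ι : E → Fin n, ∑ j : Fin m → Fin n,
        if (∀ e, Sum.elim id r (S e) = s e) ∧ Adm D b r S t then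
          (∏ v, (if v = b then F' else lam') (Mo S ι (Sum.inl v) + Mo r j v) (Mo t ι v)) *
            ∏ i, lam' (Mo S ι (Sum.inr i)) {j i} else 0 := by
      intro S
      rw [ev_ext]
      split_ifs with hc
      · exact Finset.sum_congr rfl fun _ _ => sum_equiv_inst (Equiv.refl _) _ _ fun _ => rfl
      · simp
    rw [Finset.sum_congr rfl fun S _ => this S, Finset.sum_comm]
    exact Finset.sum_congr rfl fun ι _ => Finset.sum_comm
  simp only [hsw, Finset.smul_sum]
  rw [Finset.sum_comm]
  unfold ev
  refine Finset.sum_congr rfl fun ι _ => (key ι).trans ?_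
  simp only [Finset.smul_sum]

end expand
end PointedGraph

namespace PointedGraph

theorem sum_congr_inst {α M : Type*} [AddCommMonoid M] {i₁ i₂ : Fintype α}
    {f g : α → M} (h : ∀ x, f x = g x) :
    (@Finset.univ α i₁).sum f = (@Finset.univ α i₂).sum g :=
  sum_equiv_inst (Equiv.refl α) f g h

/-! ### Counting expansions by labelled graphs -/

section count
variable {V E I : Type} [Fintype V] [Fintype E] [Fintype I]

theorem exists_equiv_extend {α : Type} [Fintype α] (f g : I ↪ α) :
    ∃ e : α ≃ α, ∀ i, e (f i) = g i := by
  let h : {x // x ∈ Set.range f} ≃ {x // x ∈ Set.range g} :=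
    (Equiv.ofInjective f f.injective).symm.trans (Equiv.ofInjective g g.injective)
  refine ⟨h.extendSubtype, fun i => ?_⟩
  rw [Equiv.extendSubtype_apply_of_mem _ _ ⟨i, rfl⟩]
  simp only [h, Equiv.trans_apply]
  have : (Equiv.ofInjective f f.injective).symm ⟨f i, ⟨i, rfl⟩⟩ = i :=
    Equiv.ofInjective_symm_apply f.injective i
  rw [this]; rfl

variable (D : Prop) (b : V) (φ : PointedGraph → ℂ) (hφ : ∀ {G H : PointedGraph}, Iso G H → φ G = φ H)

-- Relabelling the edges moves any set `M` of `|I|` edges to the edges `Sum.inr i`, so all choices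
-- of `M` inside `elimE` contribute equally.
include hφ in
theorem sum_powersetCard_elimE :
    ∑ s : E ⊕ I → V, ∑ t : E ⊕ I → V,
      (((elimE D (gr b s t)).card.choose (Fintype.card I) : ℕ) : ℂ) * φ (gr b s t) =
    ((Fintype.card E + Fintype.card I).choose (Fintype.card I) : ℕ) *
      ∑ s : E ⊕ I → V, ∑ t : E ⊕ I → V,
        if ∀ i : I, (Sum.inr i : E ⊕ I) ∈ elimE D (gr b s t) then φ (gr b s t) else 0 := by
  have h1 : ∀ s t : E ⊕ I → V, (((elimE D (gr b s t)).card.choose (Fintype.card I) : ℕ) : ℂ) *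
      φ (gr b s t) = ∑ M ∈ Finset.powersetCard (Fintype.card I) (Finset.univ : Finset (E ⊕ I)),
        if M ⊆ elimE D (gr b s t) then φ (gr b s t) else 0 := by
    intro s t
    rw [← Finset.card_powersetCard, ← Finset.sum_filter, Finset.sum_const, nsmul_eq_mul]
    congr 3
    ext M
    simp only [Finset.mem_powersetCard, Finset.mem_filter, Finset.subset_univ, true_and]
    exact and_comm
  simp only [h1]
  simp only [Finset.sum_comm (t := Finset.powersetCard (Fintype.card I) (Finset.univ : Finset (E ⊕ I)))]
  have h2 : ∀ M ∈ Finset.powersetCard (Fintype.card I) (Finset.univ : Finset (E ⊕ I)),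
      ∑ s : E ⊕ I → V, ∑ t : E ⊕ I → V, (if M ⊆ elimE D (gr b s t) then φ (gr b s t) else 0) =
      ∑ s : E ⊕ I → V, ∑ t : E ⊕ I → V,
        if ∀ i : I, (Sum.inr i : E ⊕ I) ∈ elimE D (gr b s t) then φ (gr b s t) else 0 := by
    intro M hM
    have hM' := (Finset.mem_powersetCard.1 hM).2
    let eM : I ≃ {x // x ∈ M} := Fintype.equivOfCardEq (by simp [hM'])
    obtain ⟨e, he⟩ := exists_equiv_extend (eM.toEmbedding.trans (Function.Embedding.subtype _))
      (⟨Sum.inr, Sum.inr_injective⟩ : I ↪ E ⊕ I)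
    refine sum_gr_relabel (Equiv.refl V) e _ _ fun s t => ?_
    have iso := grIso (Equiv.refl V) e (b := b) (b' := b) rfl s t
    refine if_congr ?_ (hφ iso) rfl
    constructor
    · intro h i
      have := he i
      simp only [Function.Embedding.trans_apply, Function.Embedding.subtype_apply,
        Function.Embedding.coeFn_mk] at this
      rw [← this]
      exact ((grIso (Equiv.refl V) e (b := b) (b' := b) rfl s t).mem_elimE_iff _).2 (h (eM i).2)
    · intro h x hx
      obtain ⟨i, hi⟩ := eM.surjective ⟨x, hx⟩
      have h1 := he i
      simp only [Function.Embedding.trans_apply, Function.Embedding.subtype_apply,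
        Function.Embedding.coeFn_mk, hi] at h1
      refine ((grIso (Equiv.refl V) e (b := b) (b' := b) rfl s t).mem_elimE_iff x).1 ?_
      have := h i
      rw [← h1] at this
      exact this
  rw [Finset.sum_congr rfl h2, Finset.sum_const, Finset.card_powersetCard, nsmul_eq_mul,
    Finset.card_univ, Fintype.card_sum]

-- The marked edges have distinct ordinary heads. Relabelling moves these heads to `Sum.inr`, and
-- the injections `I ↪ W` are counted by the descending factorial. With the heads in place, the
-- graph is an expansion.
include hφ in
theorem sum_elimE_heads :
    ∑ s : E ⊕ I → V ⊕ I, ∑ t : E ⊕ I → V ⊕ I,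
      (if ∀ i : I, (Sum.inr i : E ⊕ I) ∈ elimE D (gr (Sum.inl b) s t) then
        φ (gr (Sum.inl b) s t) else 0) =
    ((Fintype.card V - 1 + Fintype.card I).descFactorial (Fintype.card I) : ℕ) *
      ∑ r : I → V, ∑ S : E → V ⊕ I, ∑ t : E → V,
        if Adm D b r S t then φ (ext b r S t) else 0 := by
  let B : V ⊕ I := Sum.inl b
  let W := {w : V ⊕ I // w ≠ B}
  let cond : (E ⊕ I → V ⊕ I) → (E ⊕ I → V ⊕ I) → Prop := fun s t =>
    ∀ i : I, (Sum.inr i : E ⊕ I) ∈ elimE D (gr B s t)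
  let j0 : I ↪ W := ⟨fun i => ⟨Sum.inr i, by simp [B]⟩, fun i i' h => Sum.inr_injective (congrArg Subtype.val h)⟩
  have h1 : ∀ s t, (if cond s t then φ (gr B s t) else 0) =
      ∑ τ : I ↪ W, if (∀ i, t (Sum.inr i) = (τ i).1) ∧ cond s t then φ (gr B s t) else 0 := by
    intro s t
    by_cases hc : cond s t
    · let τ : I ↪ W := ⟨fun i => ⟨t (Sum.inr i), (mem_elimE.1 (hc i)).1.1⟩, fun i i' h => by
        have h' : t (Sum.inr i) = t (Sum.inr i') := congrArg Subtype.val h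
        exact Sum.inr_injective (eq_of_inDeg_eq_one (mem_elimE.1 (hc i)).1.2.1 rfl h'.symm)⟩
      rw [Finset.sum_eq_single τ]
      · rw [if_pos hc, if_pos ⟨fun i => rfl, hc⟩]
      · intro τ' _ hne
        rw [if_neg]
        rintro ⟨h, -⟩
        exact hne (by ext i; exact (h i).symm)
      · simp
    · simp [hc]
  have h2 : ∀ τ : I ↪ W, ∑ s, ∑ t, (if (∀ i, t (Sum.inr i) = (τ i).1) ∧ cond s t then
      φ (gr B s t) else 0) = ∑ s, ∑ t, if (∀ i, t (Sum.inr i) = Sum.inr i) ∧ cond s t then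
      φ (gr B s t) else 0 := by
    intro τ
    obtain ⟨e, he⟩ := exists_equiv_extend τ j0
    let e' : V ⊕ I ≃ V ⊕ I := e.extendSubtype
    have he' : ∀ i, e' (τ i).1 = Sum.inr i := fun i => by
      have := he i
      rw [show e' (τ i).1 = (e (τ i)).1 from Equiv.extendSubtype_apply_of_mem _ _ _, this]; rfl
    have hB : e' B = B := by
      by_contra h
      have h3 : ¬ (B ≠ B) := by simp
      exact Equiv.extendSubtype_not_mem e B h3 h
    refine sum_gr_relabel e' (Equiv.refl _) _ _ fun s t => ?_
    let iso := grIso e' (Equiv.refl (E ⊕ I)) hB s t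
    refine if_congr (and_congr (forall_congr' fun i => ?_) (forall_congr' fun i => ?_)) (hφ iso) rfl
    · rw [← he' i]
      simp [Equiv.arrowCongr_apply]
    · exact (iso.mem_elimE_iff (Sum.inr i)).symm
  have h3 : ∑ s, ∑ t, (if (∀ i, t (Sum.inr i) = Sum.inr i) ∧ cond s t then
      φ (gr B s t) else 0) = ∑ r : I → V, ∑ S : E → V ⊕ I, ∑ t : E → V,
        if Adm D b r S t then φ (ext b r S t) else 0 := by
    simp only [← Fintype.sum_prod_type']
    refine (Fintype.sum_of_injective (fun x : (I → V) × (E → V ⊕ I) × (E → V) =>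
      (Sum.elim x.2.1 (Sum.inl ∘ x.1), Sum.elim (Sum.inl ∘ x.2.2) Sum.inr)) ?_ _ _ ?_ ?_).symm
    · rintro ⟨r, S, t⟩ ⟨r', S', t'⟩ h
      simp only [Prod.mk.injEq, Sum.elim_eq_iff, Sum.inl_injective.comp_left.eq_iff] at h
      simp only [Prod.mk.injEq]
      tauto
    · rintro ⟨s, t⟩ hst
      rw [if_neg]
      rintro ⟨h, hc⟩
      apply hst
      -- A marked edge cannot start at some `Sum.inr i'`, which is itself to be eliminated, and a
      -- second edge into `Sum.inr i'` would contradict in-degree one.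
      have hX : ∀ i, elimV D (gr B s t) (Sum.inr i : V ⊕ I) := fun i => by
        have := (mem_elimE.1 (hc i)).1
        rwa [show (gr B s t).tgt (Sum.inr i : E ⊕ I) = Sum.inr i from h i] at this
      have hs : ∀ i, ∃ v, s (Sum.inr i) = Sum.inl v := fun i => by
        have := (mem_elimE.1 (hc i)).2
        rcases hsi : s (Sum.inr i) with v | i'
        · exact ⟨v, rfl⟩
        · exact absurd (hX i') (by rw [← hsi]; exact this)
      have ht : ∀ e, ∃ v, t (Sum.inl e) = Sum.inl v := fun e => by
        rcases hte : t (Sum.inl e) with v | i'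
        · exact ⟨v, rfl⟩
        · exact absurd (eq_of_inDeg_eq_one (G := gr B s t) (hX i').2.1
            (e := (Sum.inl e : E ⊕ I)) (e' := (Sum.inr i' : E ⊕ I)) hte (h i')) (by simp)
      choose r hr using hs
      choose t' ht' using ht
      refine ⟨(r, s ∘ Sum.inl, t'), ?_⟩
      ext x
      · rcases x with e | i
        · rfl
        · exact (hr i).symm
      · rcases x with e | i
        · exact (ht' e).symm
        · exact (h i).symm
    · rintro ⟨r, S, t⟩
      refine if_congr ?_ rfl rfl
      exact ⟨fun h => ⟨fun i => rfl, adm_iff.1 h⟩, fun h => adm_iff.2 h.2⟩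
  have h4 : Fintype.card (I ↪ W) =
      (Fintype.card V - 1 + Fintype.card I).descFactorial (Fintype.card I) := by
    rw [Fintype.card_embedding_eq]
    congr 1
    have : Fintype.card W = Fintype.card (V ⊕ I) - 1 := by
      rw [← Fintype.card_subtype_eq B, ← Fintype.card_subtype_compl]
    have hV : 0 < Fintype.card V := Fintype.card_pos_iff.2 ⟨b⟩
    rw [this, Fintype.card_sum]
    omega
  change ∑ s, ∑ t, (if cond s t then φ (gr B s t) else 0) = _
  simp only [h1]
  simp only [Finset.sum_comm (t := (Finset.univ : Finset (I ↪ W)))]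
  rw [Finset.sum_congr rfl fun τ _ => h2 τ, Finset.sum_const, h3, Finset.card_univ, h4, nsmul_eq_mul]

end count

/-- The sum over all graphs with `a` ordinary vertices and `b` edges, divided by the number of
labellings. -/
def tot (a b : ℕ) (φ : PointedGraph → ℂ) : ℂ :=
  ((a.factorial * b.factorial : ℕ) : ℂ)⁻¹ *
    ∑ s : Fin b → Option (Fin a), ∑ t : Fin b → Option (Fin a), φ (gr none s t)

theorem tot_eq {V E : Type} [Fintype V] [Fintype E] {a b : ℕ}
    (hV : Fintype.card V = a + 1) (hE : Fintype.card E = b) (v : V) (φ : PointedGraph → ℂ)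
    (hφ : ∀ {G H : PointedGraph}, Iso G H → φ G = φ H) :
    tot a b φ = ((a.factorial * b.factorial : ℕ) : ℂ)⁻¹ *
      ∑ s : E → V, ∑ t : E → V, φ (gr v s t) := by
  unfold tot
  congr 1
  obtain ⟨eV⟩ : Nonempty (Option (Fin a) ≃ V) := ⟨Fintype.equivOfCardEq (by simp [hV])⟩
  let e' := eV.trans (Equiv.swap (eV none) v)
  let eE : Fin b ≃ E := Fintype.equivOfCardEq (by simp [hE])
  refine sum_gr_relabel e' eE _ _ fun s t => hφ (grIso e' eE (by simp [e']) s t)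

theorem tot_congr {a b : ℕ} {φ φ' : PointedGraph → ℂ}
    (h : ∀ G : PointedGraph, Fintype.card G.V = a + 1 → Fintype.card G.E = b → φ G = φ' G) :
    tot a b φ = tot a b φ' := by
  unfold tot
  congr 1
  exact Finset.sum_congr rfl fun s _ => Finset.sum_congr rfl fun t _ => h _ (by simp) (by simp)

theorem tot_sum {ι : Type} (A : Finset ι) (a b : ℕ) (φ : ι → PointedGraph → ℂ) :
    tot a b (fun G => ∑ i ∈ A, φ i G) = ∑ i ∈ A, tot a b (φ i) := by
  unfold tot
  simp only [← Finset.mul_sum]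
  congr 1
  simp only [Finset.sum_comm (t := A)]

theorem tot_const_mul (a b : ℕ) (z : ℂ) (φ : PointedGraph → ℂ) :
    tot a b (fun G => z * φ G) = z * tot a b φ := by
  unfold tot
  simp only [← Finset.mul_sum]
  ring

/-! ### The elimination principle -/

section elim
variable {n : ℕ} {R : Type} [CommRing R] [Algebra ℂ R] {D : Prop}
  {lam F lam' F' : Multiset (Fin n) → Multiset (Fin n) → R}

/-- The coefficient of the collapsed graph is replaced by that of the expanded one by `ext_eq`. This
fails if a new vertex has no outgoing label, but then the polynomial vanishes because `lam 0 q = 0`.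
-/
theorem sum_ev_expand (h : ElimData D lam F lam' F') {C : PointedGraph → ℂ} (hC : IsStabCoeff C)
    (ℓ : R →ₗ[ℂ] ℂ) (a b : ℕ) {L : ℕ} (hL : b < L) :
    ∑ s : Fin b → Option (Fin a), ∑ t : Fin b → Option (Fin a),
      C (gr none s t) * ℓ ((gr none s t).ev lam F) =
    ∑ m ∈ Finset.range L, ((m.factorial : ℂ)⁻¹) * ∑ r : Fin m → Option (Fin a),
        ∑ S : Fin b → Option (Fin a) ⊕ Fin m, ∑ t : Fin b → Option (Fin a),
          if Adm D none r S t then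
            C (ext none r S t) * ℓ ((ext none r S t).ev lam' F') else 0 := by
  have h1 : ∀ s t : Fin b → Option (Fin a), C (gr none s t) * ℓ ((gr none s t).ev lam F) =
      ∑ m ∈ Finset.range L, ((m.factorial : ℂ)⁻¹) * ∑ r : Fin m → Option (Fin a),
        ∑ S : Fin b → Option (Fin a) ⊕ Fin m, if (∀ e, Sum.elim id r (S e) = s e) then
          (if Adm D none r S t then C (gr none s t) * ℓ ((ext none r S t).ev lam' F') else 0)
          else 0 := by
    intro s t
    rw [ev_expand h none s t (L := L) (by simpa using hL), map_sum, Finset.mul_sum]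
    refine Finset.sum_congr rfl fun m _ => ?_
    rw [map_smul, smul_eq_mul, mul_left_comm, map_sum, Finset.mul_sum]
    congr 1
    refine Finset.sum_congr rfl fun r _ => ?_
    rw [map_sum, Finset.mul_sum]
    refine sum_equiv_inst (Equiv.refl _) _ _ fun S => ?_
    by_cases c1 : ∀ e, Sum.elim id r (S e) = s e
    · by_cases c2 : Adm D none r S t
      · rw [if_pos ⟨c1, c2⟩]
        exact ((if_pos c1).trans (if_pos c2)).symm
      · rw [if_neg (fun h => c2 h.2), map_zero, mul_zero]
        exact ((if_pos c1).trans (if_neg c2)).symm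
    · rw [if_neg (fun h => c1 h.1), map_zero, mul_zero]
      exact (if_neg c1).symm
  have h2 : ∀ m, ∀ (r : Fin m → Option (Fin a)) (S : Fin b → Option (Fin a) ⊕ Fin m)
      (t : Fin b → Option (Fin a)), Adm D none r S t →
      C (gr none (fun e => Sum.elim id r (S e)) t) * ℓ ((ext none r S t).ev lam' F') =
      C (ext none r S t) * ℓ ((ext none r S t).ev lam' F') := by
    intro m r S t hA
    by_cases hS : ∀ i, ∃ e, S e = Sum.inr i
    · rw [hC.ext_eq hS]
    · push Not at hS
      obtain ⟨i, hi⟩ := hS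
      have hM : ∀ ι : Fin b → Fin n, Mo S ι (Sum.inr i) = 0 := fun ι => Mo_of_forall_ne hi _
      have hD : ¬ D := fun hD => by
        have := (hA i).2 hD
        rw [Mo_of_forall_ne hi] at this
        simp at this
      have : (ext none r S t).ev lam' F' = 0 := by
        rw [ev_ext]
        refine Finset.sum_eq_zero fun ι _ => Finset.sum_eq_zero fun j _ => ?_
        rw [Finset.prod_eq_zero (Finset.mem_univ i), mul_zero]
        rw [hM, h.elim _ _ (by simp) (fun hd => absurd hd hD), h.zero]
      simp [this]
  rw [Finset.sum_congr rfl fun s _ => Finset.sum_congr rfl fun t _ => h1 s t]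
  rw [Finset.sum_congr rfl fun s _ => Finset.sum_comm, Finset.sum_comm]
  refine Finset.sum_congr rfl fun m _ => ?_
  simp only [← Finset.mul_sum]
  congr 1
  rw [Finset.sum_congr rfl fun s _ => Finset.sum_comm, Finset.sum_comm]
  refine Finset.sum_congr rfl fun r _ => ?_
  rw [Finset.sum_congr rfl fun s _ => Finset.sum_comm, Finset.sum_comm]
  refine sum_equiv_inst (Equiv.refl _) _ _ fun S => ?_
  rw [Finset.sum_comm]
  refine Finset.sum_congr rfl fun t _ => ?_
  rw [Finset.sum_eq_single (fun e => Sum.elim id r (S e))]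
  · refine (if_pos fun _ => rfl).trans ?_
    by_cases hA : Adm D none r S t
    · rw [if_pos hA]
      exact (h2 m r S t hA).trans (if_pos hA).symm
    · rw [if_neg hA]
      exact (if_neg hA).symm
  · intro s _ hs
    rw [if_neg]
    exact fun h => hs (funext fun e => (h e).symm)
  · simp

/-- The last two factors count the ways to mark `m` of the `b + m` edges and to assign their heads
among the `a + m` ordinary vertices. -/
theorem factorial_identity (a b m : ℕ) :
    ((a.factorial * b.factorial : ℕ) : ℂ)⁻¹ * (m.factorial : ℂ)⁻¹ =
      (((a + m).factorial * (b + m).factorial : ℕ) : ℂ)⁻¹ *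
        (((b + m).choose m : ℕ) * ((a + m).descFactorial m : ℕ)) := by
  have e1 : ((b + m).factorial : ℂ) = (b + m).choose m * m.factorial * b.factorial := by
    have := Nat.choose_mul_factorial_mul_factorial (Nat.le_add_left m b)
    rw [Nat.add_sub_cancel] at this
    exact_mod_cast this.symm
  have e2 : ((a + m).factorial : ℂ) = (a + m).descFactorial m * a.factorial := by
    rw [← Nat.cast_mul, ← Nat.factorial_mul_descFactorial (Nat.le_add_left m a),
      Nat.add_sub_cancel, mul_comm]
  have p1 : ((b + m).choose m : ℂ) ≠ 0 :=
    Nat.cast_ne_zero.2 (Nat.choose_pos (Nat.le_add_left m b)).ne'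
  have p2 : ((a + m).descFactorial m : ℂ) ≠ 0 :=
    Nat.cast_ne_zero.2 fun h => by
      rw [Nat.descFactorial_eq_zero_iff_lt] at h; omega
  have p3 : ∀ k : ℕ, (k.factorial : ℂ) ≠ 0 := fun k => Nat.cast_ne_zero.2 k.factorial_ne_zero
  push_cast
  rw [e1, e2]
  have q1 := p3 a
  have q2 := p3 b
  have q3 := p3 m
  field_simp

/-- An expansion by `m` new vertices is a graph with a chosen `m`-element subset of `elimE`; the two
relabelling counts match the normalizing factors. -/
theorem sum_ext_eq_tot {φ : PointedGraph → ℂ} (hφ : ∀ {G H : PointedGraph}, Iso G H → φ G = φ H)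
    (D : Prop) (a b m : ℕ) :
    ((a.factorial * b.factorial : ℕ) : ℂ)⁻¹ * (((m.factorial : ℂ)⁻¹) *
      ∑ r : Fin m → Option (Fin a), ∑ S : Fin b → Option (Fin a) ⊕ Fin m,
        ∑ t : Fin b → Option (Fin a),
          if Adm D none r S t then
            φ (ext none r S t) else 0) =
    tot (a + m) (b + m) (fun G => ((elimE D G).card.choose m : ℂ) * φ G) := by
  have h6 := sum_elimE_heads (V := Option (Fin a)) (E := Fin b) (I := Fin m) D none φ hφ
  have h5 := (sum_powersetCard_elimE (V := Option (Fin a) ⊕ Fin m) (E := Fin b) (I := Fin m) D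
    (Sum.inl none) φ hφ).trans (congrArg _ h6)
  have h4 := tot_eq (V := Option (Fin a) ⊕ Fin m)
    (E := Fin b ⊕ Fin m) (a := a + m) (b := b + m) (by simp; omega) (by simp) (Sum.inl none)
    (fun G => ((elimE D G).card.choose m : ℂ) * φ G) (fun χ => by rw [hφ χ, χ.card_elimE])
  rw [h4, ← mul_assoc, factorial_identity a b m, mul_assoc]
  simp only [Fintype.card_fin, Fintype.card_option, Nat.add_sub_cancel] at h5
  rw [mul_assoc]
  refine congrArg _ (Eq.trans ?_ (h5.symm.trans ?_))
  · refine congrArg _ (congrArg _ ?_)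
    exact sum_congr_inst fun r => sum_congr_inst fun S => sum_congr_inst fun t => rfl
  · exact sum_congr_inst fun s => sum_congr_inst fun t => rfl

theorem tot_ev_expand (h : ElimData D lam F lam' F') {C : PointedGraph → ℂ} (hC : IsStabCoeff C)
    (ℓ : R →ₗ[ℂ] ℂ) (a b : ℕ) {L : ℕ} (hL : b < L) :
    tot a b (fun G => C G * ℓ (G.ev lam F)) = ∑ m ∈ Finset.range L, tot (a + m) (b + m)
      (fun G => ((elimE D G).card.choose m : ℂ) * (C G * ℓ (G.ev lam' F'))) := by
  refine (congrArg _ (sum_ev_expand h hC ℓ a b hL)).trans ?_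
  rw [Finset.mul_sum]
  exact Finset.sum_congr rfl fun m _ => sum_ext_eq_tot (φ := fun G => C G * ℓ (G.ev lam' F'))
    (fun φ => by rw [hC.iso φ, φ.ev_eq]) D a b m

/-- The elimination of vertices. -/
theorem sum_tot_elim (h : ElimData D lam F lam' F') {C : PointedGraph → ℂ} (hC : IsStabCoeff C)
    (ℓ : R →ₗ[ℂ] ℂ) (k T : ℕ) (hnil : ∀ G : PointedGraph, C G ≠ 0 → T + 1 < Fintype.card G.V →
      Fintype.card G.E + 1 = Fintype.card G.V + k → ℓ (G.ev lam' F') = 0) :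
    ∑ a ∈ Finset.range (T + 1), (-1) ^ a * tot a (a + k) (fun G => C G * ℓ (G.ev lam F)) =
      ∑ a ∈ Finset.range (T + 1), (-1) ^ a * tot a (a + k) (fun G =>
        if ∃ v, elimV D G v then 0 else C G * ℓ (G.ev lam' F')) := by
  let f : ℕ → ℕ → ℂ := fun a m => (-1) ^ a * tot (a + m) (a + m + k)
      (fun G => ((elimE D G).card.choose m : ℂ) * (C G * ℓ (G.ev lam' F')))
  -- Graphs with more than `T` ordinary vertices drop out by `hnil`, so the rearrangement below is
  -- finite.
  have hf : ∀ a m, T < a + m → f a m = 0 := by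
    intro a m ham
    simp only [f]
    rw [tot_congr (φ' := fun G => 0 * 0), tot_const_mul]
    · simp
    · intro G hV hE
      by_cases h0 : C G = 0
      · simp [h0]
      · rw [hnil G h0 (by omega) (by omega)]; simp
  have h1 : ∀ a ∈ Finset.range (T + 1), (-1) ^ a * tot a (a + k) (fun G => C G * ℓ (G.ev lam F)) =
      ∑ m ∈ Finset.range (T + k + 1), f a m := by
    intro a ha
    rw [tot_ev_expand h hC ℓ a (a + k) (L := T + k + 1) (by simp at ha; omega), Finset.mul_sum]
    refine Finset.sum_congr rfl fun m _ => ?_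
    simp only [f]
    rw [show a + k + m = a + m + k by ring]
  rw [Finset.sum_congr rfl h1]
  -- Regrouping by the number `c = a + m` of ordinary vertices of the expanded graph.
  have h2 : ∑ a ∈ Finset.range (T + 1), ∑ m ∈ Finset.range (T + k + 1), f a m =
      ∑ c ∈ Finset.range (T + 1), ∑ m ∈ Finset.range (c + 1), f (c - m) m := by
    have h3 : ∀ a ∈ Finset.range (T + 1), ∑ m ∈ Finset.range (T + k + 1), f a m =
        ∑ m ∈ Finset.range (T + 1 - a), f a m := by
      intro a ha
      refine (Finset.sum_subset (fun x hx => ?_) fun x hx hx' => ?_).symm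
      · simp at hx ⊢; omega
      · simp at hx' ha; exact hf a x (by omega)
    rw [Finset.sum_congr rfl h3, Finset.sum_sigma', Finset.sum_sigma']
    refine Finset.sum_nbij' (fun p => ⟨p.1 + p.2, p.2⟩) (fun p => ⟨p.1 - p.2, p.2⟩) ?_ ?_ ?_ ?_ ?_
    · rintro ⟨a, m⟩ hp; simp at hp ⊢; omega
    · rintro ⟨a, m⟩ hp; simp at hp ⊢; omega
    · rintro ⟨a, m⟩ hp; simp
    · rintro ⟨a, m⟩ hp; simp at hp ⊢; omega
    · rintro ⟨a, m⟩ hp; simp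
  rw [h2]
  refine Finset.sum_congr rfl fun c _ => ?_
  have h4 : ∀ m ∈ Finset.range (c + 1), f (c - m) m = (-1) ^ c * tot c (c + k) (fun G =>
      ((-1) ^ m * (elimE D G).card.choose m : ℂ) * (C G * ℓ (G.ev lam' F'))) := by
    intro m hm
    simp only [f, mul_assoc]
    rw [tot_const_mul, ← mul_assoc, ← pow_add]
    have hm' : m ≤ c := by simp at hm; omega
    rw [Nat.sub_add_cancel hm']
    congr 1
    obtain ⟨d, rfl⟩ := Nat.exists_eq_add_of_le hm'
    rw [Nat.add_sub_cancel_left, show m + d + m = d + 2 * m by ring, pow_add, pow_mul]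
    simp
  rw [Finset.sum_congr rfl h4, ← Finset.mul_sum, ← tot_sum]
  congr 1
  refine tot_congr fun G hV _ => ?_
  rw [← Finset.sum_mul]
  have hle : (elimE D G).card ≤ c := by have := card_elimE_le D G; omega
  -- Inclusion and exclusion over the subsets of `elimE`.
  have h5 : ∑ m ∈ Finset.range (c + 1), ((-1) ^ m * (elimE D G).card.choose m : ℂ) =
      if (elimE D G).card = 0 then 1 else 0 := by
    have : ∑ m ∈ Finset.range (c + 1), ((-1) ^ m * (elimE D G).card.choose m : ℂ) =
        ∑ m ∈ Finset.range ((elimE D G).card + 1), ((-1) ^ m * (elimE D G).card.choose m : ℂ) := by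
      refine (Finset.sum_subset (fun x hx => ?_) fun x hx hx' => ?_).symm
      · simp at hx ⊢; omega
      · simp at hx'; simp [Nat.choose_eq_zero_of_lt (show (elimE D G).card < x by omega)]
    rw [this]
    have := Int.alternating_sum_range_choose (n := (elimE D G).card)
    exact_mod_cast congrArg (Int.cast : ℤ → ℂ) this
  rw [h5]
  by_cases hE : elimE D G = ∅
  -- If vertices to be eliminated remain without any edge in `elimE`, the coefficient itself is
  -- zero.
  · by_cases hv : ∃ v, elimV D G v
    · obtain ⟨v, hv'⟩ := hv
      simp [hC.eq_zero hE hv']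
    · simp [hE, hv]
  · have : (elimE D G).card ≠ 0 := by simpa using hE
    rw [if_neg this, zero_mul, if_pos]
    obtain ⟨e, he⟩ := Finset.nonempty_iff_ne_empty.2 hE
    exact ⟨_, (mem_elimE.1 he).1⟩

end elim

end PointedGraph

/-! ### Contractions and their confluence -/

namespace PointedGraph

/-- The graph with all edges reversed. -/
@[reducible] def op (G : PointedGraph) : PointedGraph where
  V := G.V
  E := G.E
  src := G.tgt
  tgt := G.src
  base := G.base

def Iso.op {G H : PointedGraph} (φ : Iso G H) : Iso G.op H.op :=
  ⟨φ.onV, φ.onE, φ.tgt_eq, φ.src_eq, φ.base_eq⟩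

theorem inDeg_eq_one_iff {G : PointedGraph} {v : G.V} :
    G.inDeg v = 1 ↔ ∃ e, G.tgt e = v ∧ ∀ e', G.tgt e' = v → e' = e := by
  unfold inDeg inEdges
  rw [Finset.card_eq_one]
  refine exists_congr fun e => ?_
  rw [Finset.eq_singleton_iff_unique_mem]
  simp

theorem outDeg_eq_one_iff {G : PointedGraph} {v : G.V} :
    G.outDeg v = 1 ↔ ∃ e, G.src e = v ∧ ∀ e', G.src e' = v → e' = e :=
  inDeg_eq_one_iff (G := G.op)

section contract
variable {G H : PointedGraph} {e f : G.E}

/-- The quotient map to the vertices of a contraction. -/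
def cV (G : PointedGraph) (e : G.E) (v : G.V) : (G.contractEdge e).V := Quot.mk _ v

theorem cV_surj : Function.Surjective (cV G e) := Quot.mk_surjective

theorem cV_src_eq : cV G e (G.src e) = cV G e (G.tgt e) := Quot.sound ⟨rfl, rfl⟩

theorem cV_eq_iff {a b : G.V} : cV G e a = cV G e b ↔
    a = b ∨ (a = G.src e ∧ b = G.tgt e) ∨ (a = G.tgt e ∧ b = G.src e) := by
  constructor
  · intro h
    have h' := congrArg (Quot.lift (fun z : G.V => if z = G.tgt e then G.src e else z) (by
      rintro a b ⟨rfl, rfl⟩; simp)) h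
    change (if a = G.tgt e then G.src e else a) = if b = G.tgt e then G.src e else b at h'
    split_ifs at h' with h1 h2 h2
    · exact Or.inl (h1.trans h2.symm)
    · exact Or.inr (Or.inr ⟨h1, h'.symm⟩)
    · exact Or.inr (Or.inl ⟨h', h2⟩)
    · exact Or.inl h'
  · rintro (rfl | ⟨rfl, rfl⟩ | ⟨rfl, rfl⟩)
    · rfl
    · exact cV_src_eq
    · exact cV_src_eq.symm

/-- Recognition of a contraction. -/
def contractIso (pV : G.V → H.V) (pE : {x // x ≠ e} ≃ H.E) (hs : Function.Surjective pV)
    (hk : ∀ a b, pV a = pV b ↔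
      a = b ∨ (a = G.src e ∧ b = G.tgt e) ∨ (a = G.tgt e ∧ b = G.src e))
    (h1 : ∀ x, H.src (pE x) = pV (G.src x)) (h2 : ∀ x, H.tgt (pE x) = pV (G.tgt x))
    (h3 : pV G.base = H.base) : Iso (G.contractEdge e) H where
  onV := Equiv.ofBijective (Quot.lift pV (by rintro a b ⟨rfl, rfl⟩; rw [hk]; simp)) (by
    constructor
    · rintro ⟨a⟩ ⟨b⟩ h
      exact cV_eq_iff.2 ((hk a b).1 h)
    · intro y
      obtain ⟨a, rfl⟩ := hs y
      exact ⟨Quot.mk _ a, rfl⟩)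
  onE := pE
  src_eq := h1
  tgt_eq := h2
  base_eq := h3

def Iso.contract (φ : Iso G H) (e : G.E) : Iso (G.contractEdge e) (H.contractEdge (φ.onE e)) :=
  contractIso (fun v => cV H (φ.onE e) (φ.onV v))
    (φ.onE.subtypeEquiv fun x => by simp)
    (cV_surj.comp φ.onV.surjective)
    (fun a b => by rw [cV_eq_iff]; simp [φ.src_eq, φ.tgt_eq])
    (fun x => congrArg (cV H (φ.onE e)) (φ.src_eq x))
    (fun x => congrArg (cV H (φ.onE e)) (φ.tgt_eq x))
    (congrArg (cV H (φ.onE e)) φ.base_eq)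

def opContract (G : PointedGraph) (e : G.E) :
    Iso (G.op.contractEdge e) (G.contractEdge e).op :=
  contractIso (G := G.op) (H := (G.contractEdge e).op) (cV G e) (Equiv.refl _) cV_surj
    (fun a b => by rw [cV_eq_iff]; tauto) (fun _ => rfl) (fun _ => rfl) rfl

/-- The bijection between the complements of two points. -/
def swapNe {α : Type} (e f : α) : {x // x ≠ e} ≃ {x // x ≠ f} :=
  (Equiv.swap e f).subtypeEquiv fun x => by
    constructor
    · intro h h'
      exact h ((Equiv.swap e f).injective (h'.trans (Equiv.swap_apply_left e f).symm))
    · rintro h rfl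
      exact h (by simp)

theorem swapNe_of_eq {α : Type} {e f : α} (h : f ≠ e) : ((swapNe e f ⟨f, h⟩ : {x // x ≠ f}) : α) = e := by
  simp [swapNe]

theorem swapNe_of_ne {α : Type} {e f : α} (x : {x // x ≠ e}) (h : x.1 ≠ f) :
    ((swapNe e f x : {x // x ≠ f}) : α) = x := by
  simp [swapNe, Equiv.swap_apply_of_ne_of_ne x.2 h]

/-- The two edges join the same two vertices; whichever is contracted, the other one becomes a loop.
-/
theorem contract_antiparallel (hef : e ≠ f) (h1 : G.src e = G.tgt f) (h2 : G.tgt e = G.src f) :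
    Nonempty (Iso (G.contractEdge e) (G.contractEdge f)) := by
  refine ⟨contractIso (cV G f) (swapNe e f) cV_surj (fun a b => ?_) (fun x => ?_) (fun x => ?_) rfl⟩
  · rw [cV_eq_iff, h1, h2]; tauto
  · change cV G f (G.src (swapNe e f x : {x // x ≠ f})) = _
    by_cases hx : x.1 = f
    · obtain ⟨x, hx'⟩ := x
      subst hx
      rw [swapNe_of_eq, h1, cV_src_eq]
    · rw [swapNe_of_ne x hx]
  · change cV G f (G.tgt (swapNe e f x : {x // x ≠ f})) = _
    by_cases hx : x.1 = f
    · obtain ⟨x, hx'⟩ := x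
      subst hx
      rw [swapNe_of_eq, h2, cV_src_eq]
    · rw [swapNe_of_ne x hx]

/-- The two edges at a vertex of in- and out-degree one. -/
theorem contract_smooth {v : G.V} (hv : v ≠ G.base) (hf : G.tgt f = v) (he : G.src e = v)
    (hf' : ∀ x, G.tgt x = v → x = f) (he' : ∀ x, G.src x = v → x = e) (hu : G.src f ≠ v)
    (hw : G.tgt e ≠ v) (huw : G.src f ≠ G.tgt e) :
    Nonempty (Iso (G.contractEdge e) (G.contractEdge f)) := by
  let p : G.V → (G.contractEdge f).V := fun z => if z = v then cV G f (G.tgt e) else cV G f z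
  have pv : p v = cV G f (G.tgt e) := if_pos rfl
  have pn : ∀ z, z ≠ v → p z = cV G f z := fun z hz => if_neg hz
  refine ⟨contractIso p (swapNe e f) ?_ (fun a b => ?_) (fun x => ?_) (fun x => ?_) (pn _ hv.symm)⟩
  · intro q
    obtain ⟨z, rfl⟩ := cV_surj q
    by_cases hz : z = v
    · exact ⟨G.src f, by rw [pn _ hu, hz, cV_src_eq, hf]⟩
    · exact ⟨z, pn z hz⟩
  · by_cases ha : a = v <;> by_cases hb : b = v
    · simp [ha, hb]
    · rw [ha, pv, pn b hb, cV_eq_iff, hf, he]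
      have := Ne.symm hb; have := Ne.symm hw; have := Ne.symm huw
      grind
    · rw [hb, pv, pn a ha, cV_eq_iff, hf, he]
      grind
    · rw [pn a ha, pn b hb, cV_eq_iff, hf, he]
      grind
  · change cV G f (G.src (swapNe e f x : {x // x ≠ f})) = _
    by_cases hx : x.1 = f
    · obtain ⟨x, hx'⟩ := x
      subst hx
      rw [swapNe_of_eq, pn _ hu, cV_src_eq, he, hf]
    · rw [swapNe_of_ne x hx, pn _ fun h => x.2 (he' _ h)]
  · change cV G f (G.tgt (swapNe e f x : {x // x ≠ f})) = _
    by_cases hx : x.1 = f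
    · obtain ⟨x, hx'⟩ := x
      subst hx
      rw [swapNe_of_eq, hf, pv]
    · rw [swapNe_of_ne x hx, pn _ fun h => hx (hf' _ h)]

def contractComm (hef : e ≠ f) :
    Iso ((G.contractEdge e).contractEdge ⟨f, hef.symm⟩)
      ((G.contractEdge f).contractEdge ⟨e, hef⟩) where
  onV :=
    { toFun := Quot.lift (Quot.lift (fun v => cV _ _ (cV G f v)) (by
        rintro a b ⟨rfl, rfl⟩
        exact cV_src_eq (G := G.contractEdge f) (e := ⟨e, hef⟩))) (by
        rintro a b ⟨rfl, rfl⟩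
        exact congrArg (cV _ _) cV_src_eq)
      invFun := Quot.lift (Quot.lift (fun v => cV _ _ (cV G e v)) (by
        rintro a b ⟨rfl, rfl⟩
        exact cV_src_eq (G := G.contractEdge e) (e := ⟨f, hef.symm⟩))) (by
        rintro a b ⟨rfl, rfl⟩
        exact congrArg (cV _ _) cV_src_eq)
      left_inv := by rintro ⟨⟨a⟩⟩; rfl
      right_inv := by rintro ⟨⟨a⟩⟩; rfl }
  onE :=
    { toFun := fun x => ⟨⟨x.1.1, fun h => x.2 (Subtype.ext h)⟩, fun h => x.1.2 (congrArg Subtype.val h)⟩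
      invFun := fun x => ⟨⟨x.1.1, fun h => x.2 (Subtype.ext h)⟩, fun h => x.1.2 (congrArg Subtype.val h)⟩
      left_inv := fun _ => rfl
      right_inv := fun _ => rfl }
  src_eq _ := rfl
  tgt_eq _ := rfl
  base_eq := rfl

theorem card_contractEdge_lt : Fintype.card (G.contractEdge e).E < Fintype.card G.E := by
  rw [← Nat.card_eq_fintype_card, ← Nat.card_eq_fintype_card]
  change Nat.card {x // x ≠ e} < _
  rw [Nat.card_eq_fintype_card, Nat.card_eq_fintype_card]
  exact Fintype.card_subtype_lt (x := e) (by simp)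

theorem Iso.isContractible (φ : Iso G H) (h : G.IsContractible e) : H.IsContractible (φ.onE e) := by
  unfold IsContractible at *
  simpa only [φ.src_eq, φ.tgt_eq, φ.outDeg_eq, φ.inDeg_eq, ne_eq, φ.eq_base_iff,
    φ.onV.injective.eq_iff] using h

theorem op_isContractible (h : G.IsContractible e) : G.op.IsContractible e :=
  ⟨h.1.symm, h.2.symm⟩

theorem IsStable.not_isContractible (h : G.IsStable) : ¬ G.IsContractible e := by
  rintro ⟨-, ⟨h1, h2⟩ | ⟨h1, h2⟩⟩
  · have := (h _ h1).2; omega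
  · have := (h _ h1).1; omega

/-- Here `f` is contractible because its head has in-degree one. Contracting `e` preserves this
unless `e` starts at that head. In that case, if the head of `e` has in-degree one as well, so does
the merged vertex; otherwise the common vertex has in- and out-degree one, and contracting either of
its two edges gives the same graph. Antiparallel edges are treated apart. -/
theorem diamond_aux (hef : e ≠ f) (he : G.IsContractible e) (hf : G.IsContractible f)
    (h : G.tgt f ≠ G.base ∧ G.inDeg (G.tgt f) = 1) :
    Nonempty (Iso (G.contractEdge e) (G.contractEdge f)) ∨
      (G.contractEdge e).IsContractible ⟨f, hef.symm⟩ := by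
  by_cases hanti : G.src e = G.tgt f ∧ G.tgt e = G.src f
  · exact Or.inl (contract_antiparallel hef hanti.1 hanti.2)
  obtain ⟨f', hf1, hf2⟩ := inDeg_eq_one_iff.1 h.2
  obtain rfl := hf2 f rfl
  have hne : G.tgt e ≠ G.tgt f := fun h' => hef (hf2 e h')
  have h1 : cV G e (G.src f) ≠ cV G e (G.tgt f) := by
    rw [Ne, cV_eq_iff]
    have := hf.1
    grind
  by_cases hx : G.src e = G.tgt f
  · by_cases hy : G.tgt e ≠ G.base ∧ G.inDeg (G.tgt e) = 1
    · refine Or.inr ⟨h1, Or.inr ⟨?_, ?_⟩⟩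
      · change cV G e (G.tgt f) ≠ cV G e G.base
        rw [Ne, cV_eq_iff]
        grind
      · refine inDeg_eq_one_iff.2 ⟨⟨f, hef.symm⟩, rfl, fun (x : {x // x ≠ e}) hx' => ?_⟩
        have hx'' : cV G e (G.tgt x.1) = cV G e (G.tgt f) := hx'
        rw [cV_eq_iff] at hx''
        obtain ⟨e', -, he2⟩ := inDeg_eq_one_iff.1 hy.2
        obtain rfl := he2 e rfl
        have h5 : G.tgt x.1 ≠ G.tgt e := fun h => x.2 (he2 _ h)
        refine Subtype.ext (hf2 _ ?_)
        grind
    · have ho : G.src e ≠ G.base ∧ G.outDeg (G.src e) = 1 := he.2.resolve_right hy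
      obtain ⟨e', -, he2⟩ := outDeg_eq_one_iff.1 ho.2
      obtain rfl := he2 e rfl
      refine Or.inl (contract_smooth (v := G.tgt f) h.1 rfl hx hf2 (by rw [← hx]; exact he2)
        hf.1 hne fun h => hanti ⟨hx, h.symm⟩)
  · refine Or.inr ⟨h1, Or.inr ⟨?_, ?_⟩⟩
    · change cV G e (G.tgt f) ≠ cV G e G.base
      rw [Ne, cV_eq_iff]
      grind
    · refine inDeg_eq_one_iff.2 ⟨⟨f, hef.symm⟩, rfl, fun (x : {x // x ≠ e}) hx' => ?_⟩
      have hx'' : cV G e (G.tgt x.1) = cV G e (G.tgt f) := hx'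
      rw [cV_eq_iff] at hx''
      refine Subtype.ext (hf2 _ ?_)
      grind

/-- Local confluence. The case where the tail of `f` has out-degree one is the previous one on the
reversed graph. -/
theorem diamond (hef : e ≠ f) (he : G.IsContractible e) (hf : G.IsContractible f) :
    Nonempty (Iso (G.contractEdge e) (G.contractEdge f)) ∨
      (G.contractEdge e).IsContractible ⟨f, hef.symm⟩ := by
  rcases hf.2 with h | h
  · rcases diamond_aux (G := G.op) hef (op_isContractible he) (op_isContractible hf) h with ⟨⟨φ⟩⟩ | h'
    · exact Or.inl ⟨((opContract G e).symm.trans (φ.trans (opContract G f))).op⟩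
    · exact Or.inr (op_isContractible ((opContract G e).isContractible h'))
  · exact diamond_aux hef he hf h

/-- An edge into the merged vertex other than `e` is found at the tail of `e`, and an edge out of it
at the head of `e`. -/
theorem PosDeg.contract (h : G.PosDeg) (he : G.src e ≠ G.tgt e) : (G.contractEdge e).PosDeg := by
  intro q hq
  obtain ⟨v, rfl⟩ := cV_surj q
  have key : ∀ w, cV G e w = cV G e v → 1 ≤ G.inDeg w ∧ 1 ≤ G.outDeg w := fun w hw =>
    h w (by rintro rfl; exact hq hw.symm)
  have hb : ∃ w, cV G e w = cV G e v ∧ w ≠ G.tgt e := by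
    by_cases hv : v = G.tgt e
    · exact ⟨G.src e, by rw [hv, cV_src_eq], he⟩
    · exact ⟨v, rfl, hv⟩
  have hc : ∃ w, cV G e w = cV G e v ∧ w ≠ G.src e := by
    by_cases hv : v = G.src e
    · exact ⟨G.tgt e, by rw [hv, cV_src_eq], he.symm⟩
    · exact ⟨v, rfl, hv⟩
  constructor
  · obtain ⟨w, hw, hw'⟩ := hb
    obtain ⟨x, hx⟩ := one_le_inDeg.1 (key w hw).1
    exact one_le_inDeg.2 ⟨⟨x, by rintro rfl; exact hw' hx.symm⟩,
      (congrArg (cV G e) hx).trans hw⟩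
  · obtain ⟨w, hw, hw'⟩ := hc
    obtain ⟨x, hx⟩ := one_le_outDeg.1 (key w hw).2
    exact one_le_outDeg.2 ⟨⟨x, by rintro rfl; exact hw' hx.symm⟩,
      (congrArg (cV G e) hx).trans hw⟩

theorem ContractsTo.of_iso_left {S : PointedGraph} (h : ContractsTo G S) :
    ∀ {H : PointedGraph}, Iso G H → ContractsTo H S := by
  induction h with
  | refl => exact fun φ => ContractsTo.refl.iso ⟨φ.symm⟩
  | iso _ hφ ih => exact fun φ => (ih φ).iso hφ
  | contract _ e he ih => exact fun φ => (ih φ).contract e he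

theorem ContractsTo.head {S : PointedGraph} (h : (G.contractEdge e).ContractsTo S)
    (he : G.IsContractible e) : G.ContractsTo S := by
  induction h with
  | refl => exact ContractsTo.refl.contract e he
  | iso _ hφ ih => exact ih.iso hφ
  | contract _ e he ih => exact ih.contract e he

theorem ContractsTo.cases_head {S : PointedGraph} (h : G.ContractsTo S) :
    Nonempty (Iso G S) ∨ ∃ e, G.IsContractible e ∧ (G.contractEdge e).ContractsTo S := by
  induction h with
  | refl => exact Or.inl ⟨Iso.refl G⟩
  | iso _ hφ ih =>
    rcases ih with ⟨⟨χ⟩⟩ | ⟨e, he, h⟩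
    · exact Or.inl ⟨χ.trans hφ.some⟩
    · exact Or.inr ⟨e, he, h.iso hφ⟩
  | contract _ f hf ih =>
    rcases ih with ⟨⟨χ⟩⟩ | ⟨e, he, h⟩
    · refine Or.inr ⟨_, χ.symm.isContractible hf, ?_⟩
      exact ContractsTo.refl.iso ⟨(χ.symm.contract f).symm⟩
    · exact Or.inr ⟨e, he, h.contract f hf⟩

/-- Newman's argument, by induction on the number of edges. Let `f` be the first step of the given
reduction. By `diamond`, either contracting `e` and contracting `f` give isomorphic graphs, or `e`
is still contractible in `G / f`, where the induction hypothesis applies, and the two contractions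
commute. -/
theorem ContractsTo.contract_of_isStable {S : PointedGraph} (hS : S.IsStable) (N : ℕ) :
    ∀ {G : PointedGraph} {e : G.E}, Fintype.card G.E < N → G.ContractsTo S → G.IsContractible e →
      (G.contractEdge e).ContractsTo S := by
  induction N with
  | zero => intro G e h; omega
  | succ N ih =>
    intro G e hN h he
    rcases h.cases_head with ⟨⟨φ⟩⟩ | ⟨f, hf, hfS⟩
    · exact absurd (φ.isContractible he) hS.not_isContractible
    · by_cases hef : e = f
      · subst hef; exact hfS
      rcases diamond hef he hf with ⟨⟨φ⟩⟩ | h1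
      · exact hfS.of_iso_left φ.symm
      rcases diamond (Ne.symm hef) hf he with ⟨⟨φ⟩⟩ | h2
      · exact hfS.of_iso_left φ
      have hlt : Fintype.card (G.contractEdge f).E < N :=
        lt_of_lt_of_le (card_contractEdge_lt (e := f)) (Nat.lt_succ_iff.1 hN)
      exact ((ih hlt hfS h2).of_iso_left (contractComm hef).symm).head h1

theorem ContractsTo.unique {S S' : PointedGraph} (hS : S.IsStable) (hS' : S'.IsStable) (N : ℕ) :
    ∀ {G : PointedGraph}, Fintype.card G.E < N → G.ContractsTo S → G.ContractsTo S' →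
      Nonempty (Iso S S') := by
  induction N with
  | zero => intro G h; omega
  | succ N ih =>
    intro G hN h h'
    rcases h.cases_head with ⟨⟨φ⟩⟩ | ⟨f, hf, hfS⟩
    · rcases h'.cases_head with ⟨⟨φ'⟩⟩ | ⟨f, hf, hfS⟩
      · exact ⟨φ.symm.trans φ'⟩
      · exact absurd (φ.isContractible hf) hS.not_isContractible
    · exact ih (lt_of_lt_of_le (card_contractEdge_lt (e := f)) (Nat.lt_succ_iff.1 hN)) hfS
        (h'.contract_of_isStable hS' _ (Nat.lt_succ_self _) hf)

theorem ContractsTo.op {S : PointedGraph} (h : G.ContractsTo S) : G.op.ContractsTo S.op := by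
  induction h with
  | refl => exact ContractsTo.refl
  | iso _ hφ ih => exact ih.iso ⟨hφ.some.op⟩
  | contract _ f hf ih => exact (ih.contract f (op_isContractible hf)).iso ⟨opContract _ f⟩

theorem IsStable.op (h : G.IsStable) : G.op.IsStable := fun v hv => (h v hv).symm

end contract

/-! ### Obstructions to stabilization -/

/-- A set of ordinary vertices of in-degree one that no edge enters from outside. -/
structure IsObstruction (G : PointedGraph) (W : Set G.V) : Prop where
  nonempty : W.Nonempty
  base : G.base ∉ W
  exists_edge : ∀ v ∈ W, ∃ e, G.tgt e = v
  unique : ∀ e e', G.tgt e ∈ W → G.tgt e = G.tgt e' → e = e'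
  closed : ∀ e, G.tgt e ∈ W → G.src e ∈ W

section obstruction
variable {G : PointedGraph} {W : Set G.V}

theorem IsObstruction.not_isStable (h : IsObstruction G W) : ¬ G.IsStable := by
  intro hS
  obtain ⟨v, hv⟩ := h.nonempty
  have h2 := (hS v fun hb => h.base (hb ▸ hv)).1
  obtain ⟨e, he⟩ := h.exists_edge v hv
  have : G.inDeg v = 1 := inDeg_eq_one_iff.2 ⟨e, he, fun e' he' =>
    h.unique e' e (by rw [he']; exact hv) (by rw [he, he'])⟩
  omega

theorem IsObstruction.of_iso {H : PointedGraph} (φ : Iso G H) (h : IsObstruction G W) :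
    IsObstruction H (φ.onV '' W) where
  nonempty := h.nonempty.image _
  base := by
    rintro ⟨v, hv, hb⟩
    exact h.base ((φ.eq_base_iff v).1 hb ▸ hv)
  exists_edge := by
    rintro _ ⟨v, hv, rfl⟩
    obtain ⟨e, rfl⟩ := h.exists_edge v hv
    exact ⟨φ.onE e, φ.tgt_eq e⟩
  unique e e' := by
    obtain ⟨e, rfl⟩ := φ.onE.surjective e
    obtain ⟨e', rfl⟩ := φ.onE.surjective e'
    simp only [φ.tgt_eq, φ.onV.injective.mem_set_image, φ.onV.injective.eq_iff, φ.onE.injective.eq_iff]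
    exact h.unique e e'
  closed e := by
    obtain ⟨e, rfl⟩ := φ.onE.surjective e
    simp only [φ.tgt_eq, φ.src_eq, φ.onV.injective.mem_set_image]
    exact h.closed e

/-- The preimage of the image of `W` is `W`. If both ends of `e` lie in `W`, then `e` is the only
edge into its head, so the merged vertex keeps just the edge into the tail. -/
theorem IsObstruction.contract_of_iff (h : IsObstruction G W) {e : G.E} (he : G.src e ≠ G.tgt e)
    (hW : G.src e ∈ W ↔ G.tgt e ∈ W) : IsObstruction (G.contractEdge e) (cV G e '' W) := by
  have hs : ∀ v, cV G e v ∈ cV G e '' W ↔ v ∈ W := by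
    intro v
    refine ⟨?_, fun hv => ⟨v, hv, rfl⟩⟩
    rintro ⟨w, hw, hwv⟩
    rcases cV_eq_iff.1 hwv with rfl | ⟨rfl, rfl⟩ | ⟨rfl, rfl⟩
    · exact hw
    · exact hW.1 hw
    · exact hW.2 hw
  refine ⟨h.nonempty.image _, fun hb => h.base ((hs _).1 hb), ?_, ?_, ?_⟩
  · rintro _ ⟨v, hv, rfl⟩
    have : ∃ w ∈ W, cV G e w = cV G e v ∧ w ≠ G.tgt e := by
      by_cases hvt : v = G.tgt e
      · exact ⟨G.src e, hW.2 (hvt ▸ hv), by rw [hvt, cV_src_eq], he⟩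
      · exact ⟨v, hv, rfl, hvt⟩
    obtain ⟨w, hw, hwv, hwt⟩ := this
    obtain ⟨x, hx⟩ := h.exists_edge w hw
    exact ⟨⟨x, by rintro rfl; exact hwt hx.symm⟩, (congrArg (cV G e) hx).trans hwv⟩
  · rintro ⟨x, hx⟩ ⟨y, hy⟩ h1 h2
    have h1' : G.tgt x ∈ W := (hs _).1 h1
    have h2' : cV G e (G.tgt x) = cV G e (G.tgt y) := h2
    refine Subtype.ext ?_
    rcases cV_eq_iff.1 h2' with h3 | ⟨h3, h4⟩ | ⟨h3, h4⟩
    · exact h.unique _ _ h1' h3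
    · exact absurd (h.unique e y (hW.1 (h3 ▸ h1')) h4.symm).symm hy
    · exact absurd (h.unique _ _ h1' h3) hx
  · rintro ⟨x, hx⟩ h1
    exact (hs _).2 (h.closed x ((hs _).1 h1))

/-- An edge with only one end in `W` must leave `W`. If its tail has out-degree one, the tail can be
removed from `W`, since no edge inside `W` starts there; if its head has in-degree one, the head can
be added to `W`. Afterwards both ends lie on the same side. -/
theorem IsObstruction.contract (h : IsObstruction G W) {e : G.E} (he : G.IsContractible e) :
    ∃ W', IsObstruction (G.contractEdge e) W' := by
  by_cases hW : G.src e ∈ W ↔ G.tgt e ∈ W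
  · exact ⟨_, h.contract_of_iff he.1 hW⟩
  have hs : G.src e ∈ W := by
    by_contra h'
    exact hW ⟨fun h'' => absurd h'' h', fun h'' => h.closed e h''⟩
  have ht : G.tgt e ∉ W := fun h' => hW ⟨fun _ => h', fun _ => hs⟩
  rcases he.2 with ⟨hb, h1⟩ | ⟨hb, h1⟩
  · obtain ⟨e', -, he2⟩ := outDeg_eq_one_iff.1 h1
    obtain rfl := he2 e rfl
    have hn : ∀ x, G.tgt x ∈ W → G.src x ≠ G.src e := fun x hx hx' => by
      obtain rfl := he2 x hx'
      exact ht hx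
    refine ⟨_, IsObstruction.contract_of_iff (W := W \ {G.src e}) ?_ he.1 ?_⟩
    · refine ⟨?_, fun h' => h.base h'.1, fun v hv => h.exists_edge v hv.1,
        fun x y hx => h.unique x y hx.1, fun x hx => ⟨h.closed x hx.1, hn x hx.1⟩⟩
      obtain ⟨x, hx⟩ := h.exists_edge _ hs
      have hx' : G.tgt x ∈ W := by rw [hx]; exact hs
      exact ⟨G.src x, h.closed x hx', hn x hx'⟩
    · simp [ht]
  · obtain ⟨e', -, he2⟩ := inDeg_eq_one_iff.1 h1
    obtain rfl := he2 e rfl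
    refine ⟨_, IsObstruction.contract_of_iff (W := insert (G.tgt e) W) ?_ he.1 ?_⟩
    · refine ⟨⟨_, Set.mem_insert _ _⟩, ?_, ?_, ?_, ?_⟩
      · rintro (h' | h')
        · exact hb h'.symm
        · exact h.base h'
      · rintro v (rfl | h')
        · exact ⟨e, rfl⟩
        · exact h.exists_edge v h'
      · rintro x y (h' | h') hxy
        · rw [he2 x h', he2 y (hxy.symm.trans h')]
        · exact h.unique x y h' hxy
      · rintro x (h' | h')
        · rw [he2 x h']; exact Set.mem_insert_of_mem _ hs
        · exact Set.mem_insert_of_mem _ (h.closed x h')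
    · simp [hs]

theorem IsObstruction.not_contractsTo {S : PointedGraph} (hS : S.IsStable) (h : G.ContractsTo S)
    (hW : IsObstruction G W) : False := by
  have : ∃ W', IsObstruction S W' := by
    clear hS
    induction h with
    | refl => exact ⟨_, hW⟩
    | iso _ hφ ih =>
      obtain ⟨φ⟩ := hφ
      obtain ⟨W', hW'⟩ := ih
      exact ⟨_, hW'.of_iso φ⟩
    | contract _ e he ih =>
      obtain ⟨W', hW'⟩ := ih
      exact hW'.contract he
  obtain ⟨W', hW'⟩ := this
  exact hW'.not_isStable hS

end obstruction

/-! ### Generalized stabilizable graphs -/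

theorem insertVertex_inDeg (G : PointedGraph) (e : G.E) :
    (G.insertVertex e).inDeg (none : Option G.V) = 1 := by
  refine inDeg_eq_one_iff.2 ⟨(some e : Option G.E), by simp [insertVertex], ?_⟩
  rintro (_ | x) hx
  · simp [insertVertex] at hx
  · simp [insertVertex] at hx
    rw [hx]

def insertContract (G : PointedGraph) (e : G.E) :
    Iso ((G.insertVertex e).contractEdge (some e : Option G.E)) G :=
  contractIso (G := G.insertVertex e) (fun v : Option G.V => v.elim (G.src e) id)
    { toFun := fun x => Option.elim (α := G.E) x.1 e id
      invFun := fun x => if h : x = e then ⟨(none : Option G.E), (Option.some_ne_none e).symm⟩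
        else ⟨(some x : Option G.E), fun h' => h (Option.some_injective _ h')⟩
      left_inv := by
        rintro ⟨_ | x, hx⟩
        · simp
        · have : x ≠ e := fun h => hx (by rw [h])
          simp [this]
      right_inv := by
        intro x
        by_cases h : x = e
        · simp [h]
        · simp [h] }
    (fun v => ⟨(some v : Option G.V), rfl⟩)
    (by
      rintro (_ | a) (_ | b) <;> simp [insertVertex] <;> grind)
    (by rintro ⟨_ | x, hx⟩ <;> rfl)
    (by
      rintro ⟨_ | x, hx⟩
      · rfl
      · have : x ≠ e := fun h => hx (by rw [h])
        change G.tgt x = Option.elim (if x = e then none else some (G.tgt x)) (G.src e) id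
        simp [this])
    rfl

theorem PosDeg.insertVertex {G : PointedGraph} (h : G.PosDeg) (e : G.E) :
    (G.insertVertex e).PosDeg := by
  rintro (_ | v) hv
  · exact ⟨(insertVertex_inDeg G e).ge, one_le_outDeg.2 ⟨(none : Option G.E), rfl⟩⟩
  · have := h v fun h => hv (congrArg some h)
    obtain ⟨x, hx⟩ := one_le_inDeg.1 this.1
    obtain ⟨y, hy⟩ := one_le_outDeg.1 this.2
    refine ⟨one_le_inDeg.2 ?_, one_le_outDeg.2 ⟨(some y : Option G.E), congrArg some hy⟩⟩
    by_cases hxe : x = e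
    · exact ⟨(none : Option G.E), congrArg some (hxe ▸ hx)⟩
    · exact ⟨(some x : Option G.E), by simp [PointedGraph.insertVertex, hxe, hx]⟩

theorem insertVertex_isContractible (G : PointedGraph) (e : G.E) :
    (G.insertVertex e).IsContractible (some e : Option G.E) := by
  refine ⟨by simp [insertVertex], Or.inr ⟨by simp [insertVertex], ?_⟩⟩
  convert insertVertex_inDeg G e
  simp [insertVertex]

/-- A vertex of in- and out-degree one arises by insertion. -/
theorem exists_insertVertex {G : PointedGraph} {v : G.V} (hv : v ≠ G.base) {f h : G.E}
    (hf : G.tgt f = v) (hh : G.src h = v) (hf' : ∀ x, G.tgt x = v → x = f)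
    (hh' : ∀ x, G.src x = v → x = h) (hu : G.src f ≠ v) (hhf : h ≠ f) :
    Nonempty (Iso G ((G.contractEdge f).insertVertex ⟨h, hhf⟩)) := by
  let p : G.V → Option (G.contractEdge f).V := fun z => if z = v then none else some (cV G f z)
  have pv : p v = none := if_pos rfl
  have pn : ∀ z, z ≠ v → p z = some (cV G f z) := fun z hz => if_neg hz
  have hf2 : cV G f (G.src f) = cV G f v := by rw [cV_src_eq, hf]
  have hw : G.tgt h ≠ v := fun h' => hhf (hf' _ h')
  let q : G.E → Option {x // x ≠ f} := fun x => if hx : x = f then some ⟨h, hhf⟩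
    else if x = h then none else some ⟨x, hx⟩
  have qf : q f = some ⟨h, hhf⟩ := dif_pos rfl
  have qh : q h = none := by simp [q, hhf]
  have qn : ∀ x (hx : x ≠ f), x ≠ h → q x = some ⟨x, hx⟩ := fun x hx hx' => by simp [q, hx, hx']
  refine ⟨⟨Equiv.ofBijective p ⟨?_, ?_⟩, Equiv.ofBijective q ⟨?_, ?_⟩, ?_, ?_, pn _ hv.symm⟩⟩
  · intro a b hab
    by_cases ha : a = v <;> by_cases hb : b = v
    · rw [ha, hb]
    · rw [ha, pv, pn b hb] at hab; exact absurd hab (by simp)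
    · rw [hb, pv, pn a ha] at hab; exact absurd hab (by simp)
    · rw [pn a ha, pn b hb] at hab
      have hab' : cV G f a = cV G f b := Option.some_injective _ hab
      rw [cV_eq_iff, hf] at hab'
      grind
  · rintro (_ | z)
    · exact ⟨v, pv⟩
    · obtain ⟨z, rfl⟩ := cV_surj z
      by_cases hz : z = v
      · exact ⟨G.src f, by rw [pn _ hu, hf2, hz]⟩
      · exact ⟨z, pn z hz⟩
  · have hinv : Function.LeftInverse
        (fun o : Option {x // x ≠ f} => o.elim h fun x => if x.1 = h then f else x.1) q := by
      intro a
      by_cases ha : a = f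
      · simp [ha, qf]
      · by_cases ha' : a = h
        · simp [ha', qh]
        · simp [qn a ha ha', ha']
    exact hinv.injective
  · rintro (_ | ⟨x, hx⟩)
    · exact ⟨h, qh⟩
    · by_cases hxh : x = h
      · exact ⟨f, qf.trans (congrArg some (Subtype.ext hxh.symm))⟩
      · exact ⟨x, qn x hx hxh⟩
  · intro x
    change ((G.contractEdge f).insertVertex ⟨h, hhf⟩).src (q x) = p (G.src x)
    by_cases hx : x = f
    · subst hx
      rw [qf, pn _ hu, hf2, ← hh]; rfl
    · by_cases hxh : x = h
      · subst hxh
        rw [qh, hh, pv]; rfl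
      · rw [qn x hx hxh, pn _ fun h' => hxh (hh' _ h')]; rfl
  · intro x
    change ((G.contractEdge f).insertVertex ⟨h, hhf⟩).tgt (q x) = p (G.tgt x)
    by_cases hx : x = f
    · subst hx
      rw [qf, hf, pv]
      exact if_pos rfl
    · by_cases hxh : x = h
      · subst hxh
        rw [qh, pn _ hw]; rfl
      · rw [qn x hx hxh, pn _ fun h' => hx (hf' _ h')]
        exact if_neg fun h' => hxh (congrArg Subtype.val h')

/-- Inserting a vertex preserves positive degrees and is undone by contracting the first half of the
subdivided edge. -/
theorem IsStabilization.posDeg_contractsTo {G S : PointedGraph} (h : G.IsStabilization S) :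
    G.PosDeg ∧ G.ContractsTo S ∧ S.IsStable := by
  obtain ⟨H, hss, hsub, hc, hS⟩ := h
  suffices G.PosDeg ∧ G.ContractsTo S from ⟨this.1, this.2, hS⟩
  induction hsub with
  | refl => exact ⟨fun v hv => ⟨(hss v hv).1, (hss v hv).2.1⟩, hc⟩
  | iso _ hφ ih =>
    obtain ⟨φ⟩ := hφ
    exact ⟨φ.posDeg ih.1, ih.2.of_iso_left φ⟩
  | insert _ e ih =>
    refine ⟨ih.1.insertVertex e, ?_⟩
    exact (ih.2.of_iso_left (insertContract _ e).symm).head (insertVertex_isContractible _ e)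

/-- A vertex that violates semistability has in- and out-degree one, hence arises by an insertion.
Contracting the edge that enters it gives a smaller graph that still contracts to `S`, by
confluence. -/
theorem isStabilization_of_contractsTo {S : PointedGraph} (hS : S.IsStable) (N : ℕ) :
    ∀ {G : PointedGraph}, Fintype.card G.E < N → G.PosDeg → G.ContractsTo S →
      G.IsStabilization S := by
  induction N with
  | zero => intro G h; omega
  | succ N ih =>
    intro G hN hp hc
    by_cases hss : G.IsSemistable
    · exact ⟨G, hss, Subdivides.refl, hc, hS⟩
    unfold IsSemistable at hss
    push Not at hss
    obtain ⟨v, hv, hlt⟩ := hss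
    have hlt := hlt (hp v hv).1 (hp v hv).2
    have h1 := hp v hv
    obtain ⟨f, hf, hf'⟩ := inDeg_eq_one_iff.1 (show G.inDeg v = 1 by omega)
    obtain ⟨h, hh, hh'⟩ := outDeg_eq_one_iff.1 (show G.outDeg v = 1 by omega)
    -- A loop at `v` would make `{v}` an obstruction.
    have hu : G.src f ≠ v := by
      intro hu
      refine IsObstruction.not_contractsTo hS hc (W := {v}) ⟨⟨v, rfl⟩, fun h' => hv h'.symm, ?_, ?_, ?_⟩
      · rintro _ rfl
        exact ⟨f, hf⟩
      · intro e e' he hee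
        rw [hf' e he, hf' e' (hee.symm.trans he)]
      · intro e he
        rw [hf' e he]
        exact hu
    have hhf : h ≠ f := by
      rintro rfl
      exact hu hh
    have hcon : G.IsContractible f := ⟨by rw [hf]; exact hu, Or.inr ⟨by rw [hf]; exact hv,
      by rw [hf]; omega⟩⟩
    obtain ⟨H, h1, h2, h3, h4⟩ := ih
      (lt_of_lt_of_le (card_contractEdge_lt (e := f)) (Nat.lt_succ_iff.1 hN))
      (hp.contract hcon.1) (hc.contract_of_isStable hS _ (Nat.lt_succ_self _) hcon)
    obtain ⟨φ⟩ := exists_insertVertex hv hf hh hf' hh' hu hhf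
    exact ⟨H, h1, (h2.insert ⟨h, hhf⟩).iso ⟨φ.symm⟩, h3, h4⟩

/-- This removes insertions and semistability from the notion; in this form it is visibly compatible
with contractions, and it is the form used below. -/
theorem isStabilization_iff {G S : PointedGraph} :
    G.IsStabilization S ↔ G.PosDeg ∧ G.ContractsTo S ∧ S.IsStable :=
  ⟨fun h => h.posDeg_contractsTo, fun h =>
    isStabilization_of_contractsTo h.2.2 _ (Nat.lt_succ_self _) h.1 h.2.1⟩

/-- The coefficient of the stabilization graph, and zero for graphs that are not GS. -/
def stabCoeff (c : IsoClass → ℂ) (G : PointedGraph) : ℂ := if G.IsGS then c G.stabClass else 0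

theorem stabCoeff_eq (c : IsoClass → ℂ) {G S : PointedGraph} (h : G.IsStabilization S) :
    stabCoeff c G = c (Quotient.mk _ S) := by
  have hGS : G.IsGS := ⟨S, h⟩
  have h' := isStabilization_iff.1 hGS.choose_spec
  have h := isStabilization_iff.1 h
  rw [stabCoeff, if_pos hGS, stabClass, dif_pos hGS]
  exact congrArg c (Quotient.sound (h'.2.1.unique h'.2.2 h.2.2 _ (Nat.lt_succ_self _) h.2.1))

theorem stabCoeff_of_isStable (c : IsoClass → ℂ) {G : PointedGraph} (h : G.IsStable) :
    stabCoeff c G = c (Quotient.mk _ G) :=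
  stabCoeff_eq c (isStabilization_iff.2 ⟨h.posDeg, ContractsTo.refl, h⟩)

theorem IsStable.isGS {G : PointedGraph} (h : G.IsStable) : G.IsGS :=
  ⟨G, isStabilization_iff.2 ⟨h.posDeg, ContractsTo.refl, h⟩⟩

theorem stabCoeff_of_not_isGS (c : IsoClass → ℂ) {G : PointedGraph} (h : ¬ G.IsGS) :
    stabCoeff c G = 0 := if_neg h

theorem stabCoeff_iso (c : IsoClass → ℂ) {G H : PointedGraph} (φ : Iso G H) :
    stabCoeff c G = stabCoeff c H := by
  have : ∀ {G H : PointedGraph} {S}, Iso G H → G.IsStabilization S → H.IsStabilization S :=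
    fun φ ⟨K, h1, h2, h3, h4⟩ => ⟨K, h1, h2.iso ⟨φ⟩, h3, h4⟩
  by_cases hG : G.IsGS
  · obtain ⟨S, hS⟩ := hG
    rw [stabCoeff_eq c hS, stabCoeff_eq c (this φ hS)]
  · rw [stabCoeff_of_not_isGS c hG, stabCoeff_of_not_isGS c fun ⟨S, hS⟩ => hG ⟨S, this φ.symm hS⟩]

/-- A stabilization of `G` is one of the contraction by confluence; conversely, the contraction is
prepended to the reduction. -/
theorem stabCoeff_contract (c : IsoClass → ℂ) {G : PointedGraph} (hp : G.PosDeg) {e : G.E}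
    (he : G.IsContractible e) : stabCoeff c (G.contractEdge e) = stabCoeff c G := by
  by_cases hG : G.IsGS
  · obtain ⟨S, hS⟩ := hG
    rw [stabCoeff_eq c hS]
    obtain ⟨h1, h2, h3⟩ := isStabilization_iff.1 hS
    exact stabCoeff_eq c (isStabilization_iff.2 ⟨hp.contract he.1,
      h2.contract_of_isStable h3 _ (Nat.lt_succ_self _) he, h3⟩)
  · rw [stabCoeff_of_not_isGS c hG, stabCoeff_of_not_isGS c]
    rintro ⟨S, hS⟩
    obtain ⟨h1, h2, h3⟩ := isStabilization_iff.1 hS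
    exact hG ⟨S, isStabilization_iff.2 ⟨hp, h2.head he, h3⟩⟩

theorem stabCoeff_posDeg {c : IsoClass → ℂ} {G : PointedGraph} (h : stabCoeff c G ≠ 0) :
    G.PosDeg := by
  by_contra h'
  exact h (stabCoeff_of_not_isGS c fun ⟨S, hS⟩ => h' (isStabilization_iff.1 hS).1)

theorem isObstruction_of_inDeg {G : PointedGraph} {W : Set G.V} (h1 : W.Nonempty)
    (h2 : G.base ∉ W) (h3 : ∀ v ∈ W, G.inDeg v = 1) (h4 : ∀ e, G.tgt e ∈ W → G.src e ∈ W) :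
    IsObstruction G W :=
  ⟨h1, h2, fun v hv => by
      obtain ⟨e, he, -⟩ := inDeg_eq_one_iff.1 (h3 v hv)
      exact ⟨e, he⟩,
    fun e e' he hee => eq_of_inDeg_eq_one (h3 _ he) rfl hee.symm, h4⟩

theorem isStabCoeff_stabCoeff (c : IsoClass → ℂ) : IsStabCoeff (stabCoeff c) where
  iso φ := stabCoeff_iso c φ
  posDeg := stabCoeff_posDeg
  contract _ _ hp h1 h2 h3 := stabCoeff_contract c hp ⟨h1, Or.inr ⟨h2, h3⟩⟩
  obstruct _ _ h1 h2 h3 h4 := stabCoeff_of_not_isGS c fun ⟨_, hS⟩ =>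
    (isObstruction_of_inDeg h1 h2 h3 h4).not_contractsTo (isStabilization_iff.1 hS).2.2
      (isStabilization_iff.1 hS).2.1

theorem PosDeg.op {G : PointedGraph} (h : G.PosDeg) : G.op.PosDeg := fun v hv => (h v hv).symm

/-- The stabilization graph is also insensitive to contractions at vertices of out-degree one. On
reversed graphs this becomes the condition of `IsStabCoeff`, as needed for the second elimination.
-/
theorem isStabCoeff_stabCoeff_op (c : IsoClass → ℂ) : IsStabCoeff fun G => stabCoeff c G.op where
  iso φ := stabCoeff_iso c φ.op
  posDeg h := (stabCoeff_posDeg h).op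
  contract G e hp h1 h2 h3 :=
    (stabCoeff_iso c (opContract G e).symm).trans
      (stabCoeff_contract (G := G.op) c hp.op ⟨Ne.symm h1, Or.inl ⟨h2, h3⟩⟩)
  obstruct _ _ h1 h2 h3 h4 := stabCoeff_of_not_isGS c fun ⟨_, hS⟩ =>
    (isObstruction_of_inDeg h1 h2 h3 h4).not_contractsTo (isStabilization_iff.1 hS).2.2.op
      (isStabilization_iff.1 hS).2.1.op

end PointedGraph

/-! ### Isomorphism classes and automorphisms -/

namespace PointedGraph

instance (G H : PointedGraph) : Finite (Iso G H) :=
  Finite.of_injective (fun φ : Iso G H => (φ.onV, φ.onE)) fun φ χ h => by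
    cases φ; cases χ; simp_all

theorem autCard_pos (G : PointedGraph) : 0 < G.autCard := by
  have : Nonempty (Iso G G) := ⟨Iso.refl G⟩
  exact Nat.card_pos

theorem Iso.card_eq {G H : PointedGraph} (φ : Iso G H) : Nat.card (Iso G H) = H.autCard :=
  Nat.card_congr
    { toFun := fun χ => φ.symm.trans χ
      invFun := fun χ => φ.trans χ
      left_inv := fun χ => by cases χ; simp [Iso.trans, Iso.symm, ← Equiv.trans_assoc]
      right_inv := fun χ => by cases χ; simp [Iso.trans, Iso.symm, ← Equiv.trans_assoc] }

/-- Labellings of a graph. -/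
def labelEquiv (A B : Type) [Fintype A] [Fintype B] (Z : PointedGraph) :
    (Σ st : (B → Option A) × (B → Option A), Iso (gr none st.1 st.2) Z) ≃
      {e : Option A ≃ Z.V // e none = Z.base} × (B ≃ Z.E) where
  toFun x := ⟨⟨x.2.onV, x.2.base_eq⟩, x.2.onE⟩
  invFun x := ⟨⟨fun e => x.1.1.symm (Z.src (x.2 e)), fun e => x.1.1.symm (Z.tgt (x.2 e))⟩,
    ⟨x.1.1, x.2, fun e => by simp, fun e => by simp, x.1.2⟩⟩
  left_inv := by
    rintro ⟨⟨s, t⟩, ⟨(eV : Option A ≃ Z.V), (eE : B ≃ Z.E), h1, h2, h3⟩⟩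
    have hs : s = fun e => eV.symm (Z.src (eE e)) := by
      ext1 e; rw [h1, Equiv.symm_apply_apply]
    have ht : t = fun e => eV.symm (Z.tgt (eE e)) := by
      ext1 e; rw [h2, Equiv.symm_apply_apply]
    subst hs ht
    rfl
  right_inv := fun x => rfl

/-- Orbit and stabilizer: a labelled graph together with an isomorphism to `Z` is the same as a
labelling of the ordinary vertices and edges of `Z`. -/
theorem card_labellings {a b : ℕ} {Z : PointedGraph} (hV : Fintype.card Z.V = a + 1)
    (hE : Fintype.card Z.E = b) :
    (Finset.univ.filter fun st : (Fin b → Option (Fin a)) × (Fin b → Option (Fin a)) =>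
      Nonempty (Iso (gr none st.1 st.2) Z)).card * Z.autCard = a.factorial * b.factorial := by
  have h1 := Nat.card_congr (labelEquiv (Fin a) (Fin b) Z)
  rw [Nat.card_sigma, Nat.card_prod, Nat.card_congr (Equiv.optionSubtype Z.base)] at h1
  obtain ⟨e1⟩ : Nonempty (Fin a ≃ {y // y ≠ Z.base}) :=
    ⟨Fintype.equivOfCardEq (by
      rw [Fintype.card_subtype_compl (fun y => y = Z.base), Fintype.card_subtype_eq, hV]; simp)⟩
  obtain ⟨e2⟩ : Nonempty (Fin b ≃ Z.E) := ⟨Fintype.equivOfCardEq (by simp [hE])⟩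
  rw [Nat.card_eq_fintype_card, Nat.card_eq_fintype_card, Fintype.card_equiv e1,
    Fintype.card_equiv e2, Fintype.card_fin, Fintype.card_fin] at h1
  rw [← h1, ← smul_eq_mul, ← Finset.sum_const, Finset.sum_filter]
  refine Finset.sum_congr rfl fun st _ => ?_
  split_ifs with h
  · exact h.some.card_eq.symm
  · rw [not_nonempty_iff] at h
    exact Nat.card_of_isEmpty.symm

/-- Each class is met once for each of its `a! b! / |Aut|` labelled representatives. By the degree
count, a stable graph of weight `k` has at most `k` ordinary vertices. -/
theorem sum_stableClasses {φ : PointedGraph → ℂ} (hφ : ∀ {G H : PointedGraph}, Iso G H → φ G = φ H)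
    (k : ℕ) : ∑ q ∈ stableClasses k, φ q.out / q.out.autCard =
      ∑ a ∈ Finset.range (k + 1), tot a (a + k) fun G => if G.IsStable then φ G else 0 := by
  have hmem : ∀ q, q ∈ stableClasses k ↔ q.out.IsStable ∧ q.out.weight = k := fun q => by
    simp [stableClasses]
  have h1 : ∀ a ∈ Finset.range (k + 1), tot a (a + k) (fun G => if G.IsStable then φ G else 0) =
      ∑ q ∈ stableClasses k, φ q.out * (((a.factorial * (a + k).factorial : ℕ) : ℂ)⁻¹ *
        (Finset.univ.filter fun st : (Fin (a + k) → Option (Fin a)) × (Fin (a + k) → Option (Fin a)) =>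
          Nonempty (Iso (gr none st.1 st.2) q.out)).card) := by
    intro a ha
    unfold tot
    simp only [mul_left_comm (φ _), ← Finset.mul_sum]
    congr 1
    rw [← Fintype.sum_prod_type']
    simp only [Finset.card_filter, Nat.cast_sum, Finset.mul_sum]
    rw [Finset.sum_comm]
    refine Finset.sum_congr rfl fun st _ => ?_
    by_cases hst : (gr none st.1 st.2).IsStable
    · rw [if_pos hst]
      let q : IsoClass := Quotient.mk _ (gr none st.1 st.2)
      obtain ⟨iso⟩ : Nonempty (Iso q.out (gr none st.1 st.2)) := Quotient.exact (Quotient.out_eq q)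
      have hq : q ∈ stableClasses k := by
        rw [hmem]
        refine ⟨iso.symm.isStable hst, ?_⟩
        unfold weight
        rw [Fintype.card_congr iso.onV, Fintype.card_congr iso.onE]
        simp
      rw [Finset.sum_eq_single_of_mem q hq]
      · rw [if_pos ⟨iso.symm⟩, hφ iso]; simp
      · intro q' _ hne
        rw [if_neg]
        · simp
        · rintro ⟨ψ⟩
          refine hne ?_
          rw [← Quotient.out_eq q', ← Quotient.out_eq q]
          exact Quotient.sound ⟨(iso.trans ψ).symm⟩
    · rw [if_neg hst]
      refine (Finset.sum_eq_zero fun q hq => ?_).symm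
      rw [if_neg]
      · simp
      · rintro ⟨ψ⟩
        exact hst (ψ.symm.isStable ((hmem q).1 hq).1)
  rw [Finset.sum_congr rfl h1, Finset.sum_comm]
  refine Finset.sum_congr rfl fun q hq => ?_
  rw [← Finset.mul_sum, div_eq_mul_inv]
  congr 1
  obtain ⟨hs, hw⟩ := (hmem q).1 hq
  have h2 := hs.two_mul_le
  have hV : 0 < Fintype.card q.out.V := Fintype.card_pos_iff.2 ⟨q.out.base⟩
  unfold weight at hw
  obtain ⟨a, ha⟩ : ∃ a, Fintype.card q.out.V = a + 1 := ⟨Fintype.card q.out.V - 1, by omega⟩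
  have hE : Fintype.card q.out.E = a + k := by omega
  rw [Finset.sum_eq_single_of_mem a (by simp; omega)]
  · rw [← card_labellings ha hE]
    have h3 : (q.out.autCard : ℂ) ≠ 0 := Nat.cast_ne_zero.2 q.out.autCard_pos.ne'
    have h4 : ((Finset.univ.filter fun st : (Fin (a + k) → Option (Fin a)) ×
        (Fin (a + k) → Option (Fin a)) => Nonempty (Iso (gr none st.1 st.2) q.out)).card : ℂ) ≠ 0 := by
      intro h
      have := card_labellings ha hE
      rw [Nat.cast_eq_zero] at h
      rw [h, zero_mul] at this
      exact (Nat.mul_pos a.factorial_pos (a + k).factorial_pos).ne this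
    push_cast
    field_simp
  · intro a' _ hne
    rw [Finset.filter_eq_empty_iff.2]
    · simp
    · rintro st _ ⟨ψ⟩
      have := Fintype.card_congr ψ.onV
      simp only [Fintype.card_option, Fintype.card_fin, ha] at this
      omega

end PointedGraph

/-! ### Wirtinger derivatives -/

section wirtinger
variable {n : ℕ} {U : Set (Fin n → ℂ)}

/-- The derivatives `∂/∂zᵢ` and `∂/∂z̄ᵢ`. -/
def dd : Fin n ⊕ Fin n → ((Fin n → ℂ) → ℂ) → (Fin n → ℂ) → ℂ := Sum.elim wirtinger wirtingerBar

/-- A common shape of both kinds of derivatives, so that the rules of calculus need only one proof.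
-/
theorem dd_eq (s : Fin n ⊕ Fin n) : ∃ (i : Fin n) (z : ℂ), ∀ h x,
    dd s h x = (fderiv ℝ h x (Pi.single i 1) + z * fderiv ℝ h x (Pi.single i Complex.I)) / 2 := by
  rcases s with i | i
  · exact ⟨i, -Complex.I, fun h x => by simp [dd, wirtinger, sub_eq_add_neg]⟩
  · exact ⟨i, Complex.I, fun h x => by simp [dd, wirtingerBar]⟩

theorem dd_congr {f h : (Fin n → ℂ) → ℂ} {x : Fin n → ℂ} (hfh : f =ᶠ[nhds x] h)
    (s : Fin n ⊕ Fin n) : dd s f x = dd s h x := by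
  obtain ⟨i, z, hd⟩ := dd_eq s
  rw [hd, hd, hfh.fderiv_eq]

theorem dd_congr_on (hU : IsOpen U) {f h : (Fin n → ℂ) → ℂ} (hfh : Set.EqOn f h U)
    (s : Fin n ⊕ Fin n) : Set.EqOn (dd s f) (dd s h) U := fun _ hx =>
  dd_congr (hfh.eventuallyEq_of_mem (hU.mem_nhds hx)) s

theorem dd_sum {ι : Type} (A : Finset ι) {f : ι → (Fin n → ℂ) → ℂ} {x : Fin n → ℂ}
    (hf : ∀ i ∈ A, DifferentiableAt ℝ (f i) x) (s : Fin n ⊕ Fin n) :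
    dd s (fun y => ∑ i ∈ A, f i y) x = ∑ i ∈ A, dd s (f i) x := by
  obtain ⟨i, z, hd⟩ := dd_eq s
  simp only [hd, fderiv_fun_sum hf, sum_apply, Finset.mul_sum,
    ← Finset.sum_add_distrib, Finset.sum_div]

theorem dd_mul {f h : (Fin n → ℂ) → ℂ} {x : Fin n → ℂ} (hf : DifferentiableAt ℝ f x)
    (hh : DifferentiableAt ℝ h x) (s : Fin n ⊕ Fin n) :
    dd s (fun y => f y * h y) x = dd s f x * h x + f x * dd s h x := by
  obtain ⟨i, z, hd⟩ := dd_eq s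
  simp only [hd, fderiv_fun_mul hf hh, add_apply,
    smul_apply, smul_eq_mul]
  ring

theorem dd_const (c : ℂ) (s : Fin n ⊕ Fin n) (x : Fin n → ℂ) : dd s (fun _ => c) x = 0 := by
  obtain ⟨i, z, hd⟩ := dd_eq s
  simp [hd]

theorem dd_const_mul {f : (Fin n → ℂ) → ℂ} {x : Fin n → ℂ} (hf : DifferentiableAt ℝ f x) (c : ℂ)
    (s : Fin n ⊕ Fin n) : dd s (fun y => c * f y) x = c * dd s f x := by
  rw [dd_mul (differentiableAt_const c) hf, dd_const]; ring

theorem differentiableAt_prod {ι : Type} {A : Finset ι} {f : ι → (Fin n → ℂ) → ℂ} {x : Fin n → ℂ}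
    (hf : ∀ i ∈ A, DifferentiableAt ℝ (f i) x) : DifferentiableAt ℝ (fun y => ∏ i ∈ A, f i y) x :=
  (HasFDerivAt.finsetProd fun i hi => (hf i hi).hasFDerivAt).differentiableAt

theorem dd_prod {ι : Type} (A : Finset ι) {f : ι → (Fin n → ℂ) → ℂ} {x : Fin n → ℂ}
    (hf : ∀ i ∈ A, DifferentiableAt ℝ (f i) x) (s : Fin n ⊕ Fin n) :
    dd s (fun y => ∏ i ∈ A, f i y) x = ∑ i ∈ A, (∏ j ∈ A.erase i, f j x) * dd s (f i) x := by
  induction A using Finset.induction_on with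
  | empty => simp [dd_const]
  | insert a A ha ih =>
    simp only [Finset.prod_insert ha]
    rw [dd_mul (hf a (Finset.mem_insert_self _ _))
      (differentiableAt_prod fun i hi => hf i (Finset.mem_insert_of_mem hi)),
      ih fun i hi => hf i (Finset.mem_insert_of_mem hi), Finset.sum_insert ha,
      Finset.erase_insert ha, mul_comm (dd s (f a) x), Finset.mul_sum]
    congr 1
    refine Finset.sum_congr rfl fun i hi => ?_
    have hia : i ≠ a := fun h => ha (h ▸ hi)
    rw [Finset.erase_insert_of_ne hia.symm, Finset.prod_insert fun h => ha (Finset.mem_of_mem_erase h),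
      mul_assoc]

theorem fderiv_apply_single (f : (Fin n → ℂ) → ℂ) (x : Fin n → ℂ) (i : Fin n) (c : ℂ) :
    fderiv ℝ f x (Pi.single i c) =
      c * dd (Sum.inl i) f x + starRingEnd ℂ c * dd (Sum.inr i) f x := by
  have h : (Pi.single i c : Fin n → ℂ) = c.re • (Pi.single i 1 : Fin n → ℂ) +
      c.im • (Pi.single i Complex.I : Fin n → ℂ) := by
    ext j
    by_cases hj : j = i
    · subst hj
      simp [Complex.re_add_im]
    · simp [hj]
  rw [h, map_add, map_smul, map_smul]
  simp only [dd, Sum.elim_inl, Sum.elim_inr, wirtinger, wirtingerBar, Complex.real_smul]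
  have h1 : c = c.re + c.im * Complex.I := (Complex.re_add_im c).symm
  have h2 : starRingEnd ℂ c = c.re - c.im * Complex.I := by
    apply Complex.ext <;> simp
  rw [h2]
  conv_rhs => rw [h1]
  simp only [Complex.add_re, Complex.ofReal_re, Complex.mul_re, Complex.I_re, mul_zero,
    Complex.ofReal_im, Complex.I_im, mul_one, sub_self, add_zero, Complex.add_im, Complex.mul_im,
    zero_add]
  ring_nf
  rw [Complex.I_sq]
  ring

theorem fderiv_apply_eq (f : (Fin n → ℂ) → ℂ) (x v : Fin n → ℂ) :
    fderiv ℝ f x v = ∑ i, (v i * dd (Sum.inl i) f x + starRingEnd ℂ (v i) * dd (Sum.inr i) f x) := by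
  conv_lhs => rw [← Finset.univ_sum_single v]
  rw [map_sum]
  exact Finset.sum_congr rfl fun i _ => fderiv_apply_single f x i _

theorem dd_conj {f : (Fin n → ℂ) → ℂ} {x : Fin n → ℂ} (s : Fin n ⊕ Fin n) :
    dd s (fun y => starRingEnd ℂ (f y)) x = starRingEnd ℂ (dd s.swap f x) := by
  have h : fderiv ℝ (fun y => starRingEnd ℂ (f y)) x =
      (Complex.conjCLE : ℂ →L[ℝ] ℂ).comp (fderiv ℝ f x) := Complex.conjCLE.comp_fderiv
  have h2 : starRingEnd ℂ 2 = 2 := Complex.conj_ofNat 2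
  rcases s with i | i
  · simp [dd, wirtinger, wirtingerBar, h, sub_eq_add_neg, h2]
  · simp [dd, wirtinger, wirtingerBar, h, sub_eq_add_neg, h2]

/-! #### Composition with holomorphic maps -/

theorem dd_coord {θ : (Fin n → ℂ) → (Fin n → ℂ)} {x : Fin n → ℂ} (hθ : DifferentiableAt ℂ θ x)
    (i k : Fin n) : dd (Sum.inl k) (fun y => θ y i) x = fderiv ℂ θ x (Pi.single k 1) i ∧
      dd (Sum.inr k) (fun y => θ y i) x = 0 := by
  have h1 : HasFDerivAt (fun y => θ y i)
      ((ContinuousLinearMap.proj (R := ℝ) (φ := fun _ : Fin n => ℂ) i).comp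
        ((fderiv ℂ θ x).restrictScalars ℝ)) x :=
    ((ContinuousLinearMap.proj (R := ℝ) (φ := fun _ : Fin n => ℂ) i).hasFDerivAt
      (x := θ x)).comp x (hθ.hasFDerivAt.restrictScalars ℝ)
  have h2 : (Pi.single k Complex.I : Fin n → ℂ) = Complex.I • Pi.single k 1 := by
    rw [← Pi.single_smul]; simp
  constructor
  · simp only [dd, Sum.elim_inl, wirtinger, h1.fderiv]
    simp [h2, ← mul_assoc]
  · simp only [dd, Sum.elim_inr, wirtingerBar, h1.fderiv]
    simp [h2, ← mul_assoc]

theorem dd_comp {f : (Fin n → ℂ) → ℂ} {θ : (Fin n → ℂ) → (Fin n → ℂ)} {x : Fin n → ℂ}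
    (hf : DifferentiableAt ℝ f (θ x)) (hθ : DifferentiableAt ℂ θ x) (k : Fin n) :
    dd (Sum.inl k) (fun y => f (θ y)) x =
        ∑ i, dd (Sum.inl i) f (θ x) * fderiv ℂ θ x (Pi.single k 1) i ∧
      dd (Sum.inr k) (fun y => f (θ y)) x =
        ∑ i, dd (Sum.inr i) f (θ x) * starRingEnd ℂ (fderiv ℂ θ x (Pi.single k 1) i) := by
  have h1 : HasFDerivAt (fun y => f (θ y)) ((fderiv ℝ f (θ x)).comp
      ((fderiv ℂ θ x).restrictScalars ℝ)) x :=
    hf.hasFDerivAt.comp x (hθ.hasFDerivAt.restrictScalars ℝ)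
  have h2 : (Pi.single k Complex.I : Fin n → ℂ) = Complex.I • Pi.single k 1 := by
    rw [← Pi.single_smul]; simp
  constructor
  · simp only [dd, Sum.elim_inl, wirtinger, h1.fderiv]
    simp only [ContinuousLinearMap.comp_apply, ContinuousLinearMap.coe_restrictScalars', h2,
      map_smul]
    rw [fderiv_apply_eq f (θ x), fderiv_apply_eq f (θ x)]
    simp only [Pi.smul_apply, smul_eq_mul, map_mul, Complex.conj_I]
    rw [Finset.mul_sum, ← Finset.sum_sub_distrib, Finset.sum_div]
    refine Finset.sum_congr rfl fun i _ => ?_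
    simp only [dd, Sum.elim_inl, Sum.elim_inr, wirtinger, wirtingerBar]
    ring_nf
    simp only [Complex.I_sq, Complex.I_pow_three]
    ring
  · simp only [dd, Sum.elim_inr, wirtingerBar, h1.fderiv]
    simp only [ContinuousLinearMap.comp_apply, ContinuousLinearMap.coe_restrictScalars', h2,
      map_smul]
    rw [fderiv_apply_eq f (θ x), fderiv_apply_eq f (θ x)]
    simp only [Pi.smul_apply, smul_eq_mul, map_mul, Complex.conj_I]
    rw [Finset.mul_sum, ← Finset.sum_add_distrib, Finset.sum_div]
    refine Finset.sum_congr rfl fun i _ => ?_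
    simp only [dd, Sum.elim_inl, Sum.elim_inr, wirtinger, wirtingerBar]
    ring_nf
    simp only [Complex.I_sq, Complex.I_pow_three]
    ring

/-! #### Smooth functions on an open set -/

/-- Smooth functions on the open set `U`. -/
abbrev Sm (U : Set (Fin n → ℂ)) (f : (Fin n → ℂ) → ℂ) : Prop := ContDiffOn ℝ ∞ f U

theorem Sm.differentiableAt (hU : IsOpen U) {f : (Fin n → ℂ) → ℂ} (hf : Sm U f) {x : Fin n → ℂ}
    (hx : x ∈ U) : DifferentiableAt ℝ f x :=
  (hf.contDiffAt (hU.mem_nhds hx)).differentiableAt (by simp)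

theorem Sm.dd (hU : IsOpen U) {f : (Fin n → ℂ) → ℂ} (hf : Sm U f) (s : Fin n ⊕ Fin n) :
    Sm U (dd s f) := by
  obtain ⟨i, z, hd⟩ := dd_eq s
  have h1 : ContDiffOn ℝ ∞ (fderiv ℝ f) U := hf.fderiv_of_isOpen hU (by simp)
  have h2 : ∀ v, Sm U fun x => fderiv ℝ f x v := fun v => h1.clm_apply contDiffOn_const
  have : _root_.dd s f = fun x =>
      (fderiv ℝ f x (Pi.single i 1) + z * fderiv ℝ f x (Pi.single i Complex.I)) / 2 := funext (hd f)
  rw [this]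
  exact ((h2 _).add (contDiffOn_const.mul (h2 _))).div_const 2

theorem Sm.congr_on {f h : (Fin n → ℂ) → ℂ} (hf : Sm U f) (hfh : Set.EqOn f h U) : Sm U h :=
  hf.congr fun _ hx => (hfh hx).symm

theorem Sm.sum {ι : Type} {A : Finset ι} {f : ι → (Fin n → ℂ) → ℂ} (hf : ∀ i ∈ A, Sm U (f i)) :
    Sm U fun y => ∑ i ∈ A, f i y := ContDiffOn.sum hf

theorem Sm.prod {ι : Type} {A : Finset ι} {f : ι → (Fin n → ℂ) → ℂ} (hf : ∀ i ∈ A, Sm U (f i)) :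
    Sm U fun y => ∏ i ∈ A, f i y := contDiffOn_prod hf

theorem Sm.conj {f : (Fin n → ℂ) → ℂ} (hf : Sm U f) : Sm U fun y => starRingEnd ℂ (f y) :=
  Complex.conjCLE.contDiff.comp_contDiffOn hf

theorem fderiv_fderiv_apply {f : (Fin n → ℂ) → ℂ} {x : Fin n → ℂ}
    (h : DifferentiableAt ℝ (fderiv ℝ f) x) (v w : Fin n → ℂ) :
    fderiv ℝ (fun y => fderiv ℝ f y v) x w = fderiv ℝ (fderiv ℝ f) x w v := by
  rw [fderiv_clm_apply h (differentiableAt_const v)]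
  simp

theorem dd_comm (hU : IsOpen U) {f : (Fin n → ℂ) → ℂ} (hf : Sm U f) (s t : Fin n ⊕ Fin n) :
    Set.EqOn (dd s (dd t f)) (dd t (dd s f)) U := by
  intro x hx
  have h1 : ContDiffOn ℝ ∞ (fderiv ℝ f) U := hf.fderiv_of_isOpen hU (by simp)
  have h2 : DifferentiableAt ℝ (fderiv ℝ f) x :=
    (h1.contDiffAt (hU.mem_nhds hx)).differentiableAt (by simp)
  have h3 : ∀ v w, fderiv ℝ (fderiv ℝ f) x v w = fderiv ℝ (fderiv ℝ f) x w v := fun v w =>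
    ((hf.contDiffAt (hU.mem_nhds hx)).isSymmSndFDerivAt (by simpa using (WithTop.coe_le_coe.2 le_top : ((2 : ℕ∞) : WithTop ℕ∞) ≤ ((⊤ : ℕ∞) : WithTop ℕ∞)))) v w
  obtain ⟨i, z, hs⟩ := dd_eq s
  obtain ⟨j, u, ht⟩ := dd_eq t
  have h4 : ∀ v, DifferentiableAt ℝ (fun y => fderiv ℝ f y v) x := fun v =>
    h2.clm_apply (differentiableAt_const v)
  have key : ∀ (j : Fin n) (u : ℂ) (t : Fin n ⊕ Fin n), (∀ h x, dd t h x =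
      (fderiv ℝ h x (Pi.single j 1) + u * fderiv ℝ h x (Pi.single j Complex.I)) / 2) →
      ∀ w, fderiv ℝ (dd t f) x w = (fderiv ℝ (fderiv ℝ f) x w (Pi.single j 1) +
        u * fderiv ℝ (fderiv ℝ f) x w (Pi.single j Complex.I)) / 2 := by
    intro j u t ht w
    have : dd t f = fun y => (fderiv ℝ f y (Pi.single j 1) +
        u * fderiv ℝ f y (Pi.single j Complex.I)) * 2⁻¹ := by
      ext y; rw [ht, div_eq_mul_inv]
    have h5 := ((h4 (Pi.single j 1)).hasFDerivAt.fun_add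
      ((h4 (Pi.single j Complex.I)).hasFDerivAt.const_mul u)).mul_const (2⁻¹ : ℂ)
    rw [this, h5.fderiv]
    simp only [add_apply, smul_apply, smul_eq_mul,
      fderiv_fderiv_apply h2]
    ring
  rw [hs, ht]
  simp only [key j u t ht, key i z s hs]
  rw [h3 (Pi.single j 1) (Pi.single i 1), h3 (Pi.single j 1) (Pi.single i Complex.I),
    h3 (Pi.single j Complex.I) (Pi.single i 1), h3 (Pi.single j Complex.I) (Pi.single i Complex.I)]
  ring

end wirtinger

/-! ### Iterated derivatives and the Leibniz rule -/

section jets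
variable {n : ℕ} {U : Set (Fin n → ℂ)} {f h : (Fin n → ℂ) → ℂ}

/-- Iterated derivatives. -/
def dl (l : List (Fin n ⊕ Fin n)) (f : (Fin n → ℂ) → ℂ) : (Fin n → ℂ) → ℂ := l.foldr dd f

theorem Sm.dl (hU : IsOpen U) (hf : Sm U f) (l : List (Fin n ⊕ Fin n)) : Sm U (dl l f) := by
  induction l with
  | nil => exact hf
  | cons s l ih => exact Sm.dd hU ih s

theorem dl_congr_on (hU : IsOpen U) (hfh : Set.EqOn f h U) (l : List (Fin n ⊕ Fin n)) :
    Set.EqOn (dl l f) (dl l h) U := by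
  induction l with
  | nil => exact hfh
  | cons s l ih => exact dd_congr_on hU ih s

theorem dl_perm (hU : IsOpen U) (hf : Sm U f) {l l' : List (Fin n ⊕ Fin n)} (hl : l.Perm l') :
    Set.EqOn (dl l f) (dl l' f) U := by
  induction hl with
  | nil => exact fun _ _ => rfl
  | cons s _ ih => exact dd_congr_on hU ih s
  | swap s t l => exact dd_comm hU (hf.dl hU l) t s
  | trans _ _ ih1 ih2 => exact ih1.trans ih2

theorem dl_append (l l' : List (Fin n ⊕ Fin n)) : dl (l ++ l') f = dl l (dl l' f) :=
  List.foldr_append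

/-- The iterated derivative along a multiset of directions. -/
def jet (M : Multiset (Fin n ⊕ Fin n)) (f : (Fin n → ℂ) → ℂ) : (Fin n → ℂ) → ℂ := dl M.toList f

theorem Sm.jet (hU : IsOpen U) (hf : Sm U f) (M : Multiset (Fin n ⊕ Fin n)) : Sm U (jet M f) :=
  hf.dl hU _

theorem jet_congr_on (hU : IsOpen U) (hfh : Set.EqOn f h U) (M : Multiset (Fin n ⊕ Fin n)) :
    Set.EqOn (jet M f) (jet M h) U := dl_congr_on hU hfh _

@[simp] theorem jet_zero : jet 0 f = f := by simp [jet, dl]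

theorem jet_coe (hU : IsOpen U) (hf : Sm U f) (l : List (Fin n ⊕ Fin n)) :
    Set.EqOn (jet (l : Multiset (Fin n ⊕ Fin n)) f) (dl l f) U :=
  dl_perm hU hf (Multiset.coe_eq_coe.1 (Multiset.coe_toList _))

theorem jet_add (hU : IsOpen U) (hf : Sm U f) (M N : Multiset (Fin n ⊕ Fin n)) :
    Set.EqOn (jet (M + N) f) (jet M (jet N f)) U := by
  have : M + N = ((M.toList ++ N.toList : List (Fin n ⊕ Fin n)) : Multiset (Fin n ⊕ Fin n)) := by
    rw [← Multiset.coe_add, Multiset.coe_toList, Multiset.coe_toList]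
  rw [this]
  refine (jet_coe hU hf _).trans ?_
  rw [dl_append]
  exact fun _ _ => rfl

theorem jet_singleton (s : Fin n ⊕ Fin n) : jet {s} f = dd s f := by
  simp [jet, dl]

theorem jet_cons (hU : IsOpen U) (hf : Sm U f) (s : Fin n ⊕ Fin n)
    (M : Multiset (Fin n ⊕ Fin n)) : Set.EqOn (jet (s ::ₘ M) f) (dd s (jet M f)) U := by
  rw [← Multiset.singleton_add, ← jet_singleton]
  exact jet_add hU hf _ _

theorem jet_cons' (hU : IsOpen U) (hf : Sm U f) (s : Fin n ⊕ Fin n)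
    (M : Multiset (Fin n ⊕ Fin n)) : Set.EqOn (jet (s ::ₘ M) f) (jet M (dd s f)) U := by
  rw [← Multiset.singleton_add, add_comm, ← jet_singleton]
  exact jet_add hU hf _ _

theorem jet_sum (hU : IsOpen U) {ι : Type} (A : Finset ι) {f : ι → (Fin n → ℂ) → ℂ}
    (hf : ∀ i ∈ A, Sm U (f i)) (M : Multiset (Fin n ⊕ Fin n)) :
    Set.EqOn (jet M fun y => ∑ i ∈ A, f i y) (fun x => ∑ i ∈ A, jet M (f i) x) U := by
  induction M using Multiset.induction_on with
  | empty => simp only [jet_zero]; exact fun _ _ => rfl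
  | cons s M ih =>
    refine (jet_cons hU (Sm.sum hf) s M).trans ((dd_congr_on hU ih s).trans fun x hx => ?_)
    rw [dd_sum A (fun i hi => ((hf i hi).jet hU M).differentiableAt hU hx)]
    exact Finset.sum_congr rfl fun i hi => (jet_cons hU (hf i hi) s M hx).symm

theorem jet_const_mul (hU : IsOpen U) (hf : Sm U f) (c : ℂ) (M : Multiset (Fin n ⊕ Fin n)) :
    Set.EqOn (jet M fun y => c * f y) (fun x => c * jet M f x) U := by
  induction M using Multiset.induction_on with
  | empty => simp only [jet_zero]; exact fun _ _ => rfl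
  | cons s M ih =>
    refine (jet_cons hU (contDiffOn_const.mul hf) s M).trans
      ((dd_congr_on hU ih s).trans fun x hx => ?_)
    rw [dd_const_mul ((hf.jet hU M).differentiableAt hU hx), ← jet_cons hU hf s M hx]

theorem jet_const (c : ℂ) {M : Multiset (Fin n ⊕ Fin n)} (hM : M ≠ 0) (x : Fin n → ℂ) :
    jet M (fun _ => c) x = 0 := by
  have h0 : ∀ N : Multiset (Fin n ⊕ Fin n), N ≠ 0 →
      Set.EqOn (jet N (fun _ => c)) (fun _ => 0) Set.univ := by
    intro N
    induction N using Multiset.induction_on with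
    | empty => simp
    | cons s N ih =>
      intro _
      refine (jet_cons isOpen_univ contDiffOn_const s N).trans ?_
      by_cases hN : N = 0
      · subst hN
        intro x _
        rw [jet_zero, dd_const]
      · exact (dd_congr_on isOpen_univ (ih hN) s).trans fun x _ => dd_const _ _ _
  exact h0 M hM (Set.mem_univ x)

/-- The Leibniz rule for products of several functions. -/
theorem jet_prod (hU : IsOpen U) {V : Type} [Fintype V] {w : V → (Fin n → ℂ) → ℂ}
    (hw : ∀ v, Sm U (w v)) (N : ℕ) : ∀ (Q : Type) [Fintype Q], Fintype.card Q = N →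
    ∀ κ : Q → Fin n ⊕ Fin n, Set.EqOn (jet (∑ q, {κ q}) fun y => ∏ v, w v y)
      (fun x => ∑ S : Q → V, ∏ v, jet (Mo S κ v) (w v) x) U := by
  induction N with
  | zero =>
    intro Q _ hQ κ x _
    have : IsEmpty Q := Fintype.card_eq_zero_iff.1 hQ
    simp [Mo_empty]
  | succ N ih =>
    intro Q _ hQ κ
    obtain ⟨J, _, hJ, ⟨e⟩⟩ : ∃ (J : Type) (_ : Fintype J),
        Fintype.card J = N ∧ Nonempty (Option J ≃ Q) :=
      ⟨Fin N, inferInstance, by simp, ⟨Fintype.equivOfCardEq (by simp [hQ])⟩⟩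
    have h1 : ∑ q, ({κ q} : Multiset (Fin n ⊕ Fin n)) = κ (e none) ::ₘ ∑ j, {κ (e (some j))} := by
      rw [← Equiv.sum_comp e, Fintype.sum_option, Multiset.singleton_add]
    rw [h1]
    refine (jet_cons hU (Sm.prod fun v _ => hw v) _ _).trans
      ((dd_congr_on hU (ih J hJ (fun j => κ (e (some j)))) _).trans fun x hx => ?_)
    have hd : ∀ M v, DifferentiableAt ℝ (jet M (w v)) x := fun M v =>
      ((hw v).jet hU M).differentiableAt hU hx
    rw [dd_sum _ fun S _ => differentiableAt_prod fun v _ => hd _ v]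
    simp only [dd_prod _ fun v _ => hd _ v]
    rw [Finset.sum_comm]
    have h2 : ∑ S : Q → V, ∏ v, jet (Mo S κ v) (w v) x =
        ∑ S : Option J → V, ∏ v, jet (Mo S (κ ∘ e) v) (w v) x := by
      refine sum_equiv_inst (Equiv.arrowCongr e.symm (Equiv.refl V)) _ _ fun S => ?_
      refine Finset.prod_congr rfl fun v _ => ?_
      congr 1
      exact (Mo_equiv e S κ v).symm
    rw [h2, sum_pi_option]
    refine Finset.sum_congr rfl fun u _ => Finset.sum_congr rfl fun S _ => ?_
    rw [← Finset.prod_erase_mul _ _ (Finset.mem_univ u)]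
    congr 1
    · refine Finset.prod_congr rfl fun v hv => ?_
      rw [Mo_option]
      have : optFun u S none ≠ v := (Finset.ne_of_mem_erase hv).symm
      rw [if_neg this, zero_add]
      rfl
    · rw [Mo_option, if_pos (show optFun u S none = u from rfl), Multiset.singleton_add]
      exact (jet_cons hU (hw u) _ _ hx).symm

theorem sum_subtype_eq_sum_ite {Q M : Type} [Fintype Q] [AddCommMonoid M] (p : Q → Prop)
    {i : Fintype {q // p q}} (f : Q → M) :
    ∑ q : {q // p q}, f q = ∑ q, if p q then f q else 0 := by
  rw [← Finset.sum_filter]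
  exact (Finset.sum_subtype (Finset.univ.filter p) (fun x => by simp) f).symm

/-- The Leibniz rule. -/
theorem jet_mul (hU : IsOpen U) (hf : Sm U f) (hh : Sm U h) {Q : Type} [Fintype Q]
    (κ : Q → Fin n ⊕ Fin n) {x : Fin n → ℂ} (hx : x ∈ U) :
    jet (∑ q, {κ q}) (fun y => f y * h y) x = ∑ B : Finset Q,
      jet (∑ q : {q // q ∉ B}, {κ q}) f x * jet (∑ q : {q // q ∈ B}, {κ q}) h x := by
  have h1 := jet_prod hU (V := Bool) (w := fun b => if b then h else f) (fun b => by
    cases b <;> simp [hf, hh]) _ Q rfl κ hx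
  simp only [Fintype.prod_bool, if_true, Bool.false_eq_true, if_false] at h1
  simp only [mul_comm (f _)]
  rw [h1]
  let e : (Q → Bool) ≃ Finset Q :=
    { toFun := fun S => Finset.univ.filter fun q => S q = true
      invFun := fun B q => decide (q ∈ B)
      left_inv := fun S => by ext q; simp
      right_inv := fun B => by ext q; simp }
  refine sum_equiv_inst e _ _ fun S => ?_
  rw [mul_comm]
  congr 2
  · refine Eq.trans ?_ (sum_subtype_eq_sum_ite (fun q => q ∉ e S) (fun q => {κ q})).symm
    exact Finset.sum_congr rfl fun q _ => by by_cases h : S q = true <;> simp [h, e]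
  · refine Eq.trans ?_ (sum_subtype_eq_sum_ite (fun q => q ∈ e S) (fun q => {κ q})).symm
    exact Finset.sum_congr rfl fun q _ => by by_cases h : S q = true <;> simp [h, e]

theorem dl_conj (l : List (Fin n ⊕ Fin n)) (x : Fin n → ℂ) :
    dl l (fun y => starRingEnd ℂ (f y)) x = starRingEnd ℂ (dl (l.map Sum.swap) f x) := by
  induction l generalizing x with
  | nil => rfl
  | cons s l ih =>
    change dd s (dl l fun y => starRingEnd ℂ (f y)) x = _
    rw [funext ih, dd_conj]
    rfl

theorem jet_conj (hU : IsOpen U) (hf : Sm U f) (M : Multiset (Fin n ⊕ Fin n)) :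
    Set.EqOn (jet M fun y => starRingEnd ℂ (f y))
      (fun x => starRingEnd ℂ (jet (M.map Sum.swap) f x)) U := by
  intro x hx
  unfold jet
  rw [dl_conj]
  refine congrArg _ (dl_perm hU hf ?_ hx)
  rw [← Multiset.coe_eq_coe, Multiset.coe_toList, ← Multiset.map_coe, Multiset.coe_toList]

/-- Holomorphic and antiholomorphic directions. -/
def dirs (P Q : Multiset (Fin n)) : Multiset (Fin n ⊕ Fin n) := P.map Sum.inl + Q.map Sum.inr

@[simp] theorem dirs_cons_left (k : Fin n) (P Q : Multiset (Fin n)) :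
    dirs (k ::ₘ P) Q = Sum.inl k ::ₘ dirs P Q := by simp [dirs]

@[simp] theorem dirs_cons_right (k : Fin n) (P Q : Multiset (Fin n)) :
    dirs P (k ::ₘ Q) = Sum.inr k ::ₘ dirs P Q := by simp [dirs]

@[simp] theorem dirs_zero : dirs (0 : Multiset (Fin n)) 0 = 0 := rfl

theorem dirs_swap (P Q : Multiset (Fin n)) : (dirs P Q).map Sum.swap = dirs Q P := by
  simp only [dirs, Multiset.map_add, Multiset.map_map]
  rw [add_comm]
  rfl

theorem dirs_add (P P' Q Q' : Multiset (Fin n)) : dirs (P + P') (Q + Q') = dirs P Q + dirs P' Q' := by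
  simp only [dirs, Multiset.map_add]
  abel

theorem iterWirtinger_eq (a b : List (Fin n)) :
    iterWirtinger a b f = dl (a.map Sum.inl ++ b.map Sum.inr) f := by
  simp [iterWirtinger, dl, List.foldr_map, dd]

theorem iterWirtinger_eq_jet (hU : IsOpen U) (hf : Sm U f) (a b : List (Fin n)) :
    Set.EqOn (iterWirtinger a b f) (jet (dirs a b) f) U := by
  rw [iterWirtinger_eq]
  refine (jet_coe hU hf _).symm.trans ?_
  rw [← Multiset.coe_add, ← Multiset.map_coe, ← Multiset.map_coe]
  exact fun _ _ => rfl

theorem functionJet_eq_jet (hU : IsOpen U) (hf : Sm U f) (P Q : Multiset (Fin n)) :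
    Set.EqOn (functionJet f P Q) (jet (dirs P Q) f) U := by
  have := iterWirtinger_eq_jet hU hf (P.sort (· ≤ ·)) (Q.sort (· ≤ ·))
  rwa [Multiset.sort_eq, Multiset.sort_eq] at this

end jets

/-! #### Derivatives of a Kähler metric -/

section metric
variable {n : ℕ} {U : Set (Fin n → ℂ)} {g : (Fin n → ℂ) → Matrix (Fin n) (Fin n) ℂ}

theorem IsKahlerMetricOn.sm (hg : IsKahlerMetricOn g U) (i j : Fin n) : Sm U fun x => g x i j :=
  hg.contDiffOn i j

theorem IsKahlerMetricOn.conj (hg : IsKahlerMetricOn g U) (i j : Fin n) :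
    Set.EqOn (fun x => g x i j) (fun x => starRingEnd ℂ (g x j i)) U := fun x hx =>
  ((hg.posDef x hx).isHermitian.apply i j).symm

theorem IsKahlerMetricOn.closed_left (hg : IsKahlerMetricOn g U) (i j k : Fin n) :
    Set.EqOn (dd (Sum.inl k) fun y => g y i j) (dd (Sum.inl i) fun y => g y k j) U :=
  fun x hx => hg.closed x hx i j k

theorem IsKahlerMetricOn.closed_right (hU : IsOpen U) (hg : IsKahlerMetricOn g U) (i j k : Fin n) :
    Set.EqOn (dd (Sum.inr k) fun y => g y i j) (dd (Sum.inr j) fun y => g y i k) U := by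
  refine (dd_congr_on hU (hg.conj i j) _).trans
    (Set.EqOn.trans ?_ (dd_congr_on hU (hg.conj i k) _).symm)
  intro x hx
  rw [dd_conj, dd_conj]
  exact congrArg _ (hg.closed_left j i k hx)

/-- Since derivatives commute, the Kähler condition allows any index of the multiset to serve as
index of the coefficient, not just the smallest one that `metricJet` selects. -/
theorem IsKahlerMetricOn.metricJet_cons (hU : IsOpen U) (hg : IsKahlerMetricOn g U) (k l : Fin n)
    (P Q : Multiset (Fin n)) :
    Set.EqOn (metricJet g (k ::ₘ P) (l ::ₘ Q)) (jet (dirs P Q) fun y => g y k l) U := by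
  have h1 : ∀ (i k j : Fin n) (A P Q : Multiset (Fin n)), i ::ₘ A = k ::ₘ P →
      Set.EqOn (jet (dirs A Q) fun y => g y i j) (jet (dirs P Q) fun y => g y k j) U := by
    intro i k j A P Q h
    rcases Multiset.cons_eq_cons.1 h with ⟨rfl, rfl⟩ | ⟨-, C, rfl, rfl⟩
    · exact fun _ _ => rfl
    · rw [dirs_cons_left, dirs_cons_left]
      exact (jet_cons' hU (hg.sm _ _) _ _).trans ((jet_congr_on hU (hg.closed_left _ _ _) _).trans
        (jet_cons' hU (hg.sm _ _) _ _).symm)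
  have h2 : ∀ (i j l : Fin n) (P A Q : Multiset (Fin n)), j ::ₘ A = l ::ₘ Q →
      Set.EqOn (jet (dirs P A) fun y => g y i j) (jet (dirs P Q) fun y => g y i l) U := by
    intro i j l P A Q h
    rcases Multiset.cons_eq_cons.1 h with ⟨rfl, rfl⟩ | ⟨-, C, rfl, rfl⟩
    · exact fun _ _ => rfl
    · rw [dirs_cons_right, dirs_cons_right]
      exact (jet_cons' hU (hg.sm _ _) _ _).trans
        ((jet_congr_on hU (hg.closed_right hU _ _ _) _).trans
        (jet_cons' hU (hg.sm _ _) _ _).symm)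
  obtain ⟨i, a, ha⟩ : ∃ i a, (k ::ₘ P).sort (· ≤ ·) = i :: a := by
    apply List.exists_cons_of_ne_nil
    intro h
    have := Multiset.sort_eq (k ::ₘ P) (· ≤ ·)
    rw [h] at this
    exact Multiset.cons_ne_zero this.symm
  obtain ⟨j, b, hb⟩ : ∃ j b, (l ::ₘ Q).sort (· ≤ ·) = j :: b := by
    apply List.exists_cons_of_ne_nil
    intro h
    have := Multiset.sort_eq (l ::ₘ Q) (· ≤ ·)
    rw [h] at this
    exact Multiset.cons_ne_zero this.symm
  have ha' : i ::ₘ (a : Multiset (Fin n)) = k ::ₘ P := by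
    rw [Multiset.cons_coe, ← ha, Multiset.sort_eq]
  have hb' : j ::ₘ (b : Multiset (Fin n)) = l ::ₘ Q := by
    rw [Multiset.cons_coe, ← hb, Multiset.sort_eq]
  have h3 : metricJet g (k ::ₘ P) (l ::ₘ Q) = iterWirtinger a b fun y => g y i j := by
    ext x
    simp only [metricJet, ha, hb]
  rw [h3]
  exact (iterWirtinger_eq_jet hU (hg.sm i j) a b).trans
    ((h1 _ _ _ _ _ _ ha').trans (h2 _ _ _ _ _ _ hb'))

theorem metricJet_zero_left (Q : Multiset (Fin n)) : metricJet g 0 Q = fun _ => 0 := by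
  ext x; simp [metricJet]

theorem metricJet_zero_right (P : Multiset (Fin n)) : metricJet g P 0 = fun _ => 0 := by
  ext x
  unfold metricJet
  split
  · rename_i h; simp at h
  · rfl

theorem IsKahlerMetricOn.sm_metricJet (hU : IsOpen U) (hg : IsKahlerMetricOn g U)
    (P Q : Multiset (Fin n)) : Sm U (metricJet g P Q) := by
  induction P using Multiset.induction_on with
  | empty => rw [metricJet_zero_left]; exact contDiffOn_const
  | cons k P _ =>
    induction Q using Multiset.induction_on with
    | empty => rw [metricJet_zero_right]; exact contDiffOn_const
    | cons l Q _ => exact ((hg.sm k l).jet hU _).congr_on (hg.metricJet_cons hU k l P Q).symm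

/-- `P` must be nonempty because `metricJet` has the default value zero at the empty multiset, which
has nothing to do with the coefficients of the metric. -/
theorem IsKahlerMetricOn.dd_metricJet_left (hU : IsOpen U) (hg : IsKahlerMetricOn g U)
    (k : Fin n) {P Q : Multiset (Fin n)} (hP : P ≠ 0) :
    Set.EqOn (dd (Sum.inl k) (metricJet g P Q)) (metricJet g (k ::ₘ P) Q) U := by
  obtain ⟨p, hp⟩ := Multiset.exists_mem_of_ne_zero hP
  obtain ⟨P, rfl⟩ := Multiset.exists_cons_of_mem hp
  by_cases hQ : Q = 0
  · subst hQ
    rw [metricJet_zero_right, metricJet_zero_right]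
    exact fun x _ => dd_const _ _ _
  obtain ⟨q, hq⟩ := Multiset.exists_mem_of_ne_zero hQ
  obtain ⟨Q, rfl⟩ := Multiset.exists_cons_of_mem hq
  rw [Multiset.cons_swap]
  refine (dd_congr_on hU (hg.metricJet_cons hU p q P Q) _).trans
    (Set.EqOn.trans ?_ (hg.metricJet_cons hU p q (k ::ₘ P) Q).symm)
  rw [dirs_cons_left]
  exact (jet_cons hU (hg.sm _ _) _ _).symm

theorem IsKahlerMetricOn.dd_metricJet_right (hU : IsOpen U) (hg : IsKahlerMetricOn g U)
    (k : Fin n) {P Q : Multiset (Fin n)} (hQ : Q ≠ 0) :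
    Set.EqOn (dd (Sum.inr k) (metricJet g P Q)) (metricJet g P (k ::ₘ Q)) U := by
  obtain ⟨q, hq⟩ := Multiset.exists_mem_of_ne_zero hQ
  obtain ⟨Q, rfl⟩ := Multiset.exists_cons_of_mem hq
  by_cases hP : P = 0
  · subst hP
    rw [metricJet_zero_left, metricJet_zero_left]
    exact fun x _ => dd_const _ _ _
  obtain ⟨p, hp⟩ := Multiset.exists_mem_of_ne_zero hP
  obtain ⟨P, rfl⟩ := Multiset.exists_cons_of_mem hp
  rw [Multiset.cons_swap]
  refine (dd_congr_on hU (hg.metricJet_cons hU p q P Q) _).trans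
    (Set.EqOn.trans ?_ (hg.metricJet_cons hU p q P (k ::ₘ Q)).symm)
  rw [dirs_cons_right]
  exact (jet_cons hU (hg.sm _ _) _ _).symm

theorem IsKahlerMetricOn.jet_metricJet (hU : IsOpen U) (hg : IsKahlerMetricOn g U)
    {P Q : Multiset (Fin n)} (hP : P ≠ 0) (hQ : Q ≠ 0) (A B : Multiset (Fin n)) :
    Set.EqOn (jet (dirs A B) (metricJet g P Q)) (metricJet g (A + P) (B + Q)) U := by
  induction A using Multiset.induction_on with
  | empty =>
    induction B using Multiset.induction_on with
    | empty => simp only [dirs_zero, jet_zero, zero_add]; exact fun _ _ => rfl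
    | cons k B ih =>
      rw [dirs_cons_right, Multiset.cons_add]
      refine (jet_cons hU (hg.sm_metricJet hU _ _) _ _).trans ((dd_congr_on hU ih _).trans ?_)
      exact hg.dd_metricJet_right hU k (by simp [hQ])
  | cons k A ih =>
    rw [dirs_cons_left, Multiset.cons_add]
    refine (jet_cons hU (hg.sm_metricJet hU _ _) _ _).trans ((dd_congr_on hU ih _).trans ?_)
    exact hg.dd_metricJet_left hU k (by simp [hP])

theorem IsKahlerMetricOn.metricJet_conj (hU : IsOpen U) (hg : IsKahlerMetricOn g U)
    (P Q : Multiset (Fin n)) :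
    Set.EqOn (metricJet g P Q) (fun x => starRingEnd ℂ (metricJet g Q P x)) U := by
  induction P using Multiset.induction_on with
  | empty => rw [metricJet_zero_left, metricJet_zero_right]; intro x _; simp
  | cons k P _ =>
    induction Q using Multiset.induction_on with
    | empty => rw [metricJet_zero_left, metricJet_zero_right]; intro x _; simp
    | cons l Q _ =>
      intro x hx
      rw [hg.metricJet_cons hU k l P Q hx, jet_congr_on hU (hg.conj k l) _ hx,
        jet_conj hU (hg.sm l k) _ hx]
      simp only [dirs_swap]
      rw [hg.metricJet_cons hU l k Q P hx]

end metric

/-! #### Linear changes of indices -/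

/-- A system of pairs of symmetric arrays that are related by a linear change of the indices. -/
structure LinSys {n : ℕ} {R : Type} [CommRing R] (M : Fin n → Fin n → R)
    (𝒯 : Set ((Multiset (Fin n) → R) × (Multiset (Fin n) → R))) : Prop where
  zero : ∀ Ψ ∈ 𝒯, Ψ.1 0 = Ψ.2 0
  cons : ∀ Ψ ∈ 𝒯, ∃ Φ : Fin n → Multiset (Fin n) → R,
    (∀ j, (Φ j, fun J => Ψ.2 (j ::ₘ J)) ∈ 𝒯) ∧
    ∀ (p : Fin n) (P : Multiset (Fin n)), Ψ.1 (p ::ₘ P) = ∑ j, M p j * Φ j P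

section lin
variable {n : ℕ} {R : Type} [CommRing R] {M : Fin n → Fin n → R}

/-- The indices are converted one at a time through `Φ`, and every label `p` obtains its own
summation index `κ p`. -/
theorem LinSys.prod_eq {V : Type} [Fintype V]
    {𝒯 : V → Set ((Multiset (Fin n) → R) × (Multiset (Fin n) → R))}
    (h : ∀ v, LinSys M (𝒯 v)) (N : ℕ) :
    ∀ (P : Type) [Fintype P], Fintype.card P = N → ∀ (s : P → V) (ι : P → Fin n)
      (Ψ : V → (Multiset (Fin n) → R) × (Multiset (Fin n) → R)), (∀ v, Ψ v ∈ 𝒯 v) →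
      ∏ v, (Ψ v).1 (Mo s ι v) =
        ∑ κ : P → Fin n, (∏ p, M (ι p) (κ p)) * ∏ v, (Ψ v).2 (Mo s κ v) := by
  induction N with
  | zero =>
    intro P _ hP s ι Ψ hΨ
    have : IsEmpty P := Fintype.card_eq_zero_iff.1 hP
    simp only [Mo_empty, Finset.univ_eq_empty, Finset.prod_empty, one_mul, Finset.sum_const]
    rw [Finset.card_univ, Fintype.card_unique, one_smul]
    exact Finset.prod_congr rfl fun v _ => (h v).zero _ (hΨ v)
  | succ N ih =>
    intro P _ hP s ι Ψ hΨ
    obtain ⟨J, _, hJ, ⟨e⟩⟩ : ∃ (J : Type) (_ : Fintype J),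
        Fintype.card J = N ∧ Nonempty (Option J ≃ P) :=
      ⟨Fin N, inferInstance, by simp, ⟨Fintype.equivOfCardEq (by simp [hP])⟩⟩
    let s' : Option J → V := s ∘ e
    let ι' : Option J → Fin n := ι ∘ e
    let u := s' none
    obtain ⟨Φ, h1, h2⟩ := (h u).cons _ (hΨ u)
    have key : ∀ j, Φ j (Mo (s' ∘ some) (ι' ∘ some) u) *
        ∏ v ∈ Finset.univ.erase u, (Ψ v).1 (Mo (s' ∘ some) (ι' ∘ some) v) =
        ∑ κ : J → Fin n, (∏ p, M (ι' (some p)) (κ p)) *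
          ∏ v, (Ψ v).2 (Mo s' (optFun j κ) v) := by
      intro j
      have h3 := ih J hJ (s' ∘ some) (ι' ∘ some)
        (Function.update Ψ u (Φ j, fun J => (Ψ u).2 (j ::ₘ J))) (fun v => by
          by_cases hv : v = u
          · subst hv
            rw [Function.update_self]; exact h1 j
          · rw [Function.update_of_ne hv]; exact hΨ v)
      rw [← Finset.mul_prod_erase _ _ (Finset.mem_univ u), Function.update_self] at h3
      refine (Eq.trans ?_ h3).trans ?_
      · refine congrArg _ (Finset.prod_congr rfl fun v hv => ?_)
        rw [Function.update_of_ne (Finset.ne_of_mem_erase hv)]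
      · refine Finset.sum_congr rfl fun κ _ => congrArg _ (Finset.prod_congr rfl fun v _ => ?_)
        rw [Mo_option]
        by_cases hv : v = u
        · subst hv
          rw [Function.update_self, if_pos rfl, Multiset.singleton_add]
          rfl
        · rw [Function.update_of_ne hv, if_neg (Ne.symm hv), zero_add]
          rfl
    have h4 : ∏ v, (Ψ v).1 (Mo s ι v) = ∑ j, M (ι' none) j *
        (Φ j (Mo (s' ∘ some) (ι' ∘ some) u) *
        ∏ v ∈ Finset.univ.erase u, (Ψ v).1 (Mo (s' ∘ some) (ι' ∘ some) v)) := by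
      simp only [← mul_assoc]
      rw [← Finset.sum_mul, ← h2, ← Finset.mul_prod_erase _ _ (Finset.mem_univ u)]
      congr 1
      · rw [← Mo_equiv e, Mo_option, if_pos rfl, Multiset.singleton_add]
      · refine Finset.prod_congr rfl fun v hv => ?_
        rw [← Mo_equiv e, Mo_option, if_neg (Ne.symm (Finset.ne_of_mem_erase hv)), zero_add]
    rw [h4]
    simp only [key]
    have h9 : ∑ κ : P → Fin n, (∏ p, M (ι p) (κ p)) * ∏ v, (Ψ v).2 (Mo s κ v) =
        ∑ κ : Option J → Fin n, (∏ p, M (ι' p) (κ p)) * ∏ v, (Ψ v).2 (Mo s' κ v) := by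
      refine sum_equiv_inst (Equiv.arrowCongr e.symm (Equiv.refl (Fin n))) _ _ fun κ => ?_
      congr 1
      · exact prod_equiv_inst e.symm _ _ fun p => by simp [ι']
      · refine Finset.prod_congr rfl fun v _ => congrArg _ ?_
        rw [← Mo_equiv e]
        rfl
    rw [h9, sum_pi_option]
    refine Finset.sum_congr rfl fun j _ => ?_
    rw [Finset.mul_sum]
    refine Finset.sum_congr rfl fun κ _ => ?_
    rw [← mul_assoc]
    congr 1
    rw [Fintype.prod_option]
    rfl

/-- A linear change of indices is a special case of the chain rule. -/
theorem LinSys.chainSys {𝒯 : Set ((Multiset (Fin n) → R) × (Multiset (Fin n) → R))}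
    (h : LinSys M 𝒯) {θ : Multiset (Fin n) → Fin n → R}
    (h1 : ∀ p j, θ {p} j = M p j - if p = j then 1 else 0)
    (h2 : ∀ B j, Multiset.card B ≠ 1 → θ B j = 0) : ChainSys θ 𝒯 where
  zero := h.zero
  cons Ψ hΨ := by
    obtain ⟨Φ, h3, h4⟩ := h.cons Ψ hΨ
    refine ⟨Φ, h3, fun p Q _ κ => ?_⟩
    have h5 : ∀ j, ∑ B : Finset Q, Φ j (∑ q : {q // q ∉ B}, {κ q}) *
        θ (p ::ₘ ∑ q : {q // q ∈ B}, {κ q}) j = Φ j (∑ q, {κ q}) * (M p j - if p = j then 1 else 0) := by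
      intro j
      rw [Finset.sum_eq_single ∅]
      · rw [← h1]
        congr 2
        · exact sum_equiv_inst (Equiv.subtypeUnivEquiv (by simp)) _ _ fun _ => rfl
      · intro B _ hB
        rw [h2, mul_zero]
        rw [Multiset.card_cons, Multiset.card_sum]
        simpa using hB
      · simp
    simp only [h5]
    rw [h4]
    simp only [mul_sub, Finset.sum_sub_distrib, mul_ite, mul_one, mul_zero, Finset.sum_ite_eq,
      Finset.mem_univ, if_true]
    simp only [mul_comm]
    ring

end lin

/-! #### The chain rule for holomorphic maps -/

section hol
variable {n : ℕ} {U : Set (Fin n → ℂ)} {θ : (Fin n → ℂ) → (Fin n → ℂ)}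

/-- Holomorphic and smooth maps. -/
structure HolOn (θ : (Fin n → ℂ) → (Fin n → ℂ)) (U : Set (Fin n → ℂ)) : Prop where
  diff : ∀ x ∈ U, DifferentiableAt ℂ θ x
  sm : ∀ i, Sm U fun x => θ x i

theorem AnalyticOnNhd.holOn (hU : IsOpen U) (h : AnalyticOnNhd ℂ θ U) : HolOn θ U where
  diff x hx := (h x hx).differentiableAt
  sm i := by
    have h1 : ContDiffOn ℂ ∞ θ U := h.contDiffOn hU.uniqueDiffOn
    have h2 : ContDiffOn ℝ ∞ θ U := h1.restrict_scalars ℝ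
    exact contDiffOn_pi.1 h2 i

theorem HolOn.dd_right (h : HolOn θ U) (i l : Fin n) :
    Set.EqOn (dd (Sum.inr l) fun x => θ x i) (fun _ => 0) U := fun _ hx =>
  (dd_coord (h.diff _ hx) i l).2

theorem HolOn.dd_dd (hU : IsOpen U) (h : HolOn θ U) (i k l : Fin n) :
    Set.EqOn (dd (Sum.inr l) (dd (Sum.inl k) fun x => θ x i)) (fun _ => 0) U :=
  (dd_comm hU (h.sm i) _ _).trans ((dd_congr_on hU (h.dd_right i l) _).trans
    fun _ _ => dd_const _ _ _)

theorem HolOn.dd_comp_left (h : HolOn θ U) {f : (Fin n → ℂ) → ℂ} {x : Fin n → ℂ} (hx : x ∈ U)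
    (hf : DifferentiableAt ℝ f (θ x)) (k : Fin n) : dd (Sum.inl k) (fun y => f (θ y)) x =
      ∑ i, dd (Sum.inl i) f (θ x) * dd (Sum.inl k) (fun y => θ y i) x := by
  rw [(dd_comp hf (h.diff x hx) k).1]
  exact Finset.sum_congr rfl fun i _ => by rw [(dd_coord (h.diff x hx) i k).1]

theorem HolOn.sm_comp (h : HolOn θ U) {W : Set (Fin n → ℂ)} (hW : Set.MapsTo θ U W)
    {f : (Fin n → ℂ) → ℂ} (hf : Sm W f) : Sm U fun x => f (θ x) :=
  ContDiffOn.comp hf (contDiffOn_pi.2 h.sm) hW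

/-- The higher derivatives of `θ` at the origin. -/
def holArr (θ : (Fin n → ℂ) → (Fin n → ℂ)) (B : Multiset (Fin n)) (j : Fin n) : ℂ :=
  jet (dirs B 0) (fun x => θ x j) 0 - if B = {j} then 1 else 0

/-- The arrays of the holomorphic derivatives of a function, or of a closed form, before and after
the change of coordinates `θ`. -/
def holSys (θ : (Fin n → ℂ) → (Fin n → ℂ)) (U : Set (Fin n → ℂ)) :
    Set ((Multiset (Fin n) → ℂ) × (Multiset (Fin n) → ℂ)) :=
  {Ψ | Ψ.1 0 = Ψ.2 0 ∧ ∃ W : Multiset (Fin n) → (Fin n → ℂ) → ℂ, (∀ J, J ≠ 0 → Sm U (W J)) ∧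
    (∀ J, J ≠ 0 → ∀ k, Set.EqOn (dd (Sum.inl k) (W J))
      (fun x => ∑ i, W (i ::ₘ J) x * dd (Sum.inl k) (fun y => θ y i) x) U) ∧
    (∀ k P, Ψ.1 (k ::ₘ P) =
      jet (dirs P 0) (fun x => ∑ i, W {i} x * dd (Sum.inl k) (fun y => θ y i) x) 0) ∧
    ∀ J, J ≠ 0 → Ψ.2 J = W J 0}

theorem dirs_sum_left {Q : Type} [Fintype Q] (κ : Q → Fin n) :
    dirs (∑ q, {κ q}) 0 = ∑ q, ({Sum.inl (κ q)} : Multiset (Fin n ⊕ Fin n)) := by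
  have : dirs (∑ q, {κ q}) 0 = Multiset.mapAddMonoidHom (Sum.inl : Fin n → Fin n ⊕ Fin n) (∑ q, {κ q}) := by
    rw [Multiset.coe_mapAddMonoidHom]
    simp [dirs]
  rw [this, map_sum]
  simp

/-- A step differentiates the form with coefficients `W {i}` by the product rule, and the functions
`W (j ::ₘ J)` are again a family of this kind. Functions are attached to nonempty index sets only,
since a metric gives closed forms without a chosen potential; the empty index set is prescribed
separately. -/
theorem chainSys_holSys (hU : IsOpen U) (h0 : (0 : Fin n → ℂ) ∈ U) (hθ : HolOn θ U) :
    ChainSys (holArr θ) (holSys θ U) where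
  zero Ψ hΨ := hΨ.1
  cons := by
    rintro Ψ ⟨-, W, h1, h2, h3, h4⟩
    have hsm : ∀ k i, Sm U (dd (Sum.inl k) fun y => θ y i) := fun k i => (hθ.sm i).dd hU _
    refine ⟨fun j P => jet (dirs P 0) (W {j}) 0, fun j => ⟨?_, fun J => W (j ::ₘ J), ?_, ?_, ?_, ?_⟩, ?_⟩
    · simp only [dirs_zero, jet_zero]
      rw [Multiset.cons_zero]
      exact (h4 {j} (by simp)).symm
    · exact fun J _ => h1 _ (by simp)
    · intro J hJ k
      refine (h2 (j ::ₘ J) (by simp) k).trans fun x _ => ?_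
      simp only [Multiset.cons_swap j]
    · intro k P
      simp only
      rw [dirs_cons_left, jet_cons' hU (h1 _ (by simp)) _ _ h0, jet_congr_on hU (h2 _ (by simp) k) _ h0]
      congr 1
      ext x
      refine Finset.sum_congr rfl fun i _ => ?_
      rw [show (i ::ₘ {j} : Multiset (Fin n)) = j ::ₘ {i} from Multiset.pair_comm i j]
    · exact fun J _ => h4 _ (by simp)
    · intro p Q _ κ
      rw [h3, dirs_sum_left, jet_sum hU _ (fun i _ => (h1 _ (by simp)).mul (hsm p i)) _ h0]
      have h5 : ∀ j, jet (∑ q, {Sum.inl (κ q)}) (fun x => W {j} x * dd (Sum.inl p) (fun y => θ y j) x) 0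
          = (if p = j then jet (∑ q, {Sum.inl (κ q)}) (W {j}) 0 else 0) +
            ∑ B : Finset Q, jet (dirs (∑ q : {q // q ∉ B}, {κ q}) 0) (W {j}) 0 *
              holArr θ (p ::ₘ ∑ q : {q // q ∈ B}, {κ q}) j := by
        intro j
        rw [jet_mul hU (h1 _ (by simp)) (hsm p j) (fun q => (Sum.inl (κ q) : Fin n ⊕ Fin n)) h0]
        simp only [← dirs_sum_left]
        -- The identity was subtracted from the linear part in `holArr`. Restoring it gives the
        -- Kronecker delta, which accounts for the term `Φ p` of the chain rule.
        have h6 : ∀ B : Finset Q, jet (dirs (∑ q : {q // q ∈ B}, {κ q}) 0)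
            (dd (Sum.inl p) fun y => θ y j) 0 = holArr θ (p ::ₘ ∑ q : {q // q ∈ B}, {κ q}) j +
              if B = ∅ ∧ p = j then 1 else 0 := by
          intro B
          rw [← jet_cons' hU (hθ.sm j) _ _ h0, ← dirs_cons_left, holArr]
          have : (p ::ₘ ∑ q : {q // q ∈ B}, ({κ q} : Multiset (Fin n)) = {j}) ↔ (B = ∅ ∧ p = j) := by
            constructor
            · intro h
              have hB : B = ∅ := by
                have := congrArg Multiset.card h
                rw [Multiset.card_cons, Multiset.card_sum] at this
                simpa using this
              subst hB
              simpa using h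
            · rintro ⟨rfl, rfl⟩
              simp
          simp only [this]
          ring
        simp only [h6, mul_add, Finset.sum_add_distrib]
        rw [add_comm]
        congr 1
        rw [Finset.sum_eq_single ∅]
        · by_cases hp : p = j
          · rw [if_pos ⟨rfl, hp⟩, if_pos hp, mul_one]
            refine congrArg (fun M => jet (dirs M 0) (W {j}) 0) ?_
            exact sum_equiv_inst (Equiv.subtypeUnivEquiv (by simp)) _ _ fun _ => rfl
          · rw [if_neg fun h => hp h.2, if_neg hp, mul_zero]
        · intro B _ hB
          rw [if_neg fun h => hB h.1, mul_zero]
        · simp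
      simp only [h5, Finset.sum_add_distrib, Finset.sum_ite_eq, Finset.mem_univ, if_true]
      rw [dirs_sum_left]

/-- The complex conjugates of the arrays of a system. -/
theorem ChainSys.conj {θ' : Multiset (Fin n) → Fin n → ℂ}
    {𝒞 : Set ((Multiset (Fin n) → ℂ) × (Multiset (Fin n) → ℂ))} (h : ChainSys θ' 𝒞) :
    ChainSys (fun B j => starRingEnd ℂ (θ' B j))
      {Ψ | (fun P => starRingEnd ℂ (Ψ.1 P), fun P => starRingEnd ℂ (Ψ.2 P)) ∈ 𝒞} where
  zero Ψ hΨ := by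
    exact (starRingEnd ℂ).injective (h.zero _ hΨ)
  cons Ψ hΨ := by
    obtain ⟨Φ, h1, h2⟩ := h.cons _ hΨ
    refine ⟨fun j P => starRingEnd ℂ (Φ j P), fun j => ?_, fun p Q _ κ => ?_⟩
    · simpa using h1 j
    · have := congrArg (starRingEnd ℂ) (h2 p Q κ)
      simpa only [Complex.conj_conj, map_add, map_sum, map_mul] using this

end hol

section hol
variable {n : ℕ} {U W : Set (Fin n → ℂ)} {θ : (Fin n → ℂ) → (Fin n → ℂ)}

theorem Multiset.exists_eq_sum_singleton {α : Type} (P : Multiset α) :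
    ∃ (Q : Type) (_ : Fintype Q) (κ : Q → α), P = ∑ q, {κ q} := by
  obtain ⟨l, rfl⟩ : ∃ l : List α, (l : Multiset α) = P := ⟨P.toList, Multiset.coe_toList P⟩
  refine ⟨Fin l.length, inferInstance, l.get, ?_⟩
  rw [sum_singleton_eq_map, Fin.univ_val_map, List.ofFn_get]

/-- The first components of the pairs of a chain system are determined by the second ones. -/
theorem ChainSys.eq_of_le {R : Type} [CommRing R] {θ : Multiset (Fin n) → Fin n → R}
    {𝒞 : Set ((Multiset (Fin n) → R) × (Multiset (Fin n) → R))} (h : ChainSys θ 𝒞) (m : ℕ) :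
    ∀ Ψ ∈ 𝒞, ∀ Ψ' ∈ 𝒞, (∀ J, Multiset.card J ≤ m → Ψ.2 J = Ψ'.2 J) →
      ∀ P, Multiset.card P ≤ m → Ψ.1 P = Ψ'.1 P := by
  induction m with
  | zero =>
    intro Ψ hΨ Ψ' hΨ' h2 P hP
    rw [Multiset.card_eq_zero.1 (Nat.le_zero.1 hP), h.zero _ hΨ, h.zero _ hΨ', h2 0 (by simp)]
  | succ m ih =>
    intro Ψ hΨ Ψ' hΨ' h2 P hP
    induction P using Multiset.induction_on with
    | empty => rw [h.zero _ hΨ, h.zero _ hΨ', h2 0 (by simp)]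
    | cons p P _ =>
      obtain ⟨Φ, h3, h4⟩ := h.cons _ hΨ
      obtain ⟨Φ', h3', h4'⟩ := h.cons _ hΨ'
      rw [Multiset.card_cons] at hP
      have h5 : ∀ j Q, Multiset.card Q ≤ m → Φ j Q = Φ' j Q := fun j Q hQ =>
        ih _ (h3 j) _ (h3' j) (fun J hJ => h2 _ (by rw [Multiset.card_cons]; omega)) Q hQ
      obtain ⟨Q, _, κ, rfl⟩ := P.exists_eq_sum_singleton
      rw [h4, h4', h5 _ _ (by omega)]
      congr 1
      refine Finset.sum_congr rfl fun j _ => Finset.sum_congr rfl fun B _ => ?_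
      rw [h5]
      rw [Multiset.card_sum] at hP ⊢
      simp only [Multiset.card_singleton, Finset.sum_const, smul_eq_mul, mul_one, Finset.card_univ] at hP ⊢
      exact (Fintype.card_subtype_le _).trans (by omega)

/-- If all the higher derivatives vanish, the chain rule is a linear change of indices. -/
theorem ChainSys.linSys {R : Type} [CommRing R] {θ : Multiset (Fin n) → Fin n → R}
    {𝒞 : Set ((Multiset (Fin n) → R) × (Multiset (Fin n) → R))} (h : ChainSys θ 𝒞)
    {M : Fin n → Fin n → R} (h1 : ∀ p j, θ {p} j = M p j - if p = j then 1 else 0)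
    (h2 : ∀ p B j, B ≠ 0 → θ (p ::ₘ B) j = 0) : LinSys M 𝒞 where
  zero := h.zero
  cons Ψ hΨ := by
    obtain ⟨Φ, h3, h4⟩ := h.cons _ hΨ
    refine ⟨Φ, h3, fun p P => ?_⟩
    obtain ⟨Q, _, κ, rfl⟩ := P.exists_eq_sum_singleton
    rw [h4]
    have h5 : ∀ j, ∑ B : Finset (Q), Φ j (∑ q : {q // q ∉ B}, {κ q}) *
        θ (p ::ₘ ∑ q : {q // q ∈ B}, {κ q}) j =
        Φ j (∑ q, {κ q}) * (M p j - if p = j then 1 else 0) := by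
      intro j
      rw [Finset.sum_eq_single ∅]
      · rw [← h1]
        congr 2
        exact sum_equiv_inst (Equiv.subtypeUnivEquiv (by simp)) _ _ fun _ => rfl
      · intro B _ hB
        rw [h2, mul_zero]
        intro h6
        have := congrArg Multiset.card h6
        rw [Multiset.card_sum] at this
        simp at this
        exact hB this
      · simp
    simp only [h5]
    simp only [mul_sub, Finset.sum_sub_distrib, mul_ite, mul_one, mul_zero, Finset.sum_ite_eq,
      Finset.mem_univ, if_true]
    simp only [mul_comm]
    ring

/-- Families of functions with the derivatives of a function of `θ x`. -/
structure HolFam (θ : (Fin n → ℂ) → (Fin n → ℂ)) (U : Set (Fin n → ℂ))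
    (w : Multiset (Fin n) → (Fin n → ℂ) → ℂ) : Prop where
  sm : ∀ J, J ≠ 0 → Sm U (w J)
  deriv : ∀ J, J ≠ 0 → ∀ k, Set.EqOn (dd (Sum.inl k) (w J))
      (fun x => ∑ i, w (i ::ₘ J) x * dd (Sum.inl k) (fun y => θ y i) x) U

/-- The pullback along `θ` of the form with coefficients `w {i}`. -/
def formPull (θ : (Fin n → ℂ) → (Fin n → ℂ)) (w : Multiset (Fin n) → (Fin n → ℂ) → ℂ) (k : Fin n)
    (x : Fin n → ℂ) : ℂ := ∑ i, w {i} x * dd (Sum.inl k) (fun y => θ y i) x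

theorem HolFam.mem_holSys {w : Multiset (Fin n) → (Fin n → ℂ) → ℂ} (hw : HolFam θ U w)
    {Ψ₁ Ψ₂ : Multiset (Fin n) → ℂ} (h0 : Ψ₁ 0 = Ψ₂ 0)
    (h1 : ∀ k P, Ψ₁ (k ::ₘ P) = jet (dirs P 0) (formPull θ w k) 0)
    (h2 : ∀ J, J ≠ 0 → Ψ₂ J = w J 0) : (Ψ₁, Ψ₂) ∈ holSys θ U :=
  ⟨h0, w, hw.sm, hw.deriv, h1, h2⟩

theorem HolFam.sm_formPull (hU : IsOpen U) (hθ : HolOn θ U)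
    {w : Multiset (Fin n) → (Fin n → ℂ) → ℂ} (hw : HolFam θ U w) (k : Fin n) :
    Sm U (formPull θ w k) :=
  Sm.sum fun i _ => (hw.sm _ (by simp)).mul ((hθ.sm i).dd hU _)

/-- The derivative consists of a part with `w {i, j}`, symmetric because the indices form a
multiset, and a part with second derivatives of `θ`, symmetric because derivatives commute. -/
theorem HolFam.closed (hU : IsOpen U) (hθ : HolOn θ U)
    {w : Multiset (Fin n) → (Fin n → ℂ) → ℂ} (hw : HolFam θ U w) (k l : Fin n) :
    Set.EqOn (dd (Sum.inl k) (formPull θ w l)) (dd (Sum.inl l) (formPull θ w k)) U := by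
  intro x hx
  have h1 : ∀ k l, dd (Sum.inl k) (formPull θ w l) x =
      ∑ i, (∑ j, w {i, j} x * dd (Sum.inl k) (fun y => θ y j) x *
        dd (Sum.inl l) (fun y => θ y i) x) +
      ∑ i, w {i} x * dd (Sum.inl k) (dd (Sum.inl l) fun y => θ y i) x := by
    intro k l
    have h2 : ∀ i, DifferentiableAt ℝ (w {i}) x := fun i =>
      (hw.sm _ (by simp)).differentiableAt hU hx
    have h3 : ∀ i, DifferentiableAt ℝ (dd (Sum.inl l) fun y => θ y i) x := fun i =>
      ((hθ.sm i).dd hU _).differentiableAt hU hx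
    unfold formPull
    rw [dd_sum (f := fun i x => w {i} x * dd (Sum.inl l) (fun y => θ y i) x) _
      fun i _ => (h2 i).mul (h3 i), ← Finset.sum_add_distrib]
    refine Finset.sum_congr rfl fun i _ => ?_
    rw [dd_mul (h2 i) (h3 i), hw.deriv _ (by simp) k hx, Finset.sum_mul]
    congr 1
    refine Finset.sum_congr rfl fun j _ => ?_
    rw [show (j ::ₘ {i} : Multiset (Fin n)) = {i, j} from Multiset.pair_comm j i]
  rw [h1, h1, Finset.sum_comm]
  congr 1
  · refine Finset.sum_congr rfl fun i _ => Finset.sum_congr rfl fun j _ => ?_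
    rw [Multiset.pair_comm i j]
    ring
  · exact Finset.sum_congr rfl fun i _ => congrArg _ (dd_comm hU (hθ.sm i) _ _ hx)

theorem jet_mul_of_dd_eq_zero (hU : IsOpen U) {f u : (Fin n → ℂ) → ℂ} (hf : Sm U f) (hu : Sm U u)
    (M : Multiset (Fin n ⊕ Fin n)) (h : ∀ s ∈ M, Set.EqOn (dd s u) (fun _ => 0) U) :
    Set.EqOn (jet M fun x => f x * u x) (fun x => jet M f x * u x) U := by
  induction M using Multiset.induction_on with
  | empty => simp only [jet_zero]; exact fun _ _ => rfl
  | cons s M ih =>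
    refine (jet_cons hU (hf.mul hu) s M).trans ((dd_congr_on hU
      (ih fun t ht => h t (Multiset.mem_cons_of_mem ht)) s).trans fun x hx => ?_)
    rw [dd_mul ((hf.jet hU M).differentiableAt hU hx) (hu.differentiableAt hU hx),
      h s (Multiset.mem_cons_self _ _) hx, jet_cons hU hf s M hx, mul_zero, add_zero]

/-- The derivatives of `θ` are holomorphic, so antiholomorphic derivatives pass through them. -/
theorem HolFam.bar (hU : IsOpen U) (hθ : HolOn θ U)
    {w : Multiset (Fin n) → (Fin n → ℂ) → ℂ} (hw : HolFam θ U w) (Q : Multiset (Fin n)) :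
    HolFam θ U fun J => jet (dirs 0 Q) (w J) where
  sm J hJ := (hw.sm J hJ).jet hU _
  deriv J hJ k := by
    refine (jet_cons hU (hw.sm J hJ) _ _).symm.trans ((jet_cons' hU (hw.sm J hJ) _ _).trans
      ((jet_congr_on hU (hw.deriv J hJ k) _).trans ?_))
    refine (jet_sum hU _ (fun i _ => (hw.sm _ (by simp)).mul ((hθ.sm i).dd hU _)) _).trans ?_
    intro x hx
    refine Finset.sum_congr rfl fun i _ => jet_mul_of_dd_eq_zero hU (hw.sm _ (by simp))
      ((hθ.sm i).dd hU _) _ (fun s hs => ?_) hx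
    simp only [dirs, Multiset.map_zero, zero_add, Multiset.mem_map] at hs
    obtain ⟨l, -, rfl⟩ := hs
    exact hθ.dd_dd hU i k l

theorem HolFam.sum_mul (hU : IsOpen U) {w : Fin n → Multiset (Fin n) → (Fin n → ℂ) → ℂ}
    (hw : ∀ j, HolFam θ U (w j)) {u : Fin n → (Fin n → ℂ) → ℂ} (hu : ∀ j, Sm U (u j))
    (h : ∀ j k, Set.EqOn (dd (Sum.inl k) (u j)) (fun _ => 0) U) :
    HolFam θ U fun J x => ∑ j, w j J x * u j x where
  sm J hJ := Sm.sum fun j _ => ((hw j).sm J hJ).mul (hu j)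
  deriv J hJ k x hx := by
    have h2 : ∀ j, DifferentiableAt ℝ (w j J) x := fun j =>
      ((hw j).sm J hJ).differentiableAt hU hx
    have h3 : ∀ j, DifferentiableAt ℝ (u j) x := fun j => (hu j).differentiableAt hU hx
    rw [dd_sum (f := fun j x => w j J x * u j x) _ fun j _ => (h2 j).mul (h3 j)]
    simp only [Finset.sum_mul]
    rw [Finset.sum_comm]
    refine Finset.sum_congr rfl fun j _ => ?_
    rw [dd_mul (h2 j) (h3 j), h j k hx, mul_zero, add_zero, (hw j).deriv J hJ k hx, Finset.sum_mul]
    exact Finset.sum_congr rfl fun i _ => by ring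

theorem HolOn.holFam_comp (hθ : HolOn θ U) (hW : IsOpen W) (hm : Set.MapsTo θ U W)
    {w : Multiset (Fin n) → (Fin n → ℂ) → ℂ} (h1 : ∀ J, J ≠ 0 → Sm W (w J))
    (h2 : ∀ J, J ≠ 0 → ∀ k, Set.EqOn (dd (Sum.inl k) (w J)) (w (k ::ₘ J)) W) :
    HolFam θ U fun J x => w J (θ x) where
  sm J hJ := hθ.sm_comp hm (h1 J hJ)
  deriv J hJ k x hx := by
    rw [hθ.dd_comp_left hx ((h1 J hJ).differentiableAt hW (hm hx))]
    exact Finset.sum_congr rfl fun i _ => by rw [h2 J hJ i (hm hx)]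

/-- The derivatives of a closed form. -/
def formJet (η : Fin n → (Fin n → ℂ) → ℂ) (P : Multiset (Fin n)) (x : Fin n → ℂ) : ℂ :=
  match P.sort (· ≤ ·) with
  | i :: P' => jet (dirs (P' : Multiset (Fin n)) 0) (η i) x
  | _ => 0

theorem formJet_zero (η : Fin n → (Fin n → ℂ) → ℂ) (x : Fin n → ℂ) : formJet η 0 x = 0 := by
  simp [formJet]

theorem formJet_cons (hU : IsOpen U) {η : Fin n → (Fin n → ℂ) → ℂ} (hη : ∀ i, Sm U (η i))
    (h : ∀ k l, Set.EqOn (dd (Sum.inl k) (η l)) (dd (Sum.inl l) (η k)) U) (k : Fin n)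
    (P : Multiset (Fin n)) : Set.EqOn (formJet η (k ::ₘ P)) (jet (dirs P 0) (η k)) U := by
  intro x hx
  have hs : (((k ::ₘ P).sort (· ≤ ·) : List (Fin n)) : Multiset (Fin n)) = k ::ₘ P :=
    Multiset.sort_eq _ _
  unfold formJet
  split
  · rename_i i P' hi
    rw [hi, ← Multiset.cons_coe] at hs
    rcases Multiset.cons_eq_cons.1 hs with ⟨rfl, h'⟩ | ⟨-, C, h', rfl⟩
    · rw [h']
    · rw [h', dirs_cons_left, dirs_cons_left, jet_cons' hU (hη i) _ _ hx,
        jet_cons' hU (hη k) _ _ hx]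
      exact jet_congr_on hU (h k i) _ hx
  · rename_i hi
    cases hl : (k ::ₘ P).sort (· ≤ ·) with
    | nil => rw [hl] at hs; simp at hs
    | cons i P' => exact absurd hl (hi i P')

end hol

theorem dirs_eq_add {n : ℕ} (P Q : Multiset (Fin n)) : dirs P Q = dirs P 0 + dirs 0 Q := by
  simp [dirs]

theorem jet_const_zero {n : ℕ} (M : Multiset (Fin n ⊕ Fin n)) (x : Fin n → ℂ) :
    jet M (fun _ => (0 : ℂ)) x = 0 := by
  by_cases hM : M = 0
  · simp [hM]
  · exact jet_const _ hM x

theorem HolFam.jet_formPull {n : ℕ} {U : Set (Fin n → ℂ)} {θ : (Fin n → ℂ) → (Fin n → ℂ)}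
    (hU : IsOpen U) (hθ : HolOn θ U) {w : Multiset (Fin n) → (Fin n → ℂ) → ℂ}
    (hw : HolFam θ U w) (Q : Multiset (Fin n)) (k : Fin n) :
    Set.EqOn (jet (dirs 0 Q) (formPull θ w k)) (formPull θ (fun J => jet (dirs 0 Q) (w J)) k) U := by
  refine (jet_sum hU _ (fun i _ => (hw.sm _ (by simp)).mul ((hθ.sm i).dd hU _)) _).trans ?_
  intro x hx
  refine Finset.sum_congr rfl fun i _ => jet_mul_of_dd_eq_zero hU (hw.sm _ (by simp))
    ((hθ.sm i).dd hU _) _ (fun s hs => ?_) hx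
  simp only [dirs, Multiset.map_zero, zero_add, Multiset.mem_map] at hs
  obtain ⟨l, -, rfl⟩ := hs
  exact hθ.dd_dd hU i k l

/-- A holomorphic change of coordinates `θ` that relates a Kähler metric `g` and a function `f` to
their pullbacks `g'` and `f'`. -/
structure HolChange {n : ℕ} (θ : (Fin n → ℂ) → (Fin n → ℂ)) (U W : Set (Fin n → ℂ))
    (g g' : (Fin n → ℂ) → Matrix (Fin n) (Fin n) ℂ) (f f' : (Fin n → ℂ) → ℂ) : Prop where
  openU : IsOpen U
  openW : IsOpen W
  zero_mem : (0 : Fin n → ℂ) ∈ U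
  hol : HolOn θ U
  maps : Set.MapsTo θ U W
  kahlerW : IsKahlerMetricOn g W
  kahlerU : IsKahlerMetricOn g' U
  smW : Sm W f
  metric : ∀ x ∈ U, ∀ k l, g' x k l = ∑ i, ∑ j, dd (Sum.inl k) (fun y => θ y i) x *
    starRingEnd ℂ (dd (Sum.inl l) (fun y => θ y j) x) * g (θ x) i j
  fn : ∀ x ∈ U, f' x = f (θ x)

/-- The holomorphic derivatives `J` in the new coordinates of the antiholomorphic derivatives `Q`
in the old coordinates of a function. -/
def functionHalf {n : ℕ} (θ : (Fin n → ℂ) → (Fin n → ℂ)) (f : (Fin n → ℂ) → ℂ)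
    (J Q : Multiset (Fin n)) : ℂ :=
  jet (dirs 0 Q) (fun y => jet (dirs J 0) f (θ y)) 0

/-- The holomorphic derivatives `J` in the new coordinates of the antiholomorphic derivatives `Q`
in the old coordinates of a metric. -/
def metricHalf {n : ℕ} (θ : (Fin n → ℂ) → (Fin n → ℂ))
    (g : (Fin n → ℂ) → Matrix (Fin n) (Fin n) ℂ) (J Q : Multiset (Fin n)) : ℂ :=
  starRingEnd ℂ (formJet (formPull θ fun K y => metricJet g K J (θ y)) Q 0)

namespace HolChange
variable {n : ℕ} {θ : (Fin n → ℂ) → (Fin n → ℂ)} {U W : Set (Fin n → ℂ)}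
  {g g' : (Fin n → ℂ) → Matrix (Fin n) (Fin n) ℂ} {f f' : (Fin n → ℂ) → ℂ}

theorem smU (h : HolChange θ U W g g' f f') : Sm U f' :=
  (h.hol.sm_comp h.maps h.smW).congr_on fun _ hx => (h.fn _ hx).symm

theorem holFam_metric (h : HolChange θ U W g g' f f') (J : Multiset (Fin n)) :
    HolFam θ U fun K y => metricJet g K J (θ y) :=
  h.hol.holFam_comp h.openW h.maps (fun K _ => h.kahlerW.sm_metricJet h.openW K J)
    fun _ hK k => h.kahlerW.dd_metricJet_left h.openW k hK

theorem holFam_function (h : HolChange θ U W g g' f f') :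
    HolFam θ U fun K y => jet (dirs K 0) f (θ y) :=
  h.hol.holFam_comp h.openW h.maps (fun K _ => h.smW.jet h.openW _) fun K _ k => by
    rw [dirs_cons_left]
    exact (jet_cons h.openW h.smW _ _).symm

theorem dd_fn (h : HolChange θ U W g g' f f') (k : Fin n) :
    Set.EqOn (dd (Sum.inl k) f') (formPull θ (fun K y => jet (dirs K 0) f (θ y)) k) U := by
  refine (dd_congr_on h.openU h.fn _).trans fun x hx => ?_
  rw [h.hol.dd_comp_left hx (h.smW.differentiableAt h.openW (h.maps hx))]
  simp only [formPull]
  refine Finset.sum_congr rfl fun i _ => ?_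
  rw [← Multiset.cons_zero i, dirs_cons_left, dirs_zero, Multiset.cons_zero, jet_singleton]

/-- Only the holomorphic indices are converted here; the antiholomorphic derivatives `Q` are still
taken on the source of `θ`. The other half of the conversion is `functionHalf_mem_conj`. -/
theorem functionJet_mem (h : HolChange θ U W g g' f f') (Q : Multiset (Fin n)) :
    (fun P => functionJet f' P Q 0, fun J => functionHalf θ f J Q) ∈ holSys θ U := by
  refine (h.holFam_function.bar h.openU h.hol Q).mem_holSys ?_ (fun k P => ?_) fun J _ => rfl
  · rw [functionJet_eq_jet h.openU h.smU _ _ h.zero_mem, jet_congr_on h.openU h.fn _ h.zero_mem,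
      functionHalf]
    simp
  · rw [functionJet_eq_jet h.openU h.smU _ _ h.zero_mem, dirs_cons_left,
      jet_cons' h.openU h.smU _ _ h.zero_mem, dirs_eq_add,
      jet_add h.openU (h.smU.dd h.openU _) _ _ h.zero_mem]
    exact jet_congr_on h.openU ((jet_congr_on h.openU (h.dd_fn k) _).trans
      (h.holFam_function.jet_formPull h.openU h.hol Q k)) _ h.zero_mem

theorem metricHalf_cons (h : HolChange θ U W g g' f f') (J : Multiset (Fin n)) (l : Fin n)
    (Q : Multiset (Fin n)) : metricHalf θ g J (l ::ₘ Q) =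
      starRingEnd ℂ (jet (dirs Q 0) (formPull θ (fun K y => metricJet g K J (θ y)) l) 0) := by
  rw [metricHalf, formJet_cons h.openU ((h.holFam_metric J).sm_formPull h.openU h.hol)
    ((h.holFam_metric J).closed h.openU h.hol) l Q h.zero_mem]

/-- Conjugation exchanges the two kinds of indices of a Hermitian metric, so the antiholomorphic
indices are converted by the conjugate of the same system. -/
theorem metricHalf_mem_conj (h : HolChange θ U W g g' f f') (J : Multiset (Fin n)) :
    (fun Q => starRingEnd ℂ (metricHalf θ g J Q), fun K => starRingEnd ℂ (metricJet g J K (θ 0))) ∈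
      holSys θ U := by
  refine (h.holFam_metric J).mem_holSys ?_ (fun k P => ?_) fun K _ => ?_
  · simp [metricHalf, formJet_zero, metricJet_zero_right]
  · rw [h.metricHalf_cons, Complex.conj_conj]
  · exact (h.kahlerW.metricJet_conj h.openW _ _ (h.maps h.zero_mem)).symm

theorem functionHalf_mem_conj (h : HolChange θ U W g g' f f') (J : Multiset (Fin n)) :
    (fun Q => starRingEnd ℂ (functionHalf θ f J Q),
      fun K => starRingEnd ℂ (functionJet f J K (θ 0))) ∈ holSys θ U := by
  have hsm : Sm W fun y => starRingEnd ℂ (jet (dirs J 0) f y) := (h.smW.jet h.openW _).conj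
  have hsm' : Sm U fun y => jet (dirs J 0) f (θ y) := h.hol.sm_comp h.maps (h.smW.jet h.openW _)
  have hsw : ∀ K : Multiset (Fin n), (dirs K 0).map Sum.swap = dirs 0 K := fun K => dirs_swap K 0
  have h1 := h.hol.holFam_comp h.openW h.maps
    (w := fun K => jet (dirs K 0) fun y => starRingEnd ℂ (jet (dirs J 0) f y))
    (fun K _ => hsm.jet h.openW _) fun K _ k => by
      rw [dirs_cons_left]
      exact (jet_cons h.openW hsm _ _).symm
  have h3 : ∀ K : Multiset (Fin n), functionJet f J K (θ 0) =
      jet (dirs 0 K) (jet (dirs J 0) f) (θ 0) := by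
    intro K
    rw [functionJet_eq_jet h.openW h.smW _ _ (h.maps h.zero_mem), dirs_eq_add, add_comm,
      jet_add h.openW h.smW _ _ (h.maps h.zero_mem)]
  refine h1.mem_holSys ?_ (fun k P => ?_) fun K _ => ?_
  · rw [h3, functionHalf]
    simp
  · rw [functionHalf, ← hsw]
    refine (jet_conj h.openU hsm' _ h.zero_mem).symm.trans ?_
    rw [dirs_cons_left, jet_cons' h.openU hsm'.conj _ _ h.zero_mem]
    refine jet_congr_on h.openU (fun x hx => ?_) _ h.zero_mem
    rw [h.hol.dd_comp_left (f := fun y => starRingEnd ℂ (jet (dirs J 0) f y)) hx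
      (hsm.differentiableAt h.openW (h.maps hx))]
    simp only [formPull]
    refine Finset.sum_congr rfl fun i _ => ?_
    rw [← Multiset.cons_zero i, dirs_cons_left, dirs_zero, Multiset.cons_zero, jet_singleton]
  · rw [h3, ← hsw, jet_conj h.openW (h.smW.jet h.openW _) _ (h.maps h.zero_mem)]

/-- For a fixed antiholomorphic index `l`, the pullback metric is a combination of pullbacks of
closed forms, with the conjugates of the derivatives of `θ` as coefficients; these behave like
constants under holomorphic derivatives. -/
theorem metricJet_mem (h : HolChange θ U W g g' f f') (Q : Multiset (Fin n)) :
    (fun P => metricJet g' P Q 0, fun J => metricHalf θ g J Q) ∈ holSys θ U := by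
  induction Q using Multiset.induction_on with
  | empty =>
    have h1 : HolFam θ U fun _ _ => (0 : ℂ) :=
      ⟨fun _ _ => contDiffOn_const, fun _ _ k x _ => by rw [dd_const]; simp⟩
    refine h1.mem_holSys ?_ (fun k P => ?_) fun K _ => ?_
    · simp [metricHalf, formJet_zero, metricJet_zero_left]
    · rw [metricJet_zero_right]
      have : formPull θ (fun _ _ => (0 : ℂ)) k = fun _ => 0 := by ext x; simp [formPull]
      rw [this, jet_const_zero]
    · simp [metricHalf, formJet_zero]
  | cons l Q _ =>
    have hc : ∀ j, Sm U (dd (Sum.inl l) fun y => θ y j) := fun j => (h.hol.sm j).dd h.openU _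
    have h1 : HolFam θ U fun J x => ∑ j, metricJet g J {j} (θ x) *
        starRingEnd ℂ (dd (Sum.inl l) (fun y => θ y j) x) :=
      HolFam.sum_mul h.openU (fun j => h.holFam_metric {j}) (fun j => (hc j).conj) fun j k x hx => by
        rw [dd_conj]
        change starRingEnd ℂ (dd (Sum.inr k) _ x) = 0
        rw [h.hol.dd_dd h.openU j l k hx, map_zero]
    have h2 : ∀ J, metricHalf θ g J (l ::ₘ Q) = jet (dirs 0 Q) (fun x => ∑ j,
        metricJet g J {j} (θ x) * starRingEnd ℂ (dd (Sum.inl l) (fun y => θ y j) x)) 0 := by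
      intro J
      have h3 := jet_conj h.openU ((h.holFam_metric J).sm_formPull h.openU h.hol l) (dirs 0 Q)
        h.zero_mem
      rw [dirs_swap] at h3
      rw [h.metricHalf_cons]
      refine h3.symm.trans ?_
      refine jet_congr_on h.openU (fun x hx => ?_) _ h.zero_mem
      simp only [formPull, map_sum, map_mul]
      refine Finset.sum_congr rfl fun j _ => congrArg (· * _) ?_
      exact (h.kahlerW.metricJet_conj h.openW J {j} (h.maps hx)).symm
    refine (h1.bar h.openU h.hol Q).mem_holSys ?_ (fun k P => ?_) fun J _ => h2 J
    · rw [h2]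
      simp [metricJet_zero_left, jet_const_zero]
    · rw [h.kahlerU.metricJet_cons h.openU k l P Q h.zero_mem, dirs_eq_add,
        jet_add h.openU (h.kahlerU.sm k l) _ _ h.zero_mem]
      refine jet_congr_on h.openU ((jet_congr_on h.openU (fun x hx => ?_) _).trans
        (h1.jet_formPull h.openU h.hol Q k)) _ h.zero_mem
      rw [h.metric x hx]
      simp only [formPull, Finset.sum_mul]
      refine Finset.sum_congr rfl fun i _ => Finset.sum_congr rfl fun j _ => ?_
      have h4 := h.kahlerW.metricJet_cons h.openW i j 0 0 (h.maps hx)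
      simp only [dirs_zero, jet_zero, Multiset.cons_zero] at h4
      rw [h4]
      ring

end HolChange

/-! ### Degree counts and evaluation at an orthonormal centre -/

namespace PointedGraph
variable {n : ℕ}

section ev
variable {R : Type} [CommRing R] {lam F lam' F' : Multiset (Fin n) → Multiset (Fin n) → R}

theorem ev_congr {G : PointedGraph}
    (h : ∀ v, v ≠ G.base → ∀ P Q, Multiset.card P = G.outDeg v → Multiset.card Q = G.inDeg v →
      lam P Q = lam' P Q) (hF : ∀ P Q, F P Q = F' P Q) : G.ev lam F = G.ev lam' F' := by
  refine Finset.sum_congr rfl fun ι _ => Finset.prod_congr rfl fun v _ => ?_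
  split_ifs with hv
  · exact hF _ _
  · exact h v hv _ _ (outDeg_eq_card G ι v).symm (inDeg_eq_card G ι v).symm

theorem ev_eq_zero {G : PointedGraph} {v : G.V} (hv : v ≠ G.base)
    (h : ∀ P Q, Multiset.card P = G.outDeg v → Multiset.card Q = G.inDeg v → lam P Q = 0) :
    G.ev lam F = 0 := by
  refine Finset.sum_eq_zero fun ι _ => Finset.prod_eq_zero (Finset.mem_univ v) ?_
  rw [if_neg hv]
  exact h _ _ (outDeg_eq_card G ι v).symm (inDeg_eq_card G ι v).symm

theorem ev_op (G : PointedGraph) :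
    G.op.ev lam F = G.ev (fun P Q => lam Q P) (fun P Q => F Q P) := by
  refine Finset.sum_congr rfl fun ι _ => Finset.prod_congr rfl fun v _ => ?_
  by_cases hv : v = G.base
  · rw [if_pos hv, if_pos hv]
  · rw [if_neg hv, if_neg hv]

end ev

theorem tot_op (a b : ℕ) (φ : PointedGraph → ℂ) : tot a b (fun G => φ G.op) = tot a b φ := by
  unfold tot
  congr 1
  rw [Finset.sum_comm]

theorem sum_inDeg (G : PointedGraph) : ∑ v, G.inDeg v = Fintype.card G.E := by
  rw [← Finset.card_univ]
  unfold inDeg inEdges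
  rw [Finset.card_eq_sum_card_fiberwise (f := G.tgt) (t := Finset.univ) (by simp)]

theorem inDeg_le (G : PointedGraph) (v : G.V) : G.inDeg v ≤ Fintype.card G.E := by
  rw [← G.sum_inDeg]
  exact Finset.single_le_sum (f := G.inDeg) (fun _ _ => Nat.zero_le _) (Finset.mem_univ v)

theorem outDeg_le (G : PointedGraph) (v : G.V) : G.outDeg v ≤ Fintype.card G.E := by
  rw [← G.sum_outDeg]
  exact Finset.single_le_sum (f := G.outDeg) (fun _ _ => Nat.zero_le _) (Finset.mem_univ v)

/-- Otherwise every ordinary vertex has total degree at least three, and `3 (|V| - 1) ≤ 2 |E| = 2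
(|V| - 1 + k)`. -/
theorem PosDeg.exists_eq_one {G : PointedGraph} (h : G.PosDeg) {k : ℕ}
    (hE : Fintype.card G.E + 1 = Fintype.card G.V + k) (hV : 2 * k + 1 < Fintype.card G.V) :
    ∃ v, v ≠ G.base ∧ G.inDeg v = 1 ∧ G.outDeg v = 1 := by
  by_contra! h'
  have h1 : (Fintype.card G.V - 1) * 3 ≤ ∑ v ∈ Finset.univ.erase G.base, (G.inDeg v + G.outDeg v) := by
    rw [← Finset.card_univ, ← Finset.card_erase_of_mem (Finset.mem_univ G.base), ← smul_eq_mul]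
    refine Finset.card_nsmul_le_sum _ _ _ fun v hv => ?_
    have h2 := h v (Finset.ne_of_mem_erase hv)
    have h3 := h' v (Finset.ne_of_mem_erase hv)
    omega
  have h2 : ∑ v ∈ Finset.univ.erase G.base, (G.inDeg v + G.outDeg v) ≤
      ∑ v, (G.inDeg v + G.outDeg v) := Finset.sum_le_sum_of_subset (Finset.subset_univ _)
  rw [Finset.sum_add_distrib (s := Finset.univ), G.sum_inDeg, G.sum_outDeg] at h2
  omega

theorem eval_eq_sum (G : PointedGraph) (g : (Fin n → ℂ) → Matrix (Fin n) (Fin n) ℂ)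
    (f : (Fin n → ℂ) → ℂ) (x : Fin n → ℂ) : G.eval g f x = ∑ ι : G.E → Fin n, ∑ κ : G.E → Fin n,
      (∏ e, (g x)⁻¹ (κ e) (ι e)) * ∏ v, (if v = G.base then functionJet f else metricJet g)
        (Mo G.src ι v) (Mo G.tgt κ v) x := by
  refine Finset.sum_congr rfl fun ι _ => Finset.sum_congr rfl fun κ _ => ?_
  rw [mul_assoc]
  congr 1
  rw [← Finset.prod_erase_mul _ _ (Finset.mem_univ G.base), if_pos rfl, Mo_eq_map, Mo_eq_map]
  refine congrArg₂ _ (Finset.prod_congr rfl fun v hv => ?_) rfl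
  rw [if_neg (Finset.ne_of_mem_erase hv), Mo_eq_map, Mo_eq_map]
  rfl

theorem eval_eq_ev (G : PointedGraph) {g : (Fin n → ℂ) → Matrix (Fin n) (Fin n) ℂ}
    {f : (Fin n → ℂ) → ℂ} {x : Fin n → ℂ} (hx : g x = 1) :
    G.eval g f x = G.ev (fun P Q => metricJet g P Q x) fun P Q => functionJet f P Q x := by
  rw [eval_eq_sum]
  refine Finset.sum_congr rfl fun ι _ => ?_
  rw [Finset.sum_eq_single ι]
  · rw [hx, inv_one]
    simp only [Matrix.one_apply_eq, Finset.prod_const_one, one_mul]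
    refine Finset.prod_congr rfl fun v _ => ?_
    by_cases hv : v = G.base
    · rw [if_pos hv, if_pos hv]
    · rw [if_neg hv, if_neg hv]
  · intro κ _ hκ
    obtain ⟨e, he⟩ := Function.ne_iff.1 hκ
    rw [Finset.prod_eq_zero (Finset.mem_univ e), zero_mul]
    rw [hx, inv_one, Matrix.one_apply_ne he]
  · simp

end PointedGraph

/-! ### Passage to normal coordinates -/

/-- All purely holomorphic derivatives of the coefficients of `g` at the origin of order at most `N`
coincide with those of the identity. -/
structure IsNormalAt {n : ℕ} (N : ℕ) (g : (Fin n → ℂ) → Matrix (Fin n) (Fin n) ℂ) : Prop where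
  one : g 0 = 1
  pure : ∀ J : Multiset (Fin n), J ≠ 0 → Multiset.card J ≤ N → ∀ i j,
    jet (dirs J 0) (fun w => g w i j) 0 = 0

namespace HolChange
variable {n : ℕ} {θ : (Fin n → ℂ) → (Fin n → ℂ)} {U W : Set (Fin n → ℂ)}
  {g g' : (Fin n → ℂ) → Matrix (Fin n) (Fin n) ℂ} {f f' : (Fin n → ℂ) → ℂ} {N : ℕ}

/-- One element of `J` is the index of the coefficient rather than a derivative, so normality to
order `N` covers `N + 1` indices. -/
theorem _root_.IsNormalAt.metricJet_eq (hN : IsNormalAt N g) (hW : IsOpen W)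
    (h0 : (0 : Fin n → ℂ) ∈ W) (hg : IsKahlerMetricOn g W) (J : Multiset (Fin n))
    (hJ : Multiset.card J ≤ N + 1) (q : Fin n) :
    metricJet g J {q} 0 = if J = {q} then 1 else 0 := by
  induction J using Multiset.induction_on with
  | empty => rw [metricJet_zero_left, if_neg (by simp)]
  | cons k J _ =>
    rw [← Multiset.cons_zero q, hg.metricJet_cons hW k q J 0 h0]
    by_cases hJ0 : J = 0
    · subst hJ0
      simp [hN.one, Matrix.one_apply]
    · rw [hN.pure J hJ0 (by simpa using hJ), if_neg]
      intro h
      have := congrArg Multiset.card h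
      simp at this
      exact hJ0 this

theorem jet_coord (q : Fin n) (J : Multiset (Fin n)) :
    jet (dirs J 0) (fun y : Fin n → ℂ => y q) 0 = if J = {q} then 1 else 0 := by
  have hs : Sm Set.univ fun y : Fin n → ℂ => y q := (contDiff_apply ℝ ℂ q).contDiffOn
  induction J using Multiset.induction_on with
  | empty => simp
  | cons k J _ =>
    rw [dirs_cons_left, jet_cons' isOpen_univ hs _ _ (Set.mem_univ _)]
    have h1 : (dd (Sum.inl k) fun y : Fin n → ℂ => y q) = fun _ => if k = q then 1 else 0 := by
      ext x
      rw [(dd_coord (θ := fun y => y) differentiableAt_id q k).1]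
      simp [Pi.single_apply, eq_comm]
    rw [h1]
    by_cases hJ0 : J = 0
    · subst hJ0
      simp
    · rw [jet_const _ (by simpa [dirs] using hJ0), if_neg]
      intro h
      have := congrArg Multiset.card h
      simp at this
      exact hJ0 this

theorem coord (h : HolChange θ U W g g' f f') (q : Fin n) :
    HolChange θ U W g g' (fun y => y q) fun y => θ y q :=
  { h with
    smW := (contDiff_apply ℝ ℂ q).contDiffOn
    fn := fun _ _ => rfl }

/-- The chain rule for the coordinate function `y q`: its only nonzero derivative at the origin is
the first one along `q`, and the derivatives of its pullback are the Taylor coefficients of `θ`. -/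
theorem jet_mem (h : HolChange θ U W g g' f f') (h0 : θ 0 = 0) (q : Fin n) :
    (fun P => holArr θ P q + if P = {q} then 1 else 0, fun J => if J = {q} then 1 else 0) ∈
      holSys θ U := by
  have h1 := (h.coord q).functionJet_mem 0
  have h2 : (fun P => functionJet (fun y => θ y q) P 0 0) =
      fun P => holArr θ P q + if P = {q} then 1 else 0 := by
    ext P
    rw [functionJet_eq_jet h.openU (h.hol.sm q) _ _ h.zero_mem, holArr]
    ring
  have h3 : (fun J => functionHalf θ (fun y => y q) J 0) =
      fun J => if J = {q} then (1 : ℂ) else 0 := by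
    ext J
    rw [functionHalf, dirs_zero, jet_zero, h0, jet_coord]
  rwa [h2, h3] at h1

/-- A single antiholomorphic index needs no conversion, because `θ` is tangent to the identity. -/
theorem metricHalf_singleton_eq (h : HolChange θ U W g g' f f') (h0 : θ 0 = 0)
    (h1 : ∀ k j, dd (Sum.inl k) (fun y => θ y j) 0 = if k = j then 1 else 0)
    (J : Multiset (Fin n)) (q : Fin n) : metricHalf θ g J {q} = metricJet g J {q} 0 := by
  have hW : (0 : Fin n → ℂ) ∈ W := h0 ▸ h.maps h.zero_mem
  rw [h.kahlerW.metricJet_conj h.openW _ _ hW, ← Multiset.cons_zero q, h.metricHalf_cons]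
  simp [formPull, h1, h0]

end HolChange

/-- A holomorphic change of coordinates that is tangent to the identity, to a metric whose
derivatives are normalized to order `N`. -/
structure NormalChange {n : ℕ} (N : ℕ) (θ : (Fin n → ℂ) → (Fin n → ℂ)) (U W : Set (Fin n → ℂ))
    (g g' : (Fin n → ℂ) → Matrix (Fin n) (Fin n) ℂ) (f f' : (Fin n → ℂ) → ℂ) : Prop
    extends HolChange θ U W g g' f f' where
  map_zero : θ 0 = 0
  tangent : ∀ k j, dd (Sum.inl k) (fun y => θ y j) 0 = if k = j then 1 else 0
  normal : IsNormalAt N g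

namespace NormalChange
open PointedGraph
variable {n : ℕ} {θ : (Fin n → ℂ) → (Fin n → ℂ)} {U W : Set (Fin n → ℂ)}
  {g g' : (Fin n → ℂ) → Matrix (Fin n) (Fin n) ℂ} {f f' : (Fin n → ℂ) → ℂ} {N : ℕ}

theorem zero_mem' (h : NormalChange N θ U W g g' f f') : (0 : Fin n → ℂ) ∈ W :=
  h.map_zero ▸ h.maps h.zero_mem

theorem metric_zero (h : NormalChange N θ U W g g' f f') : g' 0 = 1 := by
  ext k l
  rw [h.metric 0 h.zero_mem, h.map_zero, h.normal.one]
  simp [h.tangent, Matrix.one_apply]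

theorem holArr_zero (h : NormalChange N θ U W g g' f f') (j : Fin n) : holArr θ 0 j = 0 := by
  simp [holArr, h.map_zero]

theorem holArr_singleton (h : NormalChange N θ U W g g' f f') (p j : Fin n) :
    holArr θ {p} j = 0 := by
  rw [holArr, ← Multiset.cons_zero p, dirs_cons_left, dirs_zero, Multiset.cons_zero, jet_singleton,
    h.tangent]
  simp

theorem metricHalf_singleton (h : NormalChange N θ U W g g' f f') (J : Multiset (Fin n))
    (hJ : Multiset.card J ≤ N + 1) (q : Fin n) :
    metricHalf θ g J {q} = if J = {q} then 1 else 0 := by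
  rw [← h.normal.metricJet_eq h.openW h.zero_mem' h.kahlerW J hJ q,
    h.metricHalf_singleton_eq h.map_zero h.tangent]

/-- By normality, the converted array with one antiholomorphic index `q` equals that of the
coordinate function `q` up to length `N + 1`, and converted arrays determine unconverted ones. Hence
the Taylor coefficients of `θ` occur at the vertices of in-degree one, as the elimination requires.
-/
theorem metricJet_singleton (h : NormalChange N θ U W g g' f f') (P : Multiset (Fin n))
    (hP : Multiset.card P ≤ N + 1) (q : Fin n) :
    metricJet g' P {q} 0 = holArr θ P q + if P = {q} then 1 else 0 :=
  (chainSys_holSys h.openU h.zero_mem h.hol).eq_of_le (N + 1) _ (h.metricJet_mem {q}) _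
    (h.jet_mem h.map_zero q) (fun J hJ => h.metricHalf_singleton J hJ q) P hP

theorem metricHalf_singleton_left (h : NormalChange N θ U W g g' f f') (Q : Multiset (Fin n))
    (hQ : Multiset.card Q ≤ N + 1) (j : Fin n) :
    metricHalf θ g {j} Q = starRingEnd ℂ (holArr θ Q j + if Q = {j} then 1 else 0) := by
  have h1 := (chainSys_holSys h.openU h.zero_mem h.hol).eq_of_le (N + 1) _
    (h.metricHalf_mem_conj {j}) _ (h.jet_mem h.map_zero j) (fun K hK => ?_) Q hQ
  · dsimp only at h1
    rw [← h1, Complex.conj_conj]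
  dsimp only
  rw [h.map_zero]
  exact (h.kahlerW.metricJet_conj h.openW K {j} h.zero_mem').symm.trans
    (h.normal.metricJet_eq h.openW h.zero_mem' h.kahlerW K hK j)

/-- The array of the metric, with the derivatives of `θ` at the vertices of in-degree one. -/
def arr (θ : (Fin n → ℂ) → (Fin n → ℂ)) (w : Multiset (Fin n) → Multiset (Fin n) → ℂ)
    (P Q : Multiset (Fin n)) : ℂ :=
  if Multiset.card Q = 1 then (Q.map (holArr θ P)).sum else w P Q

/-- The array of the metric, with the conjugate derivatives of `θ` at the vertices of in-degree
one. -/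
def arrBar (θ : (Fin n → ℂ) → (Fin n → ℂ)) (w : Multiset (Fin n) → Multiset (Fin n) → ℂ)
    (P Q : Multiset (Fin n)) : ℂ :=
  if Multiset.card Q = 1 then (Q.map fun j => starRingEnd ℂ (holArr θ P j)).sum else w P Q

theorem arr_singleton (w : Multiset (Fin n) → Multiset (Fin n) → ℂ) (P : Multiset (Fin n))
    (q : Fin n) : arr θ w P {q} = holArr θ P q := by simp [arr]

theorem arrBar_singleton (w : Multiset (Fin n) → Multiset (Fin n) → ℂ) (P : Multiset (Fin n))
    (q : Fin n) : arrBar θ w P {q} = starRingEnd ℂ (holArr θ P q) := by simp [arrBar]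

theorem arr_one (h : NormalChange N θ U W g g' f f') (w : Multiset (Fin n) → Multiset (Fin n) → ℂ)
    {P Q : Multiset (Fin n)} (hP : Multiset.card P = 1) (hQ : Multiset.card Q = 1) :
    arr θ w P Q = 0 := by
  obtain ⟨p, rfl⟩ := Multiset.card_eq_one.1 hP
  obtain ⟨q, rfl⟩ := Multiset.card_eq_one.1 hQ
  rw [arr_singleton, h.holArr_singleton]

theorem arrBar_one (h : NormalChange N θ U W g g' f f')
    (w : Multiset (Fin n) → Multiset (Fin n) → ℂ)
    {P Q : Multiset (Fin n)} (hP : Multiset.card P = 1) (hQ : Multiset.card Q = 1) :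
    arrBar θ w P Q = 0 := by
  obtain ⟨p, rfl⟩ := Multiset.card_eq_one.1 hP
  obtain ⟨q, rfl⟩ := Multiset.card_eq_one.1 hQ
  rw [arrBar_singleton, h.holArr_singleton, _root_.map_zero]

/-- The elimination of the vertices of in-degree one by the change of the holomorphic indices. -/
def elimData (h : NormalChange N θ U W g g' f f') : ElimData False
    (arr θ fun P Q => metricJet g' P Q 0) (fun P Q => functionJet f' P Q 0)
    (arr θ (metricHalf θ g)) (functionHalf θ f) where
  𝒞 := holSys θ U
  chain := by
    simpa only [arr_singleton, false_imp_iff, if_true] using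
      chainSys_holSys h.openU h.zero_mem h.hol
  zero q := by
    unfold arr
    split_ifs with hq
    · obtain ⟨q, rfl⟩ := Multiset.card_eq_one.1 hq
      simp [h.holArr_zero]
    · exact congrFun (metricJet_zero_left q) 0
  elim P q hq _ := by simp only [arr, if_pos hq]
  base q := h.functionJet_mem q
  core q hq := ⟨_, h.metricJet_mem q, fun P _ => by
    have : ¬ Multiset.card q = 1 := hq
    simp only [arr, if_neg this, and_self]⟩

/-- The elimination of the vertices of in-degree one, in the opposite graph, by the change of the
antiholomorphic indices. -/
def elimDataBar (h : NormalChange N θ U W g g' f f') : ElimData False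
    (arrBar θ fun Q J => metricHalf θ g J Q) (fun Q J => functionHalf θ f J Q)
    (arrBar θ fun K J => metricJet g J K 0) (fun K J => functionJet f J K 0) where
  𝒞 := {Ψ | (fun P => starRingEnd ℂ (Ψ.1 P), fun P => starRingEnd ℂ (Ψ.2 P)) ∈ holSys θ U}
  chain := by
    simpa only [arrBar_singleton, false_imp_iff, if_true] using
      (chainSys_holSys h.openU h.zero_mem h.hol).conj
  zero q := by
    unfold arrBar
    split_ifs with hq
    · obtain ⟨q, rfl⟩ := Multiset.card_eq_one.1 hq
      simp [h.holArr_zero]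
    · simp [metricHalf, formJet_zero]
  elim P q hq _ := by simp only [arrBar, if_pos hq]
  base q := by
    have := h.functionHalf_mem_conj q
    rwa [h.map_zero] at this
  core q hq := ⟨(fun Q => metricHalf θ g q Q, fun K => metricJet g q K 0), by
    have := h.metricHalf_mem_conj q
    rwa [h.map_zero] at this, fun P _ => by
    have : ¬ Multiset.card q = 1 := hq
    simp only [arrBar, if_neg this, and_self]⟩

/-- So large a graph has a vertex of in- and out-degree one. There the array is the linear part of
`θ` minus the identity, or its conjugate, which is zero. -/
theorem nil (h : NormalChange N θ U W g g' f f') {G : PointedGraph} (hp : G.PosDeg) {k T : ℕ}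
    (hT : 2 * k ≤ T) (hV : T + 1 < Fintype.card G.V)
    (hE : Fintype.card G.E + 1 = Fintype.card G.V + k)
    (w F : Multiset (Fin n) → Multiset (Fin n) → ℂ) :
    G.ev (arr θ w) F = 0 ∧ G.ev (arrBar θ w) F = 0 := by
  obtain ⟨v, hv, h1, h2⟩ := hp.exists_eq_one hE (by omega)
  exact ⟨ev_eq_zero hv fun P Q hP hQ => h.arr_one w (hP.trans h2) (hQ.trans h1),
    ev_eq_zero hv fun P Q hP hQ => h.arrBar_one w (hP.trans h2) (hQ.trans h1)⟩

/-- At vertices of in-degree one of a semistable graph, the derivatives of the metric are those of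
`θ`. A graph with nonzero coefficient that is not semistable has a vertex of in- and out-degree one,
where `arr` vanishes, so the restriction to semistable graphs can be dropped. -/
theorem eval_semistable (h : NormalChange N θ U W g g' f f') (c : IsoClass → ℂ) (G : PointedGraph)
    (hE : Fintype.card G.E ≤ N) :
    (if G.IsSemistable then stabCoeff c G * G.eval g' f' 0 else 0) =
      stabCoeff c G * G.ev (arr θ fun P Q => metricJet g' P Q 0)
        (fun P Q => functionJet f' P Q 0) := by
  by_cases hc : stabCoeff c G = 0
  · simp [hc]
  have hp := stabCoeff_posDeg hc
  split_ifs with hs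
  · rw [eval_eq_ev _ h.metric_zero]
    congr 1
    refine ev_congr (fun v hv P Q hP hQ => ?_) fun _ _ => rfl
    unfold arr
    split_ifs with h1
    · obtain ⟨q, rfl⟩ := Multiset.card_eq_one.1 h1
      have h2 := hs v hv
      have h3 := G.outDeg_le v
      rw [h.metricJet_singleton P (by omega), if_neg, add_zero]
      · simp
      · rintro rfl
        simp at hP hQ
        omega
    · rfl
  · obtain ⟨v, hv, h1⟩ : ∃ v, v ≠ G.base ∧
      ¬(1 ≤ G.inDeg v ∧ 1 ≤ G.outDeg v ∧ 3 ≤ G.inDeg v + G.outDeg v) := by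
      simpa [IsSemistable] using hs
    have h2 := hp v hv
    rw [ev_eq_zero hv fun P Q hP hQ => h.arr_one _ (by omega) (by omega), mul_zero]

/-- The interface between the two eliminations. The graphs excluded on the left have polynomial zero
on the right, since `metricHalf θ g Q {p}` vanishes unless `Q = {p}`. In the other ones, the
vertices of in-degree one of `G` carry the conjugate derivatives of `θ`, as `arrBar` prescribes. -/
theorem ev_op_arr (h : NormalChange N θ U W g g' f f') (c : IsoClass → ℂ) (G : PointedGraph)
    (hE : Fintype.card G.E ≤ N) :
    (if ∃ v, elimV False G.op v then 0 else stabCoeff c G.op *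
      G.op.ev (arr θ (metricHalf θ g)) (functionHalf θ f)) = stabCoeff c G.op *
        G.ev (arrBar θ fun Q J => metricHalf θ g J Q) (fun Q J => functionHalf θ f J Q) := by
  have key : ∀ v P Q, Multiset.card P = G.outDeg v → Multiset.card Q = G.inDeg v →
      Multiset.card Q = 1 → ∃ j, Q = {j} ∧ (arrBar θ fun Q J => metricHalf θ g J Q) P Q =
        starRingEnd ℂ (holArr θ P j) := by
    intro v P Q hP hQ h1
    obtain ⟨j, rfl⟩ := Multiset.card_eq_one.1 h1
    exact ⟨j, rfl, arrBar_singleton _ _ _⟩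
  split_ifs with h1
  · obtain ⟨v, hv, h2, -⟩ := h1
    rw [ev_eq_zero (G := G) (v := v) hv fun P Q hP hQ => ?_, mul_zero]
    have hP1 : Multiset.card P = 1 := hP.trans h2
    by_cases h3 : Multiset.card Q = 1
    · exact h.arrBar_one _ hP1 h3
    · obtain ⟨p, rfl⟩ := Multiset.card_eq_one.1 hP1
      have h4 := G.inDeg_le v
      rw [arrBar, if_neg h3, h.metricHalf_singleton _ (by omega), if_neg]
      rintro rfl
      simp at h3
  · rw [ev_op]
    congr 1
    refine ev_congr (fun v hv P Q hP hQ => ?_) fun _ _ => rfl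
    have h2 : Multiset.card P ≠ 1 := fun h2 => h1 ⟨v, hv, hP.symm.trans h2, False.elim⟩
    unfold arr
    rw [if_neg h2]
    by_cases h3 : Multiset.card Q = 1
    · obtain ⟨j, rfl, h4⟩ := key v P Q hP hQ h3
      have h5 := G.outDeg_le v
      rw [h4, h.metricHalf_singleton_left _ (by omega), if_neg, add_zero]
      rintro rfl
      simp at h2
    · rw [arrBar, if_neg h3]

/-- A graph that survives both eliminations without `G.op` being stable has a vertex of out-degree
one and in-degree at least two in `G`, where the derivative of the metric vanishes by normality. -/
theorem ev_stable (h : NormalChange N θ U W g g' f f') (c : IsoClass → ℂ) (G : PointedGraph)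
    (hE : Fintype.card G.E ≤ N) :
    (if ∃ v, elimV False G v then 0 else stabCoeff c G.op *
      G.ev (arrBar θ fun K J => metricJet g J K 0) (fun K J => functionJet f J K 0)) =
        if G.op.IsStable then c (Quotient.mk _ G.op) * G.op.eval g f 0 else 0 := by
  by_cases hs : G.op.IsStable
  · rw [if_pos hs, if_neg, stabCoeff_of_isStable c hs, eval_eq_ev _ h.normal.one, ev_op]
    · congr 1
      refine ev_congr (fun v hv P Q hP hQ => ?_) fun _ _ => rfl
      have h2 : 2 ≤ G.outDeg v ∧ 2 ≤ G.inDeg v := hs v hv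
      rw [arrBar, if_neg (by omega)]
    · rintro ⟨v, hv, h1, -⟩
      have h2 : 2 ≤ G.outDeg v ∧ 2 ≤ G.inDeg v := hs v hv
      omega
  · rw [if_neg hs]
    split_ifs with h1
    · rfl
    by_cases hc : stabCoeff c G.op = 0
    · rw [hc, zero_mul]
    have hp := stabCoeff_posDeg hc
    obtain ⟨v, hv, h2⟩ : ∃ v, v ≠ G.base ∧ ¬(2 ≤ G.outDeg v ∧ 2 ≤ G.inDeg v) := by
      simp only [IsStable] at hs
      push Not at hs
      obtain ⟨v, hv, h2⟩ := hs
      exact ⟨v, hv, fun h3 => absurd (h2 h3.1) (not_lt.2 h3.2)⟩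
    have h3 : 1 ≤ G.outDeg v ∧ 1 ≤ G.inDeg v := hp v hv
    have h4 : G.inDeg v ≠ 1 := fun h4 => h1 ⟨v, hv, h4, False.elim⟩
    rw [ev_eq_zero hv fun P Q hP hQ => ?_, mul_zero]
    obtain ⟨p, rfl⟩ := Multiset.card_eq_one.1 (show Multiset.card P = 1 by omega)
    have h5 := G.inDeg_le v
    rw [arrBar, if_neg (by omega), h.normal.metricJet_eq h.openW h.zero_mem' h.kahlerW _ (by omega),
      if_neg]
    rintro rfl
    simp at hQ
    omega

/-- The sum over all semistable graphs in arbitrary coordinates, that are orthonormal at the centre,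
equals the sum over the stable graphs in normal coordinates. -/
theorem sum_semistable (h : NormalChange N θ U W g g' f f') (c : IsoClass → ℂ) {k T : ℕ}
    (hT : 2 * k ≤ T) (hN : T + k ≤ N) :
    ∑ a ∈ Finset.range (T + 1), (-1) ^ a * tot a (a + k)
        (fun G => if G.IsSemistable then stabCoeff c G * G.eval g' f' 0 else 0) =
      ∑ a ∈ Finset.range (k + 1), (-1) ^ a * tot a (a + k)
        (fun G => if G.IsStable then c (Quotient.mk _ G) * G.eval g f 0 else 0) := by
  have hle : ∀ a ∈ Finset.range (T + 1), a + k ≤ N := fun a ha => by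
    have := Finset.mem_range.1 ha
    omega
  have e1 : ∀ a ∈ Finset.range (T + 1), (-1) ^ a * tot a (a + k)
        (fun G => if G.IsSemistable then stabCoeff c G * G.eval g' f' 0 else 0) =
      (-1) ^ a * tot a (a + k) (fun G => stabCoeff c G *
        LinearMap.id (R := ℂ) (G.ev (arr θ fun P Q => metricJet g' P Q 0)
          (fun P Q => functionJet f' P Q 0))) := fun a ha => by
    rw [tot_congr fun G _ hE => h.eval_semistable c G (hE.trans_le (hle a ha))]
    rfl
  rw [Finset.sum_congr rfl e1, sum_tot_elim h.elimData (isStabCoeff_stabCoeff c) LinearMap.id k T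
    fun G hG hV hE => (h.nil (stabCoeff_posDeg hG) hT hV hE _ _).1]
  have e2 : ∀ a ∈ Finset.range (T + 1), (-1) ^ a * tot a (a + k)
        (fun G => if ∃ v, elimV False G v then 0 else stabCoeff c G *
          LinearMap.id (R := ℂ) (G.ev (arr θ (metricHalf θ g)) (functionHalf θ f))) =
      (-1) ^ a * tot a (a + k) (fun G => stabCoeff c G.op *
        LinearMap.id (R := ℂ) (G.ev (arrBar θ fun Q J => metricHalf θ g J Q)
          (fun Q J => functionHalf θ f J Q))) := fun a ha => by
    rw [← tot_op]
    exact congrArg _ (tot_congr fun G _ hE => h.ev_op_arr c G (hE.trans_le (hle a ha)))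
  rw [Finset.sum_congr rfl e2, sum_tot_elim h.elimDataBar (isStabCoeff_stabCoeff_op c)
    LinearMap.id k T fun G hG hV hE =>
      (h.nil ((isStabCoeff_stabCoeff_op c).posDeg hG) hT hV hE _ _).2]
  have e3 : ∀ a ∈ Finset.range (T + 1), (-1) ^ a * tot a (a + k)
        (fun G => if ∃ v, elimV False G v then 0 else stabCoeff c G.op *
          LinearMap.id (R := ℂ) (G.ev (arrBar θ fun K J => metricJet g J K 0)
            (fun K J => functionJet f J K 0))) =
      (-1) ^ a * tot a (a + k)
        (fun G => if G.IsStable then c (Quotient.mk _ G) * G.eval g f 0 else 0) := fun a ha => by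
    rw [← tot_op a (a + k) fun G => if G.IsStable then c (Quotient.mk _ G) * G.eval g f 0 else 0]
    exact congrArg _ (tot_congr fun G _ hE => h.ev_stable c G (hE.trans_le (hle a ha)))
  rw [Finset.sum_congr rfl e3]
  -- Stable graphs of weight `k` have at most `k` ordinary vertices, so the range can be cut down
  -- from `T`.
  refine (Finset.sum_subset (Finset.range_mono (by omega)) fun a _ ha => ?_).symm
  have h0 : tot a (a + k) (fun G => if G.IsStable then c (Quotient.mk _ G) * G.eval g f 0 else 0) =
      tot a (a + k) fun _ => 0 := tot_congr fun G hV hE => if_neg fun hs => ha (by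
    have := hs.two_mul_le
    rw [Finset.mem_range]
    omega)
  rw [h0]
  simp [tot]

end NormalChange

/-! #### Linear changes of coordinates -/

namespace HolChange
variable {n : ℕ} {θ : (Fin n → ℂ) → (Fin n → ℂ)} {U W : Set (Fin n → ℂ)}
  {g g' : (Fin n → ℂ) → Matrix (Fin n) (Fin n) ℂ} {f f' : (Fin n → ℂ) → ℂ}

open PointedGraph

/-- Without higher derivatives, the two kinds of indices transform by `M` and by its conjugate.
Every edge collects `∑ i, M i κ * conj (M i l)`, which is the inverse metric at `θ 0` because the
pullback metric is the identity at the origin. -/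
theorem eval_eq_of_affine (h : HolChange θ U W g g' f f')
    (hθ : ∀ p B j, B ≠ 0 → holArr θ (p ::ₘ B) j = 0) (h1 : g' 0 = 1) (G : PointedGraph) :
    G.eval g' f' 0 = G.eval g f (θ 0) := by
  let M : Fin n → Fin n → ℂ := fun p j => dd (Sum.inl p) (fun y => θ y j) 0
  have hM : ∀ p j, holArr θ {p} j = M p j - if p = j then 1 else 0 := fun p j => by
    rw [holArr, ← Multiset.cons_zero p, dirs_cons_left, dirs_zero, Multiset.cons_zero,
      jet_singleton]
    simp [M]
  have hL : LinSys M (holSys θ U) := (chainSys_holSys h.openU h.zero_mem h.hol).linSys hM hθ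
  rw [eval_eq_ev _ h1, eval_eq_sum]
  have e1 : ∀ ι : G.E → Fin n,
      ∏ v, (if v = G.base then fun P Q => functionJet f' P Q 0 else fun P Q => metricJet g' P Q 0)
        (Mo G.src ι v) (Mo G.tgt ι v) = ∑ κ : G.E → Fin n, ∑ l : G.E → Fin n,
        (∏ e, M (ι e) (κ e)) * (∏ e, starRingEnd ℂ (M (ι e) (l e))) *
          ∏ v, (if v = G.base then functionJet f else metricJet g)
            (Mo G.src κ v) (Mo G.tgt l v) (θ 0) := by
    intro ι
    have e2 := LinSys.prod_eq (V := G.V) (fun _ => hL) _ G.E rfl G.src ι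
      (fun v => (fun P => (if v = G.base then fun P Q => functionJet f' P Q 0 else
        fun P Q => metricJet g' P Q 0) P (Mo G.tgt ι v), fun J =>
        (if v = G.base then functionHalf θ f else metricHalf θ g) J (Mo G.tgt ι v))) fun v => by
          by_cases hv : v = G.base
          · simp only [if_pos hv]; exact h.functionJet_mem _
          · simp only [if_neg hv]; exact h.metricJet_mem _
    rw [e2]
    refine Finset.sum_congr rfl fun κ _ => ?_
    have e3 := LinSys.prod_eq (V := G.V) (fun _ => hL) _ G.E rfl G.tgt ι
      (fun v => (fun Q => starRingEnd ℂ ((if v = G.base then functionHalf θ f else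
        metricHalf θ g) (Mo G.src κ v) Q), fun Q =>
        starRingEnd ℂ ((if v = G.base then functionJet f else metricJet g) (Mo G.src κ v) Q
          (θ 0)))) fun v => by
          by_cases hv : v = G.base
          · simp only [if_pos hv]; exact h.functionHalf_mem_conj _
          · simp only [if_neg hv]; exact h.metricHalf_mem_conj _
    have e4 := congrArg (starRingEnd ℂ) e3
    simp only [map_prod, map_sum, map_mul, Complex.conj_conj] at e4
    rw [e4, Finset.mul_sum]
    exact Finset.sum_congr rfl fun l _ => by ring
  have e5 : G.ev (fun P Q => metricJet g' P Q 0) (fun P Q => functionJet f' P Q 0) =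
      ∑ ι : G.E → Fin n, ∑ κ : G.E → Fin n, ∑ l : G.E → Fin n,
        (∏ e, M (ι e) (κ e)) * (∏ e, starRingEnd ℂ (M (ι e) (l e))) *
          ∏ v, (if v = G.base then functionJet f else metricJet g)
            (Mo G.src κ v) (Mo G.tgt l v) (θ 0) := Finset.sum_congr rfl fun ι _ => e1 ι
  rw [e5, Finset.sum_comm]
  refine Finset.sum_congr rfl fun κ _ => ?_
  rw [Finset.sum_comm]
  refine Finset.sum_congr rfl fun l _ => ?_
  rw [← Finset.sum_mul]
  congr 1
  have e6 : (g (θ 0))⁻¹ = Matrix.of fun l κ => ∑ i, M i κ * starRingEnd ℂ (M i l) := by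
    let A : Matrix (Fin n) (Fin n) ℂ := Matrix.of M
    have h3 : A * (g (θ 0) * A.conjTranspose) = 1 := by
      rw [← h1]
      ext k l
      rw [h.metric 0 h.zero_mem]
      simp only [Matrix.mul_apply, Finset.mul_sum, Matrix.conjTranspose_apply, A, Matrix.of_apply, M]
      exact Finset.sum_congr rfl fun i _ => Finset.sum_congr rfl fun j _ => by
        rw [← starRingEnd_apply]; ring
    have h4 : g (θ 0) * (A.conjTranspose * A) = 1 := by
      rw [← Matrix.mul_assoc]; exact mul_eq_one_comm.1 h3
    rw [Matrix.inv_eq_right_inv h4]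
    ext a b
    simp only [Matrix.mul_apply, Matrix.conjTranspose_apply, A, Matrix.of_apply]
    exact Finset.sum_congr rfl fun i _ => by rw [← starRingEnd_apply]; ring
  rw [e6]
  simp only [Matrix.of_apply]
  rw [Finset.prod_univ_sum, Fintype.piFinset_univ]
  exact Finset.sum_congr rfl fun ι _ => by rw [Finset.prod_mul_distrib]

end HolChange

/-! #### Pullbacks -/

section pullback
variable {n : ℕ}

/-- The matrix of the derivative of `ψ`. -/
def jac (ψ : (Fin n → ℂ) → (Fin n → ℂ)) (w : Fin n → ℂ) : Matrix (Fin n) (Fin n) ℂ :=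
  Matrix.of fun i k => fderiv ℂ ψ w (Pi.single i 1) k

theorem pullbackMetric_eq (g : (Fin n → ℂ) → Matrix (Fin n) (Fin n) ℂ)
    (ψ : (Fin n → ℂ) → (Fin n → ℂ)) (w : Fin n → ℂ) :
    pullbackMetric g ψ w = jac ψ w * g (ψ w) * (jac ψ w).conjTranspose := by
  ext i j
  simp only [pullbackMetric, jac, Matrix.mul_apply, Finset.sum_mul, Matrix.conjTranspose_apply,
    Matrix.of_apply]
  rw [Finset.sum_comm]
  refine Finset.sum_congr rfl fun l _ => Finset.sum_congr rfl fun k _ => ?_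
  rw [← starRingEnd_apply]
  ring

theorem fderiv_apply_eq_vecMul (ψ : (Fin n → ℂ) → (Fin n → ℂ)) (w v : Fin n → ℂ) :
    fderiv ℂ ψ w v = Matrix.vecMul v (jac ψ w) := by
  have h1 : v = ∑ i, v i • (Pi.single i 1 : Fin n → ℂ) := by
    ext j
    simp [Finset.sum_apply, Pi.single_apply]
  conv_lhs => rw [h1, map_sum]
  ext k
  simp [Finset.sum_apply, Matrix.vecMul, dotProduct, jac]

theorem jac_comp {ψ χ : (Fin n → ℂ) → (Fin n → ℂ)} {w : Fin n → ℂ}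
    (hψ : DifferentiableAt ℂ ψ (χ w)) (hχ : DifferentiableAt ℂ χ w) :
    jac (ψ ∘ χ) w = jac χ w * jac ψ (χ w) := by
  ext i k
  rw [jac, Matrix.of_apply, fderiv_comp w hψ hχ, ContinuousLinearMap.comp_apply,
    fderiv_apply_eq_vecMul ψ]
  rfl

theorem pullbackMetric_comp (g : (Fin n → ℂ) → Matrix (Fin n) (Fin n) ℂ)
    {ψ χ : (Fin n → ℂ) → (Fin n → ℂ)} {w : Fin n → ℂ}
    (hψ : DifferentiableAt ℂ ψ (χ w)) (hχ : DifferentiableAt ℂ χ w) :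
    pullbackMetric g (ψ ∘ χ) w = pullbackMetric (pullbackMetric g ψ) χ w := by
  rw [pullbackMetric_eq, pullbackMetric_eq _ χ, pullbackMetric_eq _ ψ, jac_comp hψ hχ,
    Matrix.conjTranspose_mul]
  simp only [Matrix.mul_assoc, Function.comp]

theorem isUnit_jac {g : (Fin n → ℂ) → Matrix (Fin n) (Fin n) ℂ} {ψ : (Fin n → ℂ) → (Fin n → ℂ)}
    {w : Fin n → ℂ} (h : pullbackMetric g ψ w = 1) : IsUnit (jac ψ w) := by
  rw [pullbackMetric_eq, Matrix.mul_assoc] at h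
  exact IsUnit.of_mul_eq_one _ h

theorem exists_local_inverse {ψ : (Fin n → ℂ) → (Fin n → ℂ)} {w : Fin n → ℂ}
    (hψ : AnalyticAt ℂ ψ w) (hu : IsUnit (jac ψ w)) :
    ∃ χ : (Fin n → ℂ) → (Fin n → ℂ), AnalyticAt ℂ χ (ψ w) ∧ χ (ψ w) = w ∧
      (∀ᶠ y in 𝓝 (ψ w), ψ (χ y) = y) ∧ ∀ᶠ z in 𝓝 w, χ (ψ z) = z := by
  have hinj : Function.Injective (fderiv ℂ ψ w) := by
    have : (fderiv ℂ ψ w : (Fin n → ℂ) → Fin n → ℂ) = fun v => Matrix.vecMul v (jac ψ w) :=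
      funext fun v => fderiv_apply_eq_vecMul ψ w v
    rw [this]
    exact Matrix.vecMul_injective_of_isUnit hu
  let e : (Fin n → ℂ) ≃L[ℂ] (Fin n → ℂ) :=
    (LinearEquiv.ofInjectiveEndo (fderiv ℂ ψ w : (Fin n → ℂ) →ₗ[ℂ] (Fin n → ℂ))
      hinj).toContinuousLinearEquiv
  have he : (e : (Fin n → ℂ) →L[ℂ] (Fin n → ℂ)) = fderiv ℂ ψ w := by
    ext v : 1
    rfl
  have h1 : HasFDerivAt ψ (e : (Fin n → ℂ) →L[ℂ] (Fin n → ℂ)) w := by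
    rw [he]; exact hψ.differentiableAt.hasFDerivAt
  have h2 : ContDiffAt ℂ ω ψ w := hψ.contDiffAt
  have h3 := h2.hasStrictFDerivAt' h1 (by simp)
  refine ⟨h2.localInverse h1 (by simp), ?_, h2.localInverse_apply_image h1 (by simp),
    h3.eventually_right_inverse, h3.eventually_left_inverse⟩
  exact analyticWithinAt_univ.1 (contDiffWithinAt_omega_iff_analyticWithinAt.1
    (contDiffWithinAt_univ.2 (h2.to_localInverse h1 (by simp))))

theorem dd_eq_jac {ψ : (Fin n → ℂ) → (Fin n → ℂ)} {x : Fin n → ℂ} (hψ : DifferentiableAt ℂ ψ x)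
    (k i : Fin n) : dd (Sum.inl k) (fun y => ψ y i) x = jac ψ x k i := (dd_coord hψ i k).1

theorem pullbackMetric_apply_eq (g : (Fin n → ℂ) → Matrix (Fin n) (Fin n) ℂ)
    {ψ : (Fin n → ℂ) → (Fin n → ℂ)} {x : Fin n → ℂ} (hψ : DifferentiableAt ℂ ψ x) (k l : Fin n) :
    pullbackMetric g ψ x k l = ∑ i, ∑ j, dd (Sum.inl k) (fun y => ψ y i) x *
      starRingEnd ℂ (dd (Sum.inl l) (fun y => ψ y j) x) * g (ψ x) i j := by
  simp only [dd_eq_jac hψ]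
  rfl

theorem pullbackMetric_eq_formPull {g : (Fin n → ℂ) → Matrix (Fin n) (Fin n) ℂ}
    {U W : Set (Fin n → ℂ)} (hU : IsOpen U) (hg : IsKahlerMetricOn g U)
    {ψ : (Fin n → ℂ) → (Fin n → ℂ)} (hψ : HolOn ψ W) (hm : Set.MapsTo ψ W U) (k l : Fin n) :
    Set.EqOn (fun x => pullbackMetric g ψ x k l) (fun x => ∑ j,
      formPull ψ (fun K y => metricJet g K {j} (ψ y)) k x *
        starRingEnd ℂ (dd (Sum.inl l) (fun y => ψ y j) x)) W := by
  intro x hx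
  dsimp only
  rw [pullbackMetric_apply_eq g (hψ.diff x hx), Finset.sum_comm]
  refine Finset.sum_congr rfl fun j _ => ?_
  rw [formPull, Finset.sum_mul]
  refine Finset.sum_congr rfl fun i _ => ?_
  have h4 := hg.metricJet_cons hU i j 0 0 (hm hx)
  simp only [dirs_zero, jet_zero, Multiset.cons_zero] at h4
  rw [h4]
  ring

/-- The pullback of a Kähler metric along a local biholomorphism. -/
theorem IsKahlerMetricOn.pullback {g : (Fin n → ℂ) → Matrix (Fin n) (Fin n) ℂ}
    {U W : Set (Fin n → ℂ)} (hU : IsOpen U) (hW : IsOpen W) (hg : IsKahlerMetricOn g U)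
    {ψ : (Fin n → ℂ) → (Fin n → ℂ)} (hψ : HolOn ψ W) (hm : Set.MapsTo ψ W U)
    (hu : ∀ x ∈ W, IsUnit (jac ψ x)) : IsKahlerMetricOn (pullbackMetric g ψ) W := by
  have hfam : ∀ j, HolFam ψ W fun K y => metricJet g K {j} (ψ y) := fun j =>
    hψ.holFam_comp hU hm (fun K _ => hg.sm_metricJet hU K {j})
      fun _ hK k => hg.dd_metricJet_left hU k hK
  have hd : ∀ l j, Sm W fun x => starRingEnd ℂ (dd (Sum.inl l) (fun y => ψ y j) x) := fun l j =>
    ((hψ.sm j).dd hW _).conj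
  refine ⟨fun k l => ?_, fun x hx => ?_, fun x hx i j k => ?_⟩
  · exact Sm.congr_on (Sm.sum fun j _ => ((hfam j).sm_formPull hW hψ k).mul (hd l j))
      (pullbackMetric_eq_formPull hU hg hψ hm k l).symm
  · rw [pullbackMetric_eq]
    exact (hg.posDef _ (hm hx)).mul_mul_conjTranspose_same (Matrix.vecMul_injective_of_isUnit (hu x hx))
  · have h1 : ∀ i k, dd (Sum.inl k) (fun x => pullbackMetric g ψ x i j) x =
        ∑ b, dd (Sum.inl k) (formPull ψ (fun K y => metricJet g K {b} (ψ y)) i) x *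
          starRingEnd ℂ (dd (Sum.inl j) (fun y => ψ y b) x) := by
      intro i k
      have h2 : ∀ b, DifferentiableAt ℝ (formPull ψ (fun K y => metricJet g K {b} (ψ y)) i) x :=
        fun b => ((hfam b).sm_formPull hW hψ i).differentiableAt hW hx
      have h3 : ∀ b, DifferentiableAt ℝ
        (fun x => starRingEnd ℂ (dd (Sum.inl j) (fun y => ψ y b) x)) x :=
        fun b => (hd j b).differentiableAt hW hx
      rw [dd_congr_on hW (pullbackMetric_eq_formPull hU hg hψ hm i j) _ hx,
        dd_sum (f := fun b x => formPull ψ (fun K y => metricJet g K {b} (ψ y)) i x *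
          starRingEnd ℂ (dd (Sum.inl j) (fun y => ψ y b) x)) _ fun b _ => (h2 b).mul (h3 b)]
      refine Finset.sum_congr rfl fun b _ => ?_
      rw [dd_mul (h2 b) (h3 b), dd_conj]
      change _ + _ * starRingEnd ℂ (dd (Sum.inr k) _ x) = _
      rw [hψ.dd_dd hW b j k hx, map_zero, mul_zero, add_zero]
    change dd (Sum.inl k) _ x = dd (Sum.inl i) _ x
    rw [h1, h1]
    exact Finset.sum_congr rfl fun b _ => by rw [(hfam b).closed hW hψ k i hx]

end pullback

/-! #### Polynomials with prescribed derivatives -/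

section poly
variable {n : ℕ}

/-- The homogeneous polynomial of degree `m` with the derivatives `c P` of order `m`. -/
def homPoly : ℕ → (Multiset (Fin n) → ℂ) → (Fin n → ℂ) → ℂ
  | 0, c, _ => c 0
  | m + 1, c, z => (m + 1 : ℂ)⁻¹ * ∑ k, z k * homPoly m (fun P => c (k ::ₘ P)) z

/-- The polynomial of degree `N` with the derivatives `c P` at the origin. -/
def jetPoly (N : ℕ) (c : Multiset (Fin n) → ℂ) (z : Fin n → ℂ) : ℂ :=
  ∑ m ∈ Finset.range (N + 1), homPoly m c z

theorem contDiff_homPoly {𝕜 : Type} [NontriviallyNormedField 𝕜] [NormedAlgebra 𝕜 ℂ]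
    (a : WithTop ℕ∞) (m : ℕ) (c : Multiset (Fin n) → ℂ) :
    ContDiff 𝕜 a (homPoly m c) := by
  induction m generalizing c with
  | zero => exact contDiff_const
  | succ m ih =>
    refine contDiff_const.mul (ContDiff.sum fun k _ => ContDiff.mul ?_ (ih _))
    exact contDiff_apply 𝕜 ℂ k

/-- In the induction step the product rule gives one copy of the result directly and `m + 1` more
copies by Euler's identity; together they cancel the normalizing factor. -/
theorem dd_homPoly (m : ℕ) (c : Multiset (Fin n) → ℂ) (l : Fin n) (z : Fin n → ℂ) :
    dd (Sum.inl l) (homPoly (m + 1) c) z = homPoly m (fun P => c (l ::ₘ P)) z := by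
  have hsm : ∀ m (c : Multiset (Fin n) → ℂ) (z : Fin n → ℂ), DifferentiableAt ℝ (homPoly m c) z :=
    fun m c z => (contDiff_homPoly (𝕜 := ℝ) ∞ m c).differentiable (by simp) z
  have hc : ∀ k (z : Fin n → ℂ), DifferentiableAt ℝ (fun z : Fin n → ℂ => z k) z := fun k z =>
    (contDiff_apply ℝ ℂ k).differentiable (n := 1) (by simp) z
  have hcd : ∀ k, dd (Sum.inl l) (fun z : Fin n → ℂ => z k) z = if l = k then 1 else 0 := by
    intro k
    rw [(dd_coord (θ := fun y => y) differentiableAt_id k l).1]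
    simp [Pi.single_apply, eq_comm]
  have h1 : ∀ m (c : Multiset (Fin n) → ℂ), dd (Sum.inl l) (homPoly (m + 1) c) z =
      (m + 1 : ℂ)⁻¹ * (homPoly m (fun P => c (l ::ₘ P)) z +
        ∑ k, z k * dd (Sum.inl l) (homPoly m fun P => c (k ::ₘ P)) z) := by
    intro m c
    have h2 : ∀ k, DifferentiableAt ℝ (fun z : Fin n → ℂ => z k * homPoly m (fun P => c (k ::ₘ P)) z) z :=
      fun k => (hc k z).mul (hsm _ _ _)
    change dd (Sum.inl l) (fun z => (m + 1 : ℂ)⁻¹ * ∑ k, z k * homPoly m (fun P => c (k ::ₘ P)) z) z = _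
    rw [dd_const_mul (DifferentiableAt.fun_sum fun k _ => h2 k), dd_sum _ fun k _ => h2 k]
    congr 1
    have h3 : ∀ k, dd (Sum.inl l) (fun z : Fin n → ℂ => z k * homPoly m (fun P => c (k ::ₘ P)) z) z =
        (if l = k then homPoly m (fun P => c (k ::ₘ P)) z else 0) +
          z k * dd (Sum.inl l) (homPoly m fun P => c (k ::ₘ P)) z := by
      intro k
      rw [dd_mul (hc k z) (hsm _ _ _), hcd]
      split_ifs <;> simp
    simp only [h3, Finset.sum_add_distrib, Finset.sum_ite_eq, Finset.mem_univ, if_true]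
  induction m generalizing c with
  | zero =>
    rw [h1]
    have h4 : ∀ c : Multiset (Fin n) → ℂ, dd (Sum.inl l) (homPoly 0 c) z = 0 := fun c =>
      dd_const (c 0) _ z
    simp [h4]
  | succ m ih =>
    rw [h1]
    simp only [ih]
    have h5 : ∑ k, z k * homPoly m (fun P => c (k ::ₘ l ::ₘ P)) z =
        (m + 1 : ℂ) * homPoly (m + 1) (fun P => c (l ::ₘ P)) z := by
      change _ = (m + 1 : ℂ) * ((m + 1 : ℂ)⁻¹ * ∑ k, z k * homPoly m (fun P => c (l ::ₘ k ::ₘ P)) z)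
      rw [mul_inv_cancel_left₀ (Nat.cast_add_one_ne_zero m)]
      exact Finset.sum_congr rfl fun k _ => by simp only [Multiset.cons_swap]
    rw [h5, ← one_add_mul, ← mul_assoc]
    have : ((m + 1 : ℕ) + 1 : ℂ)⁻¹ * (1 + (m + 1)) = 1 := by
      push_cast
      rw [add_comm (1 : ℂ)]
      exact inv_mul_cancel₀ (by exact_mod_cast Nat.succ_ne_zero (m + 1))
    rw [this, one_mul]

theorem contDiff_jetPoly {𝕜 : Type} [NontriviallyNormedField 𝕜] [NormedAlgebra 𝕜 ℂ]
    (a : WithTop ℕ∞) (N : ℕ) (c : Multiset (Fin n) → ℂ) : ContDiff 𝕜 a (jetPoly N c) :=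
  ContDiff.sum fun m _ => contDiff_homPoly a m c

theorem dd_jetPoly (N : ℕ) (c : Multiset (Fin n) → ℂ) (l : Fin n) (z : Fin n → ℂ) :
    dd (Sum.inl l) (jetPoly (N + 1) c) z = jetPoly N (fun P => c (l ::ₘ P)) z := by
  have hsm : ∀ m, DifferentiableAt ℝ (homPoly m c) z :=
    fun m => (contDiff_homPoly (𝕜 := ℝ) ∞ m c).differentiable (by simp) z
  change dd (Sum.inl l) (fun z => ∑ m ∈ Finset.range (N + 2), homPoly m c z) z = _
  rw [dd_sum _ fun m _ => hsm m, Finset.sum_range_succ']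
  have h4 : dd (Sum.inl l) (homPoly 0 c) z = 0 := dd_const (c 0) _ z
  rw [h4, add_zero]
  exact Finset.sum_congr rfl fun m _ => dd_homPoly m c l z

theorem jetPoly_zero (N : ℕ) (c : Multiset (Fin n) → ℂ) : jetPoly N c 0 = c 0 := by
  unfold jetPoly
  rw [Finset.sum_range_succ']
  simp [homPoly]

theorem jet_jetPoly (P : Multiset (Fin n)) : ∀ (N : ℕ) (c : Multiset (Fin n) → ℂ),
    Multiset.card P ≤ N → jet (dirs P 0) (jetPoly N c) 0 = c P := by
  induction P using Multiset.induction_on with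
  | empty => intro N c _; rw [dirs_zero, jet_zero, jetPoly_zero]
  | cons k P ih =>
    intro N c hP
    rw [Multiset.card_cons] at hP
    obtain ⟨N, rfl⟩ : ∃ M, N = M + 1 := ⟨N - 1, by omega⟩
    rw [dirs_cons_left, jet_cons' isOpen_univ (contDiff_jetPoly ∞ _ c).contDiffOn _ _ (Set.mem_univ _),
      funext fun z => dd_jetPoly N c k z, ih N _ (by omega)]

end poly

/-! #### Coordinate systems -/

section charts
variable {n : ℕ} {g : (Fin n → ℂ) → Matrix (Fin n) (Fin n) ℂ} {U : Set (Fin n → ℂ)}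

/-- When the linear part of `θ` vanishes, the chain rule is unitriangular in the number of indices
and can be solved for the converted array. This converse of `eq_of_le` gives the existence of normal
coordinates. -/
theorem ChainSys.eq_of_le' {R : Type} [CommRing R] {θ : Multiset (Fin n) → Fin n → R}
    {𝒞 : Set ((Multiset (Fin n) → R) × (Multiset (Fin n) → R))} (h : ChainSys θ 𝒞)
    (h1 : ∀ p j, θ {p} j = 0) (m : ℕ) :
    ∀ Ψ ∈ 𝒞, ∀ Ψ' ∈ 𝒞, (∀ P, Multiset.card P ≤ m → Ψ.1 P = Ψ'.1 P) →
      ∀ J, Multiset.card J ≤ m → Ψ.2 J = Ψ'.2 J := by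
  induction m with
  | zero =>
    intro Ψ hΨ Ψ' hΨ' h2 J hJ
    rw [Multiset.card_eq_zero.1 (Nat.le_zero.1 hJ), ← h.zero _ hΨ, ← h.zero _ hΨ', h2 0 (by simp)]
  | succ m ih =>
    intro Ψ hΨ Ψ' hΨ' h2 J hJ
    induction J using Multiset.induction_on with
    | empty => rw [← h.zero _ hΨ, ← h.zero _ hΨ', h2 0 (by simp)]
    | cons p J _ =>
      obtain ⟨Φ, h3, h4⟩ := h.cons _ hΨ
      obtain ⟨Φ', h3', h4'⟩ := h.cons _ hΨ'
      rw [Multiset.card_cons] at hJ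
      have h5 : ∀ a ≤ m, ∀ j Q, Multiset.card Q = a → Φ j Q = Φ' j Q := by
        intro a
        induction a using Nat.strong_induction_on with
        | _ a iha =>
        intro ha j Q hQ
        obtain ⟨Q, _, κ, rfl⟩ := Q.exists_eq_sum_singleton
        have h6 := h2 (j ::ₘ ∑ q, {κ q}) (by rw [Multiset.card_cons]; omega)
        rw [h4, h4'] at h6
        have h7 : ∑ i, ∑ B : Finset Q, Φ i (∑ q : {q // q ∉ B}, {κ q}) *
            θ (j ::ₘ ∑ q : {q // q ∈ B}, {κ q}) i = ∑ i, ∑ B : Finset Q,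
            Φ' i (∑ q : {q // q ∉ B}, {κ q}) * θ (j ::ₘ ∑ q : {q // q ∈ B}, {κ q}) i := by
          refine Finset.sum_congr rfl fun i _ => Finset.sum_congr rfl fun B _ => ?_
          by_cases hB : B = ∅
          · subst hB
            have : j ::ₘ ∑ q : {q // q ∈ (∅ : Finset Q)}, ({κ q} : Multiset (Fin n)) = {j} := by simp
            rw [this, h1, mul_zero, mul_zero]
          · obtain ⟨b, hb⟩ := Finset.nonempty_iff_ne_empty.2 hB
            have h8 : Fintype.card {q // q ∉ B} < Fintype.card Q :=
              Fintype.card_subtype_lt (x := b) (by simpa using hb)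
            have h9 : ∀ (A : Type) [Fintype A] (κ : A → Fin n),
                Multiset.card (∑ q, ({κ q} : Multiset (Fin n))) = Fintype.card A := by
              intro A _ κ
              rw [Multiset.card_sum]
              simp
            rw [iha _ (by rw [← hQ, h9, h9]; exact h8) (by rw [h9]; rw [h9] at hQ; omega) i _ rfl]
        rw [h7] at h6
        exact add_right_cancel h6
      exact ih _ (h3 p) _ (h3' p) (fun P hP => h5 _ hP p P rfl) J (by omega)

theorem jac_congr {ψ χ : (Fin n → ℂ) → (Fin n → ℂ)} {w : Fin n → ℂ} (h : ψ =ᶠ[𝓝 w] χ) :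
    jac ψ w = jac χ w := by
  rw [jac, jac, h.fderiv_eq]

theorem pullbackMetric_congr {ψ χ : (Fin n → ℂ) → (Fin n → ℂ)} {w : Fin n → ℂ}
    (h : ψ =ᶠ[𝓝 w] χ) : pullbackMetric g ψ w = pullbackMetric g χ w := by
  rw [pullbackMetric_eq, pullbackMetric_eq, jac_congr h, h.eq_of_nhds]

theorem exists_nhd_isUnit_jac {ψ : (Fin n → ℂ) → (Fin n → ℂ)} {w : Fin n → ℂ}
    (hψ : AnalyticAt ℂ ψ w) (hu : IsUnit (jac ψ w)) (hU : IsOpen U) (hw : ψ w ∈ U) :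
    ∃ W, IsOpen W ∧ w ∈ W ∧ AnalyticOnNhd ℂ ψ W ∧ Set.MapsTo ψ W U ∧ ∀ x ∈ W, IsUnit (jac ψ x) := by
  have h1 : ContinuousAt (fun x => (jac ψ x).det) w := by
    have h2 : ContinuousAt (fderiv ℂ ψ) w := hψ.fderiv.continuousAt
    have h3 : ContinuousAt (jac ψ) w := by
      refine continuousAt_pi.2 fun i => continuousAt_pi.2 fun k => ?_
      exact (continuousAt_pi.1 (h2.clm_apply continuousAt_const)) k
    exact (continuous_id.matrix_det.continuousAt (x := jac ψ w)).comp h3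
  have h2 : ∀ᶠ x in 𝓝 w, (jac ψ x).det ≠ 0 :=
    h1.eventually_ne ((Matrix.isUnit_iff_isUnit_det _).1 hu).ne_zero
  have h3 : ∀ᶠ x in 𝓝 w, AnalyticAt ℂ ψ x ∧ ψ x ∈ U ∧ (jac ψ x).det ≠ 0 :=
    hψ.eventually_analyticAt.and ((hψ.continuousAt.eventually (hU.mem_nhds hw)).and h2)
  obtain ⟨W, h4, h5, h6⟩ := eventually_nhds_iff.1 h3
  exact ⟨W, h5, h6, fun x hx => (h4 x hx).1, fun x hx => (h4 x hx).2.1, fun x hx =>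
    (Matrix.isUnit_iff_isUnit_det _).2 (h4 x hx).2.2.isUnit⟩

theorem holChange_pullback {W : Set (Fin n → ℂ)} (hU : IsOpen U) (hW : IsOpen W)
    (hg : IsKahlerMetricOn g U) {f : (Fin n → ℂ) → ℂ} (hf : Sm U f)
    {ψ : (Fin n → ℂ) → (Fin n → ℂ)} (hψ : AnalyticOnNhd ℂ ψ W) (hm : Set.MapsTo ψ W U)
    (hu : ∀ x ∈ W, IsUnit (jac ψ x)) (h0 : (0 : Fin n → ℂ) ∈ W) :
    HolChange ψ W U g (pullbackMetric g ψ) f (f ∘ ψ) where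
  openU := hW
  openW := hU
  zero_mem := h0
  hol := hψ.holOn hW
  maps := hm
  kahlerW := hg
  kahlerU := hg.pullback hU hW (hψ.holOn hW) hm hu
  smW := hf
  metric x hx k l := pullbackMetric_apply_eq g (hψ x hx).differentiableAt k l
  fn _ _ := rfl

theorem iterWirtinger_congr {f h : (Fin n → ℂ) → ℂ} {w : Fin n → ℂ} (hfh : f =ᶠ[𝓝 w] h)
    (a b : List (Fin n)) : iterWirtinger a b f w = iterWirtinger a b h w := by
  obtain ⟨W, h1, h2, h3⟩ := eventually_nhds_iff.1 hfh
  rw [iterWirtinger_eq, iterWirtinger_eq]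
  exact dl_congr_on h2 h1 _ h3

theorem pullbackMetric_comp_eventuallyEq {ψ χ : (Fin n → ℂ) → (Fin n → ℂ)} {w : Fin n → ℂ}
    (hψ : AnalyticAt ℂ ψ (χ w)) (hχ : AnalyticAt ℂ χ w) :
    pullbackMetric g (ψ ∘ χ) =ᶠ[𝓝 w] pullbackMetric (pullbackMetric g ψ) χ := by
  filter_upwards [hχ.eventually_analyticAt, hχ.continuousAt.eventually hψ.eventually_analyticAt]
    with z h1 h2
  exact pullbackMetric_comp g h2.differentiableAt h1.differentiableAt

theorem IsNormalChart.comp {N : ℕ} {ψ χ : (Fin n → ℂ) → (Fin n → ℂ)} {w : Fin n → ℂ}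
    (hψ : AnalyticAt ℂ ψ w) (hχ : IsNormalChart N (pullbackMetric g ψ) w χ) :
    IsNormalChart N g (ψ w) (ψ ∘ χ) := by
  have hψ' : AnalyticAt ℂ ψ (χ 0) := hχ.center.symm ▸ hψ
  have h1 := pullbackMetric_comp_eventuallyEq (g := g) hψ' hχ.analytic
  have h2 : ∀ i j, (fun z => pullbackMetric g (ψ ∘ χ) z i j) =ᶠ[𝓝 0]
      fun z => pullbackMetric (pullbackMetric g ψ) χ z i j := fun i j =>
    h1.mono fun z hz => congrFun (congrFun hz i) j
  refine ⟨hψ'.comp hχ.analytic, congrArg ψ hχ.center, h1.eq_of_nhds.trans hχ.metric_center,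
    fun a ha hN i j => ?_, fun a ha hN i j => ?_⟩
  · rw [iterWirtinger_congr (h2 i j)]; exact hχ.pure a ha hN i j
  · rw [iterWirtinger_congr (h2 i j)]; exact hχ.pure_bar a ha hN i j

end charts

section charts
variable {n : ℕ} {g : (Fin n → ℂ) → Matrix (Fin n) (Fin n) ℂ} {U : Set (Fin n → ℂ)}

/-- The affine parametrization `w ↦ y + w A`. -/
def affineMap (y : Fin n → ℂ) (A : Matrix (Fin n) (Fin n) ℂ) (w : Fin n → ℂ) : Fin n → ℂ :=
  y + Matrix.vecMul w A

theorem hasFDerivAt_affineMap (y : Fin n → ℂ) (A : Matrix (Fin n) (Fin n) ℂ) (w : Fin n → ℂ) :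
    HasFDerivAt (affineMap y A) (LinearMap.toContinuousLinearMap A.vecMulLinear) w :=
  ((LinearMap.toContinuousLinearMap A.vecMulLinear).hasFDerivAt).const_add y

theorem jac_affineMap (y : Fin n → ℂ) (A : Matrix (Fin n) (Fin n) ℂ) (w : Fin n → ℂ) :
    jac (affineMap y A) w = A := by
  ext i k
  rw [jac, Matrix.of_apply, (hasFDerivAt_affineMap y A w).fderiv]
  simp

theorem analyticOnNhd_affineMap (y : Fin n → ℂ) (A : Matrix (Fin n) (Fin n) ℂ) (W : Set (Fin n → ℂ)) :
    AnalyticOnNhd ℂ (affineMap y A) W := fun w _ =>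
  analyticAt_const.add
    (f := fun _ => y) (g := LinearMap.toContinuousLinearMap A.vecMulLinear)
    ((LinearMap.toContinuousLinearMap A.vecMulLinear).analyticAt w)

theorem affineMap_zero (y : Fin n → ℂ) (A : Matrix (Fin n) (Fin n) ℂ) : affineMap y A 0 = y := by
  simp [affineMap]

theorem holArr_affineMap (y : Fin n → ℂ) (A : Matrix (Fin n) (Fin n) ℂ) (p : Fin n)
    {B : Multiset (Fin n)} (hB : B ≠ 0) (j : Fin n) : holArr (affineMap y A) (p ::ₘ B) j = 0 := by
  have h1 : HolOn (affineMap y A) Set.univ := (analyticOnNhd_affineMap y A _).holOn isOpen_univ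
  have h2 : (dd (Sum.inl p) fun x => affineMap y A x j) = fun _ => A p j := by
    ext x
    rw [dd_eq_jac (hasFDerivAt_affineMap y A x).differentiableAt, jac_affineMap]
  rw [holArr, dirs_cons_left, jet_cons' isOpen_univ (h1.sm j) _ _ (Set.mem_univ _), h2,
    jet_const _ (by simpa [dirs] using hB), if_neg, sub_zero]
  intro h
  have := congrArg Multiset.card h
  simp at this
  exact hB this

theorem isNormalAt_of_isNormalChart {N : ℕ} {y : Fin n → ℂ} {ψ : (Fin n → ℂ) → (Fin n → ℂ)}
    (hψ : IsNormalChart N g y ψ) {W : Set (Fin n → ℂ)} (hW : IsOpen W) (h0 : (0 : Fin n → ℂ) ∈ W)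
    (hk : IsKahlerMetricOn (pullbackMetric g ψ) W) : IsNormalAt N (pullbackMetric g ψ) where
  one := hψ.metric_center
  pure J hJ hN i j := by
    obtain ⟨l, rfl⟩ : ∃ l : List (Fin n), (l : Multiset (Fin n)) = J := ⟨J.toList, J.coe_toList⟩
    have h1 := iterWirtinger_eq_jet hW (hk.sm i j) l [] h0
    rw [hψ.pure l (by simpa using hJ) (by simpa using hN)] at h1
    exact h1.symm

/-- `α` is the affine part of `ψ`, and `θ` is `α` followed by the local inverse of `ψ`, hence
tangent to the identity. The passage to normal coordinates is thus split into a linear step, for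
`eval_eq_of_affine`, and one with higher derivatives only, for the eliminations. -/
theorem exists_normalChange {N : ℕ} (hU : IsOpen U) (hg : IsKahlerMetricOn g U)
    {f : (Fin n → ℂ) → ℂ} (hf : Sm U f) {y : Fin n → ℂ} (hy : y ∈ U)
    {ψ : (Fin n → ℂ) → (Fin n → ℂ)} (hψ : IsNormalChart N g y ψ) :
    ∃ α θ U' W, NormalChange N θ U' W (pullbackMetric g ψ) (pullbackMetric g α) (f ∘ ψ) (f ∘ α) ∧
      ∃ U'', HolChange α U'' U g (pullbackMetric g α) f (f ∘ α) ∧ α 0 = y ∧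
        ∀ p B j, B ≠ 0 → holArr α (p ::ₘ B) j = 0 := by
  have hu := isUnit_jac hψ.metric_center
  obtain ⟨W, hW, hW0, h1, h2, h3⟩ := exists_nhd_isUnit_jac hψ.analytic hu hU
    (hψ.center.symm ▸ hy)
  obtain ⟨χ, h4, h5, h6, -⟩ := exists_local_inverse hψ.analytic hu
  rw [hψ.center] at h4 h5 h6
  let α := affineMap y (jac ψ 0)
  have hα : AnalyticOnNhd ℂ α Set.univ := analyticOnNhd_affineMap _ _ _
  have hα0 : α 0 = y := affineMap_zero _ _
  have hαj : ∀ x, jac α x = jac ψ 0 := jac_affineMap _ _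
  let θ := χ ∘ α
  have hθ : AnalyticAt ℂ θ 0 := AnalyticAt.comp (hα0.symm ▸ h4) (hα 0 (Set.mem_univ _))
  have hθ0 : θ 0 = 0 := by simp only [θ, Function.comp, hα0, h5]
  have hαc : ContinuousAt α 0 := (hα 0 (Set.mem_univ _)).continuousAt
  have e1 : ∀ᶠ x in 𝓝 0, ψ (θ x) = α x := hαc.eventually (hα0.symm ▸ h6)
  have e2 : ∀ᶠ x in 𝓝 0, AnalyticAt ℂ θ x ∧ θ x ∈ W ∧ α x ∈ U ∧ ψ (θ x) = α x :=
    hθ.eventually_analyticAt.and ((hθ.continuousAt.eventually (hW.mem_nhds (hθ0.symm ▸ hW0))).and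
      ((hαc.eventually (hU.mem_nhds (hα0.symm ▸ hy))).and e1))
  obtain ⟨U', h7, h8, h9⟩ := eventually_nhds_iff.1 e2
  have hθU : AnalyticOnNhd ℂ θ U' := fun x hx => (h7 x hx).1
  have hαU : HolChange α U' U g (pullbackMetric g α) f (f ∘ α) :=
    holChange_pullback hU h8 hg hf (fun x _ => hα x (Set.mem_univ _)) (fun x hx => (h7 x hx).2.2.1)
      (fun x _ => (hαj x).symm ▸ hu) h9
  have hψW := holChange_pullback hU hW hg hf h1 h2 h3 hW0
  have e3 : ∀ x ∈ U', ψ ∘ θ =ᶠ[𝓝 x] α := fun x hx =>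
    eventually_nhds_iff.2 ⟨U', fun z hz => (h7 z hz).2.2.2, h8, hx⟩
  refine ⟨α, θ, U', W, ⟨⟨h8, hW, h9, hθU.holOn h8, fun x hx => (h7 x hx).2.1, hψW.kahlerU,
    hαU.kahlerU, hψW.smU, fun x hx k l => ?_, fun x hx => ?_⟩, hθ0, fun k j => ?_, ?_⟩, U', hαU, hα0,
    fun p B j hB => holArr_affineMap _ _ p hB j⟩
  · rw [← pullbackMetric_apply_eq (pullbackMetric g ψ) (hθU x hx).differentiableAt,
      ← pullbackMetric_comp g (h1 _ (h7 x hx).2.1).differentiableAt (hθU x hx).differentiableAt,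
      pullbackMetric_congr (e3 x hx)]
  · exact congrArg f (h7 x hx).2.2.2.symm
  · rw [dd_eq_jac hθ.differentiableAt]
    have h10 := jac_comp (ψ := ψ) (χ := θ) (w := 0) (hθ0.symm ▸ hψ.analytic.differentiableAt)
      hθ.differentiableAt
    rw [jac_congr (e3 0 h9), hαj, hθ0] at h10
    have h11 : jac θ 0 = 1 := by
      exact (hu.mul_right_cancel ((one_mul _).trans h10)).symm
    rw [h11, Matrix.one_apply]
  · exact isNormalAt_of_isNormalChart hψ hW hW0 hψW.kahlerU

/-- Normal coordinates at a point where the metric is the identity. -/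
theorem exists_isNormalChart_of_one (N : ℕ) {W : Set (Fin n → ℂ)} (hW : IsOpen W)
    (hW0 : (0 : Fin n → ℂ) ∈ W) (hg : IsKahlerMetricOn g W) (h1 : g 0 = 1) :
    ∃ χ, IsNormalChart N g 0 χ := by
  -- Normal coordinates are explicit: the `l`-th one is the polynomial with the derivatives `g_{P
  -- l̄}` at the origin, up to order `N + 1`. The chart is the local inverse of `θ`.
  let θ : (Fin n → ℂ) → (Fin n → ℂ) := fun z l => jetPoly (N + 1) (fun P => metricJet g P {l} 0) z
  have hθa : AnalyticOnNhd ℂ θ Set.univ :=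
    contDiff_omega_iff_analyticOnNhd.1 (contDiff_pi.2 fun l => contDiff_jetPoly ω _ _)
  have hθ0 : θ 0 = 0 := by
    ext l
    exact (jetPoly_zero _ _).trans (congrFun (metricJet_zero_left _) 0)
  have hθj : ∀ P l, Multiset.card P ≤ N + 1 → jet (dirs P 0) (fun z => θ z l) 0 =
      metricJet g P {l} 0 := fun P l hP => jet_jetPoly P (N + 1) _ hP
  have hone : ∀ k l, metricJet g {k} {l} 0 = if k = l then 1 else 0 := by
    intro k l
    rw [← Multiset.cons_zero k, ← Multiset.cons_zero l, hg.metricJet_cons hW k l 0 0 hW0]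
    simp [h1, Matrix.one_apply]
  have hθd : ∀ k l, dd (Sum.inl k) (fun z => θ z l) 0 = if k = l then 1 else 0 := by
    intro k l
    have := hθj {k} l (by simp)
    rw [hone, ← Multiset.cons_zero k, dirs_cons_left, dirs_zero, Multiset.cons_zero,
      jet_singleton] at this
    exact this
  have hjac : jac θ 0 = 1 := by
    ext k l
    rw [← dd_eq_jac (hθa 0 (Set.mem_univ _)).differentiableAt, hθd, Matrix.one_apply]
  have hu : IsUnit (jac θ 0) := hjac.symm ▸ isUnit_one
  obtain ⟨χ, h4, h5, h6, h7⟩ := exists_local_inverse (hθa 0 (Set.mem_univ _)) hu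
  rw [hθ0] at h4 h5 h6
  have hcomp : jac χ 0 = 1 := by
    have h10 := jac_comp (ψ := θ) (χ := χ) (w := 0) (hθa _ (Set.mem_univ _)).differentiableAt
      h4.differentiableAt
    have h11 : jac (θ ∘ χ) 0 = 1 := by
      rw [jac_congr (ψ := θ ∘ χ) (χ := fun z => z) h6]
      ext i k
      simp [jac, Pi.single_apply, Matrix.one_apply, eq_comm]
    rw [h11, h5, hjac, mul_one] at h10
    exact h10.symm
  obtain ⟨W', hW', hW'0, h8, h9, h10⟩ := exists_nhd_isUnit_jac h4 (hcomp.symm ▸ isUnit_one) hW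
    (h5.symm ▸ hW0)
  have hχ := holChange_pullback (f := fun _ => 0) hW hW' hg contDiffOn_const h8 h9 h10 hW'0
  have e2 : ∀ᶠ x in 𝓝 0, θ x ∈ W' ∧ x ∈ W ∧ χ (θ x) = x :=
    ((hθa 0 (Set.mem_univ _)).continuousAt.eventually (hW'.mem_nhds (hθ0.symm ▸ hW'0))).and
      (Filter.Eventually.and (hW.mem_nhds hW0) h7)
  obtain ⟨U', h11, h12, h13⟩ := eventually_nhds_iff.1 e2
  have hθU : HolOn θ U' := AnalyticOnNhd.holOn h12 fun x _ => hθa x (Set.mem_univ _)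
  have hc : HolChange θ U' W' (pullbackMetric g χ) g (fun _ => 0) fun _ => 0 := by
    refine ⟨h12, hW', h13, hθU, fun x hx => (h11 x hx).1, hχ.kahlerU,
      ⟨fun i j => (hg.sm i j).mono fun x hx => (h11 x hx).2.1, fun x hx => hg.posDef x (h11 x hx).2.1,
        fun x hx => hg.closed x (h11 x hx).2.1⟩, contDiffOn_const, fun x hx k l => ?_, fun _ _ => rfl⟩
    rw [← pullbackMetric_apply_eq (pullbackMetric g χ) (hθU.diff x hx),
      ← pullbackMetric_comp g (h8 _ (h11 x hx).1).differentiableAt (hθU.diff x hx),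
      pullbackMetric_congr (ψ := χ ∘ θ) (χ := fun z => z)
        (eventually_nhds_iff.2 ⟨U', fun z hz => (h11 z hz).2.2, h12, hx⟩),
      pullbackMetric_eq]
    have : jac (fun z : Fin n → ℂ => z) x = 1 := by
      ext i k
      simp [jac, Pi.single_apply, Matrix.one_apply, eq_comm]
    rw [this]
    simp
  have hsing : ∀ p j, holArr θ {p} j = 0 := fun p j => by
    rw [holArr, ← Multiset.cons_zero p, dirs_cons_left, dirs_zero, Multiset.cons_zero, jet_singleton,
      hθd]
    simp
  -- By the choice of `θ`, the array of `g` with one antiholomorphic index `q` agrees with that of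
  -- the coordinate function `q`; solving the chain rule, the converted arrays agree too.
  have hhalf : ∀ J q, Multiset.card J ≤ N + 1 →
      metricHalf θ (pullbackMetric g χ) J {q} = if J = {q} then 1 else 0 := fun J q hJ =>
    (chainSys_holSys h12 h13 hθU).eq_of_le' hsing (N + 1) _ (hc.metricJet_mem {q}) _
      (hc.jet_mem hθ0 q) (fun P hP => by
        dsimp only
        rw [holArr, hθj P q hP]
        ring) J hJ
  have hpure : ∀ J : Multiset (Fin n), J ≠ 0 → Multiset.card J ≤ N → ∀ i j,
      jet (dirs J 0) (fun w => pullbackMetric g χ w i j) 0 = 0 := by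
    intro J hJ hN i j
    rw [← hχ.kahlerU.metricJet_cons hW' i j J 0 hW'0, Multiset.cons_zero,
      ← hc.metricHalf_singleton_eq hθ0 hθd, hhalf _ _ (by simpa using hN), if_neg]
    intro h
    have := congrArg Multiset.card h
    simp at this
    exact hJ this
  refine ⟨χ, h4, h5, ?_, fun a ha hN i j => ?_, fun a ha hN i j => ?_⟩
  · rw [pullbackMetric_eq, hcomp, h5, h1]
    simp
  · rw [iterWirtinger_eq_jet hW' (hχ.kahlerU.sm i j) a [] hW'0]
    exact hpure a (by simpa using ha) (by simpa using hN) i j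
  · rw [iterWirtinger_eq_jet hW' (hχ.kahlerU.sm i j) [] a hW'0]
    have h14 := hpure a (by simpa using ha) (by simpa using hN) j i
    rw [jet_congr_on hW' (hχ.kahlerU.conj i j) _ hW'0, jet_conj hW' (hχ.kahlerU.sm j i) _ hW'0]
    change starRingEnd ℂ (jet ((dirs 0 (a : Multiset (Fin n))).map Sum.swap) _ 0) = 0
    rw [dirs_swap, h14, map_zero]

open scoped MatrixOrder Matrix.Norms.L2Operator in
theorem _root_.Matrix.PosSemidef.exists_eq_conjTranspose_mul_self {m : Type} [Fintype m]
    {A : Matrix m m ℂ} (hA : A.PosSemidef) : ∃ B : Matrix m m ℂ, A = B.conjTranspose * B :=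
  CStarAlgebra.nonneg_iff_eq_star_mul_self.1 hA.nonneg

/-- A linear change makes the metric the identity at `y`; it is followed by the polynomial
construction of `exists_isNormalChart_of_one`. -/
theorem exists_isNormalChart (N : ℕ) (hU : IsOpen U) (hg : IsKahlerMetricOn g U) {y : Fin n → ℂ}
    (hy : y ∈ U) : ∃ ψ, IsNormalChart N g y ψ := by
  obtain ⟨B, hB⟩ := (hg.posDef y hy).posSemidef.exists_eq_conjTranspose_mul_self
  have hBu : IsUnit B := by
    have := (hg.posDef y hy).isUnit
    rw [hB] at this
    exact isUnit_of_mul_isUnit_right this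
  let A := (B.conjTranspose)⁻¹
  have hBd : IsUnit B.det := (Matrix.isUnit_iff_isUnit_det _).1 hBu
  have hBd' : IsUnit B.conjTranspose.det := by
    rw [Matrix.det_conjTranspose]; exact hBd.star
  have hA : A * g y * A.conjTranspose = 1 := by
    rw [hB, Matrix.conjTranspose_nonsing_inv, Matrix.conjTranspose_conjTranspose, ← Matrix.mul_assoc,
      Matrix.nonsing_inv_mul _ hBd', Matrix.one_mul, Matrix.mul_nonsing_inv _ hBd]
  have hAu : IsUnit A := (Matrix.isUnit_nonsing_inv_iff).2 ((Matrix.isUnit_iff_isUnit_det _).2 hBd')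
  have ha := analyticOnNhd_affineMap y A Set.univ
  obtain ⟨W, h1, h2, h3, h4, h5⟩ := exists_nhd_isUnit_jac (ha 0 (Set.mem_univ _))
    ((jac_affineMap y A 0).symm ▸ hAu) hU ((affineMap_zero y A).symm ▸ hy)
  obtain ⟨χ, hχ⟩ := exists_isNormalChart_of_one N h1 h2
    (hg.pullback hU h1 (h3.holOn h1) h4 h5) (by
      rw [pullbackMetric_eq, jac_affineMap, affineMap_zero, hA])
  have := hχ.comp (ha 0 (Set.mem_univ _))
  rw [affineMap_zero] at this
  exact ⟨_, this⟩

end charts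

/-! ### Semistable sums and the covariant operators -/

namespace PointedGraph
variable {n : ℕ} {g : (Fin n → ℂ) → Matrix (Fin n) (Fin n) ℂ} {U : Set (Fin n → ℂ)}
  {f : (Fin n → ℂ) → ℂ}

theorem Iso.eval_eq {G H : PointedGraph} (φ : Iso G H) (g : (Fin n → ℂ) → Matrix (Fin n) (Fin n) ℂ)
    (f : (Fin n → ℂ) → ℂ) (x : Fin n → ℂ) : G.eval g f x = H.eval g f x := by
  rw [eval_eq_sum, eval_eq_sum]
  have h1 : ∀ (s : G.E → G.V) (s' : H.E → H.V), (∀ e, s' (φ.onE e) = φ.onV (s e)) →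
      ∀ (ι : G.E → Fin n) (v : G.V), Mo s ι v = Mo s' (ι ∘ φ.onE.symm) (φ.onV v) := by
    intro s s' hs ι v
    rw [← Mo_equiv φ.onE, ← Mo_injective φ.onV.injective]
    congr 1
    · ext e; simp [hs]
    · ext e; simp
  refine sum_equiv_inst (Equiv.arrowCongr φ.onE (Equiv.refl _)) _ _ fun ι =>
    sum_equiv_inst (Equiv.arrowCongr φ.onE (Equiv.refl _)) _ _ fun κ => ?_
  congr 1
  · exact prod_equiv_inst φ.onE _ _ fun e => by simp [Equiv.arrowCongr]
  · refine prod_equiv_inst φ.onV _ _ fun v => ?_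
    rw [h1 G.src H.src φ.src_eq, h1 G.tgt H.tgt φ.tgt_eq]
    simp only [φ.eq_base_iff]
    rfl

theorem Iso.weight_eq {G H : PointedGraph} (φ : Iso G H) : G.weight = H.weight := by
  unfold weight
  rw [Fintype.card_congr φ.onV, Fintype.card_congr φ.onE]

theorem Iso.numV_eq {G H : PointedGraph} (φ : Iso G H) : G.numV = H.numV :=
  Fintype.card_congr φ.onV

theorem Iso.autCard_eq {G H : PointedGraph} (φ : Iso G H) : G.autCard = H.autCard := by
  rw [← φ.card_eq, ← φ.symm.card_eq]
  exact Nat.card_congr ⟨Iso.symm, Iso.symm, fun _ => rfl, fun _ => rfl⟩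

theorem metricJet_congr {g' : (Fin n → ℂ) → Matrix (Fin n) (Fin n) ℂ} {x : Fin n → ℂ}
    (h : g =ᶠ[𝓝 x] g') (P Q : Multiset (Fin n)) : metricJet g P Q x = metricJet g' P Q x := by
  unfold metricJet
  split
  · exact iterWirtinger_congr (h.mono fun z hz => congrFun (congrFun hz _) _) _ _
  · rfl

theorem eval_congr {g' : (Fin n → ℂ) → Matrix (Fin n) (Fin n) ℂ} {f' : (Fin n → ℂ) → ℂ}
    {x : Fin n → ℂ} (h : g =ᶠ[𝓝 x] g') (hf : f =ᶠ[𝓝 x] f') (G : PointedGraph) :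
    G.eval g f x = G.eval g' f' x := by
  unfold eval
  simp only [metricJet_congr h, functionJet, iterWirtinger_congr hf, h.eq_of_nhds]

/-- The sum over the semistable graphs of weight `k` with the coefficients of their stabilization
graphs, in given coordinates. -/
def semiSum (c : IsoClass → ℂ) (k : ℕ) (g : (Fin n → ℂ) → Matrix (Fin n) (Fin n) ℂ)
    (f : (Fin n → ℂ) → ℂ) (x : Fin n → ℂ) : ℂ :=
  ∑ a ∈ Finset.range (2 * k + 1), (-1) ^ a * tot a (a + k)
    (fun G => if G.IsSemistable then stabCoeff c G * G.eval g f x else 0)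

/-- The sum over the stable graphs of weight `k`, in given coordinates. -/
def stableSum (c : IsoClass → ℂ) (k : ℕ) (g : (Fin n → ℂ) → Matrix (Fin n) (Fin n) ℂ)
    (f : (Fin n → ℂ) → ℂ) (x : Fin n → ℂ) : ℂ :=
  ∑ a ∈ Finset.range (k + 1), (-1) ^ a * tot a (a + k)
    (fun G => if G.IsStable then c (Quotient.mk _ G) * G.eval g f x else 0)

/-- The affine part of the chart does not change single graphs, and the rest is `sum_semistable`. A
semistable graph of weight `k` has at most `2k` ordinary vertices, hence at most `3k` edges, whence
the bound on `N`. -/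
theorem semiSum_eq_stableSum (c : IsoClass → ℂ) {k N : ℕ} (hU : IsOpen U)
    (hg : IsKahlerMetricOn g U) (hf : Sm U f) {x : Fin n → ℂ} (hx : x ∈ U)
    {ψ : (Fin n → ℂ) → (Fin n → ℂ)} (hψ : IsNormalChart N g x ψ) (hN : 3 * k ≤ N) :
    semiSum c k g f x = stableSum c k (pullbackMetric g ψ) (f ∘ ψ) 0 := by
  obtain ⟨α, θ, U', W, h, U'', hα, hα0, hα1⟩ := exists_normalChange hU hg hf hx hψ
  refine Eq.trans ?_ (h.sum_semistable c (k := k) (T := 2 * k) le_rfl (by omega))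
  refine Finset.sum_congr rfl fun a _ => congrArg _ (tot_congr fun G _ _ => ?_)
  rw [hα.eval_eq_of_affine hα1 h.metric_zero, hα0]

/-- The sign arises because `numV` counts the distinguished vertex, unlike the exponent in
`stableSum`. -/
theorem stableSum_eq (c : IsoClass → ℂ) (k : ℕ) (g : (Fin n → ℂ) → Matrix (Fin n) (Fin n) ℂ)
    (f : (Fin n → ℂ) → ℂ) (x : Fin n → ℂ) : stableSum c k g f x =
      -∑ q ∈ stableClasses k, c q * (-1) ^ q.out.numV / q.out.autCard * q.out.eval g f x := by
  have h1 := sum_stableClasses (φ := fun G => (-1) ^ (Fintype.card G.V - 1) *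
    (c (Quotient.mk _ G) * G.eval g f x)) (fun {G H} φ => by
      rw [φ.eval_eq, Fintype.card_congr φ.onV,
        show (Quotient.mk _ G : IsoClass) = Quotient.mk _ H from Quotient.sound ⟨φ⟩]) k
  have h2 : stableSum c k g f x = ∑ a ∈ Finset.range (k + 1), tot a (a + k) (fun G =>
      if G.IsStable then (-1) ^ (Fintype.card G.V - 1) * (c (Quotient.mk _ G) * G.eval g f x)
      else 0) := by
    refine Finset.sum_congr rfl fun a _ => ?_
    rw [← tot_const_mul]
    refine tot_congr fun G hV _ => ?_
    rw [hV, Nat.add_sub_cancel, mul_ite, mul_zero]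
  rw [h2, ← h1, ← Finset.sum_neg_distrib]
  refine Finset.sum_congr rfl fun q _ => ?_
  have h3 : Fintype.card q.out.V = (Fintype.card q.out.V - 1) + 1 :=
    (Nat.succ_pred_eq_of_pos (Fintype.card_pos_iff.2 ⟨q.out.base⟩)).symm
  rw [Quotient.out_eq, numV, h3, pow_succ, Nat.add_sub_cancel]
  ring

theorem mem_stableClasses_iff {k : ℕ} {q : IsoClass} :
    q ∈ stableClasses k ↔ q.out.IsStable ∧ q.out.weight = k := by
  simp [stableClasses]

theorem _root_.IsNormalChart.mono {N M : ℕ} {x : Fin n → ℂ} {ψ : (Fin n → ℂ) → (Fin n → ℂ)}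
    (h : IsNormalChart N g x ψ) (hM : M ≤ N) : IsNormalChart M g x ψ :=
  { h with
    pure := fun a ha hN => h.pure a ha (hN.trans hM)
    pure_bar := fun a ha hN => h.pure_bar a ha (hN.trans hM) }

/-- The function that equals one at the class of `Γ` and zero elsewhere. -/
def indClass (Γ : PointedGraph) (q : IsoClass) : ℂ := if q = Quotient.mk _ Γ then 1 else 0

/-- With the indicator of the class of `Γ` as coefficient, the stable sum has a single term. The
right-hand side does not involve the chart, so the value is well defined and depends smoothly on
`x`. -/
theorem eval_eq_semiSum {Γ : PointedGraph} (hΓ : Γ.IsStable) {k N : ℕ} (hk : Γ.weight = k)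
    (hU : IsOpen U) (hg : IsKahlerMetricOn g U) (hf : Sm U f) {x : Fin n → ℂ} (hx : x ∈ U)
    {ψ : (Fin n → ℂ) → (Fin n → ℂ)} (hψ : IsNormalChart N g x ψ) (hN : 3 * k ≤ N) :
    Γ.eval (pullbackMetric g ψ) (f ∘ ψ) 0 =
      -(-1) ^ Γ.numV * Γ.autCard * semiSum (indClass Γ) k g f x := by
  rw [semiSum_eq_stableSum _ hU hg hf hx hψ hN, stableSum_eq]
  obtain ⟨φ⟩ : Nonempty (Iso (Quotient.mk _ Γ : IsoClass).out Γ) := Quotient.mk_out Γ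
  have h1 : (Quotient.mk _ Γ : IsoClass) ∈ stableClasses k := by
    rw [mem_stableClasses_iff, φ.weight_eq, hk]
    exact ⟨φ.symm.isStable hΓ, rfl⟩
  rw [Finset.sum_eq_single_of_mem _ h1 fun q _ hq => by simp [indClass, hq]]
  have h2 : (Γ.autCard : ℂ) ≠ 0 := Nat.cast_ne_zero.2 Γ.autCard_pos.ne'
  rw [indClass, if_pos rfl, φ.eval_eq, φ.autCard_eq, φ.numV_eq]
  have h3 : ((-1 : ℂ) ^ Γ.numV) * (-1) ^ Γ.numV = 1 := by
    rw [← mul_pow]; simp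
  field_simp
  linear_combination (-(Γ.eval (pullbackMetric g ψ) (f ∘ ψ) 0)) * h3

theorem IsStable.exists_weight {Γ : PointedGraph} (hΓ : Γ.IsStable) : ∃ k : ℕ, Γ.weight = k := by
  have h1 := hΓ.two_mul_le
  have h2 : 0 < Fintype.card Γ.V := Fintype.card_pos_iff.2 ⟨Γ.base⟩
  exact ⟨Fintype.card Γ.E - (Fintype.card Γ.V - 1), by unfold weight; omega⟩

theorem isNormalValue_unique (hU : IsOpen U) (hg : IsKahlerMetricOn g U) {x : Fin n → ℂ}
    (hx : x ∈ U) {Γ : PointedGraph} {a b : ℂ} (ha : Γ.IsNormalValue g f x a)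
    (hb : Γ.IsNormalValue g f x b) : a = b := by
  obtain ⟨N, hN⟩ := ha
  obtain ⟨M, hM⟩ := hb
  obtain ⟨ψ, hψ⟩ := exists_isNormalChart (max N M) hU hg hx
  rw [← hN ψ (hψ.mono (le_max_left _ _)), ← hM ψ (hψ.mono (le_max_right _ _))]

section stable
variable {Γ : PointedGraph} {k : ℕ}

theorem isNormalValue_semiSum (hΓ : Γ.IsStable) (hk : Γ.weight = k)
    (hU : IsOpen U) (hg : IsKahlerMetricOn g U) (hf : Sm U f) {x : Fin n → ℂ} (hx : x ∈ U) :
    Γ.IsNormalValue g f x (-(-1) ^ Γ.numV * Γ.autCard * semiSum (indClass Γ) k g f x) :=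
  ⟨3 * k, fun _ hψ => eval_eq_semiSum hΓ hk hU hg hf hx hψ le_rfl⟩

theorem isNormalValue_covOp (hΓ : Γ.IsStable)
    (hU : IsOpen U) (hg : IsKahlerMetricOn g U) (hf : Sm U f) {x : Fin n → ℂ} (hx : x ∈ U) :
    Γ.IsNormalValue g f x (Γ.covOp g f x) := by
  obtain ⟨k, hk⟩ := hΓ.exists_weight
  exact Classical.epsilon_spec (p := fun c => Γ.IsNormalValue g f x c)
    ⟨_, isNormalValue_semiSum hΓ hk hU hg hf hx⟩

theorem covOp_eq (hΓ : Γ.IsStable) (hk : Γ.weight = k)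
    (hU : IsOpen U) (hg : IsKahlerMetricOn g U) (hf : Sm U f) {x : Fin n → ℂ} (hx : x ∈ U) :
    Γ.covOp g f x = -(-1) ^ Γ.numV * Γ.autCard * semiSum (indClass Γ) k g f x :=
  isNormalValue_unique hU hg hx (isNormalValue_covOp hΓ hU hg hf hx)
    (isNormalValue_semiSum hΓ hk hU hg hf hx)

theorem covOp_eq_eval (hΓ : Γ.IsStable) (hk : Γ.weight = k)
    (hU : IsOpen U) (hg : IsKahlerMetricOn g U) (hf : Sm U f) {x : Fin n → ℂ} (hx : x ∈ U) {N : ℕ}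
    {ψ : (Fin n → ℂ) → (Fin n → ℂ)} (hψ : IsNormalChart N g x ψ) (hN : 3 * k ≤ N) :
    Γ.covOp g f x = Γ.eval (pullbackMetric g ψ) (f ∘ ψ) 0 := by
  rw [covOp_eq hΓ hk hU hg hf hx, eval_eq_semiSum hΓ hk hU hg hf hx hψ hN]

end stable

theorem sm_inv (hg : IsKahlerMetricOn g U) (i j : Fin n) : Sm U fun x => (g x)⁻¹ i j := by
  have h1 : ∀ x ∈ U, (g x).det ≠ 0 := fun x hx =>
    ((Matrix.isUnit_iff_isUnit_det _).1 (hg.posDef x hx).isUnit).ne_zero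
  have hdet : ∀ A : (Fin n → ℂ) → Matrix (Fin n) (Fin n) ℂ, (∀ i j, Sm U fun x => A x i j) →
      Sm U fun x => (A x).det := by
    intro A hA
    simp only [Matrix.det_apply]
    refine Sm.sum fun σ _ => ?_
    exact ContDiffOn.const_smul _ (Sm.prod fun i _ => hA _ _)
  have h2 : Sm U fun x => (g x).adjugate i j := by
    simp only [Matrix.adjugate_apply]
    refine hdet _ fun a b => ?_
    by_cases hab : a = j
    · subst hab
      simp only [Matrix.updateRow_self]
      exact contDiffOn_const
    · simp only [Matrix.updateRow_ne hab]
      exact hg.sm a b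
  have h3 : Sm U fun x => ((g x).det)⁻¹ * (g x).adjugate i j :=
    ((hdet g hg.sm).inv h1).mul h2
  refine h3.congr_on fun x _ => ?_
  rw [Matrix.inv_def, Matrix.smul_apply, Ring.inverse_eq_inv', smul_eq_mul]

theorem sm_functionJet (hU : IsOpen U) (hf : Sm U f) (P Q : Multiset (Fin n)) :
    Sm U (functionJet f P Q) :=
  (hf.jet hU (dirs P Q)).congr_on (functionJet_eq_jet hU hf P Q).symm

theorem sm_eval (hU : IsOpen U) (hg : IsKahlerMetricOn g U) (hf : Sm U f) (G : PointedGraph) :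
    Sm U (G.eval g f) :=
  Sm.sum fun _ _ => Sm.sum fun _ _ => ((Sm.prod fun _ _ => sm_inv hg _ _).mul
    (Sm.prod fun _ _ => hg.sm_metricJet hU _ _)).mul (sm_functionJet hU hf _ _)

theorem sm_semiSum (c : IsoClass → ℂ) (k : ℕ) (hU : IsOpen U) (hg : IsKahlerMetricOn g U)
    (hf : Sm U f) : Sm U (semiSum c k g f) := by
  refine Sm.sum fun a _ => contDiffOn_const.mul (contDiffOn_const.mul
    (Sm.sum fun s _ => Sm.sum fun t _ => ?_))
  dsimp only
  split_ifs
  · exact contDiffOn_const.mul (sm_eval hU hg hf _)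
  · exact contDiffOn_const

theorem sm_covOp {Γ : PointedGraph} (hΓ : Γ.IsStable) (hU : IsOpen U) (hg : IsKahlerMetricOn g U)
    (hf : Sm U f) : Sm U (Γ.covOp g f) := by
  obtain ⟨k, hk⟩ := hΓ.exists_weight
  exact Sm.congr_on (contDiffOn_const.mul (sm_semiSum (indClass Γ) k hU hg hf)) fun x hx =>
    (covOp_eq hΓ hk hU hg hf hx).symm

theorem graphSum_eq (c : IsoClass → ℂ) (k : ℕ) (hU : IsOpen U) (hg : IsKahlerMetricOn g U)
    (hf : Sm U f) : Set.EqOn (graphSum c k g f) (fun x => -semiSum c k g f x) U := by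
  intro x hx
  obtain ⟨ψ, hψ⟩ := exists_isNormalChart (3 * k) hU hg hx
  dsimp only
  rw [semiSum_eq_stableSum c hU hg hf hx hψ le_rfl, stableSum_eq, neg_neg, graphSum]
  refine Finset.sum_congr rfl fun q hq => ?_
  rw [mem_stableClasses_iff] at hq
  rw [covOp_eq_eval hq.1 hq.2 hU hg hf hx hψ le_rfl]

/-- At each point both sides equal the stable sum in one and the same normal chart. This invariance
is what permits `semiSum` to be differentiated in coordinates that are normal at a single point. -/
theorem semiSum_pullback (c : IsoClass → ℂ) (k : ℕ) (hU : IsOpen U) (hg : IsKahlerMetricOn g U)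
    (hf : Sm U f) {ψ : (Fin n → ℂ) → (Fin n → ℂ)} {W : Set (Fin n → ℂ)} (hW : IsOpen W)
    (hψ : AnalyticOnNhd ℂ ψ W) (hm : Set.MapsTo ψ W U) (hu : ∀ x ∈ W, IsUnit (jac ψ x)) :
    Set.EqOn (fun w => semiSum c k g f (ψ w)) (semiSum c k (pullbackMetric g ψ) (f ∘ ψ)) W := by
  intro w hw
  have hH := hψ.holOn hW
  have hk := hg.pullback hU hW hH hm hu
  have hf' : Sm W (f ∘ ψ) := hH.sm_comp hm hf
  obtain ⟨χ, hχ⟩ := exists_isNormalChart (3 * k) hW hk hw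
  rw [semiSum_eq_stableSum c hW hk hf' hw hχ le_rfl]
  have h1 : IsNormalChart (3 * k) g (ψ w) (ψ ∘ χ) := hχ.comp (hψ w hw)
  refine (semiSum_eq_stableSum c hU hg hf (hm hw) h1 le_rfl).trans ?_
  refine Finset.sum_congr rfl fun a _ => congrArg _ (tot_congr fun G _ _ => ?_)
  rw [eval_congr (pullbackMetric_comp_eventuallyEq (hχ.center.symm ▸ hψ w hw) hχ.analytic)
    (Filter.EventuallyEq.refl _ _)]
  rfl

end PointedGraph

/-! #### Raising indices -/

section raise
variable {n : ℕ} {R : Type} [CommRing R]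

theorem exists_equiv_of_sum_singleton_eq {α J Q : Type} [Fintype J] [Fintype Q] {ι : J → α}
    {κ : Q → α} (h : ∑ p, ({ι p} : Multiset α) = ∑ q, {κ q}) : ∃ e : J ≃ Q, ∀ p, κ (e p) = ι p := by
  have h1 : ∀ c, Nonempty ({p // ι p = c} ≃ {q // κ q = c}) := by
    intro c
    refine ⟨Fintype.equivOfCardEq ?_⟩
    have h2 := congrArg (Multiset.count c) h
    rw [sum_singleton_eq_map, sum_singleton_eq_map, Multiset.count_map, Multiset.count_map] at h2
    rw [Fintype.card_subtype, Fintype.card_subtype]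
    simpa only [Finset.card_def, Finset.filter_val, eq_comm] using h2
  exact ⟨Equiv.ofFiberEquiv fun c => (h1 c).some, Equiv.ofFiberEquiv_map _⟩

/-- The array obtained from `Ψ` by applying `M` to all indices. -/
def raise (M : Fin n → Fin n → R) (Ψ : Multiset (Fin n) → R) (J : Multiset (Fin n)) : R :=
  ∑ κ : Fin J.toList.length → Fin n, (∏ p, M (J.toList.get p) (κ p)) * Ψ (∑ p, {κ p})

theorem raise_sum (M : Fin n → Fin n → R) (Ψ : Multiset (Fin n) → R) {J : Type} [Fintype J]
    (ι : J → Fin n) : raise M Ψ (∑ p, {ι p}) =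
      ∑ κ : J → Fin n, (∏ p, M (ι p) (κ p)) * Ψ (∑ p, {κ p}) := by
  set K : Multiset (Fin n) := ∑ p, {ι p} with hK
  have h1 : ∑ p, ({K.toList.get p} : Multiset (Fin n)) = ∑ p, {ι p} := by
    rw [sum_singleton_eq_map, Fin.univ_val_map, List.ofFn_get, Multiset.coe_toList]
  obtain ⟨e, he⟩ := exists_equiv_of_sum_singleton_eq h1
  refine sum_equiv_inst (Equiv.arrowCongr e (Equiv.refl _)) _ _ fun κ => ?_
  congr 1
  · exact prod_equiv_inst e _ _ fun p => by simp [he]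
  · exact congrArg Ψ (sum_equiv_inst e _ _ fun p => by simp)

theorem raise_zero (M : Fin n → Fin n → R) (Ψ : Multiset (Fin n) → R) : raise M Ψ 0 = Ψ 0 := by
  have := raise_sum M Ψ (J := Empty) fun e => e.elim
  simpa using this

theorem raise_cons (M : Fin n → Fin n → R) (Ψ : Multiset (Fin n) → R) (p : Fin n)
    (P : Multiset (Fin n)) :
    raise M Ψ (p ::ₘ P) = ∑ q, M p q * raise M (fun Q => Ψ (q ::ₘ Q)) P := by
  obtain ⟨Q, _, κ, rfl⟩ := P.exists_eq_sum_singleton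
  have h1 : p ::ₘ ∑ q, ({κ q} : Multiset (Fin n)) = ∑ q : Option Q, {optFun p κ q} := by
    rw [Fintype.sum_option, ← Multiset.singleton_add]
    rfl
  rw [h1, raise_sum, sum_pi_option]
  refine Finset.sum_congr rfl fun q _ => ?_
  rw [raise_sum, Finset.mul_sum]
  refine Finset.sum_congr rfl fun l _ => ?_
  rw [Fintype.prod_option, Fintype.sum_option, ← mul_assoc, Multiset.singleton_add]
  rfl

theorem linSys_raise (M : Fin n → Fin n → R) : LinSys M {Ψ | Ψ.1 = raise M Ψ.2} where
  zero _ h := (congrFun h 0).trans (raise_zero M _)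
  cons Ψ h := ⟨fun j => raise M fun J => Ψ.2 (j ::ₘ J), fun _ => rfl, fun p P =>
    (congrFun h _).trans (raise_cons M _ p P)⟩

theorem raise_sum_mul (M : Fin n → Fin n → R) (a : Fin n → R) (Ψ : Fin n → Multiset (Fin n) → R)
    (P : Multiset (Fin n)) :
    raise M (fun Q => ∑ q, a q * Ψ q Q) P = ∑ q, a q * raise M (Ψ q) P := by
  unfold raise
  simp only [Finset.mul_sum]
  rw [Finset.sum_comm]
  exact Finset.sum_congr rfl fun q _ => Finset.sum_congr rfl fun κ _ => by ring

/-- In the application `M` is the metric and `M'` its inverse: the unraised array is expanded in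
terms of the raised one, so that eliminating the metric factors leaves the inverse metric. -/
theorem linSys_lower {M M' : Fin n → Fin n → R}
    (h : ∀ p q, ∑ j, M p j * M' j q = if p = q then 1 else 0) :
    LinSys M {Ψ | Ψ.2 = raise M' Ψ.1} where
  zero Ψ h := ((congrFun h 0).trans (raise_zero M' _)).symm
  cons Ψ hΨ := by
    have hΨ : Ψ.2 = raise M' Ψ.1 := hΨ
    refine ⟨fun j P => ∑ q, M' j q * Ψ.1 (q ::ₘ P), fun j => ?_, fun p P => ?_⟩
    · ext J
      simp only [hΨ, raise_cons, raise_sum_mul]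
    · simp only [Finset.mul_sum, ← mul_assoc]
      rw [Finset.sum_comm]
      simp only [← Finset.sum_mul, h, ite_mul, one_mul, zero_mul, Finset.sum_ite_eq,
        Finset.mem_univ, if_true]

end raise

/-! #### The elimination of the inverse metric -/

section smooth
variable {n : ℕ}

/-- The algebra of functions that are smooth on `W`. -/
def smoothAlg (W : Set (Fin n → ℂ)) : Subalgebra ℂ ((Fin n → ℂ) → ℂ) where
  carrier := {F | Sm W F}
  mul_mem' ha hb := ContDiffOn.mul ha hb
  add_mem' ha hb := ContDiffOn.add ha hb
  algebraMap_mem' _ := contDiffOn_const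

theorem smoothAlg.coe_sum {W : Set (Fin n → ℂ)} {ι : Type} (A : Finset ι) (F : ι → smoothAlg W)
    (x : Fin n → ℂ) : ((∑ i ∈ A, F i : smoothAlg W) : (Fin n → ℂ) → ℂ) x =
      ∑ i ∈ A, (F i : (Fin n → ℂ) → ℂ) x := by
  rw [AddSubmonoidClass.coe_finsetSum, Finset.sum_apply]

theorem smoothAlg.coe_prod {W : Set (Fin n → ℂ)} {ι : Type} (A : Finset ι) (F : ι → smoothAlg W)
    (x : Fin n → ℂ) : ((∏ i ∈ A, F i : smoothAlg W) : (Fin n → ℂ) → ℂ) x =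
      ∏ i ∈ A, (F i : (Fin n → ℂ) → ℂ) x := by
  rw [SubmonoidClass.coe_finsetProd, Finset.prod_apply]

/-- The derivative at the origin. -/
def jetAt {W : Set (Fin n → ℂ)} (hW : IsOpen W) (h0 : (0 : Fin n → ℂ) ∈ W)
    (M : Multiset (Fin n ⊕ Fin n)) : smoothAlg W →ₗ[ℂ] ℂ where
  toFun F := jet M F 0
  map_add' F H := by
    have := jet_sum hW Finset.univ (f := fun b : Bool => if b then (F : (Fin n → ℂ) → ℂ) else H)
      (fun b _ => by cases b <;> simp [show Sm W F from F.2, show Sm W H from H.2]) M h0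
    simp only [Fintype.sum_bool, if_true, Bool.false_eq_true, if_false] at this
    exact this
  map_smul' c F := jet_const_mul hW F.2 c M h0

/-- The derivatives reach at most `card M` factors, so one of the vanishing factors remains
undifferentiated. -/
theorem jet_prod_eq_zero {W : Set (Fin n → ℂ)} (hW : IsOpen W) (h0 : (0 : Fin n → ℂ) ∈ W) {V : Type}
    [Fintype V] {w : V → (Fin n → ℂ) → ℂ} (hw : ∀ v, Sm W (w v)) (M : Multiset (Fin n ⊕ Fin n))
    (A : Finset V) (hA : ∀ v ∈ A, w v 0 = 0) (hM : Multiset.card M < A.card) :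
    jet M (fun y => ∏ v, w v y) 0 = 0 := by
  obtain ⟨Q, _, κ, rfl⟩ := M.exists_eq_sum_singleton
  rw [jet_prod hW hw _ Q rfl κ h0]
  refine Finset.sum_eq_zero fun S _ => ?_
  obtain ⟨v, hv, hS⟩ : ∃ v ∈ A, v ∉ Finset.univ.image S := by
    by_contra! h
    have h1 := (Finset.card_le_card h).trans Finset.card_image_le
    rw [Multiset.card_sum] at hM
    simp at hM h1
    omega
  refine Finset.prod_eq_zero (Finset.mem_univ v) ?_
  rw [Mo_of_forall_ne fun q hq => hS (by simp [← hq]), jet_zero, hA v hv]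

end smooth

namespace PointedGraph
variable {n : ℕ} {g : (Fin n → ℂ) → Matrix (Fin n) (Fin n) ℂ} {W : Set (Fin n → ℂ)}
  {f : (Fin n → ℂ) → ℂ}

/-- The degree count of `exists_eq_one`, keeping track of the number of vertices of in- and
out-degree one; all other ordinary vertices have total degree at least three. -/
theorem PosDeg.card_sub_le {G : PointedGraph} (h : G.PosDeg) {k : ℕ}
    (hE : Fintype.card G.E + 1 = Fintype.card G.V + k) : Fintype.card G.V ≤
      (Finset.univ.filter fun v => v ≠ G.base ∧ G.inDeg v = 1 ∧ G.outDeg v = 1).card + 2 * k + 1 := by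
  let A := Finset.univ.filter fun v => v ≠ G.base ∧ G.inDeg v = 1 ∧ G.outDeg v = 1
  have h1 : ∑ v ∈ Finset.univ.erase G.base, (3 - if v ∈ A then 1 else 0) ≤
      ∑ v ∈ Finset.univ.erase G.base, (G.inDeg v + G.outDeg v) := by
    refine Finset.sum_le_sum fun v hv => ?_
    have h2 := h v (Finset.ne_of_mem_erase hv)
    split_ifs with h3
    · omega
    · have : ¬(G.inDeg v = 1 ∧ G.outDeg v = 1) := fun h4 =>
        h3 (by simp [A, h4, Finset.ne_of_mem_erase hv])
      omega
  have h2 : ∑ v ∈ Finset.univ.erase G.base, (G.inDeg v + G.outDeg v) ≤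
      ∑ v, (G.inDeg v + G.outDeg v) := Finset.sum_le_sum_of_subset (Finset.subset_univ _)
  rw [Finset.sum_add_distrib (s := Finset.univ), G.sum_inDeg, G.sum_outDeg] at h2
  have h3 : (Finset.univ.erase G.base).card * 3 ≤
      ∑ v ∈ Finset.univ.erase G.base, (3 - if v ∈ A then 1 else 0) + A.card := by
    have h4 : ∑ v ∈ Finset.univ.erase G.base, (if v ∈ A then 1 else 0) ≤ A.card := by
      rw [← Finset.sum_filter, Finset.sum_const, smul_eq_mul, mul_one]
      exact Finset.card_le_card fun v hv => (Finset.mem_filter.1 hv).2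
    refine le_trans ?_ (Nat.add_le_add_left h4 _)
    rw [← Finset.sum_add_distrib, ← smul_eq_mul]
    refine Finset.card_nsmul_le_sum _ _ _ fun v _ => ?_
    split_ifs <;> omega
  rw [Finset.card_erase_of_mem (Finset.mem_univ _), Finset.card_univ] at h3
  change _ ≤ A.card + _ + _
  omega

end PointedGraph

namespace PointedGraph
variable {n : ℕ} {g : (Fin n → ℂ) → Matrix (Fin n) (Fin n) ℂ} {W : Set (Fin n → ℂ)}
  {f : (Fin n → ℂ) → ℂ}

/-- The identity matrix, as an array that is supported on the `(1,1)`-vertices. -/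
def corr (P Q : Multiset (Fin n)) : ℂ := if Multiset.card P = 1 ∧ P = Q then 1 else 0

theorem _root_.Sm.ite {F H : (Fin n → ℂ) → ℂ} (hF : Sm W F) : Sm W fun y => if y ∈ W then F y else H y :=
  Sm.congr_on hF fun y hy => by simp [hy]

/-- The derivatives of the metric, minus the identity for `(1,1)`-vertices. -/
def metArr (hW : IsOpen W) (hg : IsKahlerMetricOn g W) (P Q : Multiset (Fin n)) : smoothAlg W :=
  ⟨fun y => if y ∈ W then metricJet g P Q y - corr P Q else 0,
    Sm.ite ((hg.sm_metricJet hW P Q).sub contDiffOn_const)⟩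

/-- The derivatives of the function. -/
def fnArr (hW : IsOpen W) (hf : Sm W f) (P Q : Multiset (Fin n)) : smoothAlg W :=
  ⟨functionJet f P Q, sm_functionJet hW hf P Q⟩

/-- The metric. -/
def lowMat (hg : IsKahlerMetricOn g W) (p j : Fin n) : smoothAlg W :=
  ⟨fun y => if y ∈ W then g y p j else if p = j then 1 else 0, Sm.ite (hg.sm p j)⟩

/-- The inverse metric. -/
def upMat (hg : IsKahlerMetricOn g W) (p j : Fin n) : smoothAlg W :=
  ⟨fun y => if y ∈ W then (g y)⁻¹ p j else if p = j then 1 else 0, Sm.ite (sm_inv hg p j)⟩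

/-- Both matrices are extended by the identity outside `W`, where `g` need not be invertible, since
equality in `smoothAlg W` means equality on the whole space. -/
theorem sum_lowMat_mul_upMat (hg : IsKahlerMetricOn g W) (p q : Fin n) :
    ∑ j, lowMat hg p j * upMat hg j q = if p = q then 1 else 0 := by
  apply Subtype.ext
  ext y
  have h1 : ((if p = q then 1 else 0 : smoothAlg W) : (Fin n → ℂ) → ℂ) y = if p = q then 1 else 0 := by
    split_ifs <;> rfl
  rw [smoothAlg.coe_sum, h1]
  change ∑ j, (if y ∈ W then g y p j else if p = j then 1 else 0) *
    (if y ∈ W then (g y)⁻¹ j q else if j = q then 1 else 0) = _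
  by_cases hy : y ∈ W
  · simp only [if_pos hy]
    rw [← Matrix.mul_apply, Matrix.mul_nonsing_inv _ ((Matrix.isUnit_iff_isUnit_det _).1
      (hg.posDef y hy).isUnit), Matrix.one_apply]
  · simp [if_neg hy]

/-- The arrays of the metric with the holomorphic indices raised. -/
def metArrUp (hW : IsOpen W) (hg : IsKahlerMetricOn g W) (P Q : Multiset (Fin n)) : smoothAlg W :=
  if Multiset.card P = 1 ∧ Multiset.card Q = 1 then metArr hW hg P Q else
    raise (upMat hg) (fun J => ⟨fun y => if y ∈ W then metricJet g J Q y else 0,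
      Sm.ite (hg.sm_metricJet hW J Q)⟩) P

/-- The arrays of the function with the holomorphic indices raised. -/
def fnArrUp (hW : IsOpen W) (hg : IsKahlerMetricOn g W) (hf : Sm W f) (P Q : Multiset (Fin n)) :
    smoothAlg W := raise (upMat hg) (fun J => fnArr hW hf J Q) P

theorem corr_eq_zero {P Q : Multiset (Fin n)} (h : ¬(Multiset.card P = 1 ∧ Multiset.card Q = 1)) :
    corr P Q = 0 := if_neg fun ⟨h1, h2⟩ => h ⟨h1, h2 ▸ h1⟩

/-- The elimination of the vertices of in- and out-degree one. -/
def elimDataUp (hW : IsOpen W) (hg : IsKahlerMetricOn g W) (hf : Sm W f) : ElimData True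
    (metArr hW hg) (fnArr hW hf) (metArrUp hW hg) (fnArrUp hW hg hf) where
  𝒞 := {Ψ | Ψ.2 = raise (upMat hg) Ψ.1}
  -- Here `θ` is the metric minus the identity, so iterating the expansion produces the geometric
  -- series of the inverse metric.
  chain := (linSys_lower (sum_lowMat_mul_upMat hg)).chainSys (fun p j => by
    rw [if_pos (fun _ => Multiset.card_singleton p)]
    apply Subtype.ext
    ext y
    have h1 : ((lowMat hg p j - if p = j then 1 else 0 : smoothAlg W) : (Fin n → ℂ) → ℂ) y =
        (if y ∈ W then g y p j else if p = j then 1 else 0) - if p = j then 1 else 0 := by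
      split_ifs <;> simp_all [lowMat]
    rw [h1]
    change (if y ∈ W then metricJet g {p} {j} y - corr {p} {j} else 0) = _
    split_ifs with hy h2 h2
    all_goals try simp
    all_goals
      have h3 := hg.metricJet_cons hW p j 0 0 hy
      simp only [dirs_zero, jet_zero, Multiset.cons_zero] at h3
      rw [h3]
      simp [corr, h2]) fun B j hB => if_neg fun h => hB (h trivial)
  zero q := by
    apply Subtype.ext
    ext y
    simp [metArr, metricJet_zero_left, corr]
  elim P q hq hP := if_pos ⟨hP trivial, hq⟩
  base q := rfl
  core q _ := ⟨(fun J => ⟨fun y => if y ∈ W then metricJet g J q y else 0,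
      Sm.ite (hg.sm_metricJet hW J q)⟩, raise (upMat hg) fun J => ⟨fun y =>
        if y ∈ W then metricJet g J q y else 0, Sm.ite (hg.sm_metricJet hW J q)⟩),
    (rfl : _ = _), fun P hP => by
    have hP' : ¬(Multiset.card P = 1 ∧ Multiset.card q = 1) := fun h => hP ⟨h.2, fun _ => h.1⟩
    refine ⟨?_, (if_neg hP').symm⟩
    apply Subtype.ext
    ext y
    simp [metArr, corr_eq_zero hP']⟩

/-- Raising the holomorphic end of every edge inserts one factor of the inverse metric per edge, as
in `eval`. The hypothesis is needed because `metArrUp` leaves vertices of in- and out-degree one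
unraised. -/
theorem ev_up (hW : IsOpen W) (hg : IsKahlerMetricOn g W) (hf : Sm W f) {G : PointedGraph}
    (hG : ∀ v, v ≠ G.base → ¬(G.outDeg v = 1 ∧ G.inDeg v = 1)) {y : Fin n → ℂ} (hy : y ∈ W) :
    ((G.ev (metArrUp hW hg) (fnArrUp hW hg hf) : smoothAlg W) : (Fin n → ℂ) → ℂ) y = G.eval g f y := by
  let w : G.V → Multiset (Fin n) → Multiset (Fin n) → smoothAlg W := fun v P Q =>
    if v = G.base then fnArr hW hf P Q else ⟨fun y => if y ∈ W then metricJet g P Q y else 0,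
      Sm.ite (hg.sm_metricJet hW P Q)⟩
  have h1 : ∀ ι : G.E → Fin n, ∏ v, (if v = G.base then fnArrUp hW hg hf else metArrUp hW hg)
      (Mo G.src ι v) (Mo G.tgt ι v) = ∑ κ : G.E → Fin n, (∏ e, upMat hg (ι e) (κ e)) *
        ∏ v, w v (Mo G.src κ v) (Mo G.tgt ι v) := by
    intro ι
    have h2 := LinSys.prod_eq (V := G.V) (fun _ => linSys_raise (upMat hg)) _ G.E rfl G.src ι
      (fun v => (raise (upMat hg) fun P => w v P (Mo G.tgt ι v), fun P => w v P (Mo G.tgt ι v)))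
      (fun _ => rfl)
    refine Eq.trans (Finset.prod_congr rfl fun v _ => ?_) h2
    by_cases hv : v = G.base
    · simp only [w, if_pos hv]; rfl
    · simp only [w, if_neg hv]
      exact if_neg fun h => hG v hv ⟨(outDeg_eq_card G ι v).trans h.1, (inDeg_eq_card G ι v).trans h.2⟩
  have h3 : G.ev (metArrUp hW hg) (fnArrUp hW hg hf) = ∑ ι : G.E → Fin n, ∑ κ : G.E → Fin n,
      (∏ e, upMat hg (ι e) (κ e)) * ∏ v, w v (Mo G.src κ v) (Mo G.tgt ι v) :=
    Finset.sum_congr rfl fun ι _ => h1 ι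
  rw [h3, Finset.sum_comm, smoothAlg.coe_sum, eval_eq_sum]
  refine Finset.sum_congr rfl fun κ _ => ?_
  rw [smoothAlg.coe_sum]
  refine Finset.sum_congr rfl fun ι _ => ?_
  rw [MulMemClass.coe_mul, Pi.mul_apply, smoothAlg.coe_prod, smoothAlg.coe_prod]
  congr 1
  · exact Finset.prod_congr rfl fun e _ => if_pos hy
  · refine Finset.prod_congr rfl fun v _ => ?_
    by_cases hv : v = G.base
    · simp only [w, if_pos hv]; rfl
    · simp only [w, if_neg hv]
      exact if_pos hy

/-- Every vertex of in- and out-degree one contributes an entry of the metric minus the identity,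
which vanishes at the origin. -/
theorem jetAt_ev_up_eq_zero (hW : IsOpen W) (h0 : (0 : Fin n → ℂ) ∈ W) (hg : IsKahlerMetricOn g W)
    (hf : Sm W f) (h1 : g 0 = 1) {G : PointedGraph} (M : Multiset (Fin n ⊕ Fin n))
    (hM : Multiset.card M <
      (Finset.univ.filter fun v => v ≠ G.base ∧ G.inDeg v = 1 ∧ G.outDeg v = 1).card) :
    jetAt hW h0 M (G.ev (metArrUp hW hg) (fnArrUp hW hg hf)) = 0 := by
  unfold ev
  rw [map_sum]
  refine Finset.sum_eq_zero fun ι _ => ?_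
  have h2 : jetAt hW h0 M (∏ v, (if v = G.base then fnArrUp hW hg hf else metArrUp hW hg)
      (Mo G.src ι v) (Mo G.tgt ι v)) = jet M (fun y => ∏ v, (((if v = G.base then
        fnArrUp hW hg hf else metArrUp hW hg) (Mo G.src ι v) (Mo G.tgt ι v) : smoothAlg W) :
          (Fin n → ℂ) → ℂ) y) 0 := by
    refine congrArg (fun F => jet M F 0) ?_
    ext y
    rw [smoothAlg.coe_prod]
  rw [h2]
  refine jet_prod_eq_zero hW h0 (fun v => ((if v = G.base then fnArrUp hW hg hf else
    metArrUp hW hg) (Mo G.src ι v) (Mo G.tgt ι v)).2) M _ (fun v hv => ?_) hM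
  obtain ⟨hv, hi, ho⟩ := (Finset.mem_filter.1 hv).2
  obtain ⟨p, hp⟩ := Multiset.card_eq_one.1 ((outDeg_eq_card G ι v).symm.trans ho)
  obtain ⟨q, hq⟩ := Multiset.card_eq_one.1 ((inDeg_eq_card G ι v).symm.trans hi)
  rw [if_neg hv, hp, hq, metArrUp, if_pos ⟨Multiset.card_singleton _, Multiset.card_singleton _⟩]
  have h3 := hg.metricJet_cons hW p q 0 0 h0
  simp only [dirs_zero, jet_zero, Multiset.cons_zero] at h3
  change (if (0 : Fin n → ℂ) ∈ W then metricJet g {p} {q} 0 - corr {p} {q} else 0) = 0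
  rw [if_pos h0, h3, h1, corr, Matrix.one_apply]
  simp

/-- The third elimination, under the derivative `M`: the inverse metric disappears from the edges,
while vertices of in- and out-degree one are admitted. The bound on `T` suffices because more than
`card M + 2k` ordinary vertices force more than `card M` vanishing factors. -/
theorem jet_semiSum (c : IsoClass → ℂ) (hW : IsOpen W) (h0 : (0 : Fin n → ℂ) ∈ W)
    (hg : IsKahlerMetricOn g W) (hf : Sm W f) (h1 : g 0 = 1) {k T : ℕ}
    (M : Multiset (Fin n ⊕ Fin n)) (hT : Multiset.card M + 2 * k ≤ T) :
    jet M (semiSum c k g f) 0 = ∑ a ∈ Finset.range (T + 1), (-1) ^ a * tot a (a + k) (fun G =>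
      stabCoeff c G * jetAt hW h0 M (G.ev (metArr hW hg) (fnArr hW hf))) := by
  rw [sum_tot_elim (elimDataUp hW hg hf) (isStabCoeff_stabCoeff c) (jetAt hW h0 M) k T
    fun G hG hV hE => jetAt_ev_up_eq_zero hW h0 hg hf h1 M (by
      have := (stabCoeff_posDeg hG).card_sub_le hE
      omega)]
  have hsm : ∀ G : PointedGraph, Sm W fun y =>
      if G.IsSemistable then stabCoeff c G * G.eval g f y else 0 := fun G => by
    split_ifs
    · exact contDiffOn_const.mul (sm_eval hW hg hf G)
    · exact contDiffOn_const
  have hjet : jet M (semiSum c k g f) 0 = ∑ a ∈ Finset.range (2 * k + 1), (-1) ^ a *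
      tot a (a + k) fun G => jet M (fun y =>
        if G.IsSemistable then stabCoeff c G * G.eval g f y else 0) 0 := by
    unfold semiSum tot
    rw [jet_sum hW _ (fun a _ => contDiffOn_const.mul (contDiffOn_const.mul
      (Sm.sum fun s _ => Sm.sum fun t _ => hsm _))) _ h0]
    refine Finset.sum_congr rfl fun a _ => ?_
    refine (jet_const_mul hW (contDiffOn_const.mul
      (Sm.sum fun s _ => Sm.sum fun t _ => hsm _)) _ _ h0).trans (congrArg _ ?_)
    refine (jet_const_mul hW (Sm.sum fun s _ => Sm.sum fun t _ => hsm _) _ _ h0).trans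
      (congrArg _ ?_)
    refine (jet_sum hW _ (fun s _ => Sm.sum fun t _ => hsm _) _ h0).trans
      (Finset.sum_congr rfl fun s _ => ?_)
    exact jet_sum hW _ (fun t _ => hsm _) _ h0
  -- A graph with positive degrees is semistable exactly if it has no ordinary vertex of in- and
  -- out-degree one.
  have hterm : ∀ G : PointedGraph, jet M (fun y =>
      if G.IsSemistable then stabCoeff c G * G.eval g f y else 0) 0 =
      if ∃ v, elimV True G v then 0 else stabCoeff c G *
        jetAt hW h0 M (G.ev (metArrUp hW hg) (fnArrUp hW hg hf)) := by
    intro G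
    by_cases hc : stabCoeff c G = 0
    · simp [hc, jet_const_zero]
    have hp := stabCoeff_posDeg hc
    by_cases hs : G.IsSemistable
    · simp only [if_pos hs]
      rw [if_neg, jet_const_mul hW (sm_eval hW hg hf G) _ _ h0]
      · refine congrArg _ (jet_congr_on hW (fun y hy => ?_) M h0)
        exact (ev_up hW hg hf (fun v hv h => by have := hs v hv; omega) hy).symm
      · rintro ⟨v, hv, h2, h3⟩
        have := hs v hv
        have := h3 trivial
        omega
    · simp only [if_neg hs, jet_const_zero]
      rw [if_pos]
      by_contra h
      refine hs fun v hv => ?_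
      have h2 := hp v hv
      have h3 : ¬(G.inDeg v = 1 ∧ G.outDeg v = 1) := fun h4 => h ⟨v, hv, h4.1, fun _ => h4.2⟩
      omega
  rw [hjet]
  have e1 : ∀ a, (-1 : ℂ) ^ a * tot a (a + k) (fun G => jet M (fun y =>
      if G.IsSemistable then stabCoeff c G * G.eval g f y else 0) 0) = (-1) ^ a *
      tot a (a + k) fun G => if ∃ v, elimV True G v then 0 else stabCoeff c G *
        jetAt hW h0 M (G.ev (metArrUp hW hg) (fnArrUp hW hg hf)) := fun a =>
    congrArg _ (tot_congr fun G _ _ => hterm G)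
  simp only [e1]
  refine Finset.sum_subset (Finset.range_mono (by omega)) fun a _ ha => ?_
  have h2 : tot a (a + k) (fun G => if ∃ v, elimV True G v then 0 else stabCoeff c G *
      jetAt hW h0 M (G.ev (metArrUp hW hg) (fnArrUp hW hg hf))) = tot a (a + k) fun _ => 0 := by
    refine tot_congr fun G hV hE => ?_
    by_cases hc : stabCoeff c G = 0
    · simp [hc]
    obtain ⟨v, hv, h3, h4⟩ := (stabCoeff_posDeg hc).exists_eq_one (k := k) (by omega)
      (by rw [Finset.mem_range] at ha; omega)
    exact if_pos ⟨v, hv, h3, fun _ => h4⟩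
  rw [h2]
  simp [tot]

end PointedGraph

/-- Congruence of `ite` in the condition, for arbitrary instances. -/
theorem ite_congr_inst {α : Type*} {p q : Prop} {_ : Decidable p} {_ : Decidable q} (h : p ↔ q)
    {x y : α} : (if p then x else y) = if q then x else y := by
  by_cases hp : p
  · rw [if_pos hp, if_pos (h.1 hp)]
  · rw [if_neg hp, if_neg fun hq => hp (h.2 hq)]

/-! ### Attaching outer edges to the vertices of an inner graph -/

section splice
variable {E V X : Type} [Fintype E] [Fintype V] [Fintype X]

/-- The map to `V ⊕ X` that sends the elements with `s e = none` to `X` by means of `R` and agrees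
with `s` elsewhere. -/
def splice (s : E → Option V) (R : {e // s e = none} → X) (e : E) : V ⊕ X :=
  if h : s e = none then Sum.inr (R ⟨e, h⟩) else Sum.inl ((s e).get (Option.isSome_iff_ne_none.2 h))

omit [Fintype E] [Fintype V] [Fintype X] in
theorem splice_inl_iff (s : E → Option V) (R : {e // s e = none} → X) (e : E) (v : V) :
    splice s R e = Sum.inl v ↔ s e = some v := by
  unfold splice
  split_ifs with h
  · simp [h]
  · obtain ⟨w, hw⟩ := Option.ne_none_iff_exists'.1 h
    simp [hw]

omit [Fintype E] [Fintype V] [Fintype X] in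
theorem getLeft?_splice (s : E → Option V) (R : {e // s e = none} → X) (e : E) :
    (splice s R e).getLeft? = s e := by
  unfold splice
  split_ifs with h <;> simp [h]

theorem sum_splice (s : E → Option V) (φ : (E → V ⊕ X) → ℂ) :
    ∑ R : {e // s e = none} → X, φ (splice s R) =
      ∑ S : E → V ⊕ X, if ∀ e, (S e).getLeft? = s e then φ S else 0 := by
  rw [← Finset.sum_filter]
  refine Finset.sum_nbij (splice s) (fun R _ => ?_) (fun R _ R' _ h => ?_) (fun S hS => ?_)
    fun _ _ => rfl
  · simp [getLeft?_splice]
  · ext ⟨e, he⟩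
    have := congrFun h e
    simpa [splice, he] using this
  · have hS' : ∀ e, (S e).getLeft? = s e := by simpa using hS
    have h1 : ∀ e : {e // s e = none}, ∃ x, S e = Sum.inr x := fun e => by
      have := hS' e
      rw [e.2, Sum.getLeft?_eq_none_iff, Sum.isRight_iff] at this
      exact this
    choose R hR using h1
    refine ⟨R, by simp, ?_⟩
    ext1 e
    by_cases he : s e = none
    · rw [splice, dif_pos he, hR ⟨e, he⟩]
    · obtain ⟨v, hv⟩ := Option.ne_none_iff_exists'.1 he
      have h2 := hS' e
      rw [hv, Sum.getLeft?_eq_some_iff] at h2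
      rw [h2, splice_inl_iff, hv]

theorem Mo_splice_inl {I : Type} (s : E → Option V) (R : {e // s e = none} → X) (ι : E → I) (v : V) :
    Mo (splice s R) ι (Sum.inl v) = Mo s ι (some v) :=
  Finset.sum_congr rfl fun e _ => ite_congr_inst (splice_inl_iff s R e v)

theorem Mo_splice_inr {I : Type} (s : E → Option V) (R : {e // s e = none} → X) (ι : E → I) (x : X) :
    Mo (splice s R) ι (Sum.inr x) = Mo R (fun e => ι e) x := by
  unfold Mo
  refine (Fintype.sum_subtype_add_sum_subtype (fun e => s e = none) _).symm.trans
    ((congrArg₂ (· + ·) (PointedGraph.sum_congr_inst fun e => ?_)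
      (Finset.sum_eq_zero fun e _ => if_neg ?_)).trans (add_zero _)) <;> simp [splice, e.2]

theorem Mo_none_eq_sum {I : Type} (s : E → Option V) (ι : E → I) :
    Mo s ι none = ∑ e : {e // s e = none}, {ι e} := by
  unfold Mo
  exact (Fintype.sum_subtype_add_sum_subtype (fun e => s e = none) _).symm.trans
    ((congrArg₂ (· + ·) (PointedGraph.sum_congr_inst fun e => if_pos e.2)
      (Finset.sum_eq_zero fun e _ => if_neg e.2)).trans (add_zero _))

end splice

namespace PointedGraph

/-- The pointed graph that contains `B` as a pointed subgraph, with the additional vertices `V` and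
the additional edges `E`. -/
@[reducible] def wrap (B : PointedGraph) {V E : Type} [Fintype V] [Fintype E]
    (S T : E → V ⊕ B.V) : PointedGraph :=
  gr (Sum.inr B.base) (Sum.elim S (Sum.inr ∘ B.src)) (Sum.elim T (Sum.inr ∘ B.tgt))

section wrap
variable {V E : Type} [Fintype V] [Fintype E] {n : ℕ} {R : Type} [CommRing R]

theorem Mo_elim_inl {B X I : Type} [Fintype B] (S : E → V ⊕ X) (s : B → X) (ι : E ⊕ B → I) (v : V) :
    Mo (Sum.elim S (Sum.inr ∘ s)) ι (Sum.inl v) = Mo S (ι ∘ Sum.inl) (Sum.inl v) := by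
  rw [Mo_sum, Mo_of_forall_ne (s := Sum.elim S (Sum.inr ∘ s) ∘ Sum.inr) (by simp), add_zero]
  rfl

theorem Mo_elim_inr {B X I : Type} [Fintype B] (S : E → V ⊕ X) (s : B → X) (ι : E ⊕ B → I) (x : X) :
    Mo (Sum.elim S (Sum.inr ∘ s)) ι (Sum.inr x) =
      Mo S (ι ∘ Sum.inl) (Sum.inr x) + Mo s (ι ∘ Sum.inr) x := by
  rw [Mo_sum, ← Mo_injective (Sum.inr_injective (α := V)) s]
  rfl

theorem ev_wrap (B : PointedGraph) (S T : E → V ⊕ B.V)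
    (lam F : Multiset (Fin n) → Multiset (Fin n) → R) :
    (B.wrap S T).ev lam F = ∑ ι₁ : E → Fin n, ∑ ι₂ : B.E → Fin n,
      (∏ v : V, lam (Mo S ι₁ (Sum.inl v)) (Mo T ι₁ (Sum.inl v))) *
        ∏ v : B.V, (if v = B.base then F else lam) (Mo S ι₁ (Sum.inr v) + Mo B.src ι₂ v)
          (Mo T ι₁ (Sum.inr v) + Mo B.tgt ι₂ v) := by
  rw [← Fintype.sum_prod_type']
  unfold ev
  refine sum_equiv_inst (Equiv.sumArrowEquivProdArrow E B.E (Fin n)) _ _ fun ι => ?_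
  refine (Fintype.prod_sum_type _).trans ?_
  congr 1
  · refine Finset.prod_congr rfl fun v _ => ?_
    rw [if_neg (by simp), Mo_elim_inl, Mo_elim_inl]
    rfl
  · refine Finset.prod_congr rfl fun v _ => ?_
    rw [Mo_elim_inr, Mo_elim_inr]
    simp only [Sum.inr.injEq]
    rfl

theorem outDeg_wrap_inl (B : PointedGraph) (S T : E → V ⊕ B.V) (v : V) :
    (B.wrap S T).outDeg (Sum.inl v) =
      (gr none (fun e => (S e).getLeft?) fun e => (T e).getLeft?).outDeg (some v) := by
  rw [outDeg_eq_card _ (fun _ => ()), outDeg_eq_card _ (fun _ => ()), Mo_elim_inl]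
  exact congrArg _ (Finset.sum_congr rfl fun e _ => ite_congr_inst Sum.getLeft?_eq_some_iff.symm)

theorem inDeg_wrap_inl (B : PointedGraph) (S T : E → V ⊕ B.V) (v : V) :
    (B.wrap S T).inDeg (Sum.inl v) =
      (gr none (fun e => (S e).getLeft?) fun e => (T e).getLeft?).inDeg (some v) := by
  rw [inDeg_eq_card _ (fun _ => ()), inDeg_eq_card _ (fun _ => ()), Mo_elim_inl]
  exact congrArg _ (Finset.sum_congr rfl fun e _ => ite_congr_inst Sum.getLeft?_eq_some_iff.symm)

theorem outDeg_wrap_inr (B : PointedGraph) (S T : E → V ⊕ B.V) (v : B.V) :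
    B.outDeg v ≤ (B.wrap S T).outDeg (Sum.inr v) := by
  rw [outDeg_eq_card _ (fun _ => ()), outDeg_eq_card _ (fun _ => ()), Mo_elim_inr, Multiset.card_add]
  exact Nat.le_add_left _ _

theorem inDeg_wrap_inr (B : PointedGraph) (S T : E → V ⊕ B.V) (v : B.V) :
    B.inDeg v ≤ (B.wrap S T).inDeg (Sum.inr v) := by
  rw [inDeg_eq_card _ (fun _ => ()), inDeg_eq_card _ (fun _ => ()), Mo_elim_inr, Multiset.card_add]
  exact Nat.le_add_left _ _

theorem IsStable.of_wrap {B : PointedGraph} {S T : E → V ⊕ B.V} (h : (B.wrap S T).IsStable) :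
    (gr none (fun e => (S e).getLeft?) fun e => (T e).getLeft?).IsStable := by
  rintro (_ | v) hv
  · exact absurd rfl hv
  · rw [← outDeg_wrap_inl, ← inDeg_wrap_inl]
    exact h _ (by simp)

theorem PosDeg.wrap {B : PointedGraph} (hB : B.PosDeg) {S T : E → V ⊕ B.V}
    (h : (gr none (fun e => (S e).getLeft?) fun e => (T e).getLeft?).PosDeg) :
    (B.wrap S T).PosDeg := by
  rintro (v | v) hv
  · rw [outDeg_wrap_inl, inDeg_wrap_inl]
    exact h _ (by simp)
  · have h1 := hB v fun h2 => hv (by rw [h2])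
    exact ⟨h1.1.trans (inDeg_wrap_inr B S T v), h1.2.trans (outDeg_wrap_inr B S T v)⟩

end wrap

section jets
variable {n : ℕ} {g : (Fin n → ℂ) → Matrix (Fin n) (Fin n) ℂ} {W : Set (Fin n → ℂ)}
  {f : (Fin n → ℂ) → ℂ}

/-- The derivatives of the metric at the origin, minus the identity for `(1,1)`-vertices. -/
def metVal (g : (Fin n → ℂ) → Matrix (Fin n) (Fin n) ℂ) (P Q : Multiset (Fin n)) : ℂ :=
  metricJet g P Q 0 - corr P Q

/-- The derivatives of the function at the origin. -/
def fnVal (f : (Fin n → ℂ) → ℂ) (P Q : Multiset (Fin n)) : ℂ := functionJet f P Q 0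

theorem jet_fnArr (hW : IsOpen W) (h0 : (0 : Fin n → ℂ) ∈ W) (hf : Sm W f)
    (A B P Q : Multiset (Fin n)) :
    jet (dirs A B) (fnArr hW hf P Q : (Fin n → ℂ) → ℂ) 0 = fnVal f (A + P) (B + Q) := by
  unfold fnVal
  rw [functionJet_eq_jet hW hf _ _ h0, dirs_add, jet_add hW hf _ _ h0]
  exact jet_congr_on hW (functionJet_eq_jet hW hf P Q) _ h0

/-- The correction `corr` is constant and lives on arrays with one index of each kind; any
derivative kills it on the left and adds an index on the right, where it is then zero. -/
theorem jet_metArr (hW : IsOpen W) (h0 : (0 : Fin n → ℂ) ∈ W) (hg : IsKahlerMetricOn g W)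
    (A B : Multiset (Fin n)) {P Q : Multiset (Fin n)} (hP : P ≠ 0) (hQ : Q ≠ 0) :
    jet (dirs A B) (metArr hW hg P Q : (Fin n → ℂ) → ℂ) 0 = metVal g (A + P) (B + Q) := by
  have hs := hg.sm_metricJet hW P Q
  have h1 : jet (dirs A B) (metArr hW hg P Q : (Fin n → ℂ) → ℂ) 0 =
      jet (dirs A B) (metricJet g P Q) 0 - jet (dirs A B) (fun _ => corr P Q) 0 := by
    refine (jet_congr_on hW (h := fun y => metricJet g P Q y - corr P Q)
      (fun y hy => if_pos hy) _ h0).trans ?_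
    exact map_sub (jetAt hW h0 (dirs A B)) ⟨_, hs⟩ ⟨fun _ => corr P Q, contDiffOn_const⟩
  rw [h1, hg.jet_metricJet hW hP hQ A B h0, metVal]
  congr 1
  by_cases h2 : dirs A B = 0
  · have h3 : A = 0 ∧ B = 0 := by simpa [dirs] using h2
    rw [h2, jet_zero, h3.1, h3.2, zero_add, zero_add]
  · rw [jet_const _ h2, corr_eq_zero]
    rw [Multiset.card_add, Multiset.card_add]
    have h3 := Multiset.card_pos.2 hP
    have h4 := Multiset.card_pos.2 hQ
    have h5 := Multiset.card_pos.2 h2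
    simp only [dirs, Multiset.card_add, Multiset.card_map] at h5
    omega

/-- The edges of `B` are contracted with constants, so the Leibniz rule distributes the derivatives
over the vertices of `B` only. Choosing a vertex for each derivative amounts to choosing an end
point for each edge from outside. -/
theorem jetAt_ev (hW : IsOpen W) (h0 : (0 : Fin n → ℂ) ∈ W) (hg : IsKahlerMetricOn g W)
    (hf : Sm W f) {B : PointedGraph} (hB : B.PosDeg) {L₁ L₂ : Type} [Fintype L₁] [Fintype L₂]
    (κ₁ : L₁ → Fin n) (κ₂ : L₂ → Fin n) :
    jetAt hW h0 (dirs (∑ q, {κ₁ q}) (∑ q, {κ₂ q})) (B.ev (metArr hW hg) (fnArr hW hf)) =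
      ∑ ι : B.E → Fin n, ∑ R₁ : L₁ → B.V, ∑ R₂ : L₂ → B.V,
        ∏ v, (if v = B.base then fnVal f else metVal g) (Mo R₁ κ₁ v + Mo B.src ι v)
          (Mo R₂ κ₂ v + Mo B.tgt ι v) := by
  have hd : dirs (∑ q, {κ₁ q}) (∑ q, {κ₂ q}) =
      ∑ q, {Sum.elim (Sum.inl ∘ κ₁) (Sum.inr ∘ κ₂) q} := by
    rw [Fintype.sum_sum_type]
    unfold dirs
    congr 1 <;> simp [← Multiset.coe_mapAddMonoidHom, map_sum]
  unfold ev
  rw [map_sum]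
  refine Finset.sum_congr rfl fun ι _ => ?_
  have h2 : jetAt hW h0 (dirs (∑ q, {κ₁ q}) (∑ q, {κ₂ q})) (∏ v, (if v = B.base then fnArr hW hf
      else metArr hW hg) (Mo B.src ι v) (Mo B.tgt ι v)) = jet (dirs (∑ q, {κ₁ q}) (∑ q, {κ₂ q}))
        (fun y => ∏ v, (((if v = B.base then fnArr hW hf else metArr hW hg)
          (Mo B.src ι v) (Mo B.tgt ι v) : smoothAlg W) : (Fin n → ℂ) → ℂ) y) 0 := by
    refine congrArg (fun F => jet _ F 0) ?_
    ext y
    rw [smoothAlg.coe_prod]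
  rw [h2, hd, jet_prod hW (fun v => ((if v = B.base then fnArr hW hf else metArr hW hg)
    (Mo B.src ι v) (Mo B.tgt ι v)).2) _ _ rfl _ h0, ← Fintype.sum_prod_type']
  refine sum_equiv_inst (Equiv.sumArrowEquivProdArrow L₁ L₂ B.V) _ _ fun R => ?_
  refine Finset.prod_congr rfl fun v _ => ?_
  have h3 : Mo R (Sum.elim (Sum.inl ∘ κ₁) (Sum.inr ∘ κ₂)) v =
      dirs (Mo (R ∘ Sum.inl) κ₁ v) (Mo (R ∘ Sum.inr) κ₂ v) := by
    rw [Mo_sum, dirs, Mo_map, Mo_map]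
    rfl
  rw [h3]
  by_cases hv : v = B.base
  · simp only [if_pos hv]
    exact jet_fnArr hW h0 hf _ _ _ _
  · simp only [if_neg hv]
    refine jet_metArr hW h0 hg _ _ ?_ ?_
    · rw [← Multiset.card_pos, ← outDeg_eq_card]
      exact (hB v hv).2
    · rw [← Multiset.card_pos, ← inDeg_eq_card]
      exact (hB v hv).1

theorem metVal_eq_metricJet {P : Multiset (Fin n)} (hP : 2 ≤ Multiset.card P) (Q : Multiset (Fin n)) :
    metricJet g P Q 0 = metVal g P Q := by
  rw [metVal, corr_eq_zero (by omega), sub_zero]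

/-- The corrected array vanishes at vertices of in- or out-degree one, by normality, so unstable
graphs contribute nothing. -/
theorem ev_metVal {N : ℕ} (hN : IsNormalAt N g) (hW : IsOpen W) (h0 : (0 : Fin n → ℂ) ∈ W)
    (hg : IsKahlerMetricOn g W) {G : PointedGraph} (hG : G.PosDeg) (hE : Fintype.card G.E ≤ N + 1) :
    G.ev (metVal g) (fnVal f) = if G.IsStable then G.eval g f 0 else 0 := by
  have h1 : ∀ P q, Multiset.card P ≤ N + 1 → metVal g P {q} = 0 := fun P q hP => by
    rw [metVal, hN.metricJet_eq hW h0 hg P hP q, corr]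
    by_cases h : P = {q} <;> simp [h]
  have h2 : ∀ p Q, Multiset.card Q ≤ N + 1 → metVal g {p} Q = 0 := fun p Q hQ => by
    rw [metVal, hg.metricJet_conj hW _ _ h0]
    dsimp only
    rw [hN.metricJet_eq hW h0 hg Q hQ p, corr]
    by_cases h : Q = {p}
    · simp [h]
    · simp [h, Ne.symm h]
  split_ifs with h
  · rw [eval_eq_ev G hN.one]
    exact ev_congr (fun v hv P Q hP _ => (metVal_eq_metricJet (by have := h v hv; omega) Q).symm)
      fun _ _ => rfl
  · unfold IsStable at h
    push Not at h
    obtain ⟨v, hv, h3⟩ := h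
    have h4 := hG v hv
    have h5 := G.inDeg_le v
    have h6 := G.outDeg_le v
    refine ev_eq_zero hv fun P Q hP hQ => ?_
    by_cases h7 : G.inDeg v = 1
    · obtain ⟨q, rfl⟩ := Multiset.card_eq_one.1 (hQ.trans h7)
      exact h1 _ _ (by omega)
    · obtain ⟨p, rfl⟩ := Multiset.card_eq_one.1 (hP.trans (by have := h3 (by omega); omega))
      exact h2 _ _ (by omega)

/-- This is where composition becomes gluing of graphs. Each edge end at the distinguished vertex of
the outer graph is a derivative of `semiSum`; by `jet_semiSum` and `jetAt_ev` it is attached to a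
vertex of an inner graph `B`. A loop has both ends there, so up to `2 * card E` derivatives occur;
`hTN` bounds the number of edges of the glued graph. -/
theorem eval_semiSum (c : IsoClass → ℂ) (hW : IsOpen W) (h0 : (0 : Fin n → ℂ) ∈ W)
    (hg : IsKahlerMetricOn g W) (hf : Sm W f) {k T N : ℕ} (hN : IsNormalAt N g)
    {V E : Type} [Fintype V] [Fintype E] {s t : E → Option V} (hA : (gr none s t).IsStable)
    (hT : 2 * Fintype.card E + 2 * k ≤ T) (hTN : Fintype.card E + T + k ≤ N) :
    (gr none s t).eval g (semiSum c k g f) 0 = ∑ a ∈ Finset.range (T + 1), (-1) ^ a *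
      tot a (a + k) fun B => stabCoeff c B * ∑ S : E → V ⊕ B.V, ∑ T : E → V ⊕ B.V,
        if (∀ e, (S e).getLeft? = s e) ∧ ∀ e, (T e).getLeft? = t e then
          if (B.wrap S T).IsStable then (B.wrap S T).eval g f 0 else 0 else 0 := by
  have hs := sm_semiSum c k hW hg hf
  have h1 : (gr none s t).eval g (semiSum c k g f) 0 = ∑ ι : E → Fin n,
      (∏ v : V, metVal g (Mo s ι (some v)) (Mo t ι (some v))) *
        ∑ a ∈ Finset.range (T + 1), (-1) ^ a * tot a (a + k) (fun B => stabCoeff c B *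
          jetAt hW h0 (dirs (Mo s ι none) (Mo t ι none)) (B.ev (metArr hW hg) (fnArr hW hf))) := by
    rw [eval_eq_ev _ hN.one]
    refine (ev_congr (lam' := metVal g) (F' := fnVal (semiSum c k g f))
      (fun v hv P Q hP _ => metVal_eq_metricJet (hP ▸ (hA v hv).2) Q)
      fun _ _ => rfl).trans ?_
    refine Finset.sum_congr rfl fun ι _ => ?_
    refine (Fintype.prod_option _).trans ?_
    rw [if_pos rfl, mul_comm]
    congr 1
    · exact Finset.prod_congr rfl fun v _ => by rw [if_neg (by simp)]
    unfold fnVal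
    rw [functionJet_eq_jet hW hs _ _ h0, jet_semiSum c hW h0 hg hf hN.one]
    rw [dirs, Multiset.card_add, Multiset.card_map, Multiset.card_map, card_Mo, card_Mo]
    exact le_trans (Nat.add_le_add_right ((add_le_add (Finset.card_le_univ _)
      (Finset.card_le_univ _)).trans (two_mul _).ge) _) hT
  rw [h1, Finset.sum_congr rfl fun ι _ => Finset.mul_sum _ _ _, Finset.sum_comm]
  refine Finset.sum_congr rfl fun a ha => ?_
  have h2 : ∀ (z w : ℂ) (φ : PointedGraph → ℂ), z * (w * tot a (a + k) φ) =
      w * tot a (a + k) fun B => z * φ B := fun z w φ => by rw [tot_const_mul]; ring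
  simp only [h2]
  rw [← Finset.mul_sum, ← tot_sum]
  refine congrArg _ (tot_congr fun B hV hE => ?_)
  by_cases hc : stabCoeff c B = 0
  · simp [hc]
  have hB := stabCoeff_posDeg hc
  have h3 : ∀ ι : E → Fin n, (∏ v : V, metVal g (Mo s ι (some v)) (Mo t ι (some v))) *
      jetAt hW h0 (dirs (Mo s ι none) (Mo t ι none)) (B.ev (metArr hW hg) (fnArr hW hf)) =
      ∑ R₁ : {e // s e = none} → B.V, ∑ R₂ : {e // t e = none} → B.V, ∑ ι₂ : B.E → Fin n,
        (∏ v : V, metVal g (Mo (splice s R₁) ι (Sum.inl v)) (Mo (splice t R₂) ι (Sum.inl v))) *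
        ∏ v : B.V, (if v = B.base then fnVal f else metVal g)
          (Mo (splice s R₁) ι (Sum.inr v) + Mo B.src ι₂ v)
          (Mo (splice t R₂) ι (Sum.inr v) + Mo B.tgt ι₂ v) := by
    intro ι
    rw [Mo_none_eq_sum, Mo_none_eq_sum, jetAt_ev hW h0 hg hf hB]
    simp only [Mo_splice_inl, Mo_splice_inr, ← Finset.mul_sum]
    congr 1
    rw [Finset.sum_comm]
    refine sum_congr_inst fun R₁ => ?_
    rw [Finset.sum_comm]
    exact sum_congr_inst fun R₂ => rfl
  have h4 : ∀ (S₁ : E → V ⊕ B.V) (T₁ : E → V ⊕ B.V),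
      (if (∀ e, (S₁ e).getLeft? = s e) ∧ ∀ e, (T₁ e).getLeft? = t e then
        if (B.wrap S₁ T₁).IsStable then (B.wrap S₁ T₁).eval g f 0 else 0 else 0) =
      if ∀ e, (S₁ e).getLeft? = s e then if ∀ e, (T₁ e).getLeft? = t e then
        (B.wrap S₁ T₁).ev (metVal g) (fnVal f) else 0 else 0 := by
    intro S₁ T₁
    rw [ite_and]
    split_ifs with h5 h6 h7
    all_goals try rfl
    all_goals
      obtain rfl := funext h5
      obtain rfl := funext h6
      rw [ev_metVal hN hW h0 hg (hB.wrap hA.posDeg)]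
      · simp [h7]
      · rw [Finset.mem_range] at ha
        simp only [Fintype.card_sum]
        omega
  have h5 : ∀ S₁ : E → V ⊕ B.V, (∑ T₁ : E → V ⊕ B.V, if ∀ e, (S₁ e).getLeft? = s e then
      if ∀ e, (T₁ e).getLeft? = t e then (B.wrap S₁ T₁).ev (metVal g) (fnVal f) else 0 else 0) =
      if ∀ e, (S₁ e).getLeft? = s e then ∑ R₂ : {e // t e = none} → B.V,
        (B.wrap S₁ (splice t R₂)).ev (metVal g) (fnVal f) else 0 := fun S₁ => by
    split_ifs
    · exact (sum_splice t fun T₁ => (B.wrap S₁ T₁).ev (metVal g) (fnVal f)).symm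
    · simp
  have h4' : (∑ S₁ : E → V ⊕ B.V, ∑ T₁ : E → V ⊕ B.V,
      if (∀ e, (S₁ e).getLeft? = s e) ∧ ∀ e, (T₁ e).getLeft? = t e then
        if (B.wrap S₁ T₁).IsStable then (B.wrap S₁ T₁).eval g f 0 else 0 else 0) =
      ∑ S₁ : E → V ⊕ B.V, ∑ T₁ : E → V ⊕ B.V, if ∀ e, (S₁ e).getLeft? = s e then
        if ∀ e, (T₁ e).getLeft? = t e then (B.wrap S₁ T₁).ev (metVal g) (fnVal f) else 0 else 0 :=
    Finset.sum_congr rfl fun S₁ _ => Finset.sum_congr rfl fun T₁ _ => h4 S₁ T₁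
  rw [h4', Finset.sum_congr rfl fun S₁ _ => h5 S₁]
  rw [← sum_splice s fun S₁ => ∑ R₂ : {e // t e = none} → B.V,
    (B.wrap S₁ (splice t R₂)).ev (metVal g) (fnVal f)]
  have h6 : ∀ ι : E → Fin n, (∏ v : V, metVal g (Mo s ι (some v)) (Mo t ι (some v))) *
      (stabCoeff c B * jetAt hW h0 (dirs (Mo s ι none) (Mo t ι none))
        (B.ev (metArr hW hg) (fnArr hW hf))) = stabCoeff c B * _ := fun ι =>
    (mul_left_comm _ _ _).trans (congrArg _ (h3 ι))
  rw [Finset.sum_congr rfl fun ι _ => h6 ι, ← Finset.mul_sum, Finset.sum_comm]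
  refine congrArg _ (Finset.sum_congr rfl fun R₁ _ => ?_)
  rw [Finset.sum_comm]
  exact Finset.sum_congr rfl fun R₂ _ => (ev_wrap B _ _ _ _).symm

end jets

end PointedGraph

/-! ### Graphs with a marked pointed subgraph -/

theorem exists_equiv_sum_mem {L M α : Type} [Fintype L] [Fintype M] [Fintype α] {u : Finset α}
    (hM : Fintype.card M = u.card) (hL : Fintype.card L + u.card = Fintype.card α) :
    ∃ e : L ⊕ M ≃ α, ∀ x, e x ∈ u ↔ x.isRight := by
  have h1 : Fintype.card M = Fintype.card {a // a ∈ u} := by simp [hM]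
  have h2 : Fintype.card L = Fintype.card {a // a ∉ u} := by
    rw [Fintype.card_subtype_compl (fun a => a ∈ u)]
    simp only [Fintype.card_coe]
    omega
  refine ⟨(Equiv.sumComm L M).trans ((Equiv.sumCongr (Fintype.equivOfCardEq h1)
    (Fintype.equivOfCardEq h2)).trans (Equiv.sumCompl fun a => a ∈ u)), ?_⟩
  rintro (x | x)
  · simpa using (Fintype.equivOfCardEq h2 x).2
  · simp

theorem exists_equiv_sum_mem_pointed {L M α : Type} [Fintype L] [Fintype M] [Fintype α]
    {u : Finset α} (hM : Fintype.card M = u.card)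
    (hL : Fintype.card L + u.card = Fintype.card α) {a : α} (ha : a ∈ u) (m : M) :
    ∃ e : L ⊕ M ≃ α, (∀ x, e x ∈ u ↔ x.isRight) ∧ e (Sum.inr m) = a := by
  obtain ⟨e, he⟩ := exists_equiv_sum_mem hM hL
  refine ⟨e.trans (Equiv.swap (e (Sum.inr m)) a), fun x => ?_, by simp⟩
  have h1 : e (Sum.inr m) ∈ u := (he _).2 rfl
  rw [← he, Equiv.trans_apply, Equiv.swap_apply_def]
  split_ifs with h2 h3
  · simp [h2, h1, ha]
  · simp [h3, h1, ha]
  · rfl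

theorem sum_finset_option {a : ℕ} (φ : Finset (Option (Fin a)) → ℂ) (K : ℕ → ℂ)
    (h : ∀ u : Finset (Option (Fin a)), none ∈ u → ∀ m ≤ a, u.card = m + 1 → φ u = K m)
    (h0 : ∀ u : Finset (Option (Fin a)), none ∉ u → φ u = 0) :
    ∑ u, φ u = ∑ m ∈ Finset.range (a + 1), a.choose m • K m := by
  have h1 := Finset.sum_powerset_apply_card K (x := (Finset.univ : Finset (Fin a)))
  rw [Finset.card_univ, Fintype.card_fin, Finset.powerset_univ] at h1
  rw [← h1]
  refine (Fintype.sum_of_injective Finset.insertNone Finset.insertNone.injective _ _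
    (fun u hu => h0 u fun hn => hu ⟨u.eraseNone, ?_⟩) fun u => ?_).symm
  · simp [Finset.insertNone_eraseNone, hn]
  · exact (h _ (by simp) _ (by simpa using Finset.card_le_univ u) (by simp)).symm

namespace PointedGraph

section iso
variable {V E : Type} [Fintype V] [Fintype E] {B Z : PointedGraph} {S T : E → V ⊕ B.V}

theorem Subgraph.nonempty_iso_toGraph (φ : Iso (B.wrap S T) Z) (Γ : Z.Subgraph)
    (hV : ∀ x : V ⊕ B.V, φ.onV x ∈ Γ.verts ↔ x.isRight)
    (hE : ∀ x : E ⊕ B.E, φ.onE x ∈ Γ.edges ↔ x.isRight) : Nonempty (Iso B Γ.toGraph) := by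
  refine ⟨⟨Equiv.ofBijective (fun b => (⟨φ.onV (Sum.inr b), (hV _).2 rfl⟩ : {v // v ∈ Γ.verts}))
    ⟨fun b b' h => ?_, fun v => ?_⟩,
    Equiv.ofBijective (fun b => (⟨φ.onE (Sum.inr b), (hE _).2 rfl⟩ : {e // e ∈ Γ.edges}))
    ⟨fun b b' h => ?_, fun e => ?_⟩, fun e => ?_, fun e => ?_, ?_⟩⟩
  · simpa using congrArg Subtype.val h
  · obtain ⟨x, hx⟩ := φ.onV.surjective v.1
    obtain ⟨b, rfl⟩ := Sum.isRight_iff.1 ((hV x).1 (hx ▸ v.2))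
    exact ⟨b, Subtype.ext hx⟩
  · simpa using congrArg Subtype.val h
  · obtain ⟨x, hx⟩ := φ.onE.surjective e.1
    obtain ⟨b, rfl⟩ := Sum.isRight_iff.1 ((hE x).1 (hx ▸ e.2))
    exact ⟨b, Subtype.ext hx⟩
  · exact Subtype.ext (φ.src_eq (Sum.inr e))
  · exact Subtype.ext (φ.tgt_eq (Sum.inr e))
  · exact Subtype.ext φ.base_eq

theorem Subgraph.nonempty_iso_quotient (φ : Iso (B.wrap S T) Z) (Γ : Z.Subgraph)
    (hV : ∀ x : V ⊕ B.V, φ.onV x ∈ Γ.verts ↔ x.isRight)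
    (hE : ∀ x : E ⊕ B.E, φ.onE x ∈ Γ.edges ↔ x.isRight) :
    Nonempty (Iso (gr none (fun e => (S e).getLeft?) fun e => (T e).getLeft?) Γ.quotient) := by
  let r := fun a b : Z.V => a ∈ Γ.verts ∧ b ∈ Γ.verts
  have hlift : ∀ a b : Z.V, r a b → (φ.onV.symm a).getLeft? = (φ.onV.symm b).getLeft? := by
    have h : ∀ a ∈ Γ.verts, (φ.onV.symm a).getLeft? = none := fun a ha => by
      rw [Sum.getLeft?_eq_none_iff]
      exact (hV _).1 ((φ.onV.apply_symm_apply a).symm ▸ ha)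
    exact fun a b hab => (h a hab.1).trans (h b hab.2).symm
  have hbase : ∀ b : B.V, Quot.mk r Z.base = Quot.mk r (φ.onV (Sum.inr b)) := fun b =>
    Quot.sound ⟨Γ.base_mem, (hV _).2 rfl⟩
  let eV : Option V ≃ Quot r :=
    { toFun := fun o => o.elim (Quot.mk r Z.base) fun v => Quot.mk r (φ.onV (Sum.inl v))
      invFun := Quot.lift (fun v => (φ.onV.symm v).getLeft?) hlift
      left_inv := by
        rintro (_ | v)
        · change (φ.onV.symm Z.base).getLeft? = none
          rw [← φ.base_eq, Equiv.symm_apply_apply]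
          rfl
        · change (φ.onV.symm (φ.onV (Sum.inl v))).getLeft? = some v
          rw [Equiv.symm_apply_apply]
          rfl
      right_inv := by
        rintro ⟨v⟩
        obtain ⟨x, rfl⟩ := φ.onV.surjective v
        change Option.elim (φ.onV.symm (φ.onV x)).getLeft? _ _ = _
        rw [Equiv.symm_apply_apply]
        rcases x with v | b
        · rfl
        · exact hbase b }
  have hS : ∀ x : V ⊕ B.V, Quot.mk r (φ.onV x) = eV x.getLeft? := by
    rintro (v | b)
    · rfl
    · exact (hbase b).symm
  refine ⟨⟨eV, Equiv.ofBijective (fun e => (⟨φ.onE (Sum.inl e), fun h => by simpa using (hE _).1 h⟩ :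
    {e // e ∉ Γ.edges})) ⟨fun e e' h => ?_, fun e => ?_⟩, fun e => ?_, fun e => ?_, rfl⟩⟩
  · simpa using congrArg Subtype.val h
  · obtain ⟨x, hx⟩ := φ.onE.surjective e.1
    rcases x with x | x
    · exact ⟨x, Subtype.ext hx⟩
    · exact absurd (hx ▸ (hE (Sum.inr x)).2 rfl) e.2
  · refine Eq.trans ?_ (hS (S e))
    exact congrArg (Quot.mk r) (φ.src_eq (Sum.inl e))
  · refine Eq.trans ?_ (hS (T e))
    exact congrArg (Quot.mk r) (φ.tgt_eq (Sum.inl e))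

end iso

/-- The image of a pointed subgraph under an isomorphism. -/
def Subgraph.map {Z Z' : PointedGraph} (φ : Iso Z Z') (Γ : Z.Subgraph) : Z'.Subgraph where
  verts := Γ.verts.map φ.onV.toEmbedding
  edges := Γ.edges.map φ.onE.toEmbedding
  base_mem := by
    rw [← φ.base_eq]
    exact Finset.mem_map_of_mem _ Γ.base_mem
  src_mem := by
    simp only [Finset.mem_map, forall_exists_index, and_imp]
    rintro _ e he rfl
    exact ⟨_, Γ.src_mem e he, (φ.src_eq e).symm⟩
  tgt_mem := by
    simp only [Finset.mem_map, forall_exists_index, and_imp]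
    rintro _ e he rfl
    exact ⟨_, Γ.tgt_mem e he, (φ.tgt_eq e).symm⟩

theorem Subgraph.map_injective {Z Z' : PointedGraph} (φ : Iso Z Z') :
    Function.Injective (Subgraph.map φ) := fun Γ Γ' h => by
  have h1 := congrArg Subgraph.verts h
  have h2 := congrArg Subgraph.edges h
  exact Subgraph.ext (Finset.map_injective _ h1) (Finset.map_injective _ h2)

theorem Subgraph.map_bijective {Z Z' : PointedGraph} (φ : Iso Z Z') :
    Function.Bijective (Subgraph.map φ) :=
  (Fintype.bijective_iff_injective_and_card _).2 ⟨map_injective φ,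
    (Fintype.card_le_of_injective _ (map_injective φ)).antisymm
      (Fintype.card_le_of_injective _ (map_injective φ.symm))⟩

/-- An isomorphism restricts to pointed subgraphs. -/
def Subgraph.mapToGraph {Z Z' : PointedGraph} (φ : Iso Z Z') (Γ : Z.Subgraph) :
    Iso Γ.toGraph (Γ.map φ).toGraph where
  onV := φ.onV.subtypeEquiv fun _ => (Finset.mem_map' φ.onV.toEmbedding).symm
  onE := φ.onE.subtypeEquiv fun _ => (Finset.mem_map' φ.onE.toEmbedding).symm
  src_eq e := Subtype.ext (φ.src_eq e.1)
  tgt_eq e := Subtype.ext (φ.tgt_eq e.1)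
  base_eq := Subtype.ext φ.base_eq

/-- An isomorphism descends to the quotients. -/
def Subgraph.mapQuotient {Z Z' : PointedGraph} (φ : Iso Z Z') (Γ : Z.Subgraph) :
    Iso Γ.quotient (Γ.map φ).quotient where
  onV := Quot.congr φ.onV fun _ _ => and_congr (Finset.mem_map' φ.onV.toEmbedding).symm
    (Finset.mem_map' φ.onV.toEmbedding).symm
  onE := φ.onE.subtypeEquiv fun _ => not_congr (Finset.mem_map' φ.onE.toEmbedding).symm
  src_eq e := congrArg (Quot.mk _) (φ.src_eq e.1)
  tgt_eq e := congrArg (Quot.mk _) (φ.tgt_eq e.1)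
  base_eq := congrArg (Quot.mk _) φ.base_eq

section sums
variable {χ : PointedGraph → ℂ} {Φ : PointedGraph → PointedGraph → ℂ}

theorem Iso.sum_subgraph_eq (hΦ : ∀ {A A' B B' : PointedGraph}, Iso A A' → Iso B B' → Φ A B = Φ A' B')
    {Z Z' : PointedGraph} (φ : Iso Z Z') :
    ∑ Γ : Z.Subgraph, Φ Γ.quotient Γ.toGraph = ∑ Γ : Z'.Subgraph, Φ Γ.quotient Γ.toGraph :=
  Fintype.sum_bijective _ (Subgraph.map_bijective φ) _ _ fun Γ =>
    hΦ (Γ.mapQuotient φ) (Γ.mapToGraph φ)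

/-- `Φ` of the quotient and the graph of the pointed subgraph with given vertices and edges. -/
def subVal (Φ : PointedGraph → PointedGraph → ℂ) (Z : PointedGraph) (vs : Finset Z.V)
    (es : Finset Z.E) : ℂ :=
  if h : Z.base ∈ vs ∧ ∀ e ∈ es, Z.src e ∈ vs ∧ Z.tgt e ∈ vs then
    Φ (Subgraph.mk vs es h.1 (fun e he => (h.2 e he).1) fun e he => (h.2 e he).2).quotient
      (Subgraph.mk vs es h.1 (fun e he => (h.2 e he).1) fun e he => (h.2 e he).2).toGraph
  else 0

theorem sum_subgraph (Φ : PointedGraph → PointedGraph → ℂ) (Z : PointedGraph) :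
    ∑ Γ : Z.Subgraph, Φ Γ.quotient Γ.toGraph = ∑ vs, ∑ es, subVal Φ Z vs es := by
  rw [← Fintype.sum_prod_type']
  refine Fintype.sum_of_injective (fun Γ : Z.Subgraph => (Γ.verts, Γ.edges)) (fun Γ Γ' h => ?_) _ _
    (fun p hp => dif_neg fun h => hp ⟨⟨p.1, p.2, h.1, fun e he => (h.2 e he).1,
      fun e he => (h.2 e he).2⟩, rfl⟩) fun Γ => ?_
  · exact Subgraph.ext (congrArg Prod.fst h) (congrArg Prod.snd h)
  · rw [subVal, dif_pos ⟨Γ.base_mem, fun e he => ⟨Γ.src_mem e he, Γ.tgt_mem e he⟩⟩]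

/-- The sum over the pointed graphs with a marked pointed subgraph with `a₂` ordinary vertices and
`b₂` edges and with `a₁` further vertices and `b₁` further edges. -/
def glue (a₁ b₁ a₂ b₂ : ℕ) (χ : PointedGraph → ℂ) (Φ : PointedGraph → PointedGraph → ℂ) : ℂ :=
  ((a₁.factorial * b₁.factorial : ℕ) : ℂ)⁻¹ * tot a₂ b₂ fun B =>
    ∑ S : Fin b₁ → Fin a₁ ⊕ B.V, ∑ T : Fin b₁ → Fin a₁ ⊕ B.V, χ (B.wrap S T) *
      Φ (gr none (fun e => (S e).getLeft?) fun e => (T e).getLeft?) B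

/-- Relabelling moves the marked vertices and edges into the right summands. The incidence maps for
which they form a subgraph are then precisely those of the graphs `wrap`, and the others contribute
zero. -/
theorem sum_subVal (hχ : ∀ {G H : PointedGraph}, Iso G H → χ G = χ H)
    (hΦ : ∀ {A A' B B' : PointedGraph}, Iso A A' → Iso B B' → Φ A B = Φ A' B')
    {V E : Type} [Fintype V] [Fintype E] {v : V} {vs : Finset V} {es : Finset E} (hv : v ∈ vs)
    {a₁ b₁ a₂ b₂ : ℕ} (ha₂ : vs.card = a₂ + 1) (hb₂ : es.card = b₂)
    (ha : Fintype.card V = a₁ + a₂ + 1) (hb : Fintype.card E = b₁ + b₂) :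
    ∑ s : E → V, ∑ t : E → V, χ (gr v s t) * subVal Φ (gr v s t) vs es =
      ((a₁.factorial * b₁.factorial * (a₂.factorial * b₂.factorial) : ℕ) : ℂ) *
        glue a₁ b₁ a₂ b₂ χ Φ := by
  obtain ⟨eV, hV, hV0⟩ := exists_equiv_sum_mem_pointed (L := Fin a₁) (M := Option (Fin a₂)) (u := vs)
    (by simp [ha₂]) (by simp [ha₂, ha]; ring) hv none
  obtain ⟨eE, hE⟩ := exists_equiv_sum_mem (L := Fin b₁) (M := Fin b₂) (u := es)
    (by simp [hb₂]) (by simp [hb₂, hb])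
  have h1 : ((a₁.factorial * b₁.factorial * (a₂.factorial * b₂.factorial) : ℕ) : ℂ) *
      glue a₁ b₁ a₂ b₂ χ Φ = ∑ s₂ : Fin b₂ → Option (Fin a₂), ∑ t₂ : Fin b₂ → Option (Fin a₂),
        ∑ S : Fin b₁ → Fin a₁ ⊕ Option (Fin a₂), ∑ T : Fin b₁ → Fin a₁ ⊕ Option (Fin a₂),
          χ ((gr none s₂ t₂).wrap S T) *
            Φ (gr none (fun e => (S e).getLeft?) fun e => (T e).getLeft?) (gr none s₂ t₂) := by
    have h2 : ∀ (p q : ℕ), p ≠ 0 → q ≠ 0 → ∀ Y : ℂ,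
        ((p * q : ℕ) : ℂ) * ((p : ℂ)⁻¹ * ((q : ℂ)⁻¹ * Y)) = Y := fun p q hp hq Y => by
      have : (p : ℂ) ≠ 0 := Nat.cast_ne_zero.2 hp
      have : (q : ℂ) ≠ 0 := Nat.cast_ne_zero.2 hq
      push_cast
      field_simp
    exact h2 _ _ (by positivity) (by positivity) _
  rw [h1]
  let ℬ := (((Fin b₂ → Option (Fin a₂)) × (Fin b₂ → Option (Fin a₂))) ×
    ((Fin b₁ → Fin a₁ ⊕ Option (Fin a₂)) × (Fin b₁ → Fin a₁ ⊕ Option (Fin a₂))))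
  let J : (Fin b₁ → Fin a₁ ⊕ Option (Fin a₂)) → (Fin b₂ → Option (Fin a₂)) → E → V := fun S s₂ e =>
    eV (Sum.elim S (Sum.inr ∘ s₂) (eE.symm e))
  have hJ : ∀ {S S' s s'}, J S s = J S' s' → S = S' ∧ s = s' := by
    intro S S' s s' h
    have h2 : Sum.elim S (Sum.inr ∘ s) = Sum.elim S' (Sum.inr ∘ s') := by
      ext1 x
      have := congrFun h (eE x)
      simpa only [J, Equiv.symm_apply_apply, EmbeddingLike.apply_eq_iff_eq] using this
    exact ⟨funext fun e => congrFun h2 (Sum.inl e),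
      funext fun e => Sum.inr_injective (congrFun h2 (Sum.inr e))⟩
  have hJ' : ∀ s : E → V, (∀ e ∈ es, s e ∈ vs) → ∃ S s₂, J S s₂ = s := by
    intro s hs
    have h2 : ∀ e : Fin b₂, ∃ o, eV.symm (s (eE (Sum.inr e))) = Sum.inr o := fun e => by
      have := hs _ ((hE (Sum.inr e)).2 rfl)
      rw [← eV.apply_symm_apply (s _), hV, Sum.isRight_iff] at this
      exact this
    choose s₂ hs₂ using h2
    refine ⟨fun e => eV.symm (s (eE (Sum.inl e))), s₂, funext fun e => ?_⟩
    obtain ⟨x, rfl⟩ := eE.surjective e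
    simp only [J, Equiv.symm_apply_apply]
    rcases x with x | x
    · simp
    · simp [← hs₂]
  have h2 := Fintype.sum_of_injective
    (fun p : ℬ => (J p.2.1 p.1.1, J p.2.2 p.1.2)) (fun p q h => by
      obtain ⟨h3, h4⟩ := hJ (congrArg Prod.fst h)
      obtain ⟨h5, h6⟩ := hJ (congrArg Prod.snd h)
      exact Prod.ext (Prod.ext h4 h6) (Prod.ext h3 h5))
    (fun p : ℬ => χ ((gr none p.1.1 p.1.2).wrap p.2.1 p.2.2) *
      Φ (gr none (fun e => (p.2.1 e).getLeft?) fun e => (p.2.2 e).getLeft?) (gr none p.1.1 p.1.2))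
    (fun q : (E → V) × (E → V) => χ (gr v q.1 q.2) * subVal Φ (gr v q.1 q.2) vs es)
    (fun q hq => by
      rw [subVal, dif_neg, mul_zero]
      rintro ⟨-, h⟩
      obtain ⟨S, s₂, h3⟩ := hJ' q.1 fun e he => (h e he).1
      obtain ⟨T, t₂, h4⟩ := hJ' q.2 fun e he => (h e he).2
      exact hq ⟨((s₂, t₂), (S, T)), Prod.ext h3 h4⟩)
    (fun p => by
      let φ : Iso ((gr none p.1.1 p.1.2).wrap p.2.1 p.2.2) (gr v (J p.2.1 p.1.1) (J p.2.2 p.1.2)) :=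
        ⟨eV, eE, fun e => by simp [J], fun e => by simp [J], hV0⟩
      have hcl : ∀ e ∈ es, J p.2.1 p.1.1 e ∈ vs ∧ J p.2.2 p.1.2 e ∈ vs := fun e he => by
        obtain ⟨x, rfl⟩ := eE.surjective e
        obtain ⟨e, rfl⟩ := Sum.isRight_iff.1 ((hE x).1 he)
        simp [J, hV]
      let Γ : (gr v (J p.2.1 p.1.1) (J p.2.2 p.1.2)).Subgraph :=
        ⟨vs, es, hv, fun e he => (hcl e he).1, fun e he => (hcl e he).2⟩
      obtain ⟨φ₁⟩ := Γ.nonempty_iso_quotient φ hV hE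
      obtain ⟨φ₂⟩ := Γ.nonempty_iso_toGraph φ hV hE
      dsimp only
      rw [hχ φ, subVal, dif_pos ⟨hv, hcl⟩]
      exact congrArg _ (hΦ φ₁ φ₂))
  rw [← Fintype.sum_prod_type', ← h2]
  simp only [ℬ, Fintype.sum_prod_type]

/-- The vertices and edges of the subgraph can be chosen in `a.choose a₂ * b.choose b₂` ways, which
turns `1 / (a! b!)` into the separate normalizations of the subgraph and of the rest. -/
theorem tot_sum_subgraph (hχ : ∀ {G H : PointedGraph}, Iso G H → χ G = χ H)
    (hΦ : ∀ {A A' B B' : PointedGraph}, Iso A A' → Iso B B' → Φ A B = Φ A' B') (a b : ℕ) :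
    tot a b (fun Z => χ Z * ∑ Γ : Z.Subgraph, Φ Γ.quotient Γ.toGraph) =
      ∑ a₂ ∈ Finset.range (a + 1), ∑ b₂ ∈ Finset.range (b + 1),
        glue (a - a₂) (b - b₂) a₂ b₂ χ Φ := by
  have hJ : ∀ vs : Finset (Option (Fin a)), none ∈ vs → ∀ m ≤ a, vs.card = m + 1 →
      ∑ es : Finset (Fin b), ∑ s : Fin b → Option (Fin a), ∑ t : Fin b → Option (Fin a),
        χ (gr none s t) * subVal Φ (gr none s t) vs es =
      ∑ m' ∈ Finset.range (b + 1), b.choose m' •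
        ((((a - m).factorial * (b - m').factorial * (m.factorial * m'.factorial) : ℕ) : ℂ) *
          glue (a - m) (b - m') m m' χ Φ) := by
    intro vs hvs m hm hc
    have h1 := Finset.sum_powerset_apply_card (fun m' =>
      (((a - m).factorial * (b - m').factorial * (m.factorial * m'.factorial) : ℕ) : ℂ) *
          glue (a - m) (b - m') m m' χ Φ) (x := (Finset.univ : Finset (Fin b)))
    rw [Finset.card_univ, Fintype.card_fin, Finset.powerset_univ] at h1
    rw [← h1]
    refine Finset.sum_congr rfl fun es _ => ?_
    have h2 := Finset.card_le_univ es
    rw [Fintype.card_fin] at h2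
    refine Eq.trans ?_ (sum_subVal (a₁ := a - m) (b₁ := b - es.card) (a₂ := m) (b₂ := es.card)
      hχ hΦ hvs hc rfl (by rw [Fintype.card_option, Fintype.card_fin]; omega)
      (by rw [Fintype.card_fin]; omega))
    exact sum_congr_inst fun s => sum_congr_inst fun t => rfl
  have h2 : ∑ s : Fin b → Option (Fin a), ∑ t : Fin b → Option (Fin a), χ (gr none s t) *
      ∑ Γ : (gr none s t).Subgraph, Φ Γ.quotient Γ.toGraph = ∑ vs : Finset (Option (Fin a)),
      ∑ es : Finset (Fin b), ∑ s : Fin b → Option (Fin a), ∑ t : Fin b → Option (Fin a),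
        χ (gr none s t) * subVal Φ (gr none s t) vs es := by
    have h3 : ∀ s t : Fin b → Option (Fin a), χ (gr none s t) *
        ∑ Γ : (gr none s t).Subgraph, Φ Γ.quotient Γ.toGraph = ∑ vs : Finset (Option (Fin a)),
        ∑ es : Finset (Fin b), χ (gr none s t) * subVal Φ (gr none s t) vs es := fun s t => by
      rw [sum_subgraph, Finset.mul_sum]
      exact Finset.sum_congr rfl fun vs _ => Finset.mul_sum _ _ _
    simp only [h3]
    rw [Finset.sum_congr rfl fun s _ => Finset.sum_comm, Finset.sum_comm]
    refine Finset.sum_congr rfl fun vs _ => ?_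
    rw [Finset.sum_congr rfl fun s _ => Finset.sum_comm, Finset.sum_comm]
  unfold tot
  rw [h2, sum_finset_option _ _ hJ fun vs hvs => ?_, Finset.mul_sum]
  · refine Finset.sum_congr rfl fun m hm => ?_
    rw [Finset.smul_sum, Finset.mul_sum]
    refine Finset.sum_congr rfl fun m' hm' => ?_
    rw [Finset.mem_range] at hm hm'
    have h3 := Nat.choose_mul_factorial_mul_factorial (n := a) (k := m) (by omega)
    have h4 := Nat.choose_mul_factorial_mul_factorial (n := b) (k := m') (by omega)
    rw [← h3, ← h4]
    have h5 : (a.choose m : ℂ) ≠ 0 := Nat.cast_ne_zero.2 (Nat.choose_pos (by omega)).ne'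
    have h6 : (b.choose m' : ℂ) ≠ 0 := Nat.cast_ne_zero.2 (Nat.choose_pos (by omega)).ne'
    have h7 : ∀ m : ℕ, (m.factorial : ℂ) ≠ 0 := fun m => Nat.cast_ne_zero.2 m.factorial_ne_zero
    have h8 := h7 m
    have h9 := h7 m'
    have h10 := h7 (a - m)
    have h11 := h7 (b - m')
    rw [nsmul_eq_mul, nsmul_eq_mul]
    push_cast
    field_simp
  · refine Finset.sum_eq_zero fun es _ => Finset.sum_eq_zero fun s _ =>
      Finset.sum_eq_zero fun t _ => ?_
    rw [subVal, dif_neg fun h => hvs h.1, mul_zero]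

end sums

end PointedGraph

theorem sum_sum_ite_eq {α β : Type} [Fintype α] [Fintype β] (p : α → β) (X : α → α → β → β → ℂ) :
    ∑ s : β, ∑ t : β, ∑ S : α, ∑ T : α, (if p S = s ∧ p T = t then X S T s t else 0) =
      ∑ S : α, ∑ T : α, X S T (p S) (p T) := by
  rw [Finset.sum_congr rfl fun s _ => Finset.sum_comm, Finset.sum_comm]
  refine Finset.sum_congr rfl fun S _ => ?_
  rw [Finset.sum_congr rfl fun s _ => Finset.sum_comm, Finset.sum_comm]
  refine Finset.sum_congr rfl fun T _ => ?_
  simp [ite_and]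

/-! ### The composition formula -/

namespace PointedGraph
variable {n : ℕ} {g : (Fin n → ℂ) → Matrix (Fin n) (Fin n) ℂ} {W : Set (Fin n → ℂ)}
  {f : (Fin n → ℂ) → ℂ}

/-- The value of the operator of a stable pointed graph in given coordinates. -/
def stableVal (g : (Fin n → ℂ) → Matrix (Fin n) (Fin n) ℂ) (f : (Fin n → ℂ) → ℂ)
    (Z : PointedGraph) : ℂ := if Z.IsStable then Z.eval g f 0 else 0

/-- The coefficient of a pair that consists of a quotient and a pointed subgraph. -/
def pairCoeff (c₁ c₂ : IsoClass → ℂ) (A B : PointedGraph) : ℂ :=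
  (-1) ^ (A.numV + B.numV) * (stabCoeff c₁ A * stabCoeff c₂ B)

theorem Iso.stableVal_eq {G H : PointedGraph} (φ : Iso G H) :
    stableVal g f G = stableVal g f H := by
  unfold stableVal
  rw [φ.eval_eq]
  exact ite_congr_inst ⟨φ.isStable, φ.symm.isStable⟩

theorem pairCoeff_iso (c₁ c₂ : IsoClass → ℂ) {A A' B B' : PointedGraph} (φ : Iso A A')
    (φ' : Iso B B') : pairCoeff c₁ c₂ A B = pairCoeff c₁ c₂ A' B' := by
  unfold pairCoeff
  rw [φ.numV_eq, φ'.numV_eq, stabCoeff_iso c₁ φ, stabCoeff_iso c₂ φ']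

theorem sum_sum_tot {β : Type} [Fintype β] (A : Finset ℕ) (z : ℕ → ℂ) (k : ℕ)
    (φ : ℕ → β → β → PointedGraph → ℂ) :
    ∑ s, ∑ t, ∑ a ∈ A, z a * tot a (a + k) (φ a s t) =
      ∑ a ∈ A, z a * tot a (a + k) fun B => ∑ s, ∑ t, φ a s t B := by
  rw [Finset.sum_congr rfl fun s _ => Finset.sum_comm, Finset.sum_comm]
  refine Finset.sum_congr rfl fun a _ => ?_
  rw [tot_sum, Finset.mul_sum]
  refine Finset.sum_congr rfl fun s _ => ?_
  rw [tot_sum, Finset.mul_sum]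

/-- The outer graph is determined by the glued one as its quotient, so the sum over it is absorbed
by the sum over the lifts `S` and `T`. A stable outer graph has at most `2 k₁` edges and hence at
most `4 k₁` derivatives, which explains the bounds. -/
theorem stableSum_semiSum (c₁ c₂ : IsoClass → ℂ) (hW : IsOpen W) (h0 : (0 : Fin n → ℂ) ∈ W)
    (hg : IsKahlerMetricOn g W) (hf : Sm W f) {k₁ k₂ T N : ℕ} (hN : IsNormalAt N g)
    (hT : 4 * k₁ + 2 * k₂ ≤ T) (hTN : 2 * k₁ + T + k₂ ≤ N) :
    stableSum c₁ k₁ g (semiSum c₂ k₂ g f) 0 = ∑ a₁ ∈ Finset.range (k₁ + 1),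
      ∑ a₂ ∈ Finset.range (T + 1), glue a₁ (a₁ + k₁) a₂ (a₂ + k₂) (stableVal g f)
        (pairCoeff c₁ c₂) := by
  refine Finset.sum_congr rfl fun a₁ ha₁ => ?_
  rw [Finset.mem_range] at ha₁
  have h1 : ∀ s t : Fin (a₁ + k₁) → Option (Fin a₁),
      (if (gr none s t).IsStable then c₁ (Quotient.mk _ (gr none s t)) *
        (gr none s t).eval g (semiSum c₂ k₂ g f) 0 else 0) =
      ∑ a₂ ∈ Finset.range (T + 1), (-1) ^ a₂ * tot a₂ (a₂ + k₂) fun B => stabCoeff c₂ B *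
        ∑ S : Fin (a₁ + k₁) → Fin a₁ ⊕ B.V, ∑ T : Fin (a₁ + k₁) → Fin a₁ ⊕ B.V,
          if (fun e => (S e).getLeft?) = s ∧ (fun e => (T e).getLeft?) = t then
            stabCoeff c₁ (gr none s t) * stableVal g f (B.wrap S T) else 0 := by
    intro s t
    by_cases hA : (gr none s t).IsStable
    · rw [if_pos hA, eval_semiSum c₂ hW h0 hg hf (T := T) hN hA
        (by rw [Fintype.card_fin]; omega) (by rw [Fintype.card_fin]; omega), Finset.mul_sum]
      refine Finset.sum_congr rfl fun a₂ _ => ?_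
      rw [mul_left_comm, ← tot_const_mul]
      refine congrArg _ (tot_congr fun B _ _ => ?_)
      rw [mul_left_comm, stabCoeff_of_isStable c₁ hA]
      congr 1
      simp only [Finset.mul_sum]
      refine sum_congr_inst fun S => sum_congr_inst fun T => ?_
      rw [mul_ite, mul_zero]
      exact ite_congr_inst (and_congr funext_iff.symm funext_iff.symm)
    -- An unstable outer graph contributes nothing on the right either, because a stable glued graph
    -- has a stable quotient.
    · rw [if_neg hA]
      refine (Finset.sum_eq_zero fun a₂ _ => ?_).symm
      rw [tot_congr (φ' := fun _ => 0) fun B _ _ => ?_]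
      · simp [tot]
      · rw [Finset.sum_eq_zero fun S _ => Finset.sum_eq_zero fun T _ => ?_, mul_zero]
        rw [ite_eq_right_iff]
        rintro ⟨rfl, rfl⟩
        rw [stableVal, if_neg fun h => hA h.of_wrap, mul_zero]
  have h2 : tot a₁ (a₁ + k₁) (fun G => if G.IsStable then c₁ (Quotient.mk _ G) *
      G.eval g (semiSum c₂ k₂ g f) 0 else 0) =
      ((a₁.factorial * (a₁ + k₁).factorial : ℕ) : ℂ)⁻¹ * ∑ a₂ ∈ Finset.range (T + 1), (-1) ^ a₂ *
        tot a₂ (a₂ + k₂) fun B => stabCoeff c₂ B * ∑ S : Fin (a₁ + k₁) → Fin a₁ ⊕ B.V,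
          ∑ T : Fin (a₁ + k₁) → Fin a₁ ⊕ B.V,
            stabCoeff c₁ (gr none (fun e => (S e).getLeft?) fun e => (T e).getLeft?) *
              stableVal g f (B.wrap S T) := by
    rw [tot]
    refine congrArg _ ?_
    refine (Finset.sum_congr rfl fun s _ => Finset.sum_congr rfl fun t _ => h1 s t).trans ?_
    rw [sum_sum_tot]
    refine Finset.sum_congr rfl fun a₂ _ => congrArg _ (tot_congr fun B _ _ => ?_)
    simp only [← Finset.mul_sum]
    refine congrArg _ ?_
    refine Eq.trans ?_ ((sum_sum_ite_eq
      (fun (S : Fin (a₁ + k₁) → Fin a₁ ⊕ B.V) e => (S e).getLeft?)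
      fun S T s t => stabCoeff c₁ (gr none s t) * stableVal g f (B.wrap S T)).trans ?_)
    · exact sum_congr_inst fun s => sum_congr_inst fun t => sum_congr_inst fun S =>
        sum_congr_inst fun T => ite_congr_inst Iff.rfl
    · exact sum_congr_inst fun S => sum_congr_inst fun T => rfl
  rw [h2, mul_left_comm, Finset.mul_sum, Finset.mul_sum]
  refine Finset.sum_congr rfl fun a₂ _ => ?_
  unfold glue
  rw [← mul_assoc, ← mul_assoc, mul_assoc (_ : ℂ)⁻¹, mul_assoc (_ : ℂ)⁻¹, ← tot_const_mul]
  refine congrArg _ (tot_congr fun B hB _ => ?_)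
  simp only [Finset.mul_sum]
  refine Finset.sum_congr rfl fun S _ => Finset.sum_congr rfl fun T _ => ?_
  rw [pairCoeff, numV, numV, hB, Fintype.card_option, Fintype.card_fin]
  have h3 : (-1 : ℂ) ^ (a₁ + 1 + (a₂ + 1)) = (-1) ^ a₁ * (-1) ^ a₂ := by
    rw [pow_add, pow_succ, pow_succ]; ring
  rw [h3]
  ring

theorem PosDeg.card_le {G : PointedGraph} (h : G.PosDeg) :
    Fintype.card G.V ≤ Fintype.card G.E + 1 := by
  have h1 : ∑ v ∈ Finset.univ.erase G.base, 1 ≤ ∑ v ∈ Finset.univ.erase G.base, G.outDeg v :=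
    Finset.sum_le_sum fun v hv => (h v (Finset.ne_of_mem_erase hv)).2
  have h2 : ∑ v ∈ Finset.univ.erase G.base, G.outDeg v ≤ ∑ v, G.outDeg v :=
    Finset.sum_le_sum_of_subset (Finset.subset_univ _)
  rw [Finset.sum_const, smul_eq_mul, mul_one, Finset.card_erase_of_mem (Finset.mem_univ _),
    Finset.card_univ] at h1
  rw [sum_outDeg] at h2
  omega

/-- In a nonzero term the whole graph and the quotient are stable and the subgraph has positive
degrees; the inequalities are their edge counts. -/
theorem le_of_glue_ne_zero {c₁ c₂ : IsoClass → ℂ} {a₁ b₁ a₂ b₂ : ℕ}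
    (h : glue a₁ b₁ a₂ b₂ (stableVal g f) (pairCoeff c₁ c₂) ≠ 0) :
    2 * a₁ ≤ b₁ ∧ a₂ ≤ b₂ ∧ 2 * (a₁ + a₂) ≤ b₁ + b₂ := by
  have h1 := right_ne_zero_of_mul (right_ne_zero_of_mul h)
  obtain ⟨s, -, h1⟩ := Finset.exists_ne_zero_of_sum_ne_zero h1
  obtain ⟨t, -, h1⟩ := Finset.exists_ne_zero_of_sum_ne_zero h1
  obtain ⟨S, -, h1⟩ := Finset.exists_ne_zero_of_sum_ne_zero h1
  obtain ⟨T, -, h1⟩ := Finset.exists_ne_zero_of_sum_ne_zero h1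
  have hZ : ((gr none s t).wrap S T).IsStable := by
    by_contra h2
    exact h1 (by rw [stableVal, if_neg h2, zero_mul])
  have hB := (stabCoeff_posDeg (right_ne_zero_of_mul (right_ne_zero_of_mul
    (right_ne_zero_of_mul h1)))).card_le
  have hA := hZ.of_wrap.two_mul_le
  have hZ := hZ.two_mul_le
  simp only [Fintype.card_sum, Fintype.card_option, Fintype.card_fin] at hA hB hZ
  omega

/-- The weights of subgraph and quotient add up. By `le_of_glue_ne_zero` the two index ranges differ
only in zero terms. -/
theorem sum_glue_eq {c₁ c₂ : IsoClass → ℂ} {k T : ℕ} (hT : k ≤ T) :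
    ∑ p ∈ Finset.HasAntidiagonal.antidiagonal k, ∑ a₁ ∈ Finset.range (p.1 + 1),
      ∑ a₂ ∈ Finset.range (T + 1), glue a₁ (a₁ + p.1) a₂ (a₂ + p.2) (stableVal g f)
        (pairCoeff c₁ c₂) =
    ∑ a ∈ Finset.range (k + 1), ∑ a₂ ∈ Finset.range (a + 1), ∑ b₂ ∈ Finset.range (a + k + 1),
      glue (a - a₂) (a + k - b₂) a₂ b₂ (stableVal g f) (pairCoeff c₁ c₂) := by
  simp only [Finset.sum_sigma']
  refine Finset.sum_bij_ne_zero (fun x _ _ => ⟨x.2.1 + x.2.2, x.2.2, x.2.2 + x.1.2⟩) ?_ ?_ ?_ ?_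
  · rintro ⟨⟨k₁, k₂⟩, a₁, a₂⟩ h1 h2
    have h3 := le_of_glue_ne_zero h2
    simp only [Finset.mem_sigma, Finset.HasAntidiagonal.mem_antidiagonal, Finset.mem_range] at h1 h3 ⊢
    omega
  · rintro ⟨⟨k₁, k₂⟩, a₁, a₂⟩ h1 _ ⟨⟨k₁', k₂'⟩, a₁', a₂'⟩ h1' _ h
    simp only [Finset.mem_sigma, Finset.HasAntidiagonal.mem_antidiagonal, Finset.mem_range] at h1 h1'
    simp only [Sigma.mk.injEq, heq_eq_eq] at h
    obtain ⟨h3, rfl, h5⟩ := h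
    obtain rfl : a₁ = a₁' := by omega
    obtain rfl : k₂ = k₂' := by omega
    obtain rfl : k₁ = k₁' := by omega
    rfl
  · rintro ⟨a, a₂, b₂⟩ h1 h2
    have h3 := le_of_glue_ne_zero h2
    simp only [Finset.mem_sigma, Finset.mem_range] at h1 h3
    refine ⟨⟨(k - (b₂ - a₂), b₂ - a₂), a - a₂, a₂⟩, ?_, ?_, ?_⟩
    · simp only [Finset.mem_sigma, Finset.HasAntidiagonal.mem_antidiagonal, Finset.mem_range]
      omega
    · dsimp only at h2 ⊢
      rwa [show a - a₂ + (k - (b₂ - a₂)) = a + k - b₂ by omega,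
        show a₂ + (b₂ - a₂) = b₂ by omega]
    · dsimp only
      rw [show a - a₂ + a₂ = a by omega, show a₂ + (b₂ - a₂) = b₂ by omega]
  · rintro ⟨⟨k₁, k₂⟩, a₁, a₂⟩ h1 h2
    simp only [Finset.mem_sigma, Finset.HasAntidiagonal.mem_antidiagonal, Finset.mem_range] at h1 ⊢
    rw [show a₁ + a₂ - a₂ = a₁ by omega, show a₁ + a₂ + k - (a₂ + k₂) = a₁ + k₁ by omega]

theorem eval_neg (hW : IsOpen W) {x : Fin n → ℂ} (hx : x ∈ W) (hf : Sm W f) (G : PointedGraph) :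
    G.eval g (fun y => -f y) x = -G.eval g f x := by
  have h1 : ∀ P Q, functionJet (fun y => -f y) P Q x = -functionJet f P Q x := fun P Q => by
    have h2 : (fun y => -f y) = fun y => (-1) * f y := by ext; ring
    rw [h2, functionJet_eq_jet hW (contDiffOn_const.mul hf) _ _ hx,
      functionJet_eq_jet hW hf _ _ hx, jet_const_mul hW hf _ _ hx]
    ring
  unfold eval
  simp only [h1, mul_neg, Finset.sum_neg_distrib]

end PointedGraph

namespace PointedGraph
variable {n : ℕ} {g : (Fin n → ℂ) → Matrix (Fin n) (Fin n) ℂ} {U : Set (Fin n → ℂ)}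
  {f : (Fin n → ℂ) → ℂ}

theorem mem_inEdges {G : PointedGraph} {v : G.V} {e : G.E} : e ∈ G.inEdges v ↔ G.tgt e = v := by
  simp [inEdges]

theorem mem_outEdges {G : PointedGraph} {v : G.V} {e : G.E} : e ∈ G.outEdges v ↔ G.src e = v := by
  simp [outEdges]

/-- Vertices outside the subgraph keep all their edges. Hence the quotient is its own stabilization,
and only the subgraph is subject to the GS condition. -/
theorem IsStable.quotient {Z : PointedGraph} (h : Z.IsStable) (Γ : Z.Subgraph) :
    Γ.quotient.IsStable := by
  rintro ⟨u⟩ hv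
  have hu : u ∉ Γ.verts := fun hu => hv (Quot.sound ⟨hu, Γ.base_mem⟩)
  have h1 := h u fun h => hu (h ▸ Γ.base_mem)
  have h2 : Z.inEdges u ⊆ (Γ.quotient.inEdges (Quot.mk _ u)).map (Function.Embedding.subtype _) := by
    intro e he
    obtain rfl : Z.tgt e = u := by simpa [inEdges] using he
    refine Finset.mem_map.2 ⟨⟨e, fun h => hu (Γ.tgt_mem e h)⟩, ?_, rfl⟩
    exact (mem_inEdges (G := Γ.quotient)).2 rfl
  have h3 : Z.outEdges u ⊆ (Γ.quotient.outEdges (Quot.mk _ u)).map (Function.Embedding.subtype _) := by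
    intro e he
    obtain rfl : Z.src e = u := by simpa [outEdges] using he
    refine Finset.mem_map.2 ⟨⟨e, fun h => hu (Γ.src_mem e h)⟩, ?_, rfl⟩
    exact (mem_outEdges (G := Γ.quotient)).2 rfl
  exact ⟨h1.1.trans ((Finset.card_le_card h2).trans (Finset.card_map _).le),
    h1.2.trans ((Finset.card_le_card h3).trans (Finset.card_map _).le)⟩

theorem IsStable.sum_gsSubgraphs {Z : PointedGraph} (h : Z.IsStable) (c₁ c₂ : IsoClass → ℂ) :
    ∑ Γ ∈ Z.gsSubgraphs, (-1) ^ (Γ.quotient.numV + Γ.toGraph.numV) *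
      c₁ Γ.quotient.stabClass * c₂ Γ.toGraph.stabClass =
    ∑ Γ : Z.Subgraph, pairCoeff c₁ c₂ Γ.quotient Γ.toGraph := by
  rw [gsSubgraphs, Finset.sum_filter]
  refine Finset.sum_congr rfl fun Γ _ => ?_
  rw [pairCoeff, stabCoeff, stabCoeff, if_pos (h.quotient Γ).isGS]
  split_ifs <;> ring

/-- The inner operator is `-semiSum`, which by invariance can be computed in the chart `ψ` on a
whole neighbourhood of the centre. The signs of the two factors cancel. -/
theorem graphSum_comp (c₁ c₂ : IsoClass → ℂ) {k₁ k₂ N : ℕ} (hU : IsOpen U)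
    (hg : IsKahlerMetricOn g U) (hf : Sm U f) {x : Fin n → ℂ} (hx : x ∈ U)
    {ψ : (Fin n → ℂ) → (Fin n → ℂ)} (hψ : IsNormalChart N g x ψ) (hN : 3 * k₁ ≤ N)
    {W : Set (Fin n → ℂ)} (hW : IsOpen W) (h0 : (0 : Fin n → ℂ) ∈ W) (ha : AnalyticOnNhd ℂ ψ W)
    (hm : Set.MapsTo ψ W U) (hu : ∀ x ∈ W, IsUnit (jac ψ x)) :
    graphSum c₁ k₁ g (graphSum c₂ k₂ g f) x =
      stableSum c₁ k₁ (pullbackMetric g ψ) (semiSum c₂ k₂ (pullbackMetric g ψ) (f ∘ ψ)) 0 := by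
  have hH := ha.holOn hW
  have hf' : Sm W (f ∘ ψ) := hH.sm_comp hm hf
  have hs := sm_semiSum c₂ k₂ hW (hg.pullback hU hW hH hm hu) hf'
  have h1 := graphSum_eq c₂ k₂ hU hg hf
  have h2 : Sm U (graphSum c₂ k₂ g f) := Sm.congr_on (sm_semiSum c₂ k₂ hU hg hf).neg h1.symm
  have h3 : graphSum c₂ k₂ g f ∘ ψ =ᶠ[𝓝 0]
      fun w => -semiSum c₂ k₂ (pullbackMetric g ψ) (f ∘ ψ) w := by
    filter_upwards [hW.mem_nhds h0] with w hw
    exact (h1 (hm hw)).trans (congrArg _ (semiSum_pullback c₂ k₂ hU hg hf hW ha hm hu hw))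
  rw [graphSum_eq c₁ k₁ hU hg h2 hx]
  dsimp only
  rw [semiSum_eq_stableSum c₁ hU hg h2 hx hψ hN, stableSum, stableSum, ← Finset.sum_neg_distrib]
  refine Finset.sum_congr rfl fun a _ => ?_
  rw [← mul_neg, neg_eq_neg_one_mul (tot _ _ _), ← tot_const_mul]
  refine congrArg _ (tot_congr fun G _ _ => ?_)
  rw [eval_congr (Filter.EventuallyEq.refl _ _) h3, eval_neg hW h0 hs]
  split_ifs <;> ring

theorem sum_stableClasses_covOp (c₁ c₂ : IsoClass → ℂ) {k N : ℕ} (hU : IsOpen U)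
    (hg : IsKahlerMetricOn g U) (hf : Sm U f) {x : Fin n → ℂ} (hx : x ∈ U)
    {ψ : (Fin n → ℂ) → (Fin n → ℂ)} (hψ : IsNormalChart N g x ψ) (hN : 3 * k ≤ N) :
    ∑ Z ∈ stableClasses k, (∑ Γ ∈ Z.out.gsSubgraphs, (-1) ^ (Γ.quotient.numV + Γ.toGraph.numV) *
      c₁ Γ.quotient.stabClass * c₂ Γ.toGraph.stabClass) / Z.out.autCard * Z.out.covOp g f x =
    ∑ a ∈ Finset.range (k + 1), ∑ a₂ ∈ Finset.range (a + 1), ∑ b₂ ∈ Finset.range (a + k + 1),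
      glue (a - a₂) (a + k - b₂) a₂ b₂ (stableVal (pullbackMetric g ψ) (f ∘ ψ))
        (pairCoeff c₁ c₂) := by
  have hφ : ∀ {G H : PointedGraph}, Iso G H →
      G.eval (pullbackMetric g ψ) (f ∘ ψ) 0 * ∑ Γ : G.Subgraph, pairCoeff c₁ c₂ Γ.quotient Γ.toGraph =
      H.eval (pullbackMetric g ψ) (f ∘ ψ) 0 *
        ∑ Γ : H.Subgraph, pairCoeff c₁ c₂ Γ.quotient Γ.toGraph := fun φ => by
    rw [φ.eval_eq, φ.sum_subgraph_eq (pairCoeff_iso c₁ c₂)]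
  refine Eq.trans (Finset.sum_congr rfl fun q hq => ?_) ((sum_stableClasses hφ k).trans
    (Finset.sum_congr rfl fun a _ => ?_))
  · rw [mem_stableClasses_iff] at hq
    rw [hq.1.sum_gsSubgraphs, covOp_eq_eval hq.1 hq.2 hU hg hf hx hψ hN]
    ring
  · rw [← tot_sum_subgraph Iso.stableVal_eq (pairCoeff_iso c₁ c₂)]
    refine tot_congr fun G _ _ => ?_
    rw [stableVal, ite_mul, zero_mul]

theorem sum_graphSum_comp (c₁ c₂ : IsoClass → ℂ) (k : ℕ) (hU : IsOpen U)
    (hg : IsKahlerMetricOn g U) (hf : Sm U f) {x : Fin n → ℂ} (hx : x ∈ U) :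
    ∑ p ∈ Finset.HasAntidiagonal.antidiagonal k, graphSum c₁ p.1 g (graphSum c₂ p.2 g f) x =
      ∑ Z ∈ stableClasses k, (∑ Γ ∈ Z.out.gsSubgraphs,
        (-1) ^ (Γ.quotient.numV + Γ.toGraph.numV) * c₁ Γ.quotient.stabClass *
          c₂ Γ.toGraph.stabClass) / Z.out.autCard * Z.out.covOp g f x := by
  -- With `T = 4 * k` one has `4 * p.1 + 2 * p.2 ≤ T` and `2 * p.1 + T + p.2 ≤ 6 * k`, so order `7 *
  -- k` is enough for every pair `p` at once.
  obtain ⟨ψ, hψ⟩ := exists_isNormalChart (7 * k) hU hg hx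
  obtain ⟨W, hW, h0, ha, hm, hu⟩ := exists_nhd_isUnit_jac hψ.analytic (isUnit_jac hψ.metric_center) hU
    (hψ.center.symm ▸ hx)
  have hH := ha.holOn hW
  have hf' : Sm W (f ∘ ψ) := hH.sm_comp hm hf
  have hk := hg.pullback hU hW hH hm hu
  rw [sum_stableClasses_covOp c₁ c₂ hU hg hf hx hψ (by omega),
    ← sum_glue_eq (T := 4 * k) (by omega)]
  refine Finset.sum_congr rfl fun p hp => ?_
  rw [Finset.HasAntidiagonal.mem_antidiagonal] at hp
  rw [graphSum_comp c₁ c₂ hU hg hf hx hψ (by omega) hW h0 ha hm hu,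
    stableSum_semiSum c₁ c₂ hW h0 hk hf' (T := 4 * k)
      (isNormalAt_of_isNormalChart hψ hW h0 hk) (by omega) (by omega)]

end PointedGraph

end

/-- Composition formula for covariant differential operators in the basis of stable pointed graphs,
in every weight `k`. The first part says that the operators attached to stable graphs are well
defined and preserve smoothness, so that they can be composed. -/
theorem theorem4p10 (c₁ c₂ : PointedGraph.IsoClass → ℂ) {n : ℕ} {U : Set (Fin n → ℂ)}
    (hU : IsOpen U) {g : (Fin n → ℂ) → Matrix (Fin n) (Fin n) ℂ} (hg : IsKahlerMetricOn g U) :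
    (∀ Γ : PointedGraph, Γ.IsStable → ∀ f : (Fin n → ℂ) → ℂ, ContDiffOn ℝ ∞ f U →
      ContDiffOn ℝ ∞ (Γ.covOp g f) U ∧ ∀ x ∈ U, Γ.IsNormalValue g f x (Γ.covOp g f x)) ∧
    ∀ (k : ℕ) (f : (Fin n → ℂ) → ℂ), ContDiffOn ℝ ∞ f U → ∀ x ∈ U,
      ∑ p ∈ Finset.HasAntidiagonal.antidiagonal k,
          PointedGraph.graphSum c₁ p.1 g (PointedGraph.graphSum c₂ p.2 g f) x =
        ∑ Z ∈ PointedGraph.stableClasses k,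
          (∑ Γ ∈ Z.out.gsSubgraphs, (-1) ^ (Γ.quotient.numV + Γ.toGraph.numV) *
            c₁ Γ.quotient.stabClass * c₂ Γ.toGraph.stabClass) / Z.out.autCard *
          Z.out.covOp g f x := by
  refine ⟨fun Γ hΓ f hf => ⟨PointedGraph.sm_covOp hΓ hU hg hf, fun x hx =>
    PointedGraph.isNormalValue_covOp hΓ hU hg hf hx⟩, fun k f hf x hx => ?_⟩
  exact PointedGraph.sum_graphSum_comp c₁ c₂ k hU hg hf hx
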